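/- Let $K$ be an algebraically closed field of characteristic zero. Let $S\subset\mathbf P^3$ be a Delsarte surface, i.e. the zero set of a homogeneous polynomial $F=\sum_{i=0}^3 c_i\prod_{j=0}^3 X_j^{a_{ij}}$ with $c_i\in K^*$ and $a_{ij}\in\mathbf Z_{\ge 0}$, and assume that its exponent matrix $A=(a_{ij})$ satisfies $\det(A)\neq 0$. The \emph{standard fibration} on $S$ is the rational map $(X_0:X_1:X_2:X_3)\mapsto (X_2:X_3)$; its generic fibre is the plane curve over $K(t)$ with equation $f(x,y,t):=F(x,y,t,1)\in K(t)[x,y]$, and this equation is called the affine equation of $S$. Assume that (i) the generic fibre is an irreducible curve of positive geometric genus; (ii) the standard fibration is isotrivial, i.e. over an algebraic closure of $K(t)$ the generic fibre is birational to a curve defined over $K$ (equivalently, after a finite base change the fibration becomes birational to a product). Then, after multiplying the coordinates $X_0,\dots,X_3$ and the equation by nonzero constants, there are (a) a nonzero integer $N$ and a Delsarte surface $S_N$ which, with its standard fibration, is the Delsarte base change of the standard fibration on $S$ along $t=s^N$, i.e. its affine equation is $f(x,y,s^N)$, up to a power of $s$; (b) a Delsarte surface $S'$ and a Delsarte birational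 map $\varphi:\mathbf P^3\dashrightarrow\mathbf P^3$ (a birational map $(X_0:\dots:X_3)\mapsto(\prod_j X_j^{b_{0j}}:\dots:\prod_j X_j^{b_{3j}})$ given by monomials) which maps $S_N$ onto $S'$ (i.e. the pull back of the equation of $S'$ along $\varphi$ is the equation of $S_N$ up to monomial factors) and is compatible with the standard fibrations on $S_N$ and $S'$, such that for some integer $n\ge 1$ the affine equation of $S'$ is one of 1. $m_1+m_2+(1+t^n)m_3$, where $m_1,m_2,m_3$ are monomials in $x$ and $y$; 2. $y^3+x^3+x^2+t^n$; 3. $y^a+x^2+x+t^n$ for some integer $a\ge 1$. -/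

import Mathlib

open MvPolynomial
open scoped KaehlerDifferential

noncomputable section

/-! ### Function fields of plane curves, genus -/

/-- The function field of the affine plane curve `p = 0` over `E` (a field if `p` is irreducible). -/
abbrev PlaneFunctionField {E : Type*} [Field E] (p : MvPolynomial (Fin 2) E) : Type _ :=
  FractionRing (MvPolynomial (Fin 2) E ⧸ Ideal.span {p})

theorem isDomain_planeCoordinateRing {E : Type*} [Field E] {p : MvPolynomial (Fin 2) E}
    (hp : Irreducible p) : IsDomain (MvPolynomial (Fin 2) E ⧸ Ideal.span {p}) := by
  have : (Ideal.span {p}).IsPrime :=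
    (Ideal.span_singleton_prime hp.ne_zero).2 hp.prime
  exact Ideal.Quotient.isDomain _

/-- The everywhere regular differentials of an algebraic function field `L / k`, `char k = 0`:
the Kähler differentials of `L / k` that come from a Kähler differential of `O / k` for every
valuation ring `O` of `L` containing `k`, i.e. for every place of `L / k`. -/
def regularDifferentials (k L : Type*) [Field k] [Field L] [Algebra k L] :
    Submodule k (Ω[L⁄k]) where
  carrier := {ω | ∀ O : ValuationSubring L, (∀ a : k, algebraMap k L a ∈ O) →
    ω ∈ Submodule.span O.toSubring ((KaehlerDifferential.D k L) '' (O : Set L))}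
  add_mem' := fun h₁ h₂ O hO => Submodule.add_mem _ (h₁ O hO) (h₂ O hO)
  zero_mem' := fun _ _ => Submodule.zero_mem _
  smul_mem' := fun a ω h O hO => by
    have := Submodule.smul_mem _ (⟨algebraMap k L a, hO a⟩ : O.toSubring) (h O hO)
    rw [← algebraMap_smul L a ω]
    exact this

/-- The genus of an algebraic function field in one variable `L / k`, `char k = 0`. -/
def functionFieldGenus (k L : Type*) [Field k] [Field L] [Algebra k L] : ℕ :=
  Module.finrank k (regularDifferentials k L)

/-- The geometric genus of an irreducible affine plane curve: the genus of its function field. -/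
def planeCurveGenus {E : Type*} [Field E] (p : MvPolynomial (Fin 2) E) (hp : Irreducible p) : ℕ :=
  letI := isDomain_planeCoordinateRing hp
  functionFieldGenus E (PlaneFunctionField p)

/-! ### Delsarte surfaces and their standard fibrations -/

/-- A Delsarte surface in `ℙ³` over `K`, given by its exponent matrix `A` and its nonzero
coefficients `c`; all rows of `A` have the same sum `d`, so that the equation is homogeneous. -/
structure DelsarteSurface (K : Type*) [Field K] where
  A : Matrix (Fin 4) (Fin 4) ℕ
  d : ℕ
  row_sum : ∀ i, ∑ j, A i j = d
  c : Fin 4 → K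
  c_ne_zero : ∀ i, c i ≠ 0

namespace DelsarteSurface

variable {K : Type*} [Field K]

/-- The homogeneous equation `F = ∑ᵢ cᵢ ∏ⱼ Xⱼ ^ aᵢⱼ`. -/
def equation (S : DelsarteSurface K) : MvPolynomial (Fin 4) K :=
  ∑ i, C (S.c i) * ∏ j, X j ^ S.A i j

/-- `F(x, y, u, 1)`, a polynomial in `x, y` over a `K`-algebra `E`, for `u : E`. The coordinates
are `x = X₀ / X₃`, `y = X₁ / X₃`, and the projection is `t = X₂ / X₃`. -/
def fibre (S : DelsarteSurface K) {E : Type*} [Field E] [Algebra K E] (u : E) :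
    MvPolynomial (Fin 2) E :=
  aeval ![X 0, X 1, C u, 1] S.equation

/-- The equation `f(x, y, t) = F(x, y, t, 1)` in `K(t)[x, y]` of the generic fibre of the standard
fibration `(X₀ : X₁ : X₂ : X₃) ↦ (X₂ : X₃)`. -/
def genericFibre (S : DelsarteSurface K) : MvPolynomial (Fin 2) (RatFunc K) :=
  S.fibre RatFunc.X

/-- The standard fibration is a Delsarte fibration of genus `g`: its generic fibre is an
irreducible curve of geometric genus `g`. -/
def StandardFibrationHasGenus (S : DelsarteSurface K) (g : ℕ) : Prop :=
  ∃ h : Irreducible S.genericFibre, planeCurveGenus S.genericFibre h = g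

/-- The standard fibration is isotrivial: over an algebraic closure of `K(t)` the generic fibre
becomes birational to a (plane) curve `C₀ : g = 0` defined over `K`, i.e. after a finite extension
of the base the fibration is birational to a product `C₀ × B → B`. -/
def IsIsotrivial (S : DelsarteSurface K) : Prop :=
  ∃ g : MvPolynomial (Fin 2) K, Irreducible g ∧
    Nonempty (PlaneFunctionField
        (S.fibre (algebraMap (RatFunc K) (AlgebraicClosure (RatFunc K)) RatFunc.X))
      ≃ₐ[AlgebraicClosure (RatFunc K)]
      PlaneFunctionField (map (algebraMap K (AlgebraicClosure (RatFunc K))) g))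

/-- `S₁` arises from `S` by multiplying the four coordinates and the equation by nonzero
constants. -/
def IsRescaling (S S₁ : DelsarteSurface K) : Prop :=
  ∃ (l : Fin 4 → K) (μ : K), (∀ j, l j ≠ 0) ∧ μ ≠ 0 ∧
    aeval (fun j => C (l j) * X j) S.equation = C μ * S₁.equation

/-- `S'`, with its standard fibration, is the Delsarte base change of the standard fibration of
`S` along `t = s ^ n`: the affine equation of `S'` is `f(x, y, s ^ n)`, up to a power of `s`, and
the monomial map `S' ⇢ S` is `(x, y, s) ↦ (x, y, s ^ n)`. The degree is `|n|`. -/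
def IsDelsarteBaseChange (S S' : DelsarteSurface K) (n : ℤ) : Prop :=
  n ≠ 0 ∧ ∃ e : ℤ, S'.genericFibre = C (RatFunc.X ^ e) * S.fibre (RatFunc.X ^ n : RatFunc K)

end DelsarteSurface

/-! ### Delsarte birational maps -/

/-- A monomial rational map `(X₀ : … : X₃) ↦ (∏ⱼ Xⱼ ^ b₀ⱼ : … : ∏ⱼ Xⱼ ^ b₃ⱼ)` of `ℙ³`, given by its
matrix of exponents: the four monomials have the same degree. -/
def IsMonomialMap (B : Matrix (Fin 4) (Fin 4) ℕ) : Prop :=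
  ∃ e, ∀ i, ∑ j, B i j = e

/-- The monomial map with exponent matrix `M` is the identity of `ℙ³` as a rational map: the four
monomials are `m X₀, …, m X₃` with a common monomial factor `m`. -/
def IsIdentityMap (M : Matrix (Fin 4) (Fin 4) ℕ) : Prop :=
  ∃ w : Fin 4 → ℕ, ∀ i j, M i j = (if i = j then 1 else 0) + w j

/-- A Delsarte birational map: a monomial rational map of `ℙ³` with a monomial rational inverse.
The composition of monomial maps is the product of their exponent matrices. -/
def IsDelsarteBirationalMap (B : Matrix (Fin 4) (Fin 4) ℕ) : Prop :=
  IsMonomialMap B ∧ ∃ B', IsMonomialMap B' ∧ IsIdentityMap (B * B') ∧ IsIdentityMap (B' * B)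

/-- The monomial map respects the standard fibration: the pull back of `X₂ / X₃` is `X₂ / X₃`. -/
def RespectsStandardFibration (B : Matrix (Fin 4) (Fin 4) ℕ) : Prop :=
  ∀ j, B 2 j + (if j = 3 then 1 else 0) = B 3 j + (if j = 2 then 1 else 0)

/-- The pull back of the equation of `S'` along the monomial map `B` is the equation of `S` up to
monomial factors: on the torus `X₀X₁X₂X₃ ≠ 0` the inverse image of `S'` is `S`. For a Delsarte
birational map this says that it maps `S` onto `S'`. -/
def MapsSurface {K : Type*} [Field K] (B : Matrix (Fin 4) (Fin 4) ℕ)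
    (S S' : DelsarteSurface K) : Prop :=
  ∃ u v : Fin 4 → ℕ,
    (∏ j, X j ^ u j) * aeval (fun i => ∏ j, (X j : MvPolynomial (Fin 4) K) ^ B i j) S'.equation =
      (∏ j, X j ^ v j) * S.equation

end

/-! Write the generic fibre as the curve `∑ cᵢ t ^ Tᵢ x ^ pᵢ y ^ qᵢ = 0`. The proof is governed by
the four lattice points `(pᵢ, qᵢ)` and by the affine relation `k` between them given by maximal
minors (`affineRelation`). Up to the degree, `det A` is `∑ kᵢ Tᵢ` (`det_eq`). Hence `det A ≠ 0` says
that the product of the `(cᵢ t ^ Tᵢ) ^ kᵢ`, which no rescaling of the variables or of the equation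
changes, really depends on `t` (`prod_ne_algebraMap`). A configuration of points is only relevant up
to integral affine changes: rescaling, base change and a Delsarte birational map bring the equation
to `t ^ n m₀ + m₁ + m₂ + m₃` for any equivalent configuration with `k₀ ≠ 0`
(`exists_baseChange_and_birationalMap`). It remains to show that two of the points coincide, which
gives the first normal form, or that the points are equivalent to those of the second or of the
third (`exists_perm_of_isIsotrivial`).

Let the points be distinct. If they lie on two neighbouring lattice lines, the equation is linear in
a suitable monomial coordinate, the curve is rational and its genus is zero
(`planeCurveGenus_eq_zero_of_hasWidthOne`). Otherwise an interior lattice point `(r₁, r₂)` of the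
convex hull is sought, because it yields the regular differential `x ^ r₁ y ^ r₂ / G · dx / x`,
where `G` is `y ∂/∂y` of the equation (`mem_regularDifferentials_of_isInteriorPoint`). Isotriviality
is then contradicted by degenerating this differential.

For this the isomorphism with a constant curve is descended to a finitely generated field of
constants `E` (`exists_normalized_descent`). The function field of the fibre becomes a compositum
`L` of `E` with a function field `F` over `K`, and the coefficients become `kᵢ`, or simple variants
of them, except for the first, which carries a power of a nonconstant `σ`. At a place of `E` where
`σ` vanishes the equation acquires a degenerate point. Zooming in on that point embeds `L` into
Laurent series over a field `κ` that contains the functions on the vanishing cycle, and the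
differential acquires a leading coefficient, which is a differential on `κ`.

A constant curve restricts this coefficient (`exists_primitive_or_vanishing`). Either the limit
point moves into a single place of `F`, and then the leading coefficient is exact because regular
differentials can be integrated termwise, or `F` embeds into `κ`, and then the leading coefficient
is regular at the chosen place of `κ`.

If no three points are collinear, the degenerate point is a node, since the Hessian there has
determinant `-∏ kᵢ` (`discriminant_affineRelation`). The vanishing cycle is `U V = 1` and the
leading coefficient is a multiple of `dU / U`, which is neither exact nor regular. So an interior
point is impossible (`not_isInteriorPoint_of_isIsotrivial`), while lattice geometry provides one
(`hasWidthOne_or_exists_isInteriorPoint`). If three points lie on a line and the fourth at height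
`a`, the vanishing cycle is `Y ^ a = U ^ 2 - 1` and the leading coefficient is a multiple of `Y ^
(r₂ - a) dU`. It is never exact (`apply_ne_of_mem_adjoin`), and it has a pole at infinity as soon as
`a ≤ 2 r₂`. Such an interior point exists except for the configurations in the second and third
normal form (`exists_isInteriorPoint_of_collinear`). -/

/-! ### Laurent series: coefficientwise maps and derivations -/

section Laurent

open LaurentSeries

/-- The coefficientwise extension of a ring homomorphism to Laurent series. -/
noncomputable def laurentMap {A B : Type*} [CommRing A] [CommRing B] (φ : A →+* B) :
    A⸨X⸩ →+* B⸨X⸩ where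
  toFun f := HahnSeries.map f φ
  map_one' := by ext; simp [HahnSeries.coeff_one, apply_ite φ]
  map_mul' _ _ := HahnSeries.map_mul (φ : A →ₙ+* B)
  map_zero' := by ext; simp
  map_add' _ _ := by ext; simp

@[simp]
theorem coeff_laurentMap {A B : Type*} [CommRing A] [CommRing B] (φ : A →+* B) (f : A⸨X⸩) (n : ℤ) :
    (laurentMap φ f).coeff n = φ (f.coeff n) := rfl

/-- The coefficientwise extension of an additive map to Laurent series. -/
noncomputable def coeffMap {k : Type*} [CommRing k] (δ : k →+ k) : k⸨X⸩ →+ k⸨X⸩ where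
  toFun f := HahnSeries.map f δ
  map_zero' := by ext; simp
  map_add' _ _ := by ext; simp

@[simp]
theorem coeff_coeffMap {k : Type*} [CommRing k] (δ : k →+ k) (f : k⸨X⸩) (n : ℤ) :
    (coeffMap δ f).coeff n = δ (f.coeff n) := rfl

theorem coeffMap_mul {k : Type*} [CommRing k] (δ : k →+ k)
    (hδ : ∀ a b, δ (a * b) = a * δ b + b * δ a) (f g : k⸨X⸩) :
    coeffMap δ (f * g) = f * coeffMap δ g + g * coeffMap δ f := by
  ext n
  -- The derivatives have smaller support than the series, so all three products can be summed over
  -- one index set.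
  have hs : ∀ h : k⸨X⸩, (coeffMap δ h).support ⊆ h.support := fun h m hm => by
    simp only [HahnSeries.mem_support, coeff_coeffMap] at hm ⊢
    exact fun h0 => hm (by rw [h0, map_zero])
  rw [coeff_coeffMap, HahnSeries.coeff_add, HahnSeries.coeff_mul,
    HahnSeries.coeff_mul_right' g.isPWO_support (hs g), mul_comm g,
    HahnSeries.coeff_mul_left' f.isPWO_support (hs f), map_sum, ← Finset.sum_add_distrib]
  refine Finset.sum_congr rfl fun ij _ => ?_
  simp only [hδ, coeff_coeffMap]
  ring

/-- The Euler derivation `X d/dX` of Laurent series. -/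
noncomputable def euler (k : Type*) [CommRing k] : k⸨X⸩ →+ k⸨X⸩ where
  toFun f := ⟨fun n => n * f.coeff n, f.isPWO_support.mono fun m hm => by
      simp only [HahnSeries.mem_support, Function.mem_support] at hm ⊢
      exact fun h0 => hm (by rw [h0, mul_zero])⟩
  map_zero' := by ext; simp
  map_add' _ _ := by ext; simp [mul_add]

@[simp]
theorem coeff_euler {k : Type*} [CommRing k] (f : k⸨X⸩) (n : ℤ) :
    (euler k f).coeff n = n * f.coeff n := rfl

theorem euler_mul {k : Type*} [CommRing k] (f g : k⸨X⸩) :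
    euler k (f * g) = f * euler k g + g * euler k f := by
  ext n
  have hs : ∀ h : k⸨X⸩, (euler k h).support ⊆ h.support := fun h m hm => by
    simp only [HahnSeries.mem_support, coeff_euler] at hm ⊢
    exact fun h0 => hm (by rw [h0, mul_zero])
  rw [coeff_euler, HahnSeries.coeff_add, HahnSeries.coeff_mul,
    HahnSeries.coeff_mul_right' g.isPWO_support (hs g), mul_comm g,
    HahnSeries.coeff_mul_left' f.isPWO_support (hs f), Finset.mul_sum, ← Finset.sum_add_distrib]
  refine Finset.sum_congr rfl fun ij hij => ?_
  have : ij.1 + ij.2 = n := by simp at hij; exact hij.2.2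
  rw [← this, coeff_euler, coeff_euler]
  push_cast
  ring

variable {k : Type*} [Field k]

theorem orderTop_le_coeffMap (δ : k →+ k) (f : k⸨X⸩) :
    f.orderTop ≤ (coeffMap δ f).orderTop := by
  refine HahnSeries.le_orderTop_iff_forall.2 fun j hj => ?_
  rw [coeff_coeffMap, HahnSeries.coeff_eq_zero_of_lt_orderTop hj, map_zero]

theorem orderTop_le_euler (f : k⸨X⸩) : f.orderTop ≤ (euler k f).orderTop := by
  refine HahnSeries.le_orderTop_iff_forall.2 fun j hj => ?_
  rw [coeff_euler, HahnSeries.coeff_eq_zero_of_lt_orderTop hj, mul_zero]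

/-- In characteristic zero the Euler derivation only loses the coefficient of index `0`, which is
absent here. -/
theorem orderTop_euler [CharZero k] (f : k⸨X⸩) (hf : 0 < f.orderTop) :
    (euler k f).orderTop = f.orderTop := by
  refine le_antisymm ?_ (orderTop_le_euler f)
  refine HahnSeries.le_orderTop_iff_forall.2 fun j hj => ?_
  by_cases hj0 : j = 0
  · subst hj0; exact HahnSeries.coeff_eq_zero_of_lt_orderTop hf
  have := HahnSeries.coeff_eq_zero_of_lt_orderTop hj
  rw [coeff_euler] at this
  exact (mul_eq_zero.1 this).resolve_left (by exact_mod_cast hj0)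

theorem orderTop_laurentMap {k' : Type*} [Field k'] (φ : k →+* k') (f : k⸨X⸩) :
    (laurentMap φ f).orderTop = f.orderTop := by
  refine le_antisymm ?_ ?_ <;> refine HahnSeries.le_orderTop_iff_forall.2 fun j hj => ?_
  · have := HahnSeries.coeff_eq_zero_of_lt_orderTop hj
    rwa [coeff_laurentMap, map_eq_zero] at this
  · rw [coeff_laurentMap, HahnSeries.coeff_eq_zero_of_lt_orderTop hj, map_zero]

theorem exists_powerSeries_of_orderTop_nonneg {f : k⸨X⸩} (hf : 0 ≤ f.orderTop) :
    ∃ P : PowerSeries k, f = HahnSeries.ofPowerSeries ℤ k P := by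
  refine ⟨PowerSeries.mk fun n => f.coeff n, ?_⟩
  ext n
  rcases lt_or_ge n 0 with hn | hn
  · rw [HahnSeries.coeff_eq_zero_of_lt_orderTop (lt_of_lt_of_le (by exact_mod_cast hn) hf)]
    rw [PowerSeries.coeff_coe, if_pos hn]
  · lift n to ℕ using hn
    simp

theorem orderTop_ofPowerSeries_nonneg (P : PowerSeries k) :
    0 ≤ (HahnSeries.ofPowerSeries ℤ k P).orderTop := by
  refine HahnSeries.le_orderTop_iff_forall.2 fun j hj => ?_
  rw [PowerSeries.coeff_coe, if_pos (by exact_mod_cast hj)]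

/-- The coefficient of lowest possible index of a product. -/
theorem coeff_mul_of_le_orderTop {f g : k⸨X⸩} {a b : ℤ} (hf : (a : WithTop ℤ) ≤ f.orderTop)
    (hg : (b : WithTop ℤ) ≤ g.orderTop) :
    (f * g).coeff (a + b) = f.coeff a * g.coeff b := by
  rcases hf.lt_or_eq with hf' | hf'
  · rw [HahnSeries.coeff_eq_zero_of_lt_orderTop hf', zero_mul]
    apply HahnSeries.coeff_eq_zero_of_lt_orderTop
    rw [HahnSeries.orderTop_mul, WithTop.coe_add]
    by_cases h : g.orderTop = ⊤
    · simp [h, ← WithTop.coe_add]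
    exact WithTop.add_lt_add_of_lt_of_le (by simp) hf' hg
  rcases hg.lt_or_eq with hg' | hg'
  · rw [HahnSeries.coeff_eq_zero_of_lt_orderTop hg', mul_zero]
    apply HahnSeries.coeff_eq_zero_of_lt_orderTop
    rw [HahnSeries.orderTop_mul, WithTop.coe_add]
    exact WithTop.add_lt_add_of_le_of_lt (by simp) hf hg'
  have hf0 : f ≠ 0 := by rintro rfl; simp at hf'
  have hg0 : g ≠ 0 := by rintro rfl; simp at hg'
  have ha : a = f.order := by
    rw [← HahnSeries.order_eq_orderTop_of_ne_zero hf0] at hf'; exact_mod_cast hf'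
  have hb : b = g.order := by
    rw [← HahnSeries.order_eq_orderTop_of_ne_zero hg0] at hg'; exact_mod_cast hg'
  rw [ha, hb, HahnSeries.coeff_mul_order_add_order, HahnSeries.leadingCoeff_eq,
    HahnSeries.leadingCoeff_eq]

theorem coeff_zero_mul {f g : k⸨X⸩} (hf : 0 ≤ f.orderTop) (hg : 0 ≤ g.orderTop) :
    (f * g).coeff 0 = f.coeff 0 * g.coeff 0 := by
  simpa using coeff_mul_of_le_orderTop (a := 0) (b := 0) hf hg

theorem orderTop_sub_C_pos {f : k⸨X⸩} (hf : 0 ≤ f.orderTop) :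
    0 < (f - HahnSeries.C (f.coeff 0)).orderTop := by
  rw [show (0 : WithTop ℤ) = ((0 : ℤ) : WithTop ℤ) from rfl, ← not_le]
  intro h
  rw [← not_lt] at h
  apply h
  rw [← not_le]
  intro h
  obtain ⟨j, hj, hj0⟩ := HahnSeries.orderTop_lt_iff_exists.1
    (lt_of_le_of_lt h (by exact_mod_cast (zero_lt_one : (0 : ℤ) < 1)) :
      (f - HahnSeries.C (f.coeff 0)).orderTop < ((1 : ℤ) : WithTop ℤ))
  have hj : j < 0 + 1 := by simpa using (by exact_mod_cast hj : j < 1)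
  apply hj0
  rcases (Int.lt_add_one_iff.1 hj).lt_or_eq with hj | rfl
  · rw [HahnSeries.coeff_sub, HahnSeries.C_apply, HahnSeries.coeff_single_of_ne hj.ne, sub_zero]
    exact HahnSeries.coeff_eq_zero_of_lt_orderTop (lt_of_lt_of_le (by exact_mod_cast hj) hf)
  · simp [HahnSeries.C_apply]

/-- The valuation ring of Laurent series without polar part. -/
noncomputable def laurentIntegers (k : Type*) [Field k] : ValuationSubring k⸨X⸩ where
  carrier := {f | 0 ≤ f.orderTop}
  mul_mem' {f g} hf hg := by
    simp only [Set.mem_ofPred_eq, HahnSeries.orderTop_mul] at hf hg ⊢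
    exact add_nonneg hf hg
  one_mem' := by simp
  add_mem' {f g} hf hg := by
    simp only [Set.mem_ofPred_eq] at hf hg ⊢
    exact le_trans (le_min hf hg) HahnSeries.min_orderTop_le_orderTop_add
  zero_mem' := by simp
  neg_mem' {f} hf := by simpa [HahnSeries.orderTop_neg] using hf
  mem_or_inv_mem' f := by
    by_cases h0 : f = 0
    · left; simp [h0]
    simp only [Set.mem_ofPred_eq]
    have h := congrArg HahnSeries.orderTop (mul_inv_cancel₀ h0)
    rw [HahnSeries.orderTop_mul, HahnSeries.orderTop_one,
      ← HahnSeries.order_eq_orderTop_of_ne_zero h0,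
      ← HahnSeries.order_eq_orderTop_of_ne_zero (inv_ne_zero h0)] at h
    rw [← HahnSeries.order_eq_orderTop_of_ne_zero h0,
      ← HahnSeries.order_eq_orderTop_of_ne_zero (inv_ne_zero h0)]
    norm_cast at h ⊢
    omega

@[simp]
theorem mem_laurentIntegers {f : k⸨X⸩} : f ∈ laurentIntegers k ↔ 0 ≤ f.orderTop := by
  change f ∈ {f : k⸨X⸩ | 0 ≤ f.orderTop} ↔ _
  simp

end Laurent

/-! ### Fields of transcendence degree at most one -/

section TrdegOne

variable {K F : Type*} [Field K] [Field F] [Algebra K F]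

theorem isAlgebraic_adjoin_of_transcendental (h1 : Algebra.trdeg K F ≤ 1) {z : F}
    (hz : Transcendental K z) : Algebra.IsAlgebraic (Algebra.adjoin K {z}) F := by
  have hi : AlgebraicIndependent K (fun i : ({z} : Set F) => (i : F)) := by
    rw [algebraicIndependent_singleton_iff ⟨z, rfl⟩]
    exact hz
  have hb := hi.isTranscendenceBasis_of_trdeg_le_of_finite (by simpa using h1)
  have := hb.isAlgebraic
  rwa [Subtype.range_coe] at this

theorem isAlgebraic_adjoinField_of_transcendental (h1 : Algebra.trdeg K F ≤ 1) {z : F}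
    (hz : Transcendental K z) : Algebra.IsAlgebraic (IntermediateField.adjoin K {z}) F := by
  have := isAlgebraic_adjoin_of_transcendental h1 hz
  open scoped IntermediateField.algebraAdjoinAdjoin in
  exact (IsFractionRing.comap_isAlgebraic_iff (A := Algebra.adjoin K {z})
    (K := IntermediateField.adjoin K {z}) (C := F)).1 this

theorem finiteDimensional_adjoin_of_transcendental (h1 : Algebra.trdeg K F ≤ 1) {S : Finset F}
    (hS : IntermediateField.adjoin K (S : Set F) = ⊤) {z : F} (hz : Transcendental K z) :
    FiniteDimensional (IntermediateField.adjoin K {z}) F := by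
  have := isAlgebraic_adjoinField_of_transcendental h1 hz
  have h : IntermediateField.adjoin (IntermediateField.adjoin K {z}) (S : Set F) = ⊤ := by
    have hT := IntermediateField.subset_adjoin (IntermediateField.adjoin K {z}) (S : Set F)
    generalize IntermediateField.adjoin (IntermediateField.adjoin K {z}) (S : Set F) = T at hT
    rw [← top_le_iff]
    intro x _
    have hx : x ∈ IntermediateField.adjoin K (S : Set F) := hS ▸ trivial
    induction hx using IntermediateField.adjoin_induction with
    | mem x hx => exact hT hx
    | algebraMap x => exact T.algebraMap_mem (algebraMap K (IntermediateField.adjoin K {z}) x)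
    | add x y _ _ hx hy => exact T.add_mem (hx trivial) (hy trivial)
    | inv x _ hx => exact T.inv_mem (hx trivial)
    | mul x y _ _ hx hy => exact T.mul_mem (hx trivial) (hy trivial)
  have hfin := IntermediateField.finiteDimensional_adjoin (K := IntermediateField.adjoin K {z})
    (S := (S : Set F)) (fun x _ => (Algebra.IsAlgebraic.isAlgebraic x).isIntegral)
  rw [h] at hfin
  exact Module.Finite.equiv (IntermediateField.topEquiv (F := IntermediateField.adjoin K {z})
    (E := F)).toLinearEquiv

/-- In a field of transcendence degree one a nonzero element and another element satisfy a relation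
that is not divisible by the first variable. -/
theorem exists_relation (h1 : Algebra.trdeg K F ≤ 1) {a : F} (ha : a ≠ 0) (b : F) :
    ∃ P : Polynomial (Polynomial K), P.coeff 0 ≠ 0 ∧
      P.eval₂ (Polynomial.aeval b : Polynomial K →ₐ[K] F).toRingHom a = 0 := by
  by_cases hb : Transcendental K b
  swap
  · rw [Transcendental, not_not] at hb
    obtain ⟨p, hp, hpb⟩ := hb
    exact ⟨Polynomial.C p, by simpa using hp, by simpa using hpb⟩
  have := isAlgebraic_adjoin_of_transcendental h1 hb
  obtain ⟨p, hp, hpa⟩ := Algebra.IsAlgebraic.isAlgebraic (R := Algebra.adjoin K {b}) a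
  have hmem : ∀ x : Algebra.adjoin K {b}, ∃ q : Polynomial K, Polynomial.aeval b q = (x : F) := by
    intro x
    have h : (x : F) ∈ (Polynomial.aeval b : Polynomial K →ₐ[K] F).range :=
      Algebra.adjoin_singleton_eq_range_aeval K b ▸ x.2
    exact h
  choose q hq using hmem
  let P : Polynomial (Polynomial K) := ∑ i ∈ p.support, Polynomial.monomial i (q (p.coeff i))
  have hPc : ∀ i, Polynomial.aeval b (P.coeff i) = ((p.coeff i : Algebra.adjoin K {b}) : F) := by
    intro i
    simp only [P, Polynomial.finsetSum_coeff, Polynomial.coeff_monomial, Finset.sum_ite_eq']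
    split_ifs with hi
    · exact hq _
    · rw [Polynomial.notMem_support_iff.1 hi]; simp
  have hP0 : P ≠ 0 := by
    intro h
    apply hp
    ext i
    have := hPc i
    rw [h] at this
    simpa using this.symm
  have hPa : P.eval₂ (Polynomial.aeval b : Polynomial K →ₐ[K] F).toRingHom a = 0 := by
    rw [Polynomial.aeval_eq_sum_range] at hpa
    simp only [P, Polynomial.eval₂_finsetSum, Polynomial.eval₂_monomial]
    rw [← hpa, ← Polynomial.sum_over_range' p (f := fun i c => c • a ^ i) (by simp) _
      (Nat.lt_succ_self _)]
    exact Finset.sum_congr rfl fun i _ => by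
      simp [hq, Algebra.smul_def]
  -- As `a ≠ 0`, all factors `X` can be cancelled from the relation.
  obtain ⟨Q, hQ, hQ'⟩ := Polynomial.exists_eq_pow_rootMultiplicity_mul_and_not_dvd P hP0 0
  refine ⟨Q, ?_, ?_⟩
  · rwa [map_zero, sub_zero, Polynomial.X_dvd_iff] at hQ'
  · rw [hQ] at hPa
    simpa [Polynomial.eval₂_mul, Polynomial.eval₂_pow, ha] using hPa

theorem trdeg_le_one_of_isAlgebraic_adjoin (z : F)
    [Algebra.IsAlgebraic (IntermediateField.adjoin K {z}) F] : Algebra.trdeg K F ≤ 1 := by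
  have : Algebra.IsAlgebraic (Algebra.adjoin K {z}) F := by
    open scoped IntermediateField.algebraAdjoinAdjoin in
    exact (IsFractionRing.comap_isAlgebraic_iff (A := Algebra.adjoin K {z})
      (K := IntermediateField.adjoin K {z}) (C := F)).2 inferInstance
  simpa using Algebra.IsAlgebraic.trdeg_le_cardinalMk K ({z} : Set F)

/-- A field generated by two algebraically dependent elements has transcendence degree at most
one. -/
theorem trdeg_le_one_of_pair {x y : F} (hxy : IntermediateField.adjoin K {x, y} = ⊤)
    (h : ¬ AlgebraicIndependent K ![x, y]) : Algebra.trdeg K F ≤ 1 := by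
  have halg : Algebra.IsAlgebraic (Algebra.adjoin K {x, y}) F := by
    open scoped IntermediateField.algebraAdjoinAdjoin in
    refine (IsFractionRing.comap_isAlgebraic_iff (A := Algebra.adjoin K {x, y})
      (K := IntermediateField.adjoin K {x, y}) (C := F)).2 ?_
    rw [hxy]
    exact ⟨fun f => isAlgebraic_algebraMap (⟨f, trivial⟩ : (⊤ : IntermediateField K F))⟩
  obtain ⟨T, hT, hTb⟩ := exists_isTranscendenceBasis_subset (R := K) ({x, y} : Set F)
  rw [← hTb.cardinalMk_eq_trdeg]
  by_contra hcard
  have hfin : T.Finite := (Set.toFinite _).subset hT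
  have h2 : 1 < T.ncard := by
    rw [not_le] at hcard
    have := hfin.fintype
    rw [Cardinal.mk_fintype] at hcard
    rw [Set.ncard_eq_toFinset_card', Set.toFinset_card]
    exact_mod_cast hcard
  have hne : x ≠ y := by
    rintro rfl
    have := Set.ncard_le_ncard hT (Set.toFinite _)
    simp at this
    omega
  have hTeq : T = {x, y} := Set.eq_of_subset_of_ncard_le hT (by rw [Set.ncard_pair hne]; omega)
    (Set.toFinite _)
  subst hTeq
  apply h
  have := hTb.1
  let e : Fin 2 → ({x, y} : Set F) := ![⟨x, by simp⟩, ⟨y, by simp⟩]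
  have he : Function.Injective e := by
    intro i j hij
    fin_cases i <;> fin_cases j <;> simp_all [e, hne.symm]
  have h3 := this.comp e he
  convert h3 using 1
  ext i
  fin_cases i <;> rfl

end TrdegOne

/-! ### Kähler differentials of a function field of one variable. -/

section Differentials

variable {E L : Type*} [Field E] [Field L] [Algebra E L] [CharZero E]

/-- `L` is separable algebraic over `E(z)`, so the differentials relative to `E(z)` vanish. By the
first exact sequence everything comes from differentials of `E(z)`, and these are multiples of `dz`.
-/
theorem exists_D_eq_smul_D (z : L) [Algebra.IsAlgebraic (IntermediateField.adjoin E {z}) L] (f : L) :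
    ∃ g : L, KaehlerDifferential.D E L f = g • KaehlerDifferential.D E L z := by
  have : Algebra.FormallyUnramified (IntermediateField.adjoin E {z}) L :=
    Algebra.FormallyUnramified.of_isSeparable _ _
  have hsub : Subsingleton Ω[L⁄IntermediateField.adjoin E {z}] := inferInstance
  suffices h : ∀ ω : Ω[L⁄E], ω ∈ Submodule.span L {KaehlerDifferential.D E L z} by
    obtain ⟨g, hg⟩ := Submodule.mem_span_singleton.1 (h (KaehlerDifferential.D E L f))
    exact ⟨g, hg.symm⟩
  intro ω
  have hker : ω ∈ LinearMap.ker (KaehlerDifferential.map E (IntermediateField.adjoin E {z}) L L) :=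
    Subsingleton.elim _ _
  have hex := KaehlerDifferential.exact_mapBaseChange_map E (IntermediateField.adjoin E {z}) L
  obtain ⟨w, rfl⟩ := (hex ω).1 hker
  clear hker hex
  have hz : ∀ a ∈ IntermediateField.adjoin E {z}, KaehlerDifferential.D E L a ∈
      Submodule.span L {KaehlerDifferential.D E L z} := by
    intro a ha
    induction ha using IntermediateField.adjoin_induction with
    | mem x hx =>
      rw [Set.mem_singleton_iff.1 hx]
      exact Submodule.subset_span rfl
    | algebraMap x => simp
    | add x y _ _ hx hy => rw [map_add]; exact Submodule.add_mem _ hx hy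
    | inv x _ hx =>
      rw [Derivation.leibniz_inv]
      exact Submodule.smul_mem _ _ hx
    | mul x y _ _ hx hy =>
      rw [Derivation.leibniz]
      exact Submodule.add_mem _ (Submodule.smul_mem _ _ hy) (Submodule.smul_mem _ _ hx)
  induction w using TensorProduct.induction_on with
  | zero => simp
  | add a b ha hb => rw [map_add]; exact Submodule.add_mem _ ha hb
  | tmul l η =>
    rw [KaehlerDifferential.mapBaseChange_tmul]
    refine Submodule.smul_mem _ _ ?_
    have hη : η ∈ Submodule.span (IntermediateField.adjoin E {z})
        (Set.range (KaehlerDifferential.D E (IntermediateField.adjoin E {z}))) := by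
      rw [KaehlerDifferential.span_range_derivation]; trivial
    induction hη using Submodule.span_induction with
    | mem x hx =>
      obtain ⟨a, rfl⟩ := hx
      rw [KaehlerDifferential.map_D]
      exact hz _ a.2
    | zero => simp
    | add a b _ _ ha hb => rw [map_add]; exact Submodule.add_mem _ ha hb
    | smul c a _ ha =>
      rw [map_smul]
      exact Submodule.smul_of_tower_mem _ c ha

theorem exists_eq_smul_D (z : L) [Algebra.IsAlgebraic (IntermediateField.adjoin E {z}) L]
    (ω : Ω[L⁄E]) : ∃ h : L, ω = h • KaehlerDifferential.D E L z := by
  have : ω ∈ Submodule.span L (Set.range (KaehlerDifferential.D E L)) := by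
    rw [KaehlerDifferential.span_range_derivation]; trivial
  induction this using Submodule.span_induction with
  | mem x hx =>
    obtain ⟨a, rfl⟩ := hx
    exact exists_D_eq_smul_D z a
  | zero => exact ⟨0, by simp⟩
  | add a b _ _ ha hb =>
    obtain ⟨x, rfl⟩ := ha
    obtain ⟨y, rfl⟩ := hb
    exact ⟨x + y, by rw [add_smul]⟩
  | smul c a _ ha =>
    obtain ⟨x, rfl⟩ := ha
    exact ⟨c * x, by rw [mul_smul]⟩

end Differentials

/-! ### Extension of constants of a function field -/

theorem Transcendental.linearIndependent_pow' {K F : Type*} [Field K] [Field F] [Algebra K F] {z : F}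
    (hz : Transcendental K z) : LinearIndependent K fun i : ℕ => z ^ i := by
  have h := (Polynomial.basisMonomials K).linearIndependent.map'
    (Polynomial.aeval z : Polynomial K →ₐ[K] F).toLinearMap
    (LinearMap.ker_eq_bot.2 (transcendental_iff_injective.1 hz))
  have h2 : (⇑(Polynomial.aeval z : Polynomial K →ₐ[K] F).toLinearMap ∘
      ⇑(Polynomial.basisMonomials K)) = fun i : ℕ => z ^ i := by
    ext i
    simp
  rwa [h2] at h

theorem isPrincipalIdealRing_adjoin_singleton {K F : Type*} [Field K] [Field F] [Algebra K F]
    (z : F) : IsPrincipalIdealRing (Algebra.adjoin K {z}) := by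
  refine IsPrincipalIdealRing.of_surjective (R := Polynomial K)
    (Polynomial.aeval (⟨z, Algebra.self_mem_adjoin_singleton K z⟩ : Algebra.adjoin K {z})).toRingHom
    fun x => ?_
  obtain ⟨x, hx⟩ := x
  have h := hx
  rw [Algebra.adjoin_singleton_eq_range_aeval] at h
  obtain ⟨p, hp⟩ := h
  refine ⟨p, Subtype.ext ?_⟩
  refine Eq.trans ?_ hp
  exact (Polynomial.aeval_algebraMap_apply F
    (⟨z, Algebra.self_mem_adjoin_singleton K z⟩ : Algebra.adjoin K {z}) p).symm

open scoped IntermediateField.algebraAdjoinAdjoin in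
theorem linearIndependent_adjoinField {E L : Type*} [Field E] [Field L] [Algebra E L] {z : L}
    {ι : Type*} {b : ι → L} (hb : LinearIndependent (Algebra.adjoin E {z}) b) :
    LinearIndependent (IntermediateField.adjoin E {z}) b :=
  hb.localization (IntermediateField.adjoin E {z}) (nonZeroDivisors (Algebra.adjoin E {z}))

/-- `E[z]` is a principal ideal ring, hence integrally closed in its fraction field `E(z)`. -/
theorem mem_adjoin_of_isIntegral {E L : Type*} [Field E] [Field L] [Algebra E L] {z r : L}
    (hr : r ∈ IntermediateField.adjoin E {z}) (hi : IsIntegral (Algebra.adjoin E {z}) r) :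
    r ∈ Algebra.adjoin E {z} := by
  have := isPrincipalIdealRing_adjoin_singleton (K := E) z
  open scoped IntermediateField.algebraAdjoinAdjoin in
  have h2 : IsIntegral (Algebra.adjoin E {z}) (⟨r, hr⟩ : IntermediateField.adjoin E {z}) :=
    (isIntegral_algebraMap_iff (algebraMap (IntermediateField.adjoin E {z}) L).injective).1 hi
  open scoped IntermediateField.algebraAdjoinAdjoin in
  obtain ⟨y, hy⟩ := IsIntegrallyClosed.isIntegral_iff.1 h2
  have h3 : (y : L) = r := congrArg (algebraMap (IntermediateField.adjoin E {z}) L) hy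
  exact h3 ▸ y.2

/-- `L` is generated by `E` and `F`, and `E` and `F` are linearly disjoint over `K`. -/
structure IsConstantExtension (K E F L : Type*) [Field K] [Field E] [Field F] [Field L]
    [Algebra K F] [Algebra E L] [Algebra F L] : Prop where
  linearIndependent_fin : ∀ {n : ℕ} {f : Fin n → F}, LinearIndependent K f →
    LinearIndependent E fun i => algebraMap F L (f i)
  adjoin_eq_top : IntermediateField.adjoin E (Set.range (algebraMap F L)) = ⊤

section ConstantExtension

variable {K E F L : Type*} [Field K] [Field E] [Field F] [Field L]
  [Algebra K E] [Algebra K F] [Algebra K L] [Algebra E L] [Algebra F L]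
  [IsScalarTower K E L] [IsScalarTower K F L]

namespace IsConstantExtension

theorem linearIndependent (hc : IsConstantExtension K E F L) {ι : Type*} {f : ι → F}
    (hf : LinearIndependent K f) : LinearIndependent E fun i => algebraMap F L (f i) := by
  rw [linearIndependent_iff_finset_linearIndependent]
  intro s
  have h1 : LinearIndependent K (f ∘ (Subtype.val : s → ι)) :=
    hf.comp _ Subtype.val_injective
  have h2 := hc.linearIndependent_fin (h1.comp s.equivFin.symm s.equivFin.symm.injective)
  have h3 := h2.comp s.equivFin s.equivFin.injective
  convert h3 using 1
  ext i
  simp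

theorem algebraMap_mem_adjoin (z : F) {r : F} (hr : r ∈ IntermediateField.adjoin K {z}) :
    algebraMap F L r ∈ IntermediateField.adjoin E {algebraMap F L z} := by
  induction hr using IntermediateField.adjoin_induction with
  | mem x hx => rw [Set.mem_singleton_iff.1 hx]; exact IntermediateField.mem_adjoin_simple_self _ _
  | algebraMap x =>
    rw [← IsScalarTower.algebraMap_apply, IsScalarTower.algebraMap_apply K E L]
    exact IntermediateField.algebraMap_mem _ _
  | add x y _ _ hx hy => rw [map_add]; exact add_mem hx hy
  | inv x _ hx => rw [map_inv₀]; exact inv_mem hx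
  | mul x y _ _ hx hy => rw [map_mul]; exact mul_mem hx hy

theorem algebraMap_mem_adjoin' (z : F) {r : F} (hr : r ∈ Algebra.adjoin K {z}) :
    algebraMap F L r ∈ Algebra.adjoin E {algebraMap F L z} := by
  induction hr using Algebra.adjoin_induction with
  | mem x hx => rw [Set.mem_singleton_iff.1 hx]; exact Algebra.self_mem_adjoin_singleton _ _
  | algebraMap x =>
    rw [← IsScalarTower.algebraMap_apply, IsScalarTower.algebraMap_apply K E L]
    exact Subalgebra.algebraMap_mem _ _
  | add x y _ _ hx hy => rw [map_add]; exact add_mem hx hy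
  | mul x y _ _ hx hy => rw [map_mul]; exact mul_mem hx hy

/-- Linear disjointness is only known over the constants. It is lifted to `z` by applying it to the
products `z ^ i * b j`, which are independent over `K`; clearing denominators then passes from
`E[z]` to `E(z)`. -/
theorem linearIndependent_adjoin (hc : IsConstantExtension K E F L) {z : F}
    (hz : Transcendental K z) {ι : Type*} {b : ι → F}
    (hb : LinearIndependent (IntermediateField.adjoin K {z}) b) :
    LinearIndependent (IntermediateField.adjoin E {algebraMap F L z})
      fun i => algebraMap F L (b i) := by
  have hz' : Transcendental K
      (⟨z, IntermediateField.mem_adjoin_simple_self K z⟩ : IntermediateField.adjoin K {z}) := by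
    rw [← transcendental_algebraMap_iff (S := IntermediateField.adjoin K {z}) (A := F)
      (algebraMap (IntermediateField.adjoin K {z}) F).injective]
    exact hz
  have h2 := hc.linearIndependent (linearIndependent_smul hz'.linearIndependent_pow' hb)
  refine linearIndependent_adjoinField ?_
  rw [linearIndependent_iff'] at h2 ⊢
  intro s g hg i hi
  have hp : ∀ i, ∃ p : Polynomial E, Polynomial.aeval (algebraMap F L z) p = (g i : L) := by
    intro i
    have : (g i : L) ∈ (Polynomial.aeval (algebraMap F L z) : Polynomial E →ₐ[E] L).range :=
      Algebra.adjoin_singleton_eq_range_aeval E (algebraMap F L z) ▸ (g i).2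
    exact this
  choose p hp using hp
  let n := s.sup fun i => (p i).natDegree + 1
  have hn : ∀ i ∈ s, (p i).natDegree < n := fun i hi =>
    Nat.lt_of_succ_le (Finset.le_sup (f := fun i => (p i).natDegree + 1) hi)
  have h3 := h2 (Finset.range n ×ˢ s) (fun q => (p q.2).coeff q.1) (by
    rw [Finset.sum_product_right, ← hg]
    refine Finset.sum_congr rfl fun i hi => ?_
    change _ = (g i : L) * algebraMap F L (b i)
    rw [← hp i, Polynomial.aeval_eq_sum_range' (hn i hi), Finset.sum_mul]
    refine Finset.sum_congr rfl fun j _ => ?_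
    rw [smul_mul_assoc]
    congr 1
    rw [Algebra.smul_def, map_mul, ← map_pow]
    rfl)
  have h4 : p i = 0 := by
    ext j
    by_cases hj : j < n
    · simpa using h3 (j, i) (by simp [hi, hj])
    · rw [Polynomial.coeff_eq_zero_of_natDegree_lt (by have := hn i hi; omega),
        Polynomial.coeff_zero]
  have := hp i
  rw [h4, map_zero] at this
  exact Subtype.ext this.symm

theorem isAlgebraic (z : F) [Algebra.IsAlgebraic (IntermediateField.adjoin K {z}) F] (f : F) :
    IsAlgebraic (IntermediateField.adjoin E {algebraMap F L z}) (algebraMap F L f) := by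
  let φ : IntermediateField.adjoin K {z} →+* IntermediateField.adjoin E {algebraMap F L z} :=
    ((algebraMap F L).comp (algebraMap (IntermediateField.adjoin K {z}) F)).codRestrict
      (IntermediateField.adjoin E {algebraMap F L z}).toSubring
      fun x => algebraMap_mem_adjoin z x.2
  obtain ⟨p, hp, hpf⟩ := Algebra.IsAlgebraic.isAlgebraic (R := IntermediateField.adjoin K {z}) f
  refine ⟨p.map φ, (Polynomial.map_ne_zero_iff φ.injective).2 hp, ?_⟩
  rw [Polynomial.aeval_def, Polynomial.eval₂_map]
  have h := congrArg (algebraMap F L) hpf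
  rw [Polynomial.aeval_def, Polynomial.hom_eval₂, map_zero] at h
  exact h

/-- Over `E(z)` the field `L` is algebraic and generated by `F`, so it is generated by `F` as a
ring. The elements of `F` are closed under products, so they already span. -/
theorem span_eq_top (hc : IsConstantExtension K E F L) (z : F)
    [Algebra.IsAlgebraic (IntermediateField.adjoin K {z}) F] {ι : Type*} {b : ι → F}
    (hb : Submodule.span (IntermediateField.adjoin K {z}) (Set.range b) = ⊤) :
    Submodule.span (IntermediateField.adjoin E {algebraMap F L z})
      (Set.range fun i => algebraMap F L (b i)) = ⊤ := by
  have h1 := IntermediateField.adjoin_toSubalgebra_of_isAlgebraic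
    (F := IntermediateField.adjoin E {algebraMap F L z}) (S := Set.range (algebraMap F L))
    (by rintro _ ⟨f, rfl⟩; exact isAlgebraic (K := K) z f)
  have h2 : IntermediateField.adjoin (IntermediateField.adjoin E {algebraMap F L z})
      (Set.range (algebraMap F L)) = ⊤ := by
    have hT := IntermediateField.subset_adjoin (IntermediateField.adjoin E {algebraMap F L z})
      (Set.range (algebraMap F L))
    generalize IntermediateField.adjoin (IntermediateField.adjoin E {algebraMap F L z})
      (Set.range (algebraMap F L)) = T at hT
    have h3 : IntermediateField.adjoin E (Set.range (algebraMap F L)) ≤ T.restrictScalars E :=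
      IntermediateField.adjoin_le_iff.2 hT
    rw [hc.adjoin_eq_top] at h3
    rw [← top_le_iff]
    exact fun x _ => h3 (show x ∈ (⊤ : IntermediateField E L) from trivial)
  rw [h2] at h1
  rw [← top_le_iff]
  intro x _
  have hx : x ∈ Algebra.adjoin (IntermediateField.adjoin E {algebraMap F L z})
      (Set.range (algebraMap F L)) := h1 ▸ (show x ∈ (⊤ : Subalgebra _ L) from trivial)
  rw [← Subalgebra.mem_toSubmodule, Algebra.adjoin_eq_span,
    show Set.range (algebraMap F L) = ((MonoidHom.mrange (algebraMap F L : F →* L) : Submonoid L) :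
      Set L) from rfl, Submonoid.closure_eq] at hx
  refine (Submodule.span_le.2 ?_) hx
  rintro _ ⟨f, rfl⟩
  have hf : f ∈ Submodule.span (IntermediateField.adjoin K {z}) (Set.range b) := hb ▸ trivial
  change algebraMap F L f ∈ _
  induction hf using Submodule.span_induction with
  | mem x hx =>
    obtain ⟨i, rfl⟩ := hx
    exact Submodule.subset_span ⟨i, rfl⟩
  | zero => simp
  | add a b _ _ ha hb => rw [map_add]; exact Submodule.add_mem _ ha hb
  | smul c a _ ha =>
    rw [Algebra.smul_def, map_mul]
    exact Submodule.smul_mem _ (⟨_, algebraMap_mem_adjoin z c.2⟩ :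
      IntermediateField.adjoin E {algebraMap F L z}) ha

/-- A `K(z)`-basis of `F` is an `E(z)`-basis of `L`. -/
noncomputable def basis (hc : IsConstantExtension K E F L) {z : F}
    (hz : Transcendental K z) [Algebra.IsAlgebraic (IntermediateField.adjoin K {z}) F]
    {ι : Type*} (b : Module.Basis ι (IntermediateField.adjoin K {z}) F) :
    Module.Basis ι (IntermediateField.adjoin E {algebraMap F L z}) L :=
  Module.Basis.mk (hc.linearIndependent_adjoin hz b.linearIndependent)
    (hc.span_eq_top z b.span_eq).ge

theorem basis_apply (hc : IsConstantExtension K E F L) {z : F}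
    (hz : Transcendental K z) [Algebra.IsAlgebraic (IntermediateField.adjoin K {z}) F]
    {ι : Type*} (b : Module.Basis ι (IntermediateField.adjoin K {z}) F) (i : ι) :
    hc.basis hz b i = algebraMap F L (b i) := by
  simp [basis]

theorem basis_repr (hc : IsConstantExtension K E F L) {z : F}
    (hz : Transcendental K z) [Algebra.IsAlgebraic (IntermediateField.adjoin K {z}) F]
    {ι : Type*} [Fintype ι] (b : Module.Basis ι (IntermediateField.adjoin K {z}) F) (f : F) (i : ι) :
    (((hc.basis hz b).repr (algebraMap F L f) i : IntermediateField.adjoin E {algebraMap F L z}) : L)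
      = algebraMap F L (b.repr f i) := by
  let r : ι → IntermediateField.adjoin E {algebraMap F L z} :=
    fun i => ⟨_, algebraMap_mem_adjoin z (b.repr f i).2⟩
  have : algebraMap F L f = ∑ i, r i • hc.basis hz b i := by
    conv_lhs => rw [← b.sum_repr f, map_sum]
    refine Finset.sum_congr rfl fun i _ => ?_
    rw [basis_apply, Algebra.smul_def, map_mul]
    rfl
  rw [this, Module.Basis.repr_sum_self]

/-- A common basis gives both traces by the same matrix. -/
theorem trace_algebraMap (hc : IsConstantExtension K E F L) {z : F}
    (hz : Transcendental K z) [FiniteDimensional (IntermediateField.adjoin K {z}) F] (f : F) :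
    ((Algebra.trace (IntermediateField.adjoin E {algebraMap F L z}) L (algebraMap F L f) :
      IntermediateField.adjoin E {algebraMap F L z}) : L)
      = algebraMap F L (Algebra.trace (IntermediateField.adjoin K {z}) F f) := by
  let b := Module.finBasis (IntermediateField.adjoin K {z}) F
  rw [Algebra.trace_eq_matrix_trace b, Algebra.trace_eq_matrix_trace (hc.basis hz b),
    Matrix.trace, Matrix.trace]
  simp only [Matrix.diag_apply, Algebra.leftMulMatrix_eq_repr_mul, basis_apply, ← map_mul,
    AddSubmonoidClass.coe_finsetSum, basis_repr, map_sum]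

/-- The elements of a constant field extension that are integral over `E[z]` are sums of products
of constants and elements of the original field. -/
theorem mem_adjoin_range_of_isIntegral [CharZero K] (hc : IsConstantExtension K E F L) {z : F}
    (hz : Transcendental K z) [FiniteDimensional (IntermediateField.adjoin K {z}) F] {h : L}
    (hh : IsIntegral (Algebra.adjoin E {algebraMap F L z}) h) :
    h ∈ Algebra.adjoin E (Set.range (algebraMap F L)) := by
  have halg : Algebra.IsAlgebraic (Algebra.adjoin K {z}) F := by
    open scoped IntermediateField.algebraAdjoinAdjoin in
    exact (IsFractionRing.comap_isAlgebraic_iff (A := Algebra.adjoin K {z})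
      (K := IntermediateField.adjoin K {z}) (C := F)).2 inferInstance
  let b := Module.finBasis (IntermediateField.adjoin K {z}) F
  classical
  -- `k` is a common denominator in `K[z]` of the trace dual basis. It does not depend on `h`.
  obtain ⟨k, hk, hki⟩ := Algebra.IsAlgebraic.exists_integral_multiples (R := Algebra.adjoin K {z})
    (Finset.univ.image b.traceDual)
  have hkF : algebraMap F L k ≠ 0 := by simpa using hk
  have hkE : algebraMap F L k ∈ Algebra.adjoin E {algebraMap F L z} :=
    algebraMap_mem_adjoin' z k.2
  have hkE' : algebraMap F L k ∈ IntermediateField.adjoin E {algebraMap F L z} :=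
    IntermediateField.algebra_adjoin_le_adjoin _ _ hkE
  let ψ : Algebra.adjoin K {z} →+* Algebra.adjoin E {algebraMap F L z} :=
    ((algebraMap F L).comp (algebraMap (Algebra.adjoin K {z}) F)).codRestrict
      (Algebra.adjoin E {algebraMap F L z}).toSubring fun x => algebraMap_mem_adjoin' z x.2
  let b' := hc.basis hz b
  have hfin : FiniteDimensional (IntermediateField.adjoin E {algebraMap F L z}) L := b'.finiteDimensional_of_finite
  -- The trace of `h` against `k` times a dual basis element is `k` times a coordinate of `h`. It is
  -- integral over `E[z]` and lies in `E(z)`, hence in `E[z]`.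
  have hcoef : ∀ j, algebraMap F L k * (b'.repr h j : L) ∈
      Algebra.adjoin E {algebraMap F L z} := by
    intro j
    refine mem_adjoin_of_isIntegral (mul_mem hkE' (b'.repr h j).2) ?_
    have h1 : IsIntegral (Algebra.adjoin E {algebraMap F L z})
        (algebraMap F L (k * b.traceDual j)) :=
      IsIntegral.map_of_comp_eq ψ (algebraMap F L) rfl
        (hki _ (Finset.mem_image_of_mem _ (Finset.mem_univ j)))
    open scoped IntermediateField.algebraAdjoinAdjoin in
    have h2 : IsIntegral (Algebra.adjoin E {algebraMap F L z})
      (Algebra.trace (IntermediateField.adjoin E {algebraMap F L z}) L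
        (algebraMap F L (k * b.traceDual j) * h)) := Algebra.isIntegral_trace (h1.mul hh)
    open scoped IntermediateField.algebraAdjoinAdjoin in
    have h3 := h2.algebraMap (B := L)
    convert h3 using 1
    have h4 : algebraMap F L (k * b.traceDual j) * h =
        (⟨_, hkE'⟩ : IntermediateField.adjoin E {algebraMap F L z}) •
          ∑ i, b'.repr h i • algebraMap F L (b.traceDual j * b i) := by
      conv_lhs => rw [← b'.sum_repr h]
      rw [map_mul, mul_assoc, Finset.mul_sum]
      refine congrArg₂ _ rfl (Finset.sum_congr rfl fun i _ => ?_)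
      rw [hc.basis_apply, map_mul, mul_smul_comm]
    have h5 : ∀ i, Algebra.trace (IntermediateField.adjoin E {algebraMap F L z}) L
        (algebraMap F L (b.traceDual j * b i)) = if i = j then 1 else 0 := by
      intro i
      apply Subtype.ext
      rw [hc.trace_algebraMap hz, Module.Basis.trace_traceDual_mul]
      split_ifs <;> simp
    rw [h4, map_smul, map_sum]
    simp only [map_smul, h5, smul_eq_mul, mul_ite, mul_one, mul_zero, Finset.sum_ite_eq',
      Finset.mem_univ, if_true]
    rfl
  rw [← b'.sum_repr h]
  refine Subalgebra.sum_mem _ fun j _ => ?_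
  have h6 : b'.repr h j • b' j =
      (algebraMap F L k * (b'.repr h j : L)) * algebraMap F L ((k : F)⁻¹ * b j) := by
    rw [hc.basis_apply, map_mul, map_inv₀, IntermediateField.smul_def, smul_eq_mul]
    field_simp
  rw [h6]
  refine mul_mem (Algebra.adjoin_mono ?_ (hcoef j)) (Algebra.subset_adjoin ⟨_, rfl⟩)
  rintro _ rfl
  exact ⟨z, rfl⟩

end IsConstantExtension

end ConstantExtension

/-! ### Regular differentials of a constant field extension -/

/-- A ring homomorphism followed by a derivation factors over Kähler differentials. -/
theorem exists_functional_kaehler {E L M : Type*} [Field E] [Field L] [Algebra E L] [CommRing M]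
    (Θ : L →+* M) (δ : M →+ M) (hδ : ∀ a b, δ (a * b) = a * δ b + b * δ a)
    (hE : ∀ e, δ (Θ (algebraMap E L e)) = 0) :
    ∃ φ : Ω[L⁄E] →+ M, (∀ l ω, φ (l • ω) = Θ l * φ ω) ∧
      ∀ l, φ (KaehlerDifferential.D E L l) = δ (Θ l) := by
  let := Θ.toAlgebra
  let : Algebra E M := (Θ.comp (algebraMap E L)).toAlgebra
  have : IsScalarTower E L M := .of_algebraMap_eq fun _ => rfl
  let l : L →ₗ[E] M :=
    { toFun := fun x => δ (Θ x)
      map_add' := by simp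
      map_smul' := fun e x => by
        rw [Algebra.smul_def, map_mul, hδ, hE, mul_zero, add_zero, RingHom.id_apply,
          Algebra.smul_def]
        rfl }
  let d : Derivation E L M := Derivation.mk' l fun a b => by
    change δ (Θ (a * b)) = _
    rw [map_mul, hδ, Algebra.smul_def, Algebra.smul_def]
    rfl
  refine ⟨d.liftKaehlerDifferential.toAddMonoidHom, fun l ω => ?_, fun l => ?_⟩
  · change d.liftKaehlerDifferential (l • ω) = _
    rw [map_smul, Algebra.smul_def]
    rfl
  · exact d.liftKaehlerDifferential_comp_D l

/-- The denominators of an element of the fraction field of a Dedekind domain. -/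
theorem exists_add_mul_eq_one {A L : Type*} [CommRing A] [IsDedekindDomain A] [Field L] [Algebra A L]
    [IsFractionRing A L] (o : L) :
    ∃ a b c d : A, algebraMap A L a * o = algebraMap A L c ∧
      algebraMap A L b * o = algebraMap A L d ∧ a + d = 1 := by
  let S := nonZeroDivisors A
  let I : FractionalIdeal S L :=
    FractionalIdeal.spanSingleton S 1 + FractionalIdeal.spanSingleton S o
  have hI1 : (1 : L) ∈ I := by
    have : FractionalIdeal.spanSingleton S (1 : L) ≤ I := by simp [I]
    exact this (FractionalIdeal.mem_spanSingleton_self S 1)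
  have hIo : o ∈ I := by
    have : FractionalIdeal.spanSingleton S o ≤ I := by simp [I]
    exact this (FractionalIdeal.mem_spanSingleton_self S o)
  have hI0 : I ≠ 0 := by
    intro h
    rw [h, FractionalIdeal.mem_zero_iff] at hI1
    exact one_ne_zero hI1
  have hmul : I * I⁻¹ = 1 := mul_inv_cancel₀ hI0
  have hint : ∀ j ∈ I⁻¹, ∃ a c : A, algebraMap A L a = j ∧ algebraMap A L a * o = algebraMap A L c := by
    intro j hj
    have h1 : 1 * j ∈ (1 : FractionalIdeal S L) := hmul ▸ FractionalIdeal.mul_mem_mul hI1 hj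
    have h2 : o * j ∈ (1 : FractionalIdeal S L) := hmul ▸ FractionalIdeal.mul_mem_mul hIo hj
    obtain ⟨a, ha⟩ := (FractionalIdeal.mem_one_iff S).1 h1
    obtain ⟨c, hc⟩ := (FractionalIdeal.mem_one_iff S).1 h2
    rw [one_mul] at ha
    exact ⟨a, c, ha, by rw [ha, hc, mul_comm]⟩
  -- The fractional ideal generated by `1` and `o` is invertible, so `1 = a + b * o` with `a`, `b`
  -- in its inverse. Both `a`, `b` and their products with `o` are integral.
  have h1 : (1 : L) ∈ FractionalIdeal.spanSingleton S 1 * I⁻¹ +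
      FractionalIdeal.spanSingleton S o * I⁻¹ := by
    rw [← add_mul, hmul]
    exact FractionalIdeal.one_mem_one S
  rw [← FractionalIdeal.mem_coe, FractionalIdeal.coe_add, Submodule.add_eq_sup,
    Submodule.mem_sup] at h1
  obtain ⟨u, hu, v, hv, huv⟩ := h1
  rw [FractionalIdeal.mem_coe, FractionalIdeal.mem_singleton_mul] at hu hv
  obtain ⟨j, hj, rfl⟩ := hu
  obtain ⟨j', hj', rfl⟩ := hv
  obtain ⟨a, c, ha, hc⟩ := hint j hj
  obtain ⟨b, d, hb, hd⟩ := hint j' hj'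
  refine ⟨a, b, c, d, hc, hd, FaithfulSMul.algebraMap_injective A L ?_⟩
  rw [map_add, map_one, ha, ← hd, hb, ← huv]
  ring

open scoped IntermediateField.algebraAdjoinAdjoin in
theorem isDedekindDomain_integralClosure_adjoin {E L : Type*} [Field E] [CharZero E] [Field L]
    [Algebra E L] (z : L) [FiniteDimensional (IntermediateField.adjoin E {z}) L] :
    IsDedekindDomain (integralClosure (Algebra.adjoin E {z}) L) :=
  have := isPrincipalIdealRing_adjoin_singleton (K := E) z
  integralClosure.isDedekindDomain (Algebra.adjoin E {z}) (IntermediateField.adjoin E {z}) L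

open scoped IntermediateField.algebraAdjoinAdjoin in
theorem isFractionRing_integralClosure_adjoin {E L : Type*} [Field E] [Field L]
    [Algebra E L] (z : L) [FiniteDimensional (IntermediateField.adjoin E {z}) L] :
    IsFractionRing (integralClosure (Algebra.adjoin E {z}) L) L :=
  integralClosure.isFractionRing_of_finite_extension (IntermediateField.adjoin E {z}) L

theorem inv_mem_of_isUnit {L : Type*} [Field L] {O : ValuationSubring L} {x : L} (hx : x ∈ O)
    (h : IsUnit (⟨x, hx⟩ : O)) : x ≠ 0 ∧ x⁻¹ ∈ O := by
  have hne : x ≠ 0 := fun h0 => h.ne_zero (Subtype.ext h0)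
  obtain ⟨y, hy⟩ := h.exists_right_inv
  have : x * y = 1 := congrArg Subtype.val hy
  rw [inv_eq_of_mul_eq_one_right this]
  exact ⟨hne, y.2⟩

open scoped TensorProduct in
theorem injective_tensorProduct_lift {K E F N : Type*} [Field K] [Field E] [Field F] [Field N]
    [Algebra K E] [Algebra K F] [Algebra E N] [Algebra F N] [Algebra K N]
    [IsScalarTower K E N] [IsScalarTower K F N]
    (h : ∀ (n : ℕ) (f : Fin n → F) (e : Fin n → E), LinearIndependent K f →
      ∑ i, algebraMap E N (e i) * algebraMap F N (f i) = 0 → ∀ i, e i = 0) :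
    Function.Injective (Algebra.TensorProduct.lift (S := E) (Algebra.ofId E N)
      (IsScalarTower.toAlgHom K F N) fun _ _ => Commute.all _ _ : E ⊗[K] F →ₐ[E] N) := by
  rw [injective_iff_map_eq_zero]
  intro t ht
  let B := Module.Basis.ofVectorSpace K F
  obtain ⟨c, rfl⟩ := TensorProduct.eq_repr_basis_right B t
  have h1 := h c.support.card (fun i => B (c.support.equivFin.symm i))
    (fun i => c (c.support.equivFin.symm i))
    (B.linearIndependent.comp _
      (Subtype.val_injective.comp c.support.equivFin.symm.injective)) (by
      rw [Equiv.sum_comp c.support.equivFin.symm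
        (fun i => algebraMap E N (c i) * algebraMap F N (B i)),
        Finset.sum_coe_sort c.support (fun i => algebraMap E N (c i) * algebraMap F N (B i)), ← ht,
        Finsupp.sum, map_sum]
      simp [Algebra.ofId_apply])
  rw [Finsupp.sum]
  refine Finset.sum_eq_zero fun i hi => ?_
  have := h1 (c.support.equivFin ⟨i, hi⟩)
  rw [Equiv.symm_apply_apply] at this
  rw [this, TensorProduct.zero_tmul]

namespace IsConstantExtension

section

variable {K E F L : Type*} [Field K] [Field E] [Field F] [Field L]
  [Algebra K E] [Algebra K F] [Algebra K L] [Algebra E L] [Algebra F L]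
  [IsScalarTower K E L] [IsScalarTower K F L] [CharZero K] [CharZero E]

theorem finiteDimensional (hc : IsConstantExtension K E F L) {z : F} (hz : Transcendental K z)
    [FiniteDimensional (IntermediateField.adjoin K {z}) F] :
    FiniteDimensional (IntermediateField.adjoin E {algebraMap F L z}) L :=
  (hc.basis hz (Module.finBasis (IntermediateField.adjoin K {z}) F)).finiteDimensional_of_finite

theorem exists_D_eq_smul {z : F} [FiniteDimensional (IntermediateField.adjoin K {z}) F] {c : L}
    (h : c ∈ Algebra.adjoin E (Set.range (algebraMap F L))) :
    ∃ g ∈ Algebra.adjoin E (Set.range (algebraMap F L)),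
      KaehlerDifferential.D E L c = g • KaehlerDifferential.D E L (algebraMap F L z) := by
  induction h using Algebra.adjoin_induction with
  | mem x hx =>
    obtain ⟨f, rfl⟩ := hx
    obtain ⟨g, hg⟩ := exists_D_eq_smul_D (E := K) z f
    refine ⟨algebraMap F L g, Algebra.subset_adjoin ⟨_, rfl⟩, ?_⟩
    have := congrArg (KaehlerDifferential.map K E F L) hg
    rwa [map_smul, KaehlerDifferential.map_D, KaehlerDifferential.map_D,
      ← algebraMap_smul L g] at this
  | algebraMap x => exact ⟨0, zero_mem _, by simp⟩
  | add x y hx' hy' hx hy =>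
    obtain ⟨g, hg, hg'⟩ := hx
    obtain ⟨f, hf, hf'⟩ := hy
    exact ⟨g + f, add_mem hg hf, by rw [map_add, hg', hf', add_smul]⟩
  | mul x y hx' hy' hx hy =>
    obtain ⟨g, hg, hg'⟩ := hx
    obtain ⟨f, hf, hf'⟩ := hy
    refine ⟨x * f + y * g, add_mem (mul_mem hx' hf) (mul_mem hy' hg), ?_⟩
    rw [Derivation.leibniz, hg', hf', add_smul, mul_smul, mul_smul]

/-- The ring `E·F` is stable under `d/dz`, since every element of `F` has its differential in `F
dz`. An element of `O` is locally a quotient of elements of `E·F` with denominator a unit of `O`: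
writing it over the Dedekind domain of elements integral over `E[z]` gives `a + d = 1`, and one of
the two is a unit of the local ring `O`. The quotient rule finishes. -/
theorem exists_mem_D_eq_smul (hc : IsConstantExtension K E F L) {z : F} (hz : Transcendental K z)
    [FiniteDimensional (IntermediateField.adjoin K {z}) F] (O : ValuationSubring L)
    (hO : ∀ c ∈ Algebra.adjoin E (Set.range (algebraMap F L)), c ∈ O) {o : L} (ho : o ∈ O) :
    ∃ g ∈ O, KaehlerDifferential.D E L o = g • KaehlerDifferential.D E L (algebraMap F L z) := by
  have := isPrincipalIdealRing_adjoin_singleton (K := E) (algebraMap F L z)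
  have := hc.finiteDimensional hz
  have := isDedekindDomain_integralClosure_adjoin (E := E) (algebraMap F L z)
  have := isFractionRing_integralClosure_adjoin (E := E) (algebraMap F L z)
  have hC : ∀ c : integralClosure (Algebra.adjoin E {algebraMap F L z}) L,
      (c : L) ∈ Algebra.adjoin E (Set.range (algebraMap F L)) := fun c =>
    hc.mem_adjoin_range_of_isIntegral hz c.2
  have key : ∀ j c : integralClosure (Algebra.adjoin E {algebraMap F L z}) L, (j : L) * o = c →
      (j : L) ≠ 0 → (j : L)⁻¹ ∈ O →
      ∃ g ∈ O, KaehlerDifferential.D E L o = g • KaehlerDifferential.D E L (algebraMap F L z) := by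
    intro j c hjc hj0 hj
    obtain ⟨g, hg, hg'⟩ := exists_D_eq_smul (K := K) (z := z) (hC j)
    obtain ⟨f, hf, hf'⟩ := exists_D_eq_smul (K := K) (z := z) (hC c)
    refine ⟨(j : L)⁻¹ * (f - o * g),
      O.mul_mem _ _ hj (sub_mem (hO _ hf) (O.mul_mem _ _ ho (hO _ hg))), ?_⟩
    rw [← hjc, Derivation.leibniz, hg'] at hf'
    rw [mul_smul, sub_smul, ← hf', mul_smul, add_sub_cancel_right, smul_smul,
      inv_mul_cancel₀ hj0, one_smul]
  obtain ⟨a, b, c, d, hac, hbd, had⟩ :=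
    exists_add_mul_eq_one (A := integralClosure (Algebra.adjoin E {algebraMap F L z}) L) o
  have haO : (a : L) ∈ O := hO _ (hC a)
  have hbO : (b : L) ∈ O := hO _ (hC b)
  have hdO : (d : L) ∈ O := hO _ (hC d)
  have had' : (⟨a, haO⟩ : O) + ⟨d, hdO⟩ = 1 := by
    apply Subtype.ext
    exact congrArg (algebraMap (integralClosure (Algebra.adjoin E {algebraMap F L z}) L) L) had
  rcases IsLocalRing.isUnit_or_isUnit_of_add_one had' with h | h
  · obtain ⟨h0, h1⟩ := inv_mem_of_isUnit _ h
    exact key a c hac h0 h1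
  -- Since `d = b * o` with both factors in `O`, the denominator `b` is a unit as well.
  · have h2 : (⟨d, hdO⟩ : O) = ⟨b, hbO⟩ * ⟨o, ho⟩ := Subtype.ext hbd.symm
    rw [h2, IsUnit.mul_iff] at h
    obtain ⟨h0, h1⟩ := inv_mem_of_isUnit _ h.1
    exact key b d hbd h0 h1

/-- The intersection of the valuation rings above a ring is its integral closure, so the point is
that `E·F` is integrally closed. An integral equation for `h` has finitely many coefficients. A
denominator `m` in `F` makes `m * h` integral over `E[z]`, where `mem_adjoin_range_of_isIntegral`
applies, and `m` is invertible in `F`. -/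
theorem mem_adjoin_range_of_forall_mem (hc : IsConstantExtension K E F L) {z : F}
    (hz : Transcendental K z) [FiniteDimensional (IntermediateField.adjoin K {z}) F] {h : L}
    (hh : ∀ O : ValuationSubring L, (∀ c ∈ Algebra.adjoin E (Set.range (algebraMap F L)), c ∈ O) →
      h ∈ O) :
    h ∈ Algebra.adjoin E (Set.range (algebraMap F L)) := by
  have h1 : h ∈ (⨅ V : {V : ValuationSubring L //
      (Algebra.adjoin E (Set.range (algebraMap F L)) : Set L) ⊆ V.toSubring}, V.1.toSubring) := by
    rw [Subring.mem_iInf]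
    exact fun V => hh V.1 V.2
  rw [iInf_valuationSubring_superset] at h1
  obtain ⟨p, hp, hph⟩ := h1
  have hcl : ∀ c : Subring.closure (Algebra.adjoin E (Set.range (algebraMap F L)) : Set L),
      (c : L) ∈ Algebra.adjoin E (Set.range (algebraMap F L)) := fun c =>
    (Subring.closure_le (t := (Algebra.adjoin E (Set.range (algebraMap F L))).toSubring)).2
      (fun x hx => hx) c.2
  have halg : Algebra.IsAlgebraic (Algebra.adjoin K {z}) F := by
    open scoped IntermediateField.algebraAdjoinAdjoin in
    exact (IsFractionRing.comap_isAlgebraic_iff (A := Algebra.adjoin K {z})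
      (K := IntermediateField.adjoin K {z}) (C := F)).2 inferInstance
  have hA : ∀ c ∈ Algebra.adjoin E (Set.range (algebraMap F L)), ∃ k : Algebra.adjoin K {z},
      k ≠ 0 ∧ IsIntegral (Algebra.adjoin E {algebraMap F L z}) (algebraMap F L k * c) := by
    have hk : ∀ k : Algebra.adjoin K {z},
        IsIntegral (Algebra.adjoin E {algebraMap F L z}) (algebraMap F L k) := fun k =>
      isIntegral_algebraMap (x := (⟨_, algebraMap_mem_adjoin' z k.2⟩ :
        Algebra.adjoin E {algebraMap F L z}))
    intro c hc
    induction hc using Algebra.adjoin_induction with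
    | mem x hx =>
      obtain ⟨f, rfl⟩ := hx
      obtain ⟨k, hk, hkf⟩ := Algebra.IsAlgebraic.exists_integral_multiples
        (R := Algebra.adjoin K {z}) {f}
      refine ⟨k, hk, ?_⟩
      rw [← map_mul]
      exact IsIntegral.map_of_comp_eq (((algebraMap F L).comp
        (algebraMap (Algebra.adjoin K {z}) F)).codRestrict
        (Algebra.adjoin E {algebraMap F L z}).toSubring fun x => algebraMap_mem_adjoin' z x.2)
        (algebraMap F L) rfl (hkf f (Finset.mem_singleton_self f))
    | algebraMap e =>
      refine ⟨1, one_ne_zero, ?_⟩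
      simpa using isIntegral_algebraMap (A := L) (x := algebraMap E (Algebra.adjoin E {algebraMap F L z}) e)
    | add x y _ _ hx hy =>
      obtain ⟨k, hk0, hkx⟩ := hx
      obtain ⟨l, hl0, hly⟩ := hy
      refine ⟨k * l, mul_ne_zero hk0 hl0, ?_⟩
      have h := ((hk l).mul hkx).add ((hk k).mul hly)
      rwa [show algebraMap F L l * (algebraMap F L k * x) + algebraMap F L k * (algebraMap F L l * y)
        = algebraMap F L ((k : F) * (l : F)) * (x + y) by rw [map_mul]; ring]
        at h
    | mul x y _ _ hx hy =>
      obtain ⟨k, hk0, hkx⟩ := hx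
      obtain ⟨l, hl0, hly⟩ := hy
      refine ⟨k * l, mul_ne_zero hk0 hl0, ?_⟩
      have h := hkx.mul hly
      rwa [show algebraMap F L k * x * (algebraMap F L l * y)
        = algebraMap F L ((k : F) * (l : F)) * (x * y) by rw [map_mul]; ring]
        at h
  choose! k hk0 hk using hA
  let m : F := ∏ i ∈ Finset.range p.natDegree, (k (p.coeff i : L) : F)
  have hm0 : m ≠ 0 := Finset.prod_ne_zero_iff.2 fun i _ => by
    simpa using hk0 _ (hcl (p.coeff i))
  have hmi : ∀ i ∈ Finset.range p.natDegree, IsIntegral (Algebra.adjoin E {algebraMap F L z})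
      (algebraMap F L m * (p.coeff i : L)) := by
    intro i hi
    have : algebraMap F L m * (p.coeff i : L) =
        algebraMap F L (∏ i ∈ (Finset.range p.natDegree).erase i, (k (p.coeff i : L) : F)) *
          (algebraMap F L (k (p.coeff i : L)) * (p.coeff i : L)) := by
      rw [← mul_assoc, ← map_mul, Finset.prod_erase_mul _ _ hi]
    rw [this]
    refine IsIntegral.mul ?_ (hk _ (hcl _))
    rw [map_prod]
    exact IsIntegral.prod _ fun j _ => isIntegral_algebraMap (x := (⟨_, algebraMap_mem_adjoin' z
      (k (p.coeff j : L)).2⟩ : Algebra.adjoin E {algebraMap F L z}))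
  have hint : IsIntegral (Algebra.adjoin E {algebraMap F L z}) (algebraMap F L m * h) := by
    have hint' : IsIntegral (integralClosure (Algebra.adjoin E {algebraMap F L z}) L)
        (algebraMap F L m * h) := by
      have hmI : IsIntegral (Algebra.adjoin E {algebraMap F L z}) (algebraMap F L m) := by
        rw [map_prod]
        exact IsIntegral.prod _ fun j _ => isIntegral_algebraMap (x := (⟨_, algebraMap_mem_adjoin' z
          (k (p.coeff j : L)).2⟩ : Algebra.adjoin E {algebraMap F L z}))
      have hci : ∀ i : Fin p.natDegree, IsIntegral (Algebra.adjoin E {algebraMap F L z})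
          (algebraMap F L m ^ (p.natDegree - 1 - i) * (algebraMap F L m * (p.coeff i : L))) :=
        fun i => (hmI.pow _).mul (hmi i (Finset.mem_range.2 i.2))
      -- The monic equation for `m * h`: the coefficient of index `i` is multiplied by `m ^
      -- (natDegree - i)`, which contains at least one factor `m`.
      let q : Polynomial (integralClosure (Algebra.adjoin E {algebraMap F L z}) L) :=
        Polynomial.X ^ p.natDegree + ∑ i : Fin p.natDegree,
          Polynomial.C ⟨_, hci i⟩ * Polynomial.X ^ (i : ℕ)
      refine ⟨q, Polynomial.monic_X_pow_add (Polynomial.degree_sum_fin_lt _), ?_⟩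
      have hp0 := hph
      rw [Polynomial.eval₂_eq_sum_range, Finset.sum_range_succ, hp.coeff_natDegree, map_one,
        one_mul, ← Fin.sum_univ_eq_sum_range
          (fun i => algebraMap _ L (p.coeff i) * h ^ i)] at hp0
      have hq : Polynomial.eval₂ (algebraMap _ L) (algebraMap F L m * h) q =
          algebraMap F L m ^ p.natDegree *
            (∑ i : Fin p.natDegree, (p.coeff i : L) * h ^ (i : ℕ) + h ^ p.natDegree) := by
        simp only [q, Polynomial.eval₂_add, Polynomial.eval₂_pow, Polynomial.eval₂_X,
          Polynomial.eval₂_finsetSum, Polynomial.eval₂_mul, Polynomial.eval₂_C]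
        rw [mul_add, Finset.mul_sum, add_comm, mul_pow]
        refine congrArg₂ _ (Finset.sum_congr rfl fun i _ => ?_) rfl
        change (algebraMap F L m ^ (p.natDegree - 1 - i) * (algebraMap F L m * (p.coeff i : L))) *
          _ = _
        have hi : algebraMap F L m ^ p.natDegree = algebraMap F L m ^ (p.natDegree - 1 - i) *
            algebraMap F L m * algebraMap F L m ^ (i : ℕ) := by
          rw [← pow_succ, ← pow_add]
          congr 1
          omega
        rw [mul_pow, hi]
        ring
      rw [hq]
      exact mul_eq_zero_of_right _ hp0
    exact isIntegral_trans _ hint'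
  have h2 := hc.mem_adjoin_range_of_isIntegral hz hint
  have h3 : h = algebraMap F L m⁻¹ * (algebraMap F L m * h) := by
    rw [← mul_assoc, ← map_mul, inv_mul_cancel₀ hm0, map_one, one_mul]
  rw [h3]
  exact mul_mem (Algebra.subset_adjoin ⟨_, rfl⟩) h2

/-! ### Expansion of a constant field extension -/

omit [CharZero K] [CharZero E] in
open scoped TensorProduct in
/-- The field generated by linearly disjoint `E` and `F` embeds into every field that contains `E`
and `F` linearly disjointly. -/
theorem exists_lift (hc : IsConstantExtension K E F L) {M : Type*} [Field M] (a : E →+* M)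
    (b : F →+* M) (hab : ∀ k, a (algebraMap K E k) = b (algebraMap K F k))
    (hM : ∀ (n : ℕ) (f : Fin n → F) (e : Fin n → E), LinearIndependent K f →
      ∑ i, a (e i) * b (f i) = 0 → ∀ i, e i = 0) :
    ∃ Θ : L →+* M, (∀ e, Θ (algebraMap E L e) = a e) ∧ ∀ f, Θ (algebraMap F L f) = b f := by
  let : Algebra E M := a.toAlgebra
  let : Algebra K M := (a.comp (algebraMap K E)).toAlgebra
  let : Algebra F M := b.toAlgebra
  have : IsScalarTower K E M := .of_algebraMap_eq fun _ => rfl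
  have : IsScalarTower K F M := .of_algebraMap_eq fun k => hab k
  let μ : E ⊗[K] F →ₐ[E] L := Algebra.TensorProduct.lift (S := E) (Algebra.ofId E L)
        (IsScalarTower.toAlgHom K F L) fun _ _ => Commute.all _ _
  let ν : E ⊗[K] F →ₐ[E] M := Algebra.TensorProduct.lift (S := E) (Algebra.ofId E M)
        (IsScalarTower.toAlgHom K F M) fun _ _ => Commute.all _ _
  have hμ : Function.Injective μ := injective_tensorProduct_lift fun n f e hf h => by
    have := linearIndependent_iff'.1 (hc.linearIndependent hf) Finset.univ e
      (by simpa [Algebra.smul_def] using h)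
    exact fun i => this i (Finset.mem_univ i)
  have hν : Function.Injective ν := injective_tensorProduct_lift hM
  let : Algebra (E ⊗[K] F) L := μ.toRingHom.toAlgebra
  have : FaithfulSMul (E ⊗[K] F) L := (faithfulSMul_iff_algebraMap_injective _ _).2 hμ
  have : IsDomain (E ⊗[K] F) := hμ.isDomain μ.toRingHom
  have hμF : ∀ f, μ (1 ⊗ₜ f) = algebraMap F L f := by simp [μ]
  have hrange : ∀ c ∈ Algebra.adjoin E (Set.range (algebraMap F L)), ∃ t, μ t = c := by
    intro c hc
    have : Algebra.adjoin E (Set.range (algebraMap F L)) ≤ μ.range := by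
      rw [Algebra.adjoin_le_iff]
      rintro _ ⟨f, rfl⟩
      exact ⟨_, hμF f⟩
    exact this hc
  have : IsFractionRing (E ⊗[K] F) L := by
    refine IsFractionRing.of_field _ _ fun l => ?_
    have hl : l ∈ IntermediateField.adjoin E (Set.range (algebraMap F L)) :=
      hc.adjoin_eq_top ▸ trivial
    rw [IntermediateField.mem_adjoin_iff_div] at hl
    obtain ⟨r, hr, s, hs, rfl⟩ := hl
    obtain ⟨x, rfl⟩ := hrange r hr
    obtain ⟨y, rfl⟩ := hrange s hs
    exact ⟨x, y, rfl⟩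
  have hlift : ∀ t, IsFractionRing.lift (K := L) (g := ν.toRingHom) hν (μ t) = ν t := fun t =>
    IsFractionRing.lift_algebraMap hν t
  refine ⟨IsFractionRing.lift (K := L) (g := ν.toRingHom) hν, fun e => ?_, fun f => ?_⟩
  · rw [← μ.commutes, hlift, ν.commutes]
    rfl
  · rw [← hμF, hlift]
    simp [ν]
    rfl

omit [CharZero K] [CharZero E] in
theorem exists_extension (hc : IsConstantExtension K E F L)
    (θ : F →+* LaurentSeries K) (hθ : ∀ a, θ (algebraMap K F a) = HahnSeries.C a) :
    ∃ Θ : L →+* LaurentSeries E, (∀ e, Θ (algebraMap E L e) = HahnSeries.C e) ∧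
      ∀ f, Θ (algebraMap F L f) = laurentMap (algebraMap K E) (θ f) := by
  refine hc.exists_lift HahnSeries.C ((laurentMap (algebraMap K E)).comp θ) (fun k => ?_) ?_
  · rw [RingHom.comp_apply, hθ]
    ext n
    rw [coeff_laurentMap, HahnSeries.C_apply, HahnSeries.C_apply, HahnSeries.coeff_single,
      HahnSeries.coeff_single]
    split_ifs <;> simp
  · intro n f e hf h i
    -- A `K`-linear functional on `E`, applied to the coefficients of the series, turns a relation
    -- over `E` into a relation over `K` between the `θ (f i)`, and `θ` is injective.
    refine (Module.forall_dual_apply_eq_zero_iff K (e i)).1 fun φ => ?_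
    refine linearIndependent_iff'.1 hf Finset.univ (fun i => φ (e i)) ?_ i (Finset.mem_univ i)
    refine θ.injective ?_
    rw [map_zero, map_sum]
    ext n
    have h1 := congrArg (fun x : LaurentSeries E => φ (x.coeff n)) h
    simp only [HahnSeries.coeff_sum, RingHom.comp_apply, HahnSeries.C_mul_eq_smul,
      HahnSeries.coeff_smul, coeff_laurentMap, HahnSeries.coeff_zero, map_zero, map_sum,
      smul_eq_mul] at h1
    rw [HahnSeries.coeff_sum, HahnSeries.coeff_zero, ← h1]
    refine Finset.sum_congr rfl fun i _ => ?_
    rw [Algebra.smul_def, map_mul, hθ, HahnSeries.C_mul_eq_smul, HahnSeries.coeff_smul,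
      mul_comm (e i), ← Algebra.smul_def, map_smul, smul_eq_mul, smul_eq_mul, mul_comm]

omit [CharZero K] [CharZero E] in
open scoped TensorProduct in
theorem exists_sum_of_mem_adjoin {ι : Type*} (B : Module.Basis ι K E) {h : L}
    (hh : h ∈ Algebra.adjoin E (Set.range (algebraMap F L))) :
    ∃ g : ι →₀ F, h = ∑ i ∈ g.support, algebraMap E L (B i) * algebraMap F L (g i) := by
  let μ : E ⊗[K] F →ₐ[E] L := Algebra.TensorProduct.lift (S := E) (Algebra.ofId E L)
        (IsScalarTower.toAlgHom K F L) fun _ _ => Commute.all _ _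
  have hr : Algebra.adjoin E (Set.range (algebraMap F L)) ≤ μ.range := by
    rw [Algebra.adjoin_le_iff]
    rintro _ ⟨f, rfl⟩
    exact ⟨1 ⊗ₜ f, by simp [μ]⟩
  obtain ⟨t, rfl⟩ := hr hh
  obtain ⟨g, rfl⟩ := TensorProduct.eq_repr_basis_left B t
  refine ⟨g, ?_⟩
  change μ _ = _
  rw [Finsupp.sum, map_sum]
  simp [μ, Algebra.ofId_apply]

omit [CharZero K] [CharZero E] in
/-- An element of the ring generated by `E` and `F` with an expansion without polar part. -/
theorem exists_sum_of_expansion (θ : F →+* LaurentSeries K) (hθ : ∀ a, θ (algebraMap K F a) = HahnSeries.C a)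
    (Θ : L →+* LaurentSeries E) (hΘE : ∀ e, Θ (algebraMap E L e) = HahnSeries.C e)
    (hΘF : ∀ f, Θ (algebraMap F L f) = laurentMap (algebraMap K E) (θ f)) {h : L}
    (hh : h ∈ Algebra.adjoin E (Set.range (algebraMap F L))) (hord : 0 ≤ (Θ h).orderTop) :
    ∃ (n : ℕ) (f : Fin n → F) (c : Fin n → E), LinearIndependent K f ∧
      (∀ i, 0 ≤ (θ (f i)).orderTop) ∧ h = ∑ i, algebraMap E L (c i) * algebraMap F L (f i) := by
  let B := Module.Basis.ofVectorSpace K E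
  obtain ⟨g, rfl⟩ := exists_sum_of_mem_adjoin (F := F) B hh
  let W : Submodule K F := Submodule.span K (g '' g.support)
  -- The coefficients of negative index of `Θ h` vanish. They are combinations of the basis `B` with
  -- coefficients in `K`, so no cancellation between the `g i` is possible.
  have hg : ∀ i ∈ g.support, 0 ≤ (θ (g i)).orderTop := by
    intro i hi
    refine HahnSeries.le_orderTop_iff_forall.2 fun n hn => ?_
    have h1 := HahnSeries.coeff_eq_zero_of_lt_orderTop (lt_of_lt_of_le hn hord)
    simp only [map_sum, map_mul, hΘE, hΘF, HahnSeries.coeff_sum, HahnSeries.C_mul_eq_smul,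
      HahnSeries.coeff_smul, coeff_laurentMap, smul_eq_mul] at h1
    refine linearIndependent_iff'.1 B.linearIndependent g.support (fun i => (θ (g i)).coeff n) ?_ i hi
    rw [← h1]
    refine Finset.sum_congr rfl fun i _ => ?_
    rw [Algebra.smul_def, mul_comm]
  have hW : ∀ f ∈ W, 0 ≤ (θ f).orderTop := by
    intro f hf
    induction hf using Submodule.span_induction with
    | mem x hx =>
      obtain ⟨i, hi, rfl⟩ := hx
      exact hg i hi
    | zero => simp
    | add x y _ _ hx hy =>
      rw [map_add]
      exact le_trans (le_min hx hy) HahnSeries.min_orderTop_le_orderTop_add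
    | smul k x _ hx =>
      rw [Algebra.smul_def, map_mul, hθ, HahnSeries.orderTop_mul]
      refine add_nonneg ?_ hx
      by_cases hk : k = 0
      · simp [hk]
      · rw [HahnSeries.C_apply, HahnSeries.orderTop_single hk]
        exact le_rfl
  have hfin : FiniteDimensional K W :=
    FiniteDimensional.span_of_finite K (g.support.finite_toSet.image g)
  -- The `g i` may be dependent; a basis of their span is used instead, and its elements have no
  -- pole either.
  let b := Module.finBasis K W
  refine ⟨_, fun j => (b j : F), fun j => ∑ i ∈ g.support.attach,
    b.repr ⟨g i, Submodule.subset_span ⟨i, i.2, rfl⟩⟩ j • B i,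
    b.linearIndependent.map' W.subtype (by simp), fun j => hW _ (b j).2, ?_⟩
  simp only [map_sum, Finset.sum_mul]
  rw [Finset.sum_comm, ← Finset.sum_attach]
  refine Finset.sum_congr rfl fun i _ => ?_
  have h1 := congrArg (fun x : W => algebraMap F L x)
    (b.sum_repr ⟨g i, Submodule.subset_span ⟨i, i.2, rfl⟩⟩)
  simp only [AddSubmonoidClass.coe_finsetSum, map_sum] at h1
  rw [← h1, Finset.mul_sum]
  refine Finset.sum_congr rfl fun j _ => ?_
  rw [Submodule.coe_smul, Algebra.smul_def, Algebra.smul_def, map_mul, map_mul,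
    ← IsScalarTower.algebraMap_apply, ← IsScalarTower.algebraMap_apply]
  ring

/-- Write `ω = h dz`. Regularity at the valuations that contain all of `F` forces `h` into `E·F`;
regularity at the extension to `L` of the place `θ` of `F` excludes a pole there. Together these
give an expression in functions of `F` that are regular at the chosen place, which is all that the
degeneration argument needs. -/
theorem exists_sum_of_mem_regularDifferentials (hc : IsConstantExtension K E F L) {z : F}
    (hz : Transcendental K z) [FiniteDimensional (IntermediateField.adjoin K {z}) F]
    (θ : F →+* LaurentSeries K) (hθ : ∀ a, θ (algebraMap K F a) = HahnSeries.C a)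
    (hθz : θ z = HahnSeries.single 1 1) {ω : Ω[L⁄E]} (hω : ω ∈ regularDifferentials E L)
    (hω0 : ω ≠ 0) :
    ∃ (n : ℕ) (f : Fin n → F) (c : Fin n → E), LinearIndependent K f ∧
      (∀ i, 0 ≤ (θ (f i)).orderTop) ∧
      ω = (∑ i, algebraMap E L (c i) * algebraMap F L (f i)) •
        KaehlerDifferential.D E L (algebraMap F L z) := by
  have := hc.finiteDimensional hz
  obtain ⟨h, rfl⟩ := exists_eq_smul_D (algebraMap F L z) ω
  have hDz : KaehlerDifferential.D E L (algebraMap F L z) ≠ 0 := by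
    intro h0
    rw [h0, smul_zero] at hω0
    exact hω0 rfl
  have hmem : ∀ O : ValuationSubring L, (∀ a, algebraMap E L a ∈ O) →
      (∀ o ∈ O, ∃ g ∈ O,
        KaehlerDifferential.D E L o = g • KaehlerDifferential.D E L (algebraMap F L z)) →
      h ∈ O := by
    intro O hO hD
    have h1 := hω O hO
    have h2 : ∀ η ∈ Submodule.span O.toSubring (KaehlerDifferential.D E L '' (O : Set L)),
        ∃ g ∈ O, η = g • KaehlerDifferential.D E L (algebraMap F L z) := by
      intro η hη
      induction hη using Submodule.span_induction with
      | mem x hx =>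
        obtain ⟨o, ho, rfl⟩ := hx
        exact hD o ho
      | zero => exact ⟨0, O.zero_mem, by simp⟩
      | add x y _ _ hx hy =>
        obtain ⟨a, ha, rfl⟩ := hx
        obtain ⟨b, hb, rfl⟩ := hy
        exact ⟨a + b, O.add_mem _ _ ha hb, by rw [add_smul]⟩
      | smul c x _ hx =>
        obtain ⟨a, ha, rfl⟩ := hx
        exact ⟨c * a, O.mul_mem _ _ c.2 ha, by rw [mul_smul]; rfl⟩
    obtain ⟨g, hg, hgh⟩ := h2 _ h1
    rwa [smul_left_injective L hDz hgh]
  have hC : h ∈ Algebra.adjoin E (Set.range (algebraMap F L)) :=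
    hc.mem_adjoin_range_of_forall_mem hz fun O hO =>
      hmem O (fun a => hO _ (Subalgebra.algebraMap_mem _ a)) fun o ho =>
        hc.exists_mem_D_eq_smul hz O hO ho
  obtain ⟨Θ, hΘE, hΘF⟩ := hc.exists_extension θ hθ
  have hord : h ∈ (laurentIntegers E).comap Θ := by
    refine hmem _ (fun a => ?_) fun o ho => ?_
    · change Θ _ ∈ laurentIntegers E
      rw [hΘE, mem_laurentIntegers]
      by_cases ha : a = 0
      · simp [ha]
      · rw [HahnSeries.C_apply, HahnSeries.orderTop_single ha]
        exact le_rfl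
    · obtain ⟨g, hg⟩ := exists_D_eq_smul_D (E := E) (algebraMap F L z) o
      refine ⟨g, ?_, hg⟩
      -- Evaluation on `X d/dX`, which sends `z` to `X`. The coefficient of index `n` of `g` is the
      -- one of index `n + 1` of an Euler derivative of an integral series, and this vanishes for `n
      -- + 1 ≤ 0`, the case `n + 1 = 0` included.
      obtain ⟨φ, hφ, hφD⟩ := exists_functional_kaehler Θ (euler E) euler_mul (fun e => by
        rw [hΘE]
        ext n
        rw [coeff_euler, HahnSeries.C_apply, HahnSeries.coeff_single]
        split_ifs with hn <;> simp [hn])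
      have h1 := congrArg φ hg
      have h2 : euler E (Θ (algebraMap F L z)) = HahnSeries.single 1 1 := by
        rw [hΘF, hθz]
        ext n
        rw [coeff_euler, coeff_laurentMap, HahnSeries.coeff_single, HahnSeries.coeff_single]
        split_ifs with hn <;> simp [hn]
      rw [hφ, hφD, hφD, h2] at h1
      change Θ g ∈ laurentIntegers E
      rw [mem_laurentIntegers]
      refine HahnSeries.le_orderTop_iff_forall.2 fun n hn => ?_
      have hn : n < 0 := by exact_mod_cast hn
      have h3 := congrArg (fun x : LaurentSeries E => x.coeff (n + 1)) h1
      simp only [HahnSeries.coeff_mul_single_add, mul_one, coeff_euler] at h3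
      rw [← h3]
      rcases (Int.add_one_le_iff.2 hn).lt_or_eq with h | h
      · rw [HahnSeries.coeff_eq_zero_of_lt_orderTop, mul_zero]
        exact lt_of_lt_of_le (by exact_mod_cast h) (mem_laurentIntegers.1 (show Θ o ∈ _ from ho))
      · rw [h]
        simp
  obtain ⟨n, f, c, hf, hfo, hfc⟩ := exists_sum_of_expansion θ hθ Θ hΘE hΘF hC
    (mem_laurentIntegers.1 (show Θ h ∈ _ from hord))
  exact ⟨n, f, c, hf, hfo, by rw [hfc]⟩

end

end IsConstantExtension

/-! ### Expansions at a place -/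

section Expansion

/-- The power series of digits of an element, for a ring with a residue map to `K` whose kernel is
generated by a uniformizer. -/
theorem exists_digitSeries {K R : Type*} [Field K] [CommRing R] [IsDomain R] [Algebra K R]
    (res : R →+* K) (hres : ∀ a, res (algebraMap K R a) = a) {z : R} (hz0 : z ≠ 0)
    (hz : res z = 0) (hker : ∀ f, res f = 0 → z ∣ f) :
    ∃ θ : R →+* PowerSeries K, (∀ a, θ (algebraMap K R a) = PowerSeries.C a) ∧
      θ z = PowerSeries.X ∧ ∀ f, PowerSeries.constantCoeff (θ f) = res f := by
  have hdig : ∀ f, ∃ g, f = algebraMap K R (res f) + z * g := by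
    intro f
    obtain ⟨g, hg⟩ := hker (f - algebraMap K R (res f)) (by rw [map_sub, hres, sub_self])
    exact ⟨g, by rw [← hg]; ring⟩
  choose dig hd using hdig
  have huniq : ∀ {f g a}, f = algebraMap K R a + z * g → res f = a ∧ dig f = g := by
    intro f g a h
    have h1 : res f = a := by rw [h, map_add, map_mul, hz, hres]; simp
    refine ⟨h1, mul_left_cancel₀ hz0 ?_⟩
    have := hd f
    rw [h1] at this
    exact add_left_cancel (this.symm.trans h)
  let c : R → ℕ → K := fun f n => res (dig^[n] f)
  have hc0 : ∀ f, c f 0 = res f := fun f => rfl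
  have hcs : ∀ f n, c f (n + 1) = c (dig f) n := fun f n => rfl
  have hadd : ∀ n f g, c (f + g) n = c f n + c g n := by
    intro n
    induction n with
    | zero => intro f g; simp [hc0]
    | succ n ih =>
      intro f g
      have : dig (f + g) = dig f + dig g := by
        refine (huniq (a := res f + res g) ?_).2
        conv_lhs => rw [hd f, hd g]
        rw [map_add]
        ring
      rw [hcs, hcs, hcs, this, ih]
  have hsmul : ∀ n a f, c (algebraMap K R a * f) n = a * c f n := by
    intro n
    induction n with
    | zero => intro a f; simp [hc0, hres]
    | succ n ih =>
      intro a f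
      have : dig (algebraMap K R a * f) = algebraMap K R a * dig f := by
        refine (huniq (a := a * res f) ?_).2
        conv_lhs => rw [hd f]
        rw [map_mul]
        ring
      rw [hcs, hcs, this, ih]
  have hrec : ∀ f, PowerSeries.mk (c f) =
      PowerSeries.C (res f) + PowerSeries.X * PowerSeries.mk (c (dig f)) := by
    intro f
    ext n
    cases n with
    | zero => simp [hc0]
    | succ n => simp [hcs, PowerSeries.coeff_succ_X_mul]
  have hmul : ∀ n f g, c (f * g) n = PowerSeries.coeff n (PowerSeries.mk (c f) * PowerSeries.mk (c g)) := by
    intro n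
    induction n with
    | zero => intro f g; simp [hc0]
    | succ n ih =>
      intro f g
      have : dig (f * g) = dig f * g + algebraMap K R (res f) * dig g := by
        refine (huniq (a := res f * res g) ?_).2
        conv_lhs => rw [hd f]
        conv_lhs => rw [add_mul]; arg 1; rw [hd g]
        rw [map_mul]
        ring
      rw [hcs, this, hadd, ih, hsmul, hrec f, add_mul, map_add, mul_assoc,
        PowerSeries.coeff_succ_X_mul, PowerSeries.coeff_C_mul, PowerSeries.coeff_mk, hcs, add_comm]
  have halg : ∀ a, dig (algebraMap K R a) = 0 := fun a => (huniq (a := a) (by simp)).2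
  have hzero : ∀ n, c 0 n = 0 := fun n => by simpa using hsmul n 0 0
  have hC : ∀ a, PowerSeries.mk (c (algebraMap K R a)) = PowerSeries.C a := by
    intro a
    rw [hrec, halg, hres]
    have : PowerSeries.mk (c 0) = 0 := by ext n; simp [hzero]
    rw [this]
    simp
  refine ⟨{ toFun := fun f => PowerSeries.mk (c f), map_one' := ?_, map_mul' := ?_,
            map_zero' := ?_, map_add' := ?_ }, hC, ?_, ?_⟩
  · have := hC 1
    rwa [map_one, map_one] at this
  · intro f g
    ext n
    rw [PowerSeries.coeff_mk, hmul]
  · have := hC 0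
    rwa [map_zero, map_zero] at this
  · intro f g
    ext n
    simp [hadd]
  · change PowerSeries.mk (c z) = _
    have h1 : dig z = 1 := (huniq (a := 0) (by simp)).2
    rw [hrec, hz, h1]
    have := hC 1
    rw [map_one] at this
    rw [this]
    simp
  · intro f
    change PowerSeries.constantCoeff (PowerSeries.mk (c f)) = _
    simp [hc0]

variable {K F : Type*} [Field K] [Field F] [Algebra K F]

/-- In a function field of one variable over an algebraically closed field a place with a nonunit
has residue field `K`. -/
theorem exists_residue [IsAlgClosed K] (h1 : Algebra.trdeg K F ≤ 1) (O : ValuationSubring F)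
    (hO : ∀ a, algebraMap K F a ∈ O) {z : F} (hz0 : z ≠ 0) (hz : z ∈ O) (hz' : z⁻¹ ∉ O) {f : F}
    (hf : f ∈ O) : ∃ a : K, (f - algebraMap K F a)⁻¹ ∉ O ∨ f = algebraMap K F a := by
  -- Otherwise every nonzero polynomial in `f` is a unit of `O`, because it splits into linear
  -- factors. A relation between `z` and `f` not divisible by `z` then makes a unit a multiple of
  -- `z`.
  by_contra! hcon
  obtain ⟨P, hP0, hP⟩ := exists_relation h1 hz0 f
  have hsub : ∀ p : Polynomial K, p ≠ 0 → Polynomial.aeval f p ≠ 0 ∧ (Polynomial.aeval f p)⁻¹ ∈ O := by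
    intro p hp
    have hs := IsAlgClosed.splits p
    rw [hs.eq_prod_roots, map_mul, Polynomial.aeval_C, map_multiset_prod, Multiset.map_map]
    have : ∀ m : Multiset K, (m.map ((Polynomial.aeval f : Polynomial K →ₐ[K] F) ∘
        fun a => Polynomial.X - Polynomial.C a)).prod ≠ 0 ∧
        (m.map ((Polynomial.aeval f : Polynomial K →ₐ[K] F) ∘
          fun a => Polynomial.X - Polynomial.C a)).prod⁻¹ ∈ O := by
      intro m
      induction m using Multiset.induction_on with
      | empty => simp
      | cons a m ih =>
        rw [Multiset.map_cons, Multiset.prod_cons, mul_inv]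
        have h2 := hcon a
        have h3 : ((Polynomial.aeval f : Polynomial K →ₐ[K] F) ∘
          fun a => Polynomial.X - Polynomial.C a) a = f - algebraMap K F a := by simp
        rw [h3]
        exact ⟨mul_ne_zero (sub_ne_zero.2 h2.2) ih.1, O.mul_mem _ _ h2.1 ih.2⟩
    have h4 := this p.roots
    refine ⟨mul_ne_zero (by simpa using hp) h4.1, ?_⟩
    rw [mul_inv, ← map_inv₀]
    exact O.mul_mem _ _ (hO _) h4.2
  have hmem : ∀ p : Polynomial K, Polynomial.aeval f p ∈ O := by
    intro p
    rw [Polynomial.aeval_eq_sum_range]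
    refine sum_mem fun i _ => ?_
    rw [Algebra.smul_def]
    exact O.mul_mem _ _ (hO _) (pow_mem hf _)
  obtain ⟨h2, h3⟩ := hsub _ hP0
  rw [← Polynomial.divX_mul_X_add P, Polynomial.eval₂_add, Polynomial.eval₂_mul, Polynomial.eval₂_X,
    Polynomial.eval₂_C] at hP
  have hP' : P.divX.eval₂ (Polynomial.aeval f : Polynomial K →ₐ[K] F).toRingHom z * z +
    Polynomial.aeval f (P.coeff 0) = 0 := hP
  set w := P.divX.eval₂ (Polynomial.aeval f : Polynomial K →ₐ[K] F).toRingHom z with hw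
  have hwO : w ∈ O := by
    rw [hw, Polynomial.eval₂_eq_sum_range]
    exact sum_mem fun i _ => O.mul_mem _ _ (hmem _) (pow_mem hz _)
  apply hz'
  have : z⁻¹ = - w * (Polynomial.aeval f (P.coeff 0))⁻¹ := by
    have h5 : Polynomial.aeval f (P.coeff 0) = - w * z := by linear_combination hP'
    have hw0 : w ≠ 0 := by
      rintro hw0
      rw [h5, hw0] at h2
      simp at h2
    rw [h5]
    field_simp
  rw [this]
  exact O.mul_mem _ _ (neg_mem hwO) h3

/-- The expansion of the elements of a function field of one variable at a place with a
uniformizer. -/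
theorem exists_expansion [IsAlgClosed K] (h1 : Algebra.trdeg K F ≤ 1) (O : ValuationSubring F)
    (hO : ∀ a, algebraMap K F a ∈ O) {z : F} (hz0 : z ≠ 0) (hz : z ∈ O) (hz' : z⁻¹ ∉ O)
    (hm : ∀ f ∈ O, f⁻¹ ∉ O → f * z⁻¹ ∈ O) (hinf : ∀ f ≠ 0, ∃ n : ℕ, f * z⁻¹ ^ n ∉ O) :
    ∃ θ : F →+* LaurentSeries K, (∀ a, θ (algebraMap K F a) = HahnSeries.C a) ∧
      θ z = HahnSeries.single 1 1 ∧ ∀ f, 0 ≤ (θ f).orderTop ↔ f ∈ O := by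
  let κ : K →+* O := (algebraMap K F).codRestrict O.toSubring hO
  have hnon : ∀ f : O, ¬ IsUnit f → f = 0 ∨ (f : F)⁻¹ ∉ O := by
    intro f hf
    by_contra! h
    exact hf (IsUnit.of_mul_eq_one ⟨_, h.2⟩ (Subtype.ext (mul_inv_cancel₀ fun h0 => h.1 (Subtype.ext h0))))
  have hunit : ∀ f : O, (f : F)⁻¹ ∉ O → ¬ IsUnit f := fun f hf hu => hf (inv_mem_of_isUnit f.2 hu).2
  let ρ : K →+* IsLocalRing.ResidueField O := (IsLocalRing.residue O).comp κ
  have hρ : Function.Bijective ρ := by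
    refine ⟨ρ.injective, fun x => ?_⟩
    obtain ⟨f, rfl⟩ := IsLocalRing.residue_surjective x
    obtain ⟨a, ha⟩ := exists_residue h1 O hO hz0 hz hz' f.2
    refine ⟨a, ?_⟩
    rw [← sub_eq_zero, ← neg_eq_zero, neg_sub]
    change IsLocalRing.residue O f - IsLocalRing.residue O (κ a) = 0
    rw [← map_sub, IsLocalRing.residue_eq_zero_iff, IsLocalRing.mem_maximalIdeal, mem_nonunits_iff]
    rcases ha with ha | ha
    · exact hunit _ ha
    · have : f - κ a = 0 := Subtype.ext (sub_eq_zero.2 ha)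
      rw [this]
      exact not_isUnit_zero
  let e := RingEquiv.ofBijective ρ hρ
  let res : O →+* K := e.symm.toRingHom.comp (IsLocalRing.residue O)
  have hres0 : ∀ f, res f = 0 ↔ ¬ IsUnit f := fun f => by
    change e.symm _ = 0 ↔ _
    rw [map_eq_zero_iff _ e.symm.injective, IsLocalRing.residue_eq_zero_iff,
      IsLocalRing.mem_maximalIdeal, mem_nonunits_iff]
  let : Algebra K O := κ.toAlgebra
  have hker : ∀ f : O, res f = 0 → (⟨z, hz⟩ : O) ∣ f := by
    intro f hf
    have h2 : (f : F) * z⁻¹ ∈ O := by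
      rcases hnon f ((hres0 f).1 hf) with h | h
      · rw [h]; simp
      · exact hm f f.2 h
    exact ⟨⟨_, h2⟩, Subtype.ext (by change (f : F) = z * (f * z⁻¹); field_simp)⟩
  obtain ⟨θ, hθ, hθz, hθc⟩ := exists_digitSeries (R := O) res
    (fun a => e.symm_apply_apply a) (z := ⟨z, hz⟩) (fun h => hz0 (congrArg Subtype.val h))
    ((hres0 _).2 (hunit _ hz')) hker
  -- An element with zero expansion is divisible by every power of `z`, which `hinf` excludes.
  have hinj : Function.Injective θ := by
    rw [injective_iff_map_eq_zero]
    intro f hf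
    by_contra hf0
    obtain ⟨n, hn⟩ := hinf f (fun h => hf0 (Subtype.ext h))
    apply hn
    clear hn
    have : ∃ g : O, (f : F) = z ^ n * g ∧ θ g = 0 := by
      induction n with
      | zero => exact ⟨f, by simp, hf⟩
      | succ n ih =>
        obtain ⟨g, hg, hg0⟩ := ih
        obtain ⟨g', rfl⟩ := hker g (by rw [← hθc, hg0, map_zero])
        refine ⟨g', ?_, ?_⟩
        · rw [hg, pow_succ]
          change z ^ n * (z * (g' : F)) = _
          ring
        · rw [map_mul, hθz] at hg0
          exact (mul_eq_zero.1 hg0).resolve_left PowerSeries.X_ne_zero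
    obtain ⟨g, hg, -⟩ := this
    rw [hg, mul_right_comm, ← mul_pow, mul_inv_cancel₀ hz0, one_pow, one_mul]
    exact g.2
  have hinj' : Function.Injective ((HahnSeries.ofPowerSeries ℤ K).comp θ) :=
    HahnSeries.ofPowerSeries_injective.comp hinj
  have hlift : ∀ f : O, IsFractionRing.lift (K := F) hinj' (f : F) =
      HahnSeries.ofPowerSeries ℤ K (θ f) := fun f => IsFractionRing.lift_algebraMap hinj' f
  have hnonneg : ∀ f ∈ O, 0 ≤ (IsFractionRing.lift (K := F) hinj' f).orderTop := fun f hf => by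
    rw [hlift ⟨f, hf⟩]
    exact orderTop_ofPowerSeries_nonneg _
  have hLz : IsFractionRing.lift (K := F) hinj' z = HahnSeries.single 1 1 := by
    rw [hlift ⟨z, hz⟩, hθz, HahnSeries.ofPowerSeries_X]
  refine ⟨IsFractionRing.lift (K := F) hinj', fun a => ?_, hLz, fun f => ⟨fun h => ?_, hnonneg f⟩⟩
  · refine (hlift (κ a)).trans ?_
    rw [show κ a = algebraMap K O a from rfl, hθ, HahnSeries.ofPowerSeries_C]
  · by_contra hf
    have hf' : f⁻¹ ∈ O := (O.mem_or_inv_mem f).resolve_left hf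
    have h2 := hnonneg _ (hm _ hf' (by rwa [inv_inv]))
    have hf0 : f ≠ 0 := by rintro rfl; exact hf O.zero_mem
    have h3 : (IsFractionRing.lift (K := F) hinj' (f⁻¹ * z⁻¹)) *
        (IsFractionRing.lift (K := F) hinj' f * HahnSeries.single 1 1) = 1 := by
      rw [← hLz, ← map_mul, ← map_mul, ← map_one (IsFractionRing.lift (K := F) hinj')]
      congr 1
      field_simp
    have h4 := congrArg HahnSeries.orderTop h3
    rw [HahnSeries.orderTop_mul, HahnSeries.orderTop_mul, HahnSeries.orderTop_one,
      HahnSeries.orderTop_single one_ne_zero] at h4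
    have h5 : (1 : WithTop ℤ) ≤ 0 := by
      conv_rhs => rw [← h4]
      exact le_add_of_nonneg_of_le h2 (le_add_of_nonneg_left h)
    exact absurd h5 (by decide)

/-- Finite expansions. -/
theorem exists_digits [IsAlgClosed K] (h1 : Algebra.trdeg K F ≤ 1) (O : ValuationSubring F)
    (hO : ∀ a, algebraMap K F a ∈ O) {z : F} (hz0 : z ≠ 0) (hz : z ∈ O) (hz' : z⁻¹ ∉ O)
    (hm : ∀ f ∈ O, f⁻¹ ∉ O → f * z⁻¹ ∈ O) (N : ℕ) {f : F} (hf : f ∈ O) :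
    ∃ (a : ℕ → K) (g : F), g ∈ O ∧
      f = ∑ i ∈ Finset.range N, algebraMap K F (a i) * z ^ i + z ^ N * g := by
  induction N with
  | zero => exact ⟨0, f, hf, by simp⟩
  | succ N ih =>
    obtain ⟨a, g, hg, hfg⟩ := ih
    obtain ⟨b, hb⟩ := exists_residue h1 O hO hz0 hz hz' hg
    have hb' : (g - algebraMap K F b) * z⁻¹ ∈ O := by
      rcases hb with hb | hb
      · exact hm _ (sub_mem hg (hO b)) hb
      · rw [hb]; simp
    refine ⟨fun i => if i = N then b else a i, _, hb', ?_⟩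
    have hs : ∑ i ∈ Finset.range N, algebraMap K F (if i = N then b else a i) * z ^ i =
        ∑ i ∈ Finset.range N, algebraMap K F (a i) * z ^ i :=
      Finset.sum_congr rfl fun i hi => by rw [if_neg (Finset.mem_range.1 hi).ne]
    rw [Finset.sum_range_succ, hs]
    beta_reduce
    rw [if_pos rfl, add_assoc, pow_succ]
    conv_lhs => rw [hfg]
    congr 1
    field_simp
    ring

/-- The place of a function field given by a nontrivial expansion. -/
theorem exists_uniformizer {K F κ : Type*} [Field K] [Field F] [Algebra K F] [Field κ]
    [Algebra K κ] (r : F →+* LaurentSeries κ)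
    (hr : ∀ a, r (algebraMap K F a) = HahnSeries.C (algebraMap K κ a))
    (hne : ∃ f ≠ 0, (r f).orderTop ≠ 0) :
    ∃ (O : ValuationSubring F) (z : F) (n : ℤ), (∀ f, f ∈ O ↔ 0 ≤ (r f).orderTop) ∧
      (∀ a, algebraMap K F a ∈ O) ∧ z ≠ 0 ∧ z ∈ O ∧ z⁻¹ ∉ O ∧ (∀ f ∈ O, f⁻¹ ∉ O → f * z⁻¹ ∈ O) ∧
      (∀ f ≠ 0, ∃ n : ℕ, f * z⁻¹ ^ n ∉ O) ∧ 0 < n ∧ (r z).orderTop = n := by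
  have hord : ∀ f ≠ 0, (r f).orderTop = ((r f).order : WithTop ℤ) := fun f hf =>
    (HahnSeries.order_eq_orderTop_of_ne_zero ((map_ne_zero r).2 hf)).symm
  have hmul : ∀ f g : F, f ≠ 0 → g ≠ 0 → (r (f * g)).order = (r f).order + (r g).order := by
    intro f g hf hg
    rw [map_mul, HahnSeries.order_mul ((map_ne_zero r).2 hf) ((map_ne_zero r).2 hg)]
  have hinv : ∀ f ≠ 0, (r f⁻¹).order = -(r f).order := by
    intro f hf
    have := hmul f f⁻¹ hf (inv_ne_zero hf)
    rw [mul_inv_cancel₀ hf, map_one, HahnSeries.order_one] at this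
    omega
  have hpow : ∀ f ≠ 0, ∀ n : ℕ, (r (f ^ n)).order = n * (r f).order := by
    intro f hf n
    induction n with
    | zero => simp
    | succ n ih =>
      rw [pow_succ, hmul _ _ (pow_ne_zero n hf) hf, ih]
      push_cast
      ring
  -- The orders form a nonzero subgroup of `ℤ`; an element with the least positive order is a
  -- uniformizer.
  have hex : ∃ n : ℕ, 0 < n ∧ ∃ f ≠ 0, (r f).order = n := by
    obtain ⟨f, hf, hf'⟩ := hne
    rw [hord f hf] at hf'
    have hf' : (r f).order ≠ 0 := by exact_mod_cast hf'
    rcases lt_or_gt_of_ne hf' with h | h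
    · exact ⟨(-(r f).order).toNat, by omega, f⁻¹, inv_ne_zero hf, by rw [hinv f hf]; omega⟩
    · exact ⟨(r f).order.toNat, by omega, f, hf, by omega⟩
  classical
  obtain ⟨hn, z, hz0, hz⟩ := Nat.find_spec hex
  have hmin := fun m hm => Nat.find_min hex (m := m) hm
  set n := Nat.find hex
  let O := (laurentIntegers κ).comap r
  have hO : ∀ f, f ∈ O ↔ 0 ≤ (r f).orderTop := fun f => mem_laurentIntegers
  have hO' : ∀ f ≠ 0, (f ∈ O ↔ 0 ≤ (r f).order) := fun f hf => by
    rw [hO, hord f hf]; exact_mod_cast Iff.rfl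
  refine ⟨O, z, n, hO, fun a => ?_, hz0, ?_, ?_, ?_, ?_, by exact_mod_cast hn, ?_⟩
  · rw [hO, hr]
    by_cases ha : algebraMap K κ a = 0
    · simp [ha]
    · rw [HahnSeries.C_apply, HahnSeries.orderTop_single ha]
      exact le_rfl
  · rw [hO' z hz0]; omega
  · rw [hO' _ (inv_ne_zero hz0), hinv z hz0]; omega
  · intro f hf hf'
    have hf0 : f ≠ 0 := by rintro rfl; simp [O.zero_mem] at hf'
    rw [hO' _ (inv_ne_zero hf0), hinv f hf0] at hf'
    rw [hO' _ (mul_ne_zero hf0 (inv_ne_zero hz0)), hmul _ _ hf0 (inv_ne_zero hz0), hinv z hz0]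
    by_contra hlt
    exact hmin (r f).order.toNat (by omega) ⟨by omega, f, hf0, by omega⟩
  · intro f hf
    refine ⟨(r f).order.toNat + 1, ?_⟩
    rw [hO' _ (mul_ne_zero hf (pow_ne_zero _ (inv_ne_zero hz0))),
      hmul _ _ hf (pow_ne_zero _ (inv_ne_zero hz0)), hpow _ (inv_ne_zero hz0), hinv z hz0, hz]
    have h1 : (1 : ℤ) ≤ n := by exact_mod_cast hn
    push_cast
    have h2 : (r f).order ≤ ((r f).order.toNat : ℤ) := Int.self_le_toNat _
    nlinarith [Int.natCast_nonneg (r f).order.toNat]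
  · rw [hord z hz0, hz]

end Expansion

/-! ### Leading coefficients of regular differentials -/

section Core

open LaurentSeries in
theorem le_orderTop_mul {k : Type*} [Field k] {f g : k⸨X⸩} {a b : ℤ}
    (hf : (a : WithTop ℤ) ≤ f.orderTop) (hg : (b : WithTop ℤ) ≤ g.orderTop) :
    ((a + b : ℤ) : WithTop ℤ) ≤ (f * g).orderTop := by
  rw [HahnSeries.orderTop_mul, WithTop.coe_add]
  exact add_le_add hf hg

open LaurentSeries in
theorem le_orderTop_pow {k : Type*} [Field k] {f : k⸨X⸩} {a : ℤ}
    (hf : (a : WithTop ℤ) ≤ f.orderTop) (n : ℕ) : ((n * a : ℤ) : WithTop ℤ) ≤ (f ^ n).orderTop := by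
  induction n with
  | zero => simp
  | succ n ih =>
    rw [pow_succ, show ((n + 1 : ℕ) : ℤ) * a = n * a + a by push_cast; ring]
    exact le_orderTop_mul ih hf

open LaurentSeries in
theorem le_orderTop_sum {k : Type*} [Field k] {ι : Type*} {s : Finset ι} {f : ι → k⸨X⸩}
    {a : WithTop ℤ} (hf : ∀ i ∈ s, a ≤ (f i).orderTop) : a ≤ (∑ i ∈ s, f i).orderTop := by
  refine HahnSeries.le_orderTop_iff_forall.2 fun n hn => ?_
  rw [HahnSeries.coeff_sum]
  exact Finset.sum_eq_zero fun i hi => HahnSeries.coeff_eq_zero_of_lt_orderTop (hn.trans_le (hf i hi))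

variable {K E F L κ : Type*} [Field K] [Field E] [Field F] [Field L] [Field κ]
  [Algebra K E] [Algebra K F] [Algebra K L] [Algebra E L] [Algebra F L] [Algebra K κ]
  [IsScalarTower K E L] [IsScalarTower K F L] [CharZero K] [CharZero E] [IsAlgClosed K]

omit [CharZero K] [CharZero E] in
theorem transcendental_of_notMem_range {z : F} (hz : ∀ a, algebraMap K F a ≠ z) :
    Transcendental K z := by
  intro h
  have hirr := minpoly.irreducible h.isIntegral
  obtain ⟨a, ha⟩ := minpoly.mem_range_of_degree_eq_one K z
    (IsAlgClosed.degree_eq_one_of_irreducible K hirr)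
  exact hz a ha

omit [CharZero E] in
theorem coeffMap_C_algebraMap (δ : κ →+ κ) (hδK : ∀ a, δ (algebraMap K κ a) = 0) (e : LaurentSeries K) :
    coeffMap δ (laurentMap (algebraMap K κ) e) = 0 := by
  ext n
  simp [hδK]

/-- How regular differentials of a constant curve degenerate. The outer Laurent variable is the
parameter of the degeneration and `κ` carries a derivation `δ`, which corresponds to `X d/dX` at a
place `j`. If the embedding of `F` is not of constant order in the parameter, the image of `F`
concentrates at a place of `F`; near it a regular differential is exact up to high order, so its
leading coefficient is a derivative. Otherwise reduction embeds `F` into `κ`, and the leading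
coefficient is a differential of `F` that is regular at the place induced by `j`; as `δ` corresponds
to `X d/dX`, regularity means order at least one. -/
theorem exists_primitive_or_vanishing (hc : IsConstantExtension K E F L) (h1 : Algebra.trdeg K F ≤ 1)
    {S : Finset F} (hS : IntermediateField.adjoin K (S : Set F) = ⊤)
    (hF : ∃ f : F, ∀ a, algebraMap K F a ≠ f) (θE : E →+* LaurentSeries K)
    (ι : L →+* LaurentSeries κ)
    (hι : ∀ e, ι (algebraMap E L e) = laurentMap (algebraMap K κ) (θE e))
    (hθE : ∀ a, θE (algebraMap K E a) = HahnSeries.C a)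
    (j : κ →+* LaurentSeries K) (hj : ∀ a, j (algebraMap K κ a) = HahnSeries.C a)
    (δ : κ →+ κ) (hjδ : ∀ u, j (δ u) = euler K (j u)) {x w : L}
    (hω : w • KaehlerDifferential.D E L x ∈ regularDifferentials E L) {m : ℤ}
    (hm : (ι w * coeffMap δ (ι x)).orderTop = m) :
    (∃ g, δ g = (ι w * coeffMap δ (ι x)).coeff m) ∨
      1 ≤ (j ((ι w * coeffMap δ (ι x)).coeff m)).orderTop := by
  have hδ : ∀ a b, δ (a * b) = a * δ b + b * δ a := fun a b => j.injective (by
    rw [hjδ, map_mul, euler_mul, map_add, map_mul, map_mul, hjδ, hjδ])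
  have hδK : ∀ a, δ (algebraMap K κ a) = 0 := fun a => j.injective (by
    rw [hjδ, hj, map_zero]
    ext n
    rw [coeff_euler, HahnSeries.C_apply, HahnSeries.coeff_single]
    split_ifs with hn <;> simp [hn])
  have hιF : ∀ a, ι (algebraMap F L (algebraMap K F a)) = HahnSeries.C (algebraMap K κ a) := by
    intro a
    rw [← IsScalarTower.algebraMap_apply, IsScalarTower.algebraMap_apply K E L, hι, hθE]
    ext n
    rw [coeff_laurentMap, HahnSeries.C_apply, HahnSeries.C_apply, HahnSeries.coeff_single,
      HahnSeries.coeff_single]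
    split_ifs <;> simp
  obtain ⟨φ, hφ, hφD⟩ := exists_functional_kaehler (E := E) ι (coeffMap δ) (coeffMap_mul δ hδ)
    (fun e => by rw [hι, coeffMap_C_algebraMap δ hδK])
  rw [← hφD, ← hφ] at hm ⊢
  generalize w • KaehlerDifferential.D E L x = ω at hm hω ⊢
  have hω0 : ω ≠ 0 := by
    rintro rfl
    simp at hm
  have hfin : ∀ z : F, z ≠ 0 → ∀ O : ValuationSubring F, (∀ a, algebraMap K F a ∈ O) → z⁻¹ ∉ O →
      Transcendental K z := by
    intro z hz O hO hz'
    refine transcendental_of_notMem_range fun a ha => hz' ?_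
    rw [← ha, ← map_inv₀]
    exact hO _
  by_cases hA : ∃ f : F, f ≠ 0 ∧ (ι (algebraMap F L f)).orderTop ≠ 0
  · left
    obtain ⟨O, z, n, hO, hOK, hz0, hz, hz', hmax, hinf, hn, hzn⟩ :=
      exists_uniformizer (ι.comp (algebraMap F L)) hιF hA
    obtain ⟨θ, hθ, hθz, hθO⟩ := exists_expansion h1 O hOK hz0 hz hz' hmax hinf
    have hzt := hfin z hz0 O hOK hz'
    have := finiteDimensional_adjoin_of_transcendental h1 hS hzt
    obtain ⟨r, f, c, hf, hfo, rfl⟩ :=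
      hc.exists_sum_of_mem_regularDifferentials hzt θ hθ hθz hω hω0
    have hfO : ∀ i, f i ∈ O := fun i => (hθO _).1 (hfo i)
    obtain ⟨M, hM⟩ : ∃ M : ℤ, ∀ i, (M : WithTop ℤ) ≤ (ι (algebraMap E L (c i))).orderTop := by
      refine ⟨-∑ i, |(ι (algebraMap E L (c i))).order|, fun i => ?_⟩
      by_cases hci : ι (algebraMap E L (c i)) = 0
      · simp [hci]
      rw [← HahnSeries.order_eq_orderTop_of_ne_zero hci, WithTop.coe_le_coe]
      have h2 : |(ι (algebraMap E L (c i))).order| ≤ ∑ i, |(ι (algebraMap E L (c i))).order| :=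
        Finset.single_le_sum (f := fun i => |(ι (algebraMap E L (c i))).order|)
          (fun _ _ => abs_nonneg _) (Finset.mem_univ i)
      have := neg_abs_le (ι (algebraMap E L (c i))).order
      omega
    -- Enough terms for the remainder `z ^ N * R`, whose order is at least `N * n + M`, to lie
    -- beyond the index `m`.
    let N : ℕ := (m - M).toNat + 1
    have hN : m < N * n + M := by
      have h2 : m - M ≤ ((m - M).toNat : ℤ) := Int.self_le_toNat _
      have h3 : (N : ℤ) ≤ N * n := le_mul_of_one_le_right (by positivity) hn
      simp only [N] at h3 ⊢
      push_cast at h3 ⊢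
      omega
    choose a g hg hfg using fun i => exists_digits h1 O hOK hz0 hz hz' hmax N (hfO i)
    have hD : ∀ (a : K) (k : ℕ), KaehlerDifferential.D E L (algebraMap F L
        (algebraMap K F (a / (k + 1)) * z ^ (k + 1))) =
        algebraMap F L (algebraMap K F a * z ^ k) •
          KaehlerDifferential.D E L (algebraMap F L z) := by
      intro a k
      have hk : ((k : K) + 1) ≠ 0 := by exact_mod_cast Nat.succ_ne_zero k
      have h2 : algebraMap F L (algebraMap K F (a / (k + 1))) =
          algebraMap E L (algebraMap K E (a / (k + 1))) := by
        rw [← IsScalarTower.algebraMap_apply, ← IsScalarTower.algebraMap_apply]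
      rw [map_mul (algebraMap F L), map_mul (algebraMap F L), Derivation.leibniz, h2,
        Derivation.map_algebraMap, smul_zero, add_zero, map_pow, Derivation.leibniz_pow, ← h2, ← Nat.cast_smul_eq_nsmul L, smul_smul, smul_smul,
        Nat.add_sub_cancel, map_pow]
      congr 1
      rw [map_div₀, map_div₀, map_add, map_add, map_natCast, map_natCast, map_one, map_one]
      have hk' : ((k : L) + 1) ≠ 0 := by
        have := (map_ne_zero (algebraMap K L)).2 hk
        rwa [map_add, map_natCast, map_one] at this
      push_cast
      field_simp
    -- The termwise primitive of the truncated expansions; here characteristic zero is essential.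
    let G : L := ∑ i, algebraMap E L (c i) * ∑ k ∈ Finset.range N,
      algebraMap F L (algebraMap K F (a i k / (k + 1)) * z ^ (k + 1))
    let R : L := ∑ i, algebraMap E L (c i) * algebraMap F L (g i)
    have hGR : (∑ i, algebraMap E L (c i) * algebraMap F L (f i)) •
        KaehlerDifferential.D E L (algebraMap F L z) = KaehlerDifferential.D E L G +
          (algebraMap F L z ^ N * R) • KaehlerDifferential.D E L (algebraMap F L z) := by
      simp only [G, R, map_sum, Derivation.leibniz, Derivation.map_algebraMap, smul_zero, add_zero,
        hD, ← Finset.sum_smul, smul_smul, ← add_smul]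
      congr 1
      rw [Finset.mul_sum, ← Finset.sum_add_distrib]
      refine Finset.sum_congr rfl fun i _ => ?_
      rw [hfg i, map_add, map_sum, map_mul, map_pow]
      ring
    refine ⟨(ι G).coeff m, ?_⟩
    rw [hGR, map_add, HahnSeries.coeff_add, hφD, coeff_coeffMap, hφ, hφD]
    rw [left_eq_add]
    apply HahnSeries.coeff_eq_zero_of_lt_orderTop
    have h2 : ((n : ℤ) : WithTop ℤ) ≤ (ι (algebraMap F L z)).orderTop := hzn.ge
    have h3 : ((M : ℤ) : WithTop ℤ) ≤ (ι R).orderTop := by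
      simp only [R, map_sum, map_mul]
      refine le_orderTop_sum fun i _ => ?_
      have := le_orderTop_mul (hM i) (b := 0) ((hO _).1 (hg i))
      rwa [add_zero] at this
    rw [map_mul, map_pow]
    refine lt_of_lt_of_le (WithTop.coe_lt_coe.2 ?_) (le_orderTop_mul
      (le_orderTop_mul (le_orderTop_pow h2 N) h3) (h2.trans (orderTop_le_coeffMap δ _)))
    omega
  · right
    push Not at hA
    -- All nonzero elements of `F` have order zero, so the constant coefficient is an embedding of
    -- `F` into `κ`.
    let r : F →+* κ :=
      { toFun := fun f => (ι (algebraMap F L f)).coeff 0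
        map_one' := by simp
        map_zero' := by simp
        map_add' := by simp
        map_mul' := fun f g => by
          have hnn : ∀ f : F, 0 ≤ (ι (algebraMap F L f)).orderTop := fun f => by
            by_cases hf : f = 0
            · simp [hf]
            · exact (hA f hf).ge
          rw [map_mul, map_mul, coeff_zero_mul (hnn f) (hnn g)] }
    have hr : ∀ a, j (r (algebraMap K F a)) = HahnSeries.C (algebraMap K K a) := fun a => by
      change j ((ι (algebraMap F L (algebraMap K F a))).coeff 0) = _
      rw [hιF, HahnSeries.C_apply, HahnSeries.coeff_single_same, hj]
      rfl
    -- If every order at `j` were zero, subtracting the constant coefficient from an element of `F`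
    -- would have to give zero, and `F` would be `K`.
    have hB : ∃ f : F, f ≠ 0 ∧ (j (r f)).orderTop ≠ 0 := by
      by_contra! hB
      obtain ⟨f, hf⟩ := hF
      set a := (j (r f)).coeff 0 with ha
      have hf0 : f - algebraMap K F a ≠ 0 := fun h => hf a (sub_eq_zero.1 h).symm
      have h2 := hB _ hf0
      rw [map_sub, map_sub, hr, ha] at h2
      have h3 := orderTop_sub_C_pos (f := j (r f)) (by
        by_cases hf : f = 0
        · simp [hf]
        · exact (hB f hf).ge)
      exact h3.ne' h2
    obtain ⟨O, z, n, hO, hOK, hz0, hz, hz', hmax, hinf, hn, hzn⟩ :=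
      exists_uniformizer (j.comp r) hr hB
    obtain ⟨θ, hθ, hθz, hθO⟩ := exists_expansion h1 O hOK hz0 hz hz' hmax hinf
    have hzt := hfin z hz0 O hOK hz'
    have := finiteDimensional_adjoin_of_transcendental h1 hS hzt
    obtain ⟨q, f, c, hf, hfo, rfl⟩ :=
      hc.exists_sum_of_mem_regularDifferentials hzt θ hθ hθz hω hω0
    have hrK : ∀ a, r (algebraMap K F a) = algebraMap K κ a := fun a => by
      change (ι (algebraMap F L (algebraMap K F a))).coeff 0 = _
      rw [hιF, HahnSeries.C_apply, HahnSeries.coeff_single_same]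
    have hnn : ∀ f : F, ((0 : ℤ) : WithTop ℤ) ≤ (ι (algebraMap F L f)).orderTop := fun f => by
      by_cases hf : f = 0
      · simp [hf]
      · exact (hA f hf).ge
    have hfO : ∀ i, f i ∈ O := fun i => (hθO _).1 (hfo i)
    have hcE : ∀ e, (ι (algebraMap E L e)).orderTop = (θE e).orderTop := fun e => by
      rw [hι, orderTop_laurentMap]
    have hne : ∃ i, c i ≠ 0 := by
      by_contra! h
      simp [h] at hω0
    obtain ⟨i₁, hi₁⟩ := hne
    -- The constants may vanish or blow up with the parameter; only those of minimal order
    -- contribute to the leading coefficient.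
    obtain ⟨i₀, -, hi₀⟩ := Finset.exists_min_image Finset.univ (fun i => (θE (c i)).orderTop)
      ⟨i₁, Finset.mem_univ _⟩
    have hc0 : θE (c i₀) ≠ 0 := by
      intro h
      have h2 := hi₀ i₁ (Finset.mem_univ _)
      rw [h, HahnSeries.orderTop_zero, top_le_iff, HahnSeries.orderTop_eq_top, map_eq_zero] at h2
      exact hi₁ h2
    set M := (θE (c i₀)).order with hMdef
    have hM : ∀ i, (M : WithTop ℤ) ≤ (ι (algebraMap E L (c i))).orderTop := fun i => by
      rw [hcE, hMdef, HahnSeries.order_eq_orderTop_of_ne_zero hc0]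
      exact hi₀ i (Finset.mem_univ _)
    -- The leading coefficient of `∑ c i * f i`. It is nonzero because the `f i` are independent
    -- over `K`.
    let u : F := ∑ i, algebraMap K F ((θE (c i)).coeff M) * f i
    have hu0 : u ≠ 0 := by
      intro h
      have := linearIndependent_iff'.1 hf Finset.univ (fun i => (θE (c i)).coeff M)
        (by simpa [u, Algebra.smul_def] using h) i₀ (Finset.mem_univ _)
      rw [hMdef, HahnSeries.coeff_order_eq_zero] at this
      exact hc0 this
    have huO : u ∈ O := sum_mem fun i _ => O.mul_mem _ _ (hOK _) (hfO i)
    have hw : (ι (∑ i, algebraMap E L (c i) * algebraMap F L (f i))).coeff (M + 0) = r u := by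
      rw [map_sum, HahnSeries.coeff_sum, map_sum]
      refine Finset.sum_congr rfl fun i _ => ?_
      rw [map_mul, coeff_mul_of_le_orderTop (hM i) (hnn (f i)), hι, coeff_laurentMap, map_mul, hrK]
      rfl
    have hwo : (M : WithTop ℤ) ≤
        (ι (∑ i, algebraMap E L (c i) * algebraMap F L (f i))).orderTop := by
      rw [map_sum]
      refine le_orderTop_sum fun i _ => ?_
      have := le_orderTop_mul (hM i) (hnn (f i))
      rwa [add_zero, ← map_mul] at this
    have hzo := (hnn z).trans (orderTop_le_coeffMap δ _)
    have hcoef : (ι (∑ i, algebraMap E L (c i) * algebraMap F L (f i)) *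
        coeffMap δ (ι (algebraMap F L z))).coeff M = r u * δ (r z) := by
      have := coeff_mul_of_le_orderTop hwo hzo
      rw [add_zero] at this hw
      rw [this, hw]
      rfl
    have hzn' : (j (r z)).orderTop = n := hzn
    have hδz : (j (δ (r z))).orderTop = n := by
      rw [hjδ, orderTop_euler, hzn']
      rw [hzn']
      exact_mod_cast hn
    have hδz0 : δ (r z) ≠ 0 := by
      intro h
      rw [h, map_zero] at hδz
      simp at hδz
    rw [hφ, hφD] at hm ⊢
    have hmM : m = M := by
      refine le_antisymm ?_ ?_
      · have := HahnSeries.orderTop_le_of_coeff_ne_zero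
          (hcoef.trans_ne (mul_ne_zero ((map_ne_zero r).2 hu0) hδz0))
        rw [hm] at this
        exact_mod_cast this
      · have := le_orderTop_mul hwo hzo
        rw [add_zero, hm] at this
        exact_mod_cast this
    rw [hmM, hcoef, map_mul, HahnSeries.orderTop_mul, hδz]
    have h2 : 0 ≤ (j (r u)).orderTop := (hO u).1 huO
    refine le_add_of_nonneg_of_le h2 ?_
    exact_mod_cast hn

end Core

/-! ### Places of function fields -/

open IsDedekindDomain in
/-- A function field of one variable over an algebraically closed field has an expansion in which a
given nonconstant element is small. -/
theorem exists_place {K E : Type*} [Field K] [IsAlgClosed K] [CharZero K] [Field E] [Algebra K E]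
    (h1 : Algebra.trdeg K E ≤ 1) {S : Finset E} (hS : IntermediateField.adjoin K (S : Set E) = ⊤)
    {s : E} (hs : ∀ a, algebraMap K E a ≠ s) :
    ∃ θ : E →+* LaurentSeries K, (∀ a, θ (algebraMap K E a) = HahnSeries.C a) ∧
      0 < (θ s).orderTop := by
  have hst := transcendental_of_notMem_range hs
  have hs0 : s ≠ 0 := fun h => hs 0 (by rw [h, map_zero])
  have := finiteDimensional_adjoin_of_transcendental h1 hS hst
  have := isDedekindDomain_integralClosure_adjoin (E := K) s
  have := isFractionRing_integralClosure_adjoin (E := K) s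
  let C := integralClosure (Algebra.adjoin K {s}) E
  let s' : C := algebraMap (Algebra.adjoin K {s}) C ⟨s, Algebra.self_mem_adjoin_singleton K s⟩
  have hs' : (s' : E) = s := rfl
  -- An inverse of `s` that is integral over `K[s]` would lie in `K[s]`, contradicting the
  -- transcendence of `s`. So `s` lies in a maximal ideal, whose valuation is the place.
  have hnu : ¬ IsUnit s' := by
    intro hu
    obtain ⟨y, hy⟩ := hu.exists_right_inv
    have hy' : s * (y : E) = 1 := congrArg (algebraMap C E) hy
    have hyi : (y : E) = s⁻¹ := (inv_eq_of_mul_eq_one_right hy').symm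
    have hmem : s⁻¹ ∈ Algebra.adjoin K {s} := by
      refine mem_adjoin_of_isIntegral (inv_mem (IntermediateField.mem_adjoin_simple_self K s)) ?_
      rw [← hyi]
      exact y.2
    rw [Algebra.adjoin_singleton_eq_range_aeval] at hmem
    obtain ⟨p, hp⟩ := hmem
    have hp : Polynomial.aeval s p = s⁻¹ := hp
    have h2 := (transcendental_iff.1 hst) (Polynomial.X * p - 1) (by
      rw [map_sub, map_mul, Polynomial.aeval_X, hp, map_one, mul_inv_cancel₀ hs0, sub_self])
    have h3 := congrArg (Polynomial.eval 0) h2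
    simp at h3
  obtain ⟨P, hP, hsP⟩ := exists_max_ideal_of_mem_nonunits hnu
  have hs'0 : s' ≠ 0 := fun h => hs0 (congrArg (algebraMap C E) h)
  let v : HeightOneSpectrum C :=
    { asIdeal := P, isPrime := hP.isPrime, ne_bot := fun h => hs'0 (by rw [h] at hsP; exact hsP) }
  let O := (v.valuation E).valuationSubring
  have hO : ∀ x, x ∈ O ↔ v.valuation E x ≤ 1 := fun x => Iff.rfl
  have hvs : v.valuation E s < 1 := by
    have := (v.valuation_lt_one_iff_mem (K := E) s').2 hsP
    exact this
  have hinv : ∀ x ≠ 0, (x⁻¹ ∉ O ↔ v.valuation E x < 1) := fun x hx => by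
    rw [hO, map_inv₀, not_le, one_lt_inv₀ (by simpa [zero_lt_iff] using hx)]
  have hOK : ∀ a, algebraMap K E a ∈ O := fun a => by
    have : algebraMap K E a = algebraMap C E (algebraMap _ C (algebraMap K (Algebra.adjoin K {s}) a)) := rfl
    rw [hO, this]
    exact v.valuation_le_one _
  obtain ⟨z, hz⟩ := v.valuation_exists_uniformizer E
  have hz0 : z ≠ 0 := by
    rintro rfl
    rw [map_zero] at hz
    exact WithZero.exp_ne_zero hz.symm
  have hlog : ∀ x ≠ 0, ∃ k : ℤ, v.valuation E x = WithZero.exp k := fun x hx =>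
    ⟨_, (WithZero.exp_log ((Valuation.ne_zero_iff _).2 hx)).symm⟩
  have hz1 : v.valuation E z < 1 := by
    rw [hz, ← WithZero.exp_zero, WithZero.exp_lt_exp]
    norm_num
  obtain ⟨θ, hθ, -, hθO⟩ := exists_expansion h1 O hOK hz0 ((hO z).2 hz1.le) ((hinv z hz0).2 hz1)
    (fun f hf hf' => by
      by_cases hf0 : f = 0
      · rw [hf0, zero_mul]; exact O.zero_mem
      obtain ⟨k, hk⟩ := hlog f hf0
      rw [hinv f hf0, hk, ← WithZero.exp_zero, WithZero.exp_lt_exp] at hf'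
      rw [hO, map_mul, map_inv₀, hz, hk, ← WithZero.exp_neg, ← WithZero.exp_add,
        ← WithZero.exp_zero, WithZero.exp_le_exp]
      omega)
    (fun f hf => by
      obtain ⟨k, hk⟩ := hlog f hf
      refine ⟨k.natAbs + 1, ?_⟩
      rw [hO, map_mul, map_pow, map_inv₀, hz, hk, ← WithZero.exp_neg, ← WithZero.exp_nsmul,
        ← WithZero.exp_add, ← WithZero.exp_zero, WithZero.exp_le_exp]
      simp only [nsmul_eq_mul]
      push_cast
      have := neg_abs_le k
      omega)
  refine ⟨θ, hθ, ?_⟩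
  have h2 : ¬ 0 ≤ (θ s⁻¹).orderTop := by rw [hθO]; exact (hinv s hs0).2 hvs
  have hs1 : θ s ≠ 0 := (map_ne_zero θ).2 hs0
  have hs2 : θ s⁻¹ ≠ 0 := (map_ne_zero θ).2 (inv_ne_zero hs0)
  have h3 : (θ s).order + (θ s⁻¹).order = 0 := by
    rw [← HahnSeries.order_mul hs1 hs2, ← map_mul, mul_inv_cancel₀ hs0, map_one,
      HahnSeries.order_one]
  rw [← HahnSeries.order_eq_orderTop_of_ne_zero hs2] at h2
  rw [← HahnSeries.order_eq_orderTop_of_ne_zero hs1]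
  norm_cast at h2 ⊢
  omega

/-! ### Regular differentials of a curve with four monomials -/

/-- The signed maximal minors of the matrix with rows `(pᵢ, qᵢ, 1)`. -/
def affineRelation (p q : Fin 4 → ℤ) : Fin 4 → ℤ :=
  let d (a b c : Fin 4) := (p b - p a) * (q c - q a) - (p c - p a) * (q b - q a)
  ![d 1 2 3, -d 0 2 3, d 0 1 3, -d 0 1 2]

theorem sum_affineRelation (p q : Fin 4 → ℤ) : ∑ i, affineRelation p q i = 0 := by
  simp only [affineRelation, Fin.sum_univ_four, Matrix.cons_val]
  ring

theorem sum_affineRelation_mul_left (p q : Fin 4 → ℤ) : ∑ i, affineRelation p q i * p i = 0 := by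
  simp only [affineRelation, Fin.sum_univ_four, Matrix.cons_val]
  ring

theorem sum_affineRelation_mul_right (p q : Fin 4 → ℤ) : ∑ i, affineRelation p q i * q i = 0 := by
  simp only [affineRelation, Fin.sum_univ_four, Matrix.cons_val]
  ring

/-- The affine relations between four points that are not collinear are proportional. -/
theorem affineRelation_mul_comm {k : Type*} [Field k] (p q : Fin 4 → ℤ) {z : Fin 4 → k}
    (h0 : ∑ i, z i = 0) (hp : ∑ i, z i * p i = 0) (hq : ∑ i, z i * q i = 0) (i j : Fin 4) :
    affineRelation p q j * z i = affineRelation p q i * z j := by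
  simp only [Fin.sum_univ_four] at h0 hp hq
  have h : ∀ a b : Fin 4,
      z 0 * ((p b - p a) * (q 0 - q a) - (p 0 - p a) * (q b - q a)) +
      z 1 * ((p b - p a) * (q 1 - q a) - (p 1 - p a) * (q b - q a)) +
      z 2 * ((p b - p a) * (q 2 - q a) - (p 2 - p a) * (q b - q a)) +
      z 3 * ((p b - p a) * (q 3 - q a) - (p 3 - p a) * (q b - q a)) = 0 := fun a b => by
    linear_combination (p b - p a : k) * hq - (q b - q a : k) * hp +
      ((q b - q a) * p a - (p b - p a) * q a : k) * h0
  fin_cases i <;> fin_cases j <;>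
    simp only [affineRelation, Fin.zero_eta, Fin.mk_one, Fin.reduceFinMk, Matrix.cons_val] <;>
    push_cast <;>
    first
    | ring1
    | linear_combination h 2 3
    | linear_combination -h 2 3
    | linear_combination h 1 3
    | linear_combination -h 1 3
    | linear_combination h 1 2
    | linear_combination -h 1 2
    | linear_combination h 0 3
    | linear_combination -h 0 3
    | linear_combination h 0 2
    | linear_combination -h 0 2
    | linear_combination h 0 1
    | linear_combination -h 0 1

/-- The lattice point `(r₁, r₂)` lies in the interior of the convex hull of the points
`(pᵢ, qᵢ)`. -/
def IsInteriorPoint (p q : Fin 4 → ℤ) (r₁ r₂ : ℤ) : Prop :=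
  ∀ u v : ℤ, (u ≠ 0 ∨ v ≠ 0) → ∃ i, u * p i + v * q i < u * r₁ + v * r₂

section Monomials

variable {E L : Type*} [Field E] [Field L] [Algebra E L]

theorem D_zpow_mul_zpow {x y : L} (hx : x ≠ 0) (hy : y ≠ 0) (a b : ℤ) :
    KaehlerDifferential.D E L (x ^ a * y ^ b) = (x ^ a * y ^ b) •
      ((a * x⁻¹) • KaehlerDifferential.D E L x + (b * y⁻¹) • KaehlerDifferential.D E L y) := by
  rw [Derivation.leibniz, Derivation.leibniz_zpow, Derivation.leibniz_zpow, smul_add, smul_smul,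
    smul_smul, add_comm, zpow_sub_one₀ hx, zpow_sub_one₀ hy, ← Int.cast_smul_eq_zsmul L,
    ← Int.cast_smul_eq_zsmul L, smul_smul, smul_smul, smul_smul, smul_smul]
  congr 2 <;> ring

theorem sum_smul_D_eq_zero {x y : L} (hx : x ≠ 0) (hy : y ≠ 0) {p q : Fin 4 → ℤ} {c : Fin 4 → E}
    (hrel : ∑ i, algebraMap E L (c i) * (x ^ p i * y ^ q i) = 0) :
    (∑ i, algebraMap E L (c i) * p i * (x ^ p i * y ^ q i)) •
        x⁻¹ • KaehlerDifferential.D E L x +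
      (∑ i, algebraMap E L (c i) * q i * (x ^ p i * y ^ q i)) •
        y⁻¹ • KaehlerDifferential.D E L y = 0 := by
  have h := congrArg (KaehlerDifferential.D E L) hrel
  simp only [map_sum, map_zero] at h
  rw [← h, Finset.sum_smul, Finset.sum_smul, ← Finset.sum_add_distrib]
  refine Finset.sum_congr rfl fun i _ => ?_
  rw [Derivation.leibniz, Derivation.map_algebraMap, smul_zero, add_zero, D_zpow_mul_zpow hx hy,
    smul_add, smul_add, smul_smul, smul_smul, smul_smul, smul_smul, smul_smul, smul_smul]
  congr 2 <;> ring

end Monomials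

section Regular

variable {E L : Type*} [Field E] [CharZero E] [Field L] [Algebra E L]

theorem mem_iff_valuation_mul_inv_le {O : ValuationSubring L} {a b : L} (hb : b ≠ 0) :
    a * b⁻¹ ∈ O ↔ O.valuation a ≤ O.valuation b := by
  rw [← O.valuation_le_one_iff, map_mul, map_inv₀, mul_inv_le_iff₀ (by simpa [zero_lt_iff] using hb),
    one_mul]

/-- Monomials of the same value satisfy no affine relation other than the trivial ones modulo the
maximal ideal. -/
theorem not_residue_relation {O : ValuationSubring L} (hO : ∀ a : E, algebraMap E L a ∈ O)
    {x y : L} (hx : x ≠ 0) (hy : y ≠ 0) {p q : Fin 4 → ℤ}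
    {c : Fin 4 → E} (hk : ∃ i, affineRelation p q i ≠ 0)
    (hprod : ∏ i, c i ^ affineRelation p q i ≠
      ∏ i, (affineRelation p q i : E) ^ affineRelation p q i)
    {m : L} (hm : m ≠ 0) (r : Fin 4 → O)
    (hr : ∀ i, (r i : L) = algebraMap E L (c i) * (x ^ p i * y ^ q i) * m⁻¹)
    (hr0 : ∃ i, IsLocalRing.residue O (r i) ≠ 0)
    (h0 : ∑ i, IsLocalRing.residue O (r i) = 0)
    (hp : ∑ i, IsLocalRing.residue O (r i) * p i = 0)
    (hq : ∑ i, IsLocalRing.residue O (r i) * q i = 0) : False := by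
  let κ : E →+* O := (algebraMap E L).codRestrict O.toSubring hO
  let ρ : E →+* IsLocalRing.ResidueField O := (IsLocalRing.residue O).comp κ
  have hchar : CharZero (IsLocalRing.ResidueField O) := charZero_of_injective_ringHom ρ.injective
  obtain ⟨j, hj⟩ := hk
  have hcomm := affineRelation_mul_comm p q h0 hp hq
  have hjk : (affineRelation p q j : IsLocalRing.ResidueField O) ≠ 0 := by exact_mod_cast hj
  -- The residues satisfy the same three equations as the affine relation, so they are its multiple
  -- by `l`. Taking the product with exponents `affineRelation p q i` removes the monomials and `m`
  -- on one side and `l` on the other, which leaves exactly the equality that `hprod` forbids.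
  set l : IsLocalRing.ResidueField O :=
    IsLocalRing.residue O (r j) / affineRelation p q j with hl
  have hz : ∀ i, IsLocalRing.residue O (r i) = l * affineRelation p q i := fun i => by
    rw [hl, div_mul_eq_mul_div, eq_div_iff hjk, mul_comm, hcomm i j, mul_comm]
  have hl0 : l ≠ 0 := by
    rintro hl0
    obtain ⟨i, hi⟩ := hr0
    rw [hz, hl0, zero_mul] at hi
    exact hi rfl
  have hu : ∀ i, ∃ a : Oˣ, affineRelation p q i ≠ 0 → (a : O) = r i := by
    intro i
    by_cases hi : affineRelation p q i = 0
    · exact ⟨1, fun h => absurd hi h⟩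
    · have : IsUnit (r i) := by
        rw [← IsLocalRing.residue_ne_zero_iff_isUnit, hz]
        exact mul_ne_zero hl0 (by exact_mod_cast hi)
      exact ⟨this.unit, fun _ => rfl⟩
  choose a ha using hu
  have hz1 : ((Units.map (algebraMap O L : O →* L) (∏ i, a i ^ affineRelation p q i) : Lˣ) : L) =
      algebraMap E L (∏ i, c i ^ affineRelation p q i) := by
    have h1 : ∀ i, (algebraMap O L (a i)) ^ affineRelation p q i = algebraMap E L (c i) ^ affineRelation p q i *
        ((x ^ (affineRelation p q i * p i) * y ^ (affineRelation p q i * q i)) *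
          (m⁻¹) ^ affineRelation p q i) := by
      intro i
      by_cases hi : affineRelation p q i = 0
      · simp [hi]
      · rw [ha i hi]
        change (r i : L) ^ _ = _
        rw [hr, mul_zpow, mul_zpow, mul_zpow, mul_comm _ (p i), mul_comm _ (q i), zpow_mul, zpow_mul,
          mul_assoc]
    rw [map_prod, Units.coe_prod, map_prod]
    simp only [map_zpow, Units.val_zpow_eq_zpow_val, map_zpow₀]
    have h2 : ∀ i, ((Units.map (algebraMap O L : O →* L) (a i) : Lˣ) : L) = algebraMap O L (a i) := fun i => rfl
    simp only [h2, h1]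
    rw [Finset.prod_mul_distrib, Finset.prod_mul_distrib, Finset.prod_mul_distrib]
    have h3 : ∀ (b : L) (hb : b ≠ 0) (f : Fin 4 → ℤ), ∏ i, b ^ f i = b ^ ∑ i, f i := by
      intro b hb f
      simp only [Fin.prod_univ_four, Fin.sum_univ_four, zpow_add₀ hb]
    rw [h3 x hx, h3 y hy, h3 _ (inv_ne_zero hm), sum_affineRelation, sum_affineRelation_mul_left,
      sum_affineRelation_mul_right]
    simp
  have hz2 : ((Units.map (IsLocalRing.residue O : O →* IsLocalRing.ResidueField O)
      (∏ i, a i ^ affineRelation p q i) : (IsLocalRing.ResidueField O)ˣ) :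
        IsLocalRing.ResidueField O) = ρ (∏ i, (affineRelation p q i : E) ^ affineRelation p q i) := by
    rw [map_prod, Units.coe_prod, map_prod]
    simp only [map_zpow, Units.val_zpow_eq_zpow_val, map_zpow₀, map_intCast]
    have h1 : ∀ i, ((Units.map (IsLocalRing.residue O : O →* IsLocalRing.ResidueField O) (a i) :
        (IsLocalRing.ResidueField O)ˣ) : IsLocalRing.ResidueField O) ^ affineRelation p q i =
        l ^ affineRelation p q i * (affineRelation p q i : IsLocalRing.ResidueField O) ^
          affineRelation p q i := by
      intro i
      by_cases hi : affineRelation p q i = 0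
      · simp [hi]
      · rw [← mul_zpow, ← hz, ← ha i hi]
        rfl
    simp only [h1]
    rw [Finset.prod_mul_distrib]
    have h3 : ∏ i, l ^ affineRelation p q i = l ^ ∑ i, affineRelation p q i := by
      simp only [Fin.prod_univ_four, Fin.sum_univ_four, zpow_add₀ hl0]
    rw [h3, sum_affineRelation, zpow_zero, one_mul]
  have hz3 : ((∏ i, a i ^ affineRelation p q i : Oˣ) : O) = κ (∏ i, c i ^ affineRelation p q i) :=
    Subtype.ext hz1
  apply hprod
  apply ρ.injective
  rw [← hz2]
  change IsLocalRing.residue O _ = IsLocalRing.residue O _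
  rw [hz3]

end Regular

/-! ### Regularity of the differential of an interior lattice point. -/

section Regular

variable {E L : Type*} [Field E] [CharZero E] [Field L] [Algebra E L]

/-- Dividing `(d₁, d₂)` by its content gives a primitive exponent vector of value one, as an ordered
group has no torsion. A Bézout vector completes it to a basis of `ℤ²`; its value cannot be one, as
then `a = b = 1`, and a change of sign makes it smaller than one. -/
theorem exists_basis_of_zpow_eq_one {Γ : Type*} [LinearOrderedCommGroupWithZero Γ] {a b : Γ}
    (ha : a ≠ 0) (hb : b ≠ 0) (hab : a ≠ 1 ∨ b ≠ 1) {d₁ d₂ : ℤ} (hd : d₁ ≠ 0 ∨ d₂ ≠ 0)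
    (h : a ^ d₁ * b ^ d₂ = 1) :
    ∃ e₁ e₂ f₁ f₂ : ℤ, e₁ * f₂ - e₂ * f₁ = 1 ∧ a ^ e₁ * b ^ e₂ = 1 ∧ a ^ f₁ * b ^ f₂ < 1 := by
  have hg : 0 < Int.gcd d₁ d₂ := Int.gcd_pos_iff.2 hd
  obtain ⟨e₁, e₂, hcop, h1, h2⟩ := Int.exists_gcd_one hg
  obtain ⟨u, v, huv⟩ := Int.isCoprime_iff_gcd_eq_one.2 hcop
  have he : a ^ e₁ * b ^ e₂ = 1 := by
    have h3 : (a ^ e₁ * b ^ e₂) ^ Int.gcd d₁ d₂ = 1 := by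
      rw [mul_pow, ← zpow_natCast, ← zpow_natCast, ← zpow_mul, ← zpow_mul, ← h1, ← h2, h]
    exact (pow_eq_one_iff_of_nonneg zero_le hg.ne').1 h3
  have hf : a ^ (-v) * b ^ u ≠ 1 := by
    intro hf
    have ha1 : a = (a ^ e₁ * b ^ e₂) ^ u * (a ^ (-v) * b ^ u) ^ (-e₂) := by
      rw [mul_zpow, mul_zpow, ← zpow_mul, ← zpow_mul, ← zpow_mul, ← zpow_mul, mul_mul_mul_comm,
        ← zpow_add₀ ha, ← zpow_add₀ hb, show e₁ * u + -v * -e₂ = 1 by linear_combination huv,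
        show e₂ * u + u * -e₂ = 0 by ring, zpow_one, zpow_zero, mul_one]
    have hb1 : b = (a ^ e₁ * b ^ e₂) ^ v * (a ^ (-v) * b ^ u) ^ e₁ := by
      rw [mul_zpow, mul_zpow, ← zpow_mul, ← zpow_mul, ← zpow_mul, ← zpow_mul, mul_mul_mul_comm,
        ← zpow_add₀ ha, ← zpow_add₀ hb, show e₁ * v + -v * e₁ = 0 by ring,
        show e₂ * v + u * e₁ = 1 by linear_combination huv, zpow_one, zpow_zero, one_mul]
    rw [he, hf, one_zpow, one_zpow, one_mul] at ha1 hb1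
    rcases hab with h' | h'
    exacts [h' ha1, h' hb1]
  rcases lt_or_gt_of_ne hf with hf | hf
  · exact ⟨e₁, e₂, -v, u, by linear_combination huv, he, hf⟩
  · refine ⟨-e₁, -e₂, v, -u, by linear_combination huv, ?_, ?_⟩
    · rw [zpow_neg, zpow_neg, ← mul_inv, he, inv_one]
    · rw [show v = -(-v) by ring, zpow_neg a, zpow_neg b, ← mul_inv]
      exact inv_lt_one_of_one_lt₀ hf

/-- The differential of an interior lattice point is regular. -/
theorem mem_regularDifferentials_of_isInteriorPoint
    {x y : L} (hx : x ≠ 0) (hy : y ≠ 0) {p q : Fin 4 → ℤ}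
    (hpq : ∀ i j, i ≠ j → p i ≠ p j ∨ q i ≠ q j)
    {c : Fin 4 → E} (hc : ∀ i, c i ≠ 0)
    (hrel : ∑ i, algebraMap E L (c i) * (x ^ p i * y ^ q i) = 0)
    (hg : ∑ i, algebraMap E L (c i) * q i * (x ^ p i * y ^ q i) ≠ 0)
    (hk : ∃ i, affineRelation p q i ≠ 0)
    (hprod : ∏ i, c i ^ affineRelation p q i ≠
      ∏ i, (affineRelation p q i : E) ^ affineRelation p q i)
    {r₁ r₂ : ℤ} (hr : IsInteriorPoint p q r₁ r₂) :
    (x ^ r₁ * y ^ r₂ * (∑ i, algebraMap E L (c i) * q i * (x ^ p i * y ^ q i))⁻¹ * x⁻¹) •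
      KaehlerDifferential.D E L x ∈ regularDifferentials E L := by
  intro O hO
  have hm0 : ∀ a b : ℤ, x ^ a * y ^ b ≠ 0 := fun a b =>
    mul_ne_zero (zpow_ne_zero _ hx) (zpow_ne_zero _ hy)
  set v := O.valuation with hv
  have hvx : v x ≠ 0 := (Valuation.ne_zero_iff _).2 hx
  have hvy : v y ≠ 0 := (Valuation.ne_zero_iff _).2 hy
  have hvm : ∀ a b : ℤ, v (x ^ a * y ^ b) = v x ^ a * v y ^ b := fun a b => by
    rw [map_mul, map_zpow₀, map_zpow₀]
  have hE : ∀ a : E, a ≠ 0 → v (algebraMap E L a) = 1 := by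
    intro a ha
    refine le_antisymm ((O.valuation_le_one_iff _).2 (hO a)) ?_
    have := (O.valuation_le_one_iff _).2 (hO a⁻¹)
    rw [map_inv₀, map_inv₀] at this
    exact (inv_le_one₀ (zero_lt_iff.2 ((Valuation.ne_zero_iff _).2
      ((map_ne_zero _).2 ha)))).1 this
  -- After division by the monomial `m` of maximal value only the terms on the face of the polygon
  -- selected by the valuation survive in the residue field.
  obtain ⟨i₀, -, hi₀⟩ := Finset.exists_max_image Finset.univ
    (fun i => v (x ^ p i * y ^ q i)) ⟨0, Finset.mem_univ _⟩
  set m := x ^ p i₀ * y ^ q i₀ with hm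
  have hmm : m ≠ 0 := hm0 _ _
  have hrO : ∀ i, algebraMap E L (c i) * (x ^ p i * y ^ q i) * m⁻¹ ∈ O := fun i => by
    rw [mul_assoc]
    exact O.mul_mem _ _ (hO _) ((mem_iff_valuation_mul_inv_le hmm).2 (hi₀ i (Finset.mem_univ _)))
  let r : Fin 4 → O := fun i => ⟨_, hrO i⟩
  have hrr : ∀ i, (r i : L) = algebraMap E L (c i) * (x ^ p i * y ^ q i) * m⁻¹ := fun i => rfl
  have hz : ∀ i, IsLocalRing.residue O (r i) ≠ 0 ↔ v (x ^ p i * y ^ q i) = v m := by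
    intro i
    rw [IsLocalRing.residue_ne_zero_iff_isUnit, O.valuation_eq_one_iff, hrr, map_mul, map_mul,
      hE _ (hc i), one_mul, map_inv₀, mul_inv_eq_one₀ ((Valuation.ne_zero_iff _).2 hmm)]
  have hr0 : ∃ i, IsLocalRing.residue O (r i) ≠ 0 := ⟨i₀, (hz i₀).2 rfl⟩
  have hsum : ∀ l : Fin 4 → ℤ, ((∑ i, r i * l i : O) : L) =
      (∑ i, algebraMap E L (c i) * l i * (x ^ p i * y ^ q i)) * m⁻¹ := by
    intro l
    rw [Finset.sum_mul]
    change algebraMap O L (∑ i, r i * l i) = _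
    rw [map_sum]
    refine Finset.sum_congr rfl fun i _ => ?_
    rw [map_mul, map_intCast]
    change (r i : L) * _ = _
    rw [hrr]
    ring
  have h0 : ∑ i, IsLocalRing.residue O (r i) = 0 := by
    have h1 := hsum 1
    simp only [Pi.one_apply, Int.cast_one, mul_one, hrel, zero_mul] at h1
    rw [← map_sum, show ∑ i, r i = 0 from Subtype.ext h1, map_zero]
  have hnot := not_residue_relation hO hx hy hk hprod hmm r hrr hr0 h0
  have hunit : ∀ l : Fin 4 → ℤ, ∑ i, IsLocalRing.residue O (r i) * l i ≠ 0 →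
      v (∑ i, algebraMap E L (c i) * l i * (x ^ p i * y ^ q i)) = v m := by
    intro l hl
    have h1 : IsUnit (∑ i, r i * l i : O) := by
      rw [← IsLocalRing.residue_ne_zero_iff_isUnit, map_sum]
      simpa using hl
    rw [O.valuation_eq_one_iff, hsum, map_mul, map_inv₀,
      mul_inv_eq_one₀ ((Valuation.ne_zero_iff _).2 hmm)] at h1
    exact h1
  set G₁ := ∑ i, algebraMap E L (c i) * p i * (x ^ p i * y ^ q i) with hG₁
  set G₂ := ∑ i, algebraMap E L (c i) * q i * (x ^ p i * y ^ q i) with hG₂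
  have hdiff := sum_smul_D_eq_zero hx hy hrel
  rw [← hG₁, ← hG₂] at hdiff
  set X := x⁻¹ • KaehlerDifferential.D E L x with hX
  set Y := y⁻¹ • KaehlerDifferential.D E L y with hY
  -- it suffices to find a monomial with a small logarithmic differential
  have key : ∀ e₁ e₂ f₁ f₂ : ℤ, e₁ * f₂ - e₂ * f₁ = 1 →
      v (f₂ * G₁ - f₁ * G₂) = v m → v (x ^ f₁ * y ^ f₂) ≤ 1 →
      v (x ^ r₁ * y ^ r₂) ≤ v m * v (x ^ f₁ * y ^ f₂) →
      (x ^ r₁ * y ^ r₂ * G₂⁻¹ * x⁻¹) • KaehlerDifferential.D E L x ∈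
        Submodule.span O.toSubring (KaehlerDifferential.D E L '' (O : Set L)) := by
    intro e₁ e₂ f₁ f₂ hef hG hf hR
    set w := x ^ f₁ * y ^ f₂ with hw
    have hw0 : w ≠ 0 := hm0 _ _
    have hwO : w ∈ O := (O.valuation_le_one_iff _).1 hf
    set G := f₂ * G₁ - f₁ * G₂ with hGdef
    have hG0 : G ≠ 0 := by
      rw [← Valuation.ne_zero_iff v, hG]
      exact (Valuation.ne_zero_iff v).2 hmm
    have hDw : KaehlerDifferential.D E L w = w • ((f₁ : L) • X + (f₂ : L) • Y) := by
      rw [hw, D_zpow_mul_zpow hx hy, hX, hY, smul_smul, smul_smul]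
    have hYX : Y = (-(G₁ * G₂⁻¹)) • X := by
      have h1 : G₂ • Y = (-G₁) • X := by
        rw [neg_smul]
        exact (neg_eq_of_add_eq_zero_right hdiff).symm
      have h2 := congrArg (fun t => G₂⁻¹ • t) h1
      simp only [smul_smul, inv_mul_cancel₀ hg, one_smul] at h2
      rw [h2]
      congr 1
      ring
    have hmem : -(x ^ r₁ * y ^ r₂ * (m * w)⁻¹) * (m * G⁻¹) ∈ O := by
      refine O.mul_mem _ _ (neg_mem ?_) ?_
      · rw [mem_iff_valuation_mul_inv_le (mul_ne_zero hmm hw0), ← hv, map_mul v m]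
        exact hR
      · rw [mem_iff_valuation_mul_inv_le hG0, ← hv, hG]
    have heq : (x ^ r₁ * y ^ r₂ * G₂⁻¹ * x⁻¹) • KaehlerDifferential.D E L x =
        (⟨_, hmem⟩ : O.toSubring) • KaehlerDifferential.D E L w := by
      change _ = (-(x ^ r₁ * y ^ r₂ * (m * w)⁻¹) * (m * G⁻¹)) • KaehlerDifferential.D E L w
      have h3 : (f₁ : L) + f₂ * (-(G₁ * G₂⁻¹)) = - G * G₂⁻¹ := by
        rw [hGdef]
        field_simp
        ring
      rw [hDw, hYX, smul_smul (f₂ : L), ← add_smul, h3, smul_smul, smul_smul,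
        mul_smul (x ^ r₁ * y ^ r₂ * G₂⁻¹) x⁻¹, ← hX]
      congr 1
      field_simp
    rw [heq]
    exact Submodule.smul_mem _ _ (Submodule.subset_span ⟨w, hwO, rfl⟩)
  have hG : ∀ f₁ f₂ : ℤ, (f₂ : L) * G₁ - f₁ * G₂ = ∑ i, algebraMap E L (c i) *
      (f₂ * p i - f₁ * q i : ℤ) * (x ^ p i * y ^ q i) := by
    intro f₁ f₂
    rw [hG₁, hG₂, Finset.mul_sum, Finset.mul_sum, ← Finset.sum_sub_distrib]
    refine Finset.sum_congr rfl fun i _ => ?_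
    push_cast
    ring
  have hv0 : ∀ f₁ f₂ : ℤ, ∑ i, IsLocalRing.residue O (r i) * (f₂ * p i - f₁ * q i : ℤ) =
      f₂ * ∑ i, IsLocalRing.residue O (r i) * p i -
        f₁ * ∑ i, IsLocalRing.residue O (r i) * q i := by
    intro f₁ f₂
    rw [Finset.mul_sum, Finset.mul_sum, ← Finset.sum_sub_distrib]
    refine Finset.sum_congr rfl fun i _ => ?_
    push_cast
    ring
  -- A reduction inside the torus. By `not_residue_relation` the reduced curve is not singular
  -- there, so `x⁻¹` or `y` can serve as `w`.
  by_cases hab : v x = 1 ∧ v y = 1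
  · have h1 : ∀ a b : ℤ, v (x ^ a * y ^ b) = 1 := fun a b => by simp [hvm, hab.1, hab.2]
    by_cases hp0 : ∑ i, IsLocalRing.residue O (r i) * p i = 0
    · have hq0 : ∑ i, IsLocalRing.residue O (r i) * q i ≠ 0 := fun h => hnot hp0 h
      refine key 0 1 (-1) 0 (by norm_num) ?_ (h1 _ _).le ?_
      · rw [hG]
        refine hunit _ ?_
        rw [hv0]
        simpa using hq0
      · rw [h1, hm, h1, h1, one_mul]
    · refine key 1 0 0 1 (by norm_num) ?_ (h1 _ _).le ?_
      · rw [hG]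
        refine hunit _ ?_
        rw [hv0]
        simpa using hp0
      · rw [h1, hm, h1, h1, one_mul]
  -- The residues sum to zero and are not all zero, so two monomials attain the maximal value, and
  -- their quotient has value one.
  · obtain ⟨i₁, hi₁, hi₁'⟩ : ∃ i, i ≠ i₀ ∧ IsLocalRing.residue O (r i) ≠ 0 := by
      by_contra! h
      rw [Finset.sum_eq_single i₀ (fun i _ hi => h i hi) (by simp)] at h0
      exact (hz i₀).2 rfl h0
    have hd : v x ^ (p i₁ - p i₀) * v y ^ (q i₁ - q i₀) = 1 := by
      have h1 := (hz i₁).1 hi₁'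
      rw [hm, hvm, hvm] at h1
      rw [zpow_sub₀ hvx, zpow_sub₀ hvy, div_mul_div_comm, h1, div_self]
      exact mul_ne_zero (zpow_ne_zero _ hvx) (zpow_ne_zero _ hvy)
    obtain ⟨e₁, e₂, f₁, f₂, hef, he, hf⟩ := exists_basis_of_zpow_eq_one hvx hvy
      (by tauto) (by have := hpq _ _ hi₁; omega) hd
    have hpow : ∀ a b : ℤ, v (x ^ a * y ^ b) = (v x ^ f₁ * v y ^ f₂) ^ (e₁ * b - e₂ * a) := by
      intro a b
      have h1 : v x ^ a * v y ^ b = (v x ^ e₁ * v y ^ e₂) ^ (f₂ * a - f₁ * b) *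
          (v x ^ f₁ * v y ^ f₂) ^ (e₁ * b - e₂ * a) := by
        rw [mul_zpow, mul_zpow, ← zpow_mul, ← zpow_mul, ← zpow_mul, ← zpow_mul, mul_mul_mul_comm,
          ← zpow_add₀ hvx, ← zpow_add₀ hvy,
          show e₁ * (f₂ * a - f₁ * b) + f₁ * (e₁ * b - e₂ * a) = a by linear_combination a * hef,
          show e₂ * (f₂ * a - f₁ * b) + f₂ * (e₁ * b - e₂ * a) = b by linear_combination b * hef]
      rw [hvm, h1, he, one_zpow, one_mul]
    set W := v x ^ f₁ * v y ^ f₂ with hW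
    have hW0 : 0 < W := zero_lt_iff.2
      (mul_ne_zero (zpow_ne_zero _ hvx) (zpow_ne_zero _ hvy))
    have hmono : ∀ k l : ℤ, W ^ k ≤ W ^ l ↔ l ≤ k := fun k l =>
      zpow_le_zpow_iff_right_of_lt_one₀ hW0 hf
    -- The surviving terms lie on one edge, where this linear form is constant. One logarithmic
    -- derivative of the reduction therefore vanishes, and by `not_residue_relation` the
    -- complementary one does not.
    have hβ : ∑ i, IsLocalRing.residue O (r i) * (e₁ * q i - e₂ * p i : ℤ) = 0 := by
      have h1 : ∀ i, IsLocalRing.residue O (r i) * (e₁ * q i - e₂ * p i : ℤ) =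
          IsLocalRing.residue O (r i) * (e₁ * q i₀ - e₂ * p i₀ : ℤ) := by
        intro i
        by_cases hi : IsLocalRing.residue O (r i) = 0
        · rw [hi, zero_mul, zero_mul]
        · have h2 := (hz i).1 hi
          rw [hm, hpow, hpow] at h2
          rw [le_antisymm ((hmono _ _).1 h2.ge) ((hmono _ _).1 h2.le)]
      simp only [h1]
      rw [← Finset.sum_mul, h0, zero_mul]
    have hβ' : (e₁ : IsLocalRing.ResidueField O) * ∑ i, IsLocalRing.residue O (r i) * q i -
        e₂ * ∑ i, IsLocalRing.residue O (r i) * p i = 0 := by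
      rw [← hβ, Finset.mul_sum, Finset.mul_sum, ← Finset.sum_sub_distrib]
      refine Finset.sum_congr rfl fun i _ => ?_
      push_cast
      ring
    have hef' : (e₁ * f₂ - e₂ * f₁ : IsLocalRing.ResidueField O) = 1 := by
      have := congrArg (fun z : ℤ => (z : IsLocalRing.ResidueField O)) hef
      push_cast at this
      exact this
    refine key e₁ e₂ f₁ f₂ hef ?_ ?_ ?_
    · rw [hG]
      refine hunit _ fun h2 => ?_
      rw [hv0] at h2
      refine hnot ?_ ?_
      · linear_combination (e₁ : IsLocalRing.ResidueField O) * h2 + (f₁ : IsLocalRing.ResidueField O) * hβ' -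
          (∑ i, IsLocalRing.residue O (r i) * p i) * hef'
      · linear_combination (e₂ : IsLocalRing.ResidueField O) * h2 + (f₂ : IsLocalRing.ResidueField O) * hβ' -
          (∑ i, IsLocalRing.residue O (r i) * q i) * hef'
    · rw [hvm]
      exact hf.le
    -- An interior lattice point has integral distance at least one from the supporting line of the
    -- edge. This gains the factor `W` that compensates the pole of `dw / w`.
    · have he0 : -e₂ ≠ 0 ∨ e₁ ≠ 0 := by
        by_contra! h
        rw [h.2, neg_eq_zero.1 h.1] at hef
        simp at hef
      obtain ⟨i, hi⟩ := hr (-e₂) e₁ he0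
      have h1 : e₁ * q i₀ - e₂ * p i₀ ≤ e₁ * q i - e₂ * p i := by
        have h2 := hi₀ i (Finset.mem_univ _)
        rwa [hpow, hm, hpow, hmono] at h2
      rw [hvm f₁ f₂, ← hW, hpow, hm, hpow, ← zpow_add_one₀ hW0.ne', hmono]
      linarith

end Regular

/-! ### Rational function fields have no regular differentials -/

section RationalFunctionField

variable {E L : Type*} [Field E] [CharZero E] [Field L] [Algebra E L]

omit [CharZero E] in
/-- A regular differential has no pole at a place given by an expansion. -/
theorem one_le_orderTop_of_mem_regularDifferentials {κ : Type*} [Field κ]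
    (Θ : L →+* LaurentSeries κ) (hΘ : ∀ e, ∃ a, Θ (algebraMap E L e) = HahnSeries.C a)
    {h u : L} (hω : h • KaehlerDifferential.D E L u ∈ regularDifferentials E L) :
    1 ≤ (Θ h * euler κ (Θ u)).orderTop := by
  have hC : ∀ a : κ, euler κ (HahnSeries.C a) = 0 := fun a => by
    ext n
    rw [coeff_euler, HahnSeries.C_apply, HahnSeries.coeff_single]
    split_ifs with hn <;> simp [hn]
  obtain ⟨φ, hφ, hφD⟩ := exists_functional_kaehler Θ (euler κ) euler_mul (fun e => by
    obtain ⟨a, ha⟩ := hΘ e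
    rw [ha, hC])
  let O : ValuationSubring L := (laurentIntegers κ).comap Θ
  have hO : ∀ l, l ∈ O ↔ 0 ≤ (Θ l).orderTop := fun l => mem_laurentIntegers
  have h1 := hω O fun e => by
    obtain ⟨a, ha⟩ := hΘ e
    rw [hO, ha]
    by_cases h0 : a = 0
    · simp [h0]
    · rw [HahnSeries.C_apply, HahnSeries.orderTop_single h0]
      exact le_rfl
  rw [← hφD, ← hφ]
  generalize h • KaehlerDifferential.D E L u = ω at h1
  induction h1 using Submodule.span_induction with
  | mem x hx =>
    obtain ⟨o, ho, rfl⟩ := hx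
    rw [hφD]
    refine HahnSeries.le_orderTop_iff_forall.2 fun n hn => ?_
    have hn : n < 1 := by exact_mod_cast hn
    rw [coeff_euler]
    rcases (Int.lt_add_one_iff.1 (by simpa using hn) : n ≤ 0).lt_or_eq with h | h
    · rw [HahnSeries.coeff_eq_zero_of_lt_orderTop, mul_zero]
      exact lt_of_lt_of_le (by exact_mod_cast h) ((hO o).1 ho)
    · simp [h]
  | zero => simp
  | add x y _ _ hx hy =>
    rw [map_add]
    exact (le_min hx hy).trans HahnSeries.min_orderTop_le_orderTop_add
  | smul c x _ hx =>
    have h2 : φ (c • x) = Θ c * φ x := hφ c x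
    rw [h2]
    have h3 := le_orderTop_mul (a := 0) (b := 1) ((hO c).1 c.2) hx
    simpa using h3

omit [CharZero E] in
theorem exists_isCoprime_div {u h : L} (h1 : h ∈ IntermediateField.adjoin E {u}) :
    ∃ a b : Polynomial E, IsCoprime a b ∧ Polynomial.aeval u b ≠ 0 ∧
      h * Polynomial.aeval u b = Polynomial.aeval u a := by
  obtain ⟨r, s, hrs⟩ := (IntermediateField.mem_adjoin_simple_iff E h).1 h1
  by_cases hs : Polynomial.aeval u s = 0
  · refine ⟨0, 1, isCoprime_zero_left.2 isUnit_one, by simp, ?_⟩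
    rw [hrs, hs]
    simp
  · classical
    let := EuclideanDomain.gcdMonoid (Polynomial E)
    have hs0 : s ≠ 0 := by
      rintro rfl
      simp at hs
    have hgs : GCDMonoid.gcd r s ≠ 0 := fun h0 => hs0 ((gcd_eq_zero_iff _ _).1 h0).2
    have hr := EuclideanDomain.mul_div_cancel' (b := GCDMonoid.gcd r s) (a := r)
      hgs (gcd_dvd_left r s)
    have hs' := EuclideanDomain.mul_div_cancel' (b := GCDMonoid.gcd r s) (a := s)
      hgs (gcd_dvd_right r s)
    refine ⟨r / GCDMonoid.gcd r s, s / GCDMonoid.gcd r s, isCoprime_div_gcd_div_gcd hs0, ?_, ?_⟩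
    · intro h0
      rw [← hs', map_mul, h0, mul_zero] at hs
      exact hs rfl
    · have hg : Polynomial.aeval u (GCDMonoid.gcd r s) ≠ 0 := by
        intro h0
        rw [← hs', map_mul, h0, zero_mul] at hs
        exact hs rfl
      apply mul_left_cancel₀ hg
      rw [← map_mul, hr, mul_left_comm, ← map_mul, hs', hrs, div_mul_cancel₀ _ hs]

omit [CharZero E] in
theorem exists_ringHom_of_adjoin_eq_top {u : L} (hu : IntermediateField.adjoin E {u} = ⊤)
    (hut : Transcendental E u) {M : Type*} [Field M] (φ : Polynomial E →+* M)
    (hφ : Function.Injective φ) :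
    ∃ Θ : L →+* M, ∀ p, Θ (Polynomial.aeval u p) = φ p := by
  let : Algebra (Polynomial E) L := (Polynomial.aeval u).toRingHom.toAlgebra
  have halg : ∀ p : Polynomial E, algebraMap (Polynomial E) L p = Polynomial.aeval u p :=
    fun _ => rfl
  have : FaithfulSMul (Polynomial E) L := by
    rw [faithfulSMul_iff_algebraMap_injective]
    exact transcendental_iff_injective.1 hut
  have : IsFractionRing (Polynomial E) L := IsFractionRing.of_field _ _ fun z => by
    obtain ⟨a, b, -, hb, hab⟩ := exists_isCoprime_div (E := E) (u := u) (h := z) (by rw [hu]; trivial)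
    refine ⟨a, b, ?_⟩
    rw [halg, halg, ← hab, mul_div_cancel_right₀ _ hb]
  exact ⟨IsFractionRing.lift hφ, fun p => by rw [← halg, IsFractionRing.lift_algebraMap]⟩

-- If the denominator of `h` is not constant, it has an irreducible factor `P`. Taylor expansion at
-- a root of `P` in `AdjoinRoot P` is a place where `u` minus the root is a uniformizer and `h` has
-- a pole, so `h du` is not regular there.
omit [CharZero E] in
theorem mem_range_aeval_of_mem_regularDifferentials {u : L}
    (hu : IntermediateField.adjoin E {u} = ⊤) (hut : Transcendental E u) {h : L}
    (hω : h • KaehlerDifferential.D E L u ∈ regularDifferentials E L) :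
    ∃ p : Polynomial E, h = Polynomial.aeval u p := by
  obtain ⟨a, b, hab, hb, hh⟩ := exists_isCoprime_div (E := E) (u := u) (h := h) (by rw [hu]; trivial)
  by_cases hbu : IsUnit b
  · obtain ⟨c, hc⟩ := hbu.exists_right_inv
    refine ⟨a * c, ?_⟩
    rw [map_mul, ← hh, mul_assoc, ← map_mul, hc, map_one, mul_one]
  · exfalso
    have hb0 : b ≠ 0 := by
      rintro rfl
      simp at hb
    obtain ⟨P, hP, hPb⟩ := WfDvdMonoid.exists_irreducible_factor hbu hb0
    have : Fact (Irreducible P) := ⟨hP⟩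
    let α : AdjoinRoot P := AdjoinRoot.root P
    let φ : Polynomial E →+* LaurentSeries (AdjoinRoot P) :=
      (HahnSeries.ofPowerSeries ℤ (AdjoinRoot P)).comp
        (Polynomial.coeToPowerSeries.ringHom.comp
          ((Polynomial.taylorAlgHom α).toRingHom.comp
            (Polynomial.mapRingHom (algebraMap E (AdjoinRoot P)))))
    have hφ : Function.Injective φ := by
      refine HahnSeries.ofPowerSeries_injective.comp ((Polynomial.coe_injective _).comp
        ((Polynomial.taylor_injective α).comp ?_))
      exact Polynomial.map_injective _ (algebraMap E (AdjoinRoot P)).injective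
    have hφ1 : ∀ p, φ p = ((Polynomial.taylor α (p.map (algebraMap E (AdjoinRoot P))) :
      PowerSeries (AdjoinRoot P)) : LaurentSeries (AdjoinRoot P)) := fun _ => rfl
    have hφ0 : ∀ p, (φ p).coeff 0 = Polynomial.aeval α p := fun p => by
      rw [hφ1, PowerSeries.coeff_coe]
      simp [Polynomial.taylor_coeff_zero, Polynomial.aeval_def, Polynomial.eval_map]
    obtain ⟨Θ, hΘ⟩ := exists_ringHom_of_adjoin_eq_top hu hut φ hφ
    have h1 := one_le_orderTop_of_mem_regularDifferentials Θ (fun e => by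
      refine ⟨algebraMap E _ e, ?_⟩
      rw [← Polynomial.aeval_C u e, hΘ, hφ1]
      simp) hω
    have h2 : euler _ (Θ u) = HahnSeries.single 1 1 := by
      have h3 : Θ u = HahnSeries.C α + HahnSeries.single 1 1 := by
        rw [← Polynomial.aeval_X (R := E) u, hΘ, hφ1]
        simp [add_comm]
      rw [h3]
      ext n
      rw [coeff_euler, HahnSeries.coeff_add, HahnSeries.C_apply, HahnSeries.coeff_single,
        HahnSeries.coeff_single]
      split_ifs with h4 h5 <;> simp_all
    rw [h2] at h1
    have h3 : (Θ h * HahnSeries.single 1 1) * φ b = φ a * HahnSeries.single 1 1 := by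
      rw [← hΘ a, ← hh, map_mul, hΘ]
      ring
    have h4 := congrArg (fun f => f.coeff (1 + 0)) h3
    rw [coeff_mul_of_le_orderTop (a := 1) (b := 0) h1
      (show _ ≤ (φ b).orderTop from orderTop_ofPowerSeries_nonneg _), hφ0] at h4
    have hb1 : Polynomial.aeval α b = 0 := by
      obtain ⟨c, rfl⟩ := hPb
      rw [map_mul, AdjoinRoot.aeval_eq, AdjoinRoot.mk_self, zero_mul]
    rw [hb1, mul_zero, add_comm (1 : ℤ), HahnSeries.coeff_mul_single_add, mul_one, hφ0] at h4
    obtain ⟨c, d, hcd⟩ := hab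
    have h5 := congrArg (Polynomial.aeval α) hcd
    rw [map_add, map_mul, map_mul, hb1, ← h4] at h5
    simp at h5

/-- In terms of `u` the coefficient of a regular differential is a polynomial, and so is the
coefficient in terms of `u⁻¹`. The factor `-u ^ 2` between them makes the degrees incompatible,
unless the coefficient is zero. If `u` is algebraic there are no differentials at all. -/
theorem regularDifferentials_eq_bot {u : L} (hu : IntermediateField.adjoin E {u} = ⊤) :
    regularDifferentials E L = ⊥ := by
  rw [eq_bot_iff]
  intro ω hω
  rw [Submodule.mem_bot]
  by_cases hut : Transcendental E u
  · have halg : ∀ v : L, IntermediateField.adjoin E {v} = ⊤ →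
        Algebra.IsAlgebraic (IntermediateField.adjoin E {v}) L := fun v hv =>
      ⟨fun l => isAlgebraic_algebraMap (⟨l, hv ▸ trivial⟩ : IntermediateField.adjoin E {v})⟩
    have := halg u hu
    obtain ⟨h, rfl⟩ := exists_eq_smul_D (E := E) u ω
    obtain ⟨p, rfl⟩ := mem_range_aeval_of_mem_regularDifferentials hu hut hω
    have hu0 : u ≠ 0 := fun h => hut (h ▸ isAlgebraic_zero)
    have hD : KaehlerDifferential.D E L u = (-u ^ 2) • KaehlerDifferential.D E L u⁻¹ := by
      rw [Derivation.leibniz_inv, smul_smul]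
      field_simp
      simp
    rw [hD, smul_smul] at hω ⊢
    have hu' : IntermediateField.adjoin E {u⁻¹} = ⊤ := by
      rw [eq_top_iff, ← hu, IntermediateField.adjoin_simple_le_iff]
      exact inv_mem_iff.1 (IntermediateField.mem_adjoin_simple_self E u⁻¹)
    obtain ⟨q, hq⟩ := mem_range_aeval_of_mem_regularDifferentials hu'
      (fun h => hut (by simpa using h.inv)) hω
    have h1 : Polynomial.aeval u (p * Polynomial.X ^ (q.natDegree + 2)) =
        Polynomial.aeval u (-q.reverse) := by
      let := invertibleOfNonzero (inv_ne_zero hu0)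
      have h2 := Polynomial.eval₂_reverse_mul_pow (algebraMap E L) u⁻¹ q
      rw [invOf_eq_inv, inv_inv, ← Polynomial.aeval_def, ← Polynomial.aeval_def, ← hq, inv_pow] at h2
      rw [map_mul, map_pow, Polynomial.aeval_X, map_neg, pow_add,
        (mul_inv_eq_iff_eq_mul₀ (pow_ne_zero _ hu0)).1 h2]
      ring
    have h2 := transcendental_iff_injective.1 hut h1
    by_cases hp : p = 0
    · simp [hp]
    · have h3 := congrArg Polynomial.natDegree h2
      rw [Polynomial.natDegree_mul_X_pow _ hp, Polynomial.natDegree_neg] at h3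
      have := Polynomial.reverse_natDegree_le q
      omega
  · have hua : IsAlgebraic E u := not_not.1 hut
    have : Algebra.IsAlgebraic E L := by
      have h1 := IntermediateField.isAlgebraic_adjoin_simple hua.isIntegral
      rw [hu] at h1
      exact (IntermediateField.topEquiv (F := E) (E := L)).isAlgebraic
    have := Algebra.FormallyUnramified.of_isSeparable E L
    exact Subsingleton.elim _ _

/-- The points `(pᵢ, qᵢ)` lie on two neighbouring lattice lines. -/
def HasWidthOne (p q : Fin 4 → ℤ) : Prop :=
  ∃ w₁ w₂ c : ℤ, IsCoprime w₁ w₂ ∧ ∀ i, w₁ * p i + w₂ * q i = c ∨ w₁ * p i + w₂ * q i = c + 1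

theorem affineRelation_eq_zero_of_collinear {p q : Fin 4 → ℤ} {w₁ w₂ c : ℤ}
    (hw : IsCoprime w₁ w₂) (h : ∀ i, w₁ * p i + w₂ * q i = c) (i : Fin 4) :
    affineRelation p q i = 0 := by
  obtain ⟨a, b, hab⟩ := hw
  have h1 : ∀ i j k : Fin 4, (p j - p i) * (q k - q i) - (p k - p i) * (q j - q i) = 0 := by
    intro i j k
    have hj : w₁ * (p j - p i) + w₂ * (q j - q i) = 0 := by linear_combination h j - h i
    have hk : w₁ * (p k - p i) + w₂ * (q k - q i) = 0 := by linear_combination h k - h i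
    linear_combination (-((p j - p i) * (q k - q i) - (p k - p i) * (q j - q i))) * hab +
      (a * (q k - q i) - b * (p k - p i)) * hj + (b * (p j - p i) - a * (q j - q i)) * hk
  fin_cases i <;> simp [affineRelation, h1]

theorem zpow_mul_neg_zpow_neg {L : Type*} [Field L] {z z' : L} {k k' : ℤ} (hz : z ≠ 0)
    (h : z + z' = 0) (hk : k + k' = 0) : z ^ k * z' ^ k' = 1 ∨ z ^ k * z' ^ k' = -1 := by
  obtain rfl : z' = -z := by linear_combination h
  obtain rfl : k' = -k := by linear_combination hk
  rcases Int.even_or_odd k with hk | hk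
  · left
    rw [hk.neg.neg_zpow, zpow_neg, mul_inv_cancel₀ (zpow_ne_zero _ hz)]
  · right
    rw [hk.neg.neg_zpow, zpow_neg, mul_neg, mul_inv_cancel₀ (zpow_ne_zero _ hz)]

/-- If the weighted sums of four nonzero terms over the two parts of a partition vanish, then so
does the weighted product, up to sign. -/
theorem prod_zpow_eq_one_or_neg_one {L : Type*} [Field L] {z : Fin 4 → L} {k : Fin 4 → ℤ}
    (hz : ∀ i, z i ≠ 0) (s : Fin 4 → Prop) [DecidablePred s] (h1 : ∃ i, s i) (h2 : ∃ i, ¬ s i)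
    (hz1 : ∑ i, (if s i then z i else 0) = 0) (hz2 : ∑ i, (if s i then 0 else z i) = 0)
    (hk1 : ∑ i, (if s i then k i else 0) = 0) (hk2 : ∑ i, (if s i then 0 else k i) = 0) :
    ∏ i, z i ^ k i = 1 ∨ ∏ i, z i ^ k i = -1 := by
  have key : ∀ a b c d : Fin 4, z a + z b = 0 → z c + z d = 0 → k a + k b = 0 → k c + k d = 0 →
      (z a ^ k a * z b ^ k b) * (z c ^ k c * z d ^ k d) = 1 ∨
      (z a ^ k a * z b ^ k b) * (z c ^ k c * z d ^ k d) = -1 := by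
    intro a b c d h1 h2 h3 h4
    rcases zpow_mul_neg_zpow_neg (hz a) h1 h3 with h | h <;>
      rcases zpow_mul_neg_zpow_neg (hz c) h2 h4 with h' | h' <;> simp [h, h']
  rw [Fin.sum_univ_four] at hz1 hz2 hk1 hk2
  rw [Fin.prod_univ_four]
  rw [Fin.exists_fin_succ, Fin.exists_fin_succ, Fin.exists_fin_succ, Fin.exists_fin_succ] at h1 h2
  by_cases s0 : s 0 <;> by_cases s1 : s 1 <;> by_cases s2 : s 2 <;> by_cases s3 : s 3 <;>
    simp only [s0, s1, s2, s3, if_true, if_false, add_zero, zero_add] at hz1 hz2 hk1 hk2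
  -- A part with one element would force some `z i = 0`, so both parts have two elements; these are
  -- opposite in `z` and in `k`.
  all_goals first
    | exact absurd hz1 (hz _)
    | exact absurd hz2 (hz _)
    | (have := key _ _ _ _ hz1 hz2 hk1 hk2
       convert this using 2 <;> ring1)
    | (exfalso
       revert h1 h2
       simp [s0, s1, s2, s3, IsEmpty.exists_iff])

omit [CharZero E] in
/-- A curve given by four monomials on two neighbouring lattice lines is rational. -/
theorem exists_adjoin_eq_top_of_hasWidthOne {x y : L} (hx : x ≠ 0) (hy : y ≠ 0)
    (hxy : IntermediateField.adjoin E {x, y} = ⊤) {p q : Fin 4 → ℤ} (hw : HasWidthOne p q)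
    {c : Fin 4 → E} (hc : ∀ i, c i ≠ 0)
    (hrel : ∑ i, algebraMap E L (c i) * (x ^ p i * y ^ q i) = 0)
    (hk : ∃ i, affineRelation p q i ≠ 0)
    (h1 : ∏ i, c i ^ affineRelation p q i ≠ 1) (h2 : ∏ i, c i ^ affineRelation p q i ≠ -1) :
    ∃ u : L, IntermediateField.adjoin E {u} = ⊤ := by
  classical
  obtain ⟨w₁, w₂, d, ⟨a, b, hab⟩, hd⟩ := hw
  -- Monomial coordinates in which the exponent of `v` is `w₁ * p + w₂ * q`. Up to a power of `v`
  -- the equation has degree at most one in `v`.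
  set u := x ^ (-w₂) * y ^ w₁ with hu
  set v := x ^ a * y ^ b with hv
  have hu0 : u ≠ 0 := mul_ne_zero (zpow_ne_zero _ hx) (zpow_ne_zero _ hy)
  have hv0 : v ≠ 0 := mul_ne_zero (zpow_ne_zero _ hx) (zpow_ne_zero _ hy)
  have hm : ∀ r t : ℤ, x ^ r * y ^ t = u ^ (a * t - b * r) * v ^ (w₁ * r + w₂ * t) := by
    intro r t
    rw [hu, hv, mul_zpow, mul_zpow, ← zpow_mul, ← zpow_mul, ← zpow_mul, ← zpow_mul,
      mul_mul_mul_comm, ← zpow_add₀ hx, ← zpow_add₀ hy]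
    congr 2
    · linear_combination -r * hab
    · linear_combination -t * hab
  let s : Fin 4 → Prop := fun i => w₁ * p i + w₂ * q i = d + 1
  have hs : ∀ i, ¬ s i → w₁ * p i + w₂ * q i = d := fun i h => (hd i).resolve_right h
  let z : Fin 4 → L := fun i => algebraMap E L (c i) * u ^ (a * q i - b * p i)
  have hsum : (∑ i, if s i then 0 else z i) + v * ∑ i, (if s i then z i else 0) = 0 := by
    have h3 : v ^ d * ((∑ i, if s i then 0 else z i) + v * ∑ i, (if s i then z i else 0)) = 0 := by
      refine Eq.trans ?_ hrel
      rw [mul_add, ← mul_assoc, ← zpow_add_one₀ hv0, Finset.mul_sum, Finset.mul_sum,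
        ← Finset.sum_add_distrib]
      refine Finset.sum_congr rfl fun i _ => ?_
      rw [hm]
      split_ifs with h
      · rw [show w₁ * p i + w₂ * q i = d + 1 from h]
        simp only [z]
        ring
      · rw [hs i h]
        simp only [z]
        ring
    exact (mul_eq_zero.1 h3).resolve_left (zpow_ne_zero _ hv0)
  -- If the coefficient of `v` vanishes, so does the constant term, and then the invariant product
  -- of the coefficients is `1` or `-1`. Otherwise `v` is a rational function of `u`.
  by_cases hB : ∑ i, (if s i then z i else 0) = 0
  · exfalso
    have hk0 := sum_affineRelation p q
    have hkp := sum_affineRelation_mul_left p q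
    have hkq := sum_affineRelation_mul_right p q
    have hks : ∑ i, (if s i then affineRelation p q i else 0) = 0 := by
      have h3 : ∑ i, (if s i then affineRelation p q i else 0) =
          w₁ * ∑ i, affineRelation p q i * p i + w₂ * ∑ i, affineRelation p q i * q i -
            d * ∑ i, affineRelation p q i := by
        rw [Finset.mul_sum, Finset.mul_sum, Finset.mul_sum, ← Finset.sum_add_distrib,
          ← Finset.sum_sub_distrib]
        refine Finset.sum_congr rfl fun i _ => ?_
        split_ifs with h
        · have h : w₁ * p i + w₂ * q i = d + 1 := h
          linear_combination -affineRelation p q i * h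
        · linear_combination -affineRelation p q i * hs i h
      rw [h3, hkp, hkq, hk0]
      ring
    have hks' : ∑ i, (if s i then 0 else affineRelation p q i) = 0 := by
      have h3 : ∑ i, (if s i then affineRelation p q i else 0) +
          ∑ i, (if s i then 0 else affineRelation p q i) = ∑ i, affineRelation p q i := by
        rw [← Finset.sum_add_distrib]
        refine Finset.sum_congr rfl fun i _ => ?_
        split_ifs <;> simp
      rwa [hks, hk0, zero_add] at h3
    obtain ⟨i, hi⟩ := hk
    have h3 := prod_zpow_eq_one_or_neg_one (z := z) (k := affineRelation p q)
      (fun i => mul_ne_zero ((map_ne_zero _).2 (hc i)) (zpow_ne_zero _ hu0)) s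
      (by
        by_contra! h
        exact hi (affineRelation_eq_zero_of_collinear ⟨a, b, hab⟩ (fun i => hs i (h i)) i))
      (by
        by_contra! h
        exact hi (affineRelation_eq_zero_of_collinear ⟨a, b, hab⟩ (fun i => h i) i))
      hB (by simpa [hB] using hsum) hks hks'
    have h4 : ∏ i, z i ^ affineRelation p q i =
        algebraMap E L (∏ i, c i ^ affineRelation p q i) := by
      have h5 : ∀ f : Fin 4 → ℤ, ∏ i, u ^ f i = u ^ ∑ i, f i := by
        intro f
        simp only [Fin.prod_univ_four, Fin.sum_univ_four, zpow_add₀ hu0]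
      simp only [z, mul_zpow, ← zpow_mul, Finset.prod_mul_distrib, h5, map_prod, map_zpow₀]
      rw [show ∑ i, (a * q i - b * p i) * affineRelation p q i = a * ∑ i, affineRelation p q i * q i
          - b * ∑ i, affineRelation p q i * p i by
        rw [Finset.mul_sum, Finset.mul_sum, ← Finset.sum_sub_distrib]
        exact Finset.sum_congr rfl fun i _ => by ring, hkp, hkq]
      simp
    rw [h4] at h3
    rcases h3 with h3 | h3
    · exact h1 ((algebraMap E L).injective (by rw [h3, map_one]))
    · exact h2 ((algebraMap E L).injective (by rw [h3, map_neg, map_one]))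
  · refine ⟨u, ?_⟩
    have hu1 := IntermediateField.mem_adjoin_simple_self E u
    have hz : ∀ i, z i ∈ IntermediateField.adjoin E {u} := fun i =>
      mul_mem (algebraMap_mem _ _) (zpow_mem hu1 _)
    have hv1 : v ∈ IntermediateField.adjoin E {u} := by
      rw [show v = -(∑ i, if s i then 0 else z i) / ∑ i, (if s i then z i else 0) by
        rw [eq_div_iff hB]
        linear_combination hsum]
      refine div_mem (neg_mem (sum_mem fun i _ => ?_)) (sum_mem fun i _ => ?_) <;> split_ifs
      exacts [zero_mem _, hz i, hz i, zero_mem _]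
    have hmem : ∀ r t : ℤ, x ^ r * y ^ t ∈ IntermediateField.adjoin E {u} := fun r t => by
      rw [hm]
      exact mul_mem (zpow_mem hu1 _) (zpow_mem hv1 _)
    rw [eq_top_iff, ← hxy, IntermediateField.adjoin_le_iff]
    rintro _ (rfl | rfl)
    · simpa using hmem 1 0
    · simpa using hmem 0 1

end RationalFunctionField

/-! ### Curves given by four monomials -/

section FourTerms

universe v

/-- `L / E` is generated by `x, y ≠ 0` subject to the single relation
`∑ᵢ cᵢ x ^ pᵢ y ^ qᵢ = 0`: each solution of this equation in an extension of `E` that is not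
algebraic over `E` comes from an embedding of `L`. -/
structure IsFourTermCurve {E L : Type v} [Field E] [Field L] [Algebra E L] (c : Fin 4 → E)
    (p q : Fin 4 → ℤ) (x y : L) : Prop where
  x_ne_zero : x ≠ 0
  y_ne_zero : y ≠ 0
  adjoin_eq_top : IntermediateField.adjoin E {x, y} = ⊤
  relation : ∑ i, algebraMap E L (c i) * (x ^ p i * y ^ q i) = 0
  lift : ∀ (M : Type v) [Field M] [Algebra E M] (x' y' : M), x' ≠ 0 → y' ≠ 0 →
    ∑ i, algebraMap E M (c i) * (x' ^ p i * y' ^ q i) = 0 →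
    (Transcendental E x' ∨ Transcendental E y') → ∃ ι : L →ₐ[E] M, ι x = x' ∧ ι y = y'

/-- The inclusion of kernels has to be an equality for a map of fields to exist. If `r` vanished at
`(x', y')` but not at `(x, y)`, a relation between `r(x, y)` and the `j`-th coordinate, not
divisible by the former, would transfer to `(x', y')` and make the transcendental coordinate
algebraic. -/
theorem exists_algHom_of_transcendental {E L M : Type*} [Field E] [Field L] [Algebra E L]
    (h1 : Algebra.trdeg E L ≤ 1) {x y : L} (hxy : IntermediateField.adjoin E {x, y} = ⊤)
    [Field M] [Algebra E M] {x' y' : M}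
    (hker : ∀ r : MvPolynomial (Fin 2) E, aeval ![x, y] r = 0 → aeval ![x', y'] r = 0)
    (ht : Transcendental E x' ∨ Transcendental E y') : ∃ ι : L →ₐ[E] M, ι x = x' ∧ ι y = y' := by
  obtain ⟨j, hj⟩ : ∃ j, Transcendental E (![x', y'] j) := by
    rcases ht with ht | ht
    exacts [⟨0, ht⟩, ⟨1, ht⟩]
  have hker' : ∀ r : MvPolynomial (Fin 2) E, aeval ![x', y'] r = 0 → aeval ![x, y] r = 0 := by
    intro r hr
    by_contra hr0
    obtain ⟨P, hP0, hP⟩ := exists_relation h1 hr0 (![x, y] j)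
    let Q : MvPolynomial (Fin 2) E :=
      P.eval₂ (Polynomial.aeval (X j : MvPolynomial (Fin 2) E)).toRingHom r
    have hQ : aeval ![x, y] Q = P.eval₂ (Polynomial.aeval (![x, y] j) :
        Polynomial E →ₐ[E] L).toRingHom (aeval ![x, y] r) := by
      simp only [Q]
      rw [← AlgHom.coe_toRingHom, Polynomial.hom_eval₂]
      congr 1
      refine Polynomial.ringHom_ext (fun a => ?_) ?_ <;> simp
    have hQ' : aeval ![x', y'] Q = P.eval₂ (Polynomial.aeval (![x', y'] j) :
        Polynomial E →ₐ[E] M).toRingHom (aeval ![x', y'] r) := by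
      simp only [Q]
      rw [← AlgHom.coe_toRingHom, Polynomial.hom_eval₂]
      congr 1
      refine Polynomial.ringHom_ext (fun a => ?_) ?_ <;> simp
    have h2 := hker Q (hQ.trans hP)
    rw [hQ', hr, Polynomial.eval₂_at_zero] at h2
    exact hj ⟨_, hP0, h2⟩
  let : Algebra (MvPolynomial (Fin 2) E ⧸ RingHom.ker (aeval ![x, y] : _ →ₐ[E] L)) L :=
    (Ideal.Quotient.liftₐ _ (aeval ![x, y] : MvPolynomial (Fin 2) E →ₐ[E] L)
      (fun a ha => ha)).toRingHom.toAlgebra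
  have hmk : ∀ r, algebraMap (MvPolynomial (Fin 2) E ⧸ RingHom.ker (aeval ![x, y] : _ →ₐ[E] L)) L
      (Ideal.Quotient.mk _ r) = aeval ![x, y] r := fun r => rfl
  have : FaithfulSMul (MvPolynomial (Fin 2) E ⧸ RingHom.ker (aeval ![x, y] : _ →ₐ[E] L)) L := by
    rw [faithfulSMul_iff_algebraMap_injective, injective_iff_map_eq_zero]
    intro a ha
    obtain ⟨r, rfl⟩ := Ideal.Quotient.mk_surjective a
    exact Ideal.Quotient.eq_zero_iff_mem.2 ha
  have : IsFractionRing (MvPolynomial (Fin 2) E ⧸ RingHom.ker (aeval ![x, y] : _ →ₐ[E] L)) L := by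
    refine IsFractionRing.of_field _ _ fun z => ?_
    have hz : z ∈ IntermediateField.adjoin E (Set.range ![x, y]) := by
      rw [Matrix.range_cons, Matrix.range_cons, Matrix.range_empty, Set.union_empty,
        Set.singleton_union, hxy]
      trivial
    obtain ⟨r, s, hrs⟩ := (IntermediateField.mem_adjoin_range_iff _ _ _).1 hz
    exact ⟨Ideal.Quotient.mk _ r, Ideal.Quotient.mk _ s, hrs⟩
  let ψ : MvPolynomial (Fin 2) E ⧸ RingHom.ker (aeval ![x, y] : _ →ₐ[E] L) →+* M :=
    Ideal.Quotient.lift _ (aeval ![x', y'] : MvPolynomial (Fin 2) E →ₐ[E] M).toRingHom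
      fun a ha => hker a ha
  have hψ : Function.Injective ψ := by
    rw [injective_iff_map_eq_zero]
    intro a ha
    obtain ⟨r, rfl⟩ := Ideal.Quotient.mk_surjective a
    exact Ideal.Quotient.eq_zero_iff_mem.2 (hker' r ha)
  have hι : ∀ r : MvPolynomial (Fin 2) E, IsFractionRing.lift hψ (aeval ![x, y] r : L) = aeval ![x', y'] r := by
    intro r
    rw [← hmk, IsFractionRing.lift_algebraMap]
    rfl
  refine ⟨{ (IsFractionRing.lift hψ : L →+* M) with commutes' := fun e => ?_ }, ?_, ?_⟩
  · have := hι (C e)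
    rwa [algHom_C, algHom_C] at this
  · have := hι (X 0)
    rwa [aeval_X, aeval_X] at this
  · have := hι (X 1)
    rwa [aeval_X, aeval_X] at this

variable {E L : Type v} [Field E] [Field L] [Algebra E L]

theorem isFourTermCurve_of_ker (h1 : Algebra.trdeg E L ≤ 1) {x y : L} (hx : x ≠ 0) (hy : y ≠ 0)
    (hxy : IntermediateField.adjoin E {x, y} = ⊤) {c : Fin 4 → E} {p q : Fin 4 → ℕ}
    (hrel : ∑ i, algebraMap E L (c i) * (x ^ p i * y ^ q i) = 0)
    (hker : ∀ r : MvPolynomial (Fin 2) E, aeval ![x, y] r = 0 →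
      (∑ i, C (c i) * (X 0 ^ p i * X 1 ^ q i)) ∣ r) :
    IsFourTermCurve c (fun i => (p i : ℤ)) (fun i => (q i : ℤ)) x y where
  x_ne_zero := hx
  y_ne_zero := hy
  adjoin_eq_top := hxy
  relation := by simpa using hrel
  lift M _ _ x' y' _ _ hrel' ht := by
    refine exists_algHom_of_transcendental h1 hxy (fun r hr => ?_) ht
    obtain ⟨t, rfl⟩ := hker r hr
    rw [map_mul]
    convert zero_mul _
    simpa using hrel'

namespace IsFourTermCurve

variable {c : Fin 4 → E} {p q : Fin 4 → ℤ} {x y : L}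

theorem adjoin_eq_top_of_mem (h : IsFourTermCurve c p q x y) {x' y' : L}
    (hx : x ∈ IntermediateField.adjoin E {x', y'}) (hy : y ∈ IntermediateField.adjoin E {x', y'}) :
    IntermediateField.adjoin E {x', y'} = ⊤ := by
  rw [eq_top_iff, ← h.adjoin_eq_top, IntermediateField.adjoin_le_iff]
  rintro _ (rfl | rfl)
  exacts [hx, hy]

theorem rescale (h : IsFourTermCurve c p q x y) {a b m : E} (ha : a ≠ 0) (hb : b ≠ 0) (hm : m ≠ 0) :
    IsFourTermCurve (fun i => m * (a ^ p i * b ^ q i) * c i) p q (algebraMap E L a⁻¹ * x)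
      (algebraMap E L b⁻¹ * y) where
  x_ne_zero := mul_ne_zero ((map_ne_zero _).2 (inv_ne_zero ha)) h.x_ne_zero
  y_ne_zero := mul_ne_zero ((map_ne_zero _).2 (inv_ne_zero hb)) h.y_ne_zero
  adjoin_eq_top := by
    have hmem : ∀ {a : E} {x : L} {S : Set L}, a ≠ 0 → algebraMap E L a⁻¹ * x ∈ S →
        x ∈ IntermediateField.adjoin E S := by
      intro a x S ha hx
      have h1 := mul_mem (algebraMap_mem (IntermediateField.adjoin E S) a)
        (IntermediateField.subset_adjoin E S hx)
      rwa [← mul_assoc, ← map_mul, mul_inv_cancel₀ ha, map_one, one_mul] at h1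
    exact h.adjoin_eq_top_of_mem (hmem ha (by simp)) (hmem hb (by simp))
  relation := by
    have ha' : algebraMap E L a ≠ 0 := (map_ne_zero _).2 ha
    have hb' : algebraMap E L b ≠ 0 := (map_ne_zero _).2 hb
    rw [← mul_zero (algebraMap E L m), ← h.relation, Finset.mul_sum]
    refine Finset.sum_congr rfl fun i _ => ?_
    simp only [map_mul, map_zpow₀, map_inv₀, mul_zpow, inv_zpow]
    field_simp
  lift M _ _ x' y' hx' hy' hrel ht := by
    have ha' : algebraMap E M a ≠ 0 := (map_ne_zero _).2 ha
    have hb' : algebraMap E M b ≠ 0 := (map_ne_zero _).2 hb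
    obtain ⟨ι, h1, h2⟩ := h.lift M (algebraMap E M a * x') (algebraMap E M b * y')
      (mul_ne_zero ha' hx') (mul_ne_zero hb' hy') (by
        have hm' : algebraMap E M m ≠ 0 := (map_ne_zero _).2 hm
        apply mul_left_cancel₀ hm'
        rw [mul_zero, ← hrel, Finset.mul_sum]
        refine Finset.sum_congr rfl fun i _ => ?_
        simp only [map_mul, map_zpow₀, mul_zpow]
        ring) (by
        refine ht.imp (fun h3 h4 => h3 ?_) fun h3 h4 => h3 ?_
        · have := (isAlgebraic_algebraMap (A := M) a⁻¹).mul h4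
          rwa [← mul_assoc, ← map_mul, inv_mul_cancel₀ ha, map_one, one_mul] at this
        · have := (isAlgebraic_algebraMap (A := M) b⁻¹).mul h4
          rwa [← mul_assoc, ← map_mul, inv_mul_cancel₀ hb, map_one, one_mul] at this)
    refine ⟨ι, ?_, ?_⟩
    · rw [map_mul, h1, AlgHom.commutes, ← mul_assoc, ← map_mul, inv_mul_cancel₀ ha, map_one, one_mul]
    · rw [map_mul, h2, AlgHom.commutes, ← mul_assoc, ← map_mul, inv_mul_cancel₀ hb, map_one, one_mul]

/-- An integral matrix of determinant `ε = ±1` is invertible on monomials. The translation `(a, b)`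
multiplies the equation by a monomial, which is harmless as `x` and `y` are nonzero. -/
theorem monomialChange (h : IsFourTermCurve c p q x y) {p' q' : Fin 4 → ℤ} {α β γ δ ε a b : ℤ}
    (hε : ε * (α * δ - β * γ) = 1) (hp : ∀ i, p i = α * p' i + γ * q' i + a)
    (hq : ∀ i, q i = β * p' i + δ * q' i + b) :
    IsFourTermCurve c p' q' (x ^ α * y ^ β) (x ^ γ * y ^ δ) := by
  have hm : ∀ {N : Type v} [Field N] {x y : N}, x ≠ 0 → y ≠ 0 → ∀ i,
      x ^ p i * y ^ q i = x ^ a * y ^ b * ((x ^ α * y ^ β) ^ p' i * (x ^ γ * y ^ δ) ^ q' i) := by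
    intro N _ x y hx hy i
    rw [mul_zpow, mul_zpow, ← zpow_mul, ← zpow_mul, ← zpow_mul, ← zpow_mul, 
      mul_mul_mul_comm (x ^ (α * p' i)), ← zpow_add₀ hx, ← zpow_add₀ hy,
      mul_mul_mul_comm, ← zpow_add₀ hx, ← zpow_add₀ hy, hp, hq]
    congr 2 <;> ring
  have hinv : ∀ {N : Type v} [Field N] {x y : N}, x ≠ 0 → y ≠ 0 →
      (x ^ α * y ^ β) ^ (ε * δ) * (x ^ γ * y ^ δ) ^ (-(ε * β)) = x ∧
      (x ^ α * y ^ β) ^ (-(ε * γ)) * (x ^ γ * y ^ δ) ^ (ε * α) = y := by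
    intro N _ x y hx hy
    simp only [mul_zpow, ← zpow_mul]
    rw [mul_mul_mul_comm, ← zpow_add₀ hx, ← zpow_add₀ hy, mul_mul_mul_comm, ← zpow_add₀ hx,
      ← zpow_add₀ hy]
    constructor
    · rw [show α * (ε * δ) + γ * -(ε * β) = 1 by linear_combination hε,
        show β * (ε * δ) + δ * -(ε * β) = 0 by ring, zpow_one, zpow_zero, mul_one]
    · rw [show β * -(ε * γ) + δ * (ε * α) = 1 by linear_combination hε,
        show α * -(ε * γ) + γ * (ε * α) = 0 by ring, zpow_one, zpow_zero, one_mul]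
  have hinv' : ∀ {N : Type v} [Field N] {x y : N}, x ≠ 0 → y ≠ 0 →
      (x ^ (ε * δ) * y ^ (-(ε * β))) ^ α * (x ^ (-(ε * γ)) * y ^ (ε * α)) ^ β = x ∧
      (x ^ (ε * δ) * y ^ (-(ε * β))) ^ γ * (x ^ (-(ε * γ)) * y ^ (ε * α)) ^ δ = y := by
    intro N _ x y hx hy
    simp only [mul_zpow, ← zpow_mul]
    rw [mul_mul_mul_comm, ← zpow_add₀ hx, ← zpow_add₀ hy, mul_mul_mul_comm, ← zpow_add₀ hx,
      ← zpow_add₀ hy]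
    constructor
    · rw [show ε * δ * α + -(ε * γ) * β = 1 by linear_combination hε,
        show -(ε * β) * α + ε * α * β = 0 by ring, zpow_one, zpow_zero, mul_one]
    · rw [show -(ε * β) * γ + ε * α * δ = 1 by linear_combination hε,
        show ε * δ * γ + -(ε * γ) * δ = 0 by ring, zpow_one, zpow_zero, one_mul]
  refine ⟨mul_ne_zero (zpow_ne_zero _ h.x_ne_zero) (zpow_ne_zero _ h.y_ne_zero),
    mul_ne_zero (zpow_ne_zero _ h.x_ne_zero) (zpow_ne_zero _ h.y_ne_zero), ?_, ?_, ?_⟩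
  · obtain ⟨h1, h2⟩ := hinv h.x_ne_zero h.y_ne_zero
    have hu := IntermediateField.subset_adjoin E {x ^ α * y ^ β, x ^ γ * y ^ δ}
      (Set.mem_insert _ _)
    have hv := IntermediateField.subset_adjoin E {x ^ α * y ^ β, x ^ γ * y ^ δ}
      (Set.mem_insert_of_mem _ rfl)
    refine h.adjoin_eq_top_of_mem ?_ ?_
    · have h3 := mul_mem (zpow_mem hu (ε * δ)) (zpow_mem hv (-(ε * β)))
      rwa [h1] at h3
    · have h3 := mul_mem (zpow_mem hu (-(ε * γ))) (zpow_mem hv (ε * α))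
      rwa [h2] at h3
  · have h1 := h.relation
    simp only [hm h.x_ne_zero h.y_ne_zero, mul_left_comm _ (x ^ a * y ^ b)] at h1
    rw [← Finset.mul_sum] at h1
    exact (mul_eq_zero.1 h1).resolve_left
      (mul_ne_zero (zpow_ne_zero _ h.x_ne_zero) (zpow_ne_zero _ h.y_ne_zero))
  · intro M _ _ x' y' hx' hy' hrel ht
    obtain ⟨h1, h2⟩ := hinv' hx' hy'
    set u := x' ^ (ε * δ) * y' ^ (-(ε * β)) with hu
    set w := x' ^ (-(ε * γ)) * y' ^ (ε * α) with hw
    have hu0 : u ≠ 0 := mul_ne_zero (zpow_ne_zero _ hx') (zpow_ne_zero _ hy')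
    have hw0 : w ≠ 0 := mul_ne_zero (zpow_ne_zero _ hx') (zpow_ne_zero _ hy')
    obtain ⟨ι, h3, h4⟩ := h.lift M u w hu0 hw0 (by
      simp only [hm hu0 hw0, mul_left_comm _ (u ^ a * w ^ b), ← Finset.mul_sum, h1, h2]
      rw [hrel, mul_zero]) (by
      by_contra! h5
      have hz : ∀ {z : M} (a : ℤ), IsAlgebraic E z → IsAlgebraic E (z ^ a) := by
        intro z a hz
        cases a with
        | ofNat n => simpa using hz.pow n
        | negSucc n => simpa using (hz.pow (n + 1)).inv
      have h6 : ∀ a b : ℤ, IsAlgebraic E (u ^ a * w ^ b) := fun a b =>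
        (hz a (not_not.1 h5.1)).mul (hz b (not_not.1 h5.2))
      have hx6 := h6 α β
      have hy6 := h6 γ δ
      rw [h1] at hx6
      rw [h2] at hy6
      exact ht.elim (fun h => h hx6) fun h => h hy6)
    refine ⟨ι, ?_, ?_⟩
    · rw [map_mul, map_zpow₀, map_zpow₀, h3, h4, h1]
    · rw [map_mul, map_zpow₀, map_zpow₀, h3, h4, h2]

end IsFourTermCurve

end FourTerms

/-! ### Residues of Laurent series and fixed points -/

/-- The Laurent series `f` has no pole and value `a`. -/
def HasResidue {k : Type*} [Field k] (f : LaurentSeries k) (a : k) : Prop :=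
  0 ≤ f.orderTop ∧ f.coeff 0 = a

namespace HasResidue

variable {k : Type*} [Field k] {f g : LaurentSeries k} {a b : k}

theorem mul (hf : HasResidue f a) (hg : HasResidue g b) : HasResidue (f * g) (a * b) :=
  ⟨by simpa using le_orderTop_mul (a := 0) (b := 0) hf.1 hg.1,
    by rw [coeff_zero_mul hf.1 hg.1, hf.2, hg.2]⟩

theorem orderTop_eq (hf : HasResidue f a) (ha : a ≠ 0) : f.orderTop = 0 := by
  refine le_antisymm ?_ hf.1
  exact HahnSeries.orderTop_le_of_coeff_ne_zero (by rwa [hf.2])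

theorem inv (hf : HasResidue f a) (ha : a ≠ 0) : HasResidue f⁻¹ a⁻¹ := by
  have h0 : f ≠ 0 := by
    rintro rfl
    exact ha hf.2.symm
  have h1 : f⁻¹.orderTop = 0 := by
    have h2 := congrArg HahnSeries.orderTop (mul_inv_cancel₀ h0)
    rwa [HahnSeries.orderTop_mul, hf.orderTop_eq ha, zero_add, HahnSeries.orderTop_one] at h2
  refine ⟨h1.ge, ?_⟩
  have h2 := congrArg (fun f => HahnSeries.coeff f 0) (mul_inv_cancel₀ h0)
  simp only [coeff_zero_mul hf.1 h1.ge, hf.2] at h2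
  rw [HahnSeries.coeff_one, if_pos rfl] at h2
  exact eq_inv_of_mul_eq_one_right h2

theorem pow (hf : HasResidue f a) (n : ℕ) : HasResidue (f ^ n) (a ^ n) := by
  induction n with
  | zero => exact ⟨by simp, by simp⟩
  | succ n ih => simpa only [pow_succ] using ih.mul hf

theorem zpow (hf : HasResidue f a) (ha : a ≠ 0) (n : ℤ) : HasResidue (f ^ n) (a ^ n) := by
  cases n with
  | ofNat n => simpa using hf.pow n
  | negSucc n =>
    rw [zpow_negSucc, zpow_negSucc]
    exact (hf.pow (n + 1)).inv (pow_ne_zero _ ha)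

theorem coeffMap (hf : HasResidue f a) (δ : k →+ k) : HasResidue (coeffMap δ f) (δ a) :=
  ⟨hf.1.trans (orderTop_le_coeffMap _ _), by rw [coeff_coeffMap, hf.2]⟩

end HasResidue

theorem hasResidue_ofPowerSeries {k : Type*} [Field k] (f : PowerSeries k) :
    HasResidue (HahnSeries.ofPowerSeries ℤ k f) (PowerSeries.constantCoeff f) :=
  ⟨orderTop_ofPowerSeries_nonneg f, by
    rw [show (0 : ℤ) = (0 : ℕ) from rfl, HahnSeries.ofPowerSeries_apply_coeff]
    simp⟩

/-- The map `V ↦ v + s * P(V)` contracts in the adic topology because `s` lies in `I`; its iterates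
converge to a fixed point. -/
theorem exists_fixedPoint {A : Type*} [CommRing A] {I : Ideal A} [IsAdicComplete I A] (v : A) {s : A}
    (hs : s ∈ I) (P : Polynomial A) : ∃ V, V = v + s * P.eval V := by
  let T : A → A := fun V => v + s * P.eval V
  have hT : ∀ {n : ℕ} {a b : A}, a - b ∈ I ^ n → T a - T b ∈ I ^ (n + 1) := by
    intro n a b h
    have h1 : T a - T b = s * (P.eval a - P.eval b) := by simp only [T]; ring
    rw [h1, pow_succ']
    obtain ⟨c, hc⟩ := Polynomial.sub_dvd_eval_sub a b P
    rw [hc]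
    exact Ideal.mul_mem_mul hs (Ideal.mul_mem_right _ _ h)
  let V : ℕ → A := fun n => T^[n] v
  have hV : ∀ n, V (n + 1) = T (V n) := fun n => Function.iterate_succ_apply' T n v
  have hstep : ∀ n, V (n + 1) - V n ∈ I ^ n := by
    intro n
    induction n with
    | zero => simp
    | succ n ih =>
      rw [hV (n + 1), hV n, ← hV n]
      have := hT ih
      rwa [hV n] at this ⊢
  have hcauchy : ∀ m n, m ≤ n → V m ≡ V n [SMOD I ^ m • (⊤ : Submodule A A)] := by
    intro m n hmn
    induction n, hmn using Nat.le_induction with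
    | base => rfl
    | succ n hmn ih =>
      refine ih.trans (SModEq.symm ?_)
      rw [SModEq.sub_mem, smul_eq_mul, Ideal.mul_top]
      exact Ideal.pow_le_pow_right hmn (hstep n)
  obtain ⟨W, hW⟩ := IsPrecomplete.prec' (I := I) (M := A) V fun {m n} h => hcauchy m n h
  refine ⟨W, ?_⟩
  have hW' : ∀ n, V n - W ∈ I ^ n := fun n => by
    have := hW n
    rwa [SModEq.sub_mem, smul_eq_mul, Ideal.mul_top] at this
  have h0 : ∀ n, W - T W ∈ I ^ n := by
    intro n
    have h1 := hW' (n + 1)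
    have h2 := hT (hW' n)
    rw [← hV] at h2
    have h3 := sub_mem h2 h1
    rw [sub_sub_sub_cancel_left] at h3
    exact Ideal.pow_le_pow_right (Nat.le_succ n) h3
  refine sub_eq_zero.1 (IsHausdorff.haus' (I := I) (M := A) _ fun n => ?_)
  rw [SModEq.zero, smul_eq_mul, Ideal.mul_top]
  exact h0 n

/-- In a polynomial relation over `E` the coefficients of lowest order give a nonzero polynomial
over `K` which vanishes at the residue `z`. But `z` is not in `K`, which is algebraically closed. -/
theorem transcendental_of_hasResidue {K E κ : Type*} [Field K] [Field E] [Field κ] [IsAlgClosed K]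
    [Algebra K κ] (θ : E →+* LaurentSeries K) [Algebra E (LaurentSeries κ)]
    (hE : ∀ e, algebraMap E (LaurentSeries κ) e = laurentMap (algebraMap K κ) (θ e))
    {f : LaurentSeries κ} {z : κ} (hf : HasResidue f z) (hz : ∀ a, algebraMap K κ a ≠ z) :
    Transcendental E f := by
  rintro ⟨P, hP0, hP⟩
  have hne : P.support.Nonempty := Polynomial.support_nonempty.2 hP0
  obtain ⟨i₀, hi₀, hmin⟩ := P.support.exists_min_image (fun i => (θ (P.coeff i)).orderTop) hne
  have hi₀' : θ (P.coeff i₀) ≠ 0 := (map_ne_zero _).2 (Polynomial.mem_support_iff.1 hi₀)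
  obtain ⟨m, hm⟩ := WithTop.ne_top_iff_exists.1 (HahnSeries.orderTop_ne_top.2 hi₀')
  let Q : Polynomial K := ∑ i ∈ P.support, Polynomial.monomial i ((θ (P.coeff i)).coeff m)
  have hQ0 : Q ≠ 0 := by
    intro h
    have h1 := congrArg (fun p => Polynomial.coeff p i₀) h
    simp only [Q, Polynomial.finsetSum_coeff, Polynomial.coeff_monomial, Polynomial.coeff_zero,
      Finset.sum_ite_eq' , hi₀, if_true] at h1
    exact HahnSeries.coeff_orderTop_ne hm.symm h1
  refine transcendental_of_notMem_range hz ⟨Q, hQ0, ?_⟩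
  have h1 := congrArg (fun g => HahnSeries.coeff g m) hP
  simp only [Polynomial.aeval_eq_sum_range, HahnSeries.coeff_zero] at h1
  rw [← Polynomial.sum_over_range (f := fun i a => a • f ^ i) P (by simp), Polynomial.sum,
    HahnSeries.coeff_sum] at h1
  rw [← h1]
  simp only [Q, map_sum, Polynomial.aeval_monomial]
  refine Finset.sum_congr rfl fun i hi => ?_
  rw [Algebra.smul_def, hE]
  have h2 := coeff_mul_of_le_orderTop (a := m) (b := 0)
    (f := laurentMap (algebraMap K κ) (θ (P.coeff i))) (g := f ^ i)
    (by rw [orderTop_laurentMap, hm]; exact hmin i hi) (hf.pow i).1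
  rw [add_zero] at h2
  rw [h2, coeff_laurentMap, (hf.pow i).2]

/-! ### Expansions to second order -/

section Expansion

variable {A : Type*} [CommRing A]

/-- The factor `2`, and `4` in the next lemma, clears the denominators of the binomial coefficients,
so that the expansion holds in any commutative ring. -/
theorem exists_one_add_pow_eq (s x : A) (n : ℕ) :
    ∃ h, 2 * (1 + s * x) ^ n = 2 + s * (2 * (n * x)) + s ^ 2 * ((n * n - n) * x ^ 2) + s ^ 3 * h := by
  induction n with
  | zero => exact ⟨0, by simp⟩
  | succ n ih =>
    obtain ⟨h, hh⟩ := ih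
    refine ⟨h + (n * n - n) * x ^ 3 + s * x * h, ?_⟩
    rw [pow_succ, ← mul_assoc, hh]
    push_cast
    ring

theorem exists_one_add_pow_mul_eq (s x y : A) (n m : ℕ) :
    ∃ h, 4 * ((1 + s * x) ^ n * (1 + s * y) ^ m) = 4 + s * (4 * (n * x + m * y)) +
      s ^ 2 * (2 * ((n * n - n) * x ^ 2 + 2 * n * m * x * y + (m * m - m) * y ^ 2)) + s ^ 3 * h := by
  obtain ⟨h, hh⟩ := exists_one_add_pow_eq s x n
  obtain ⟨h', hh'⟩ := exists_one_add_pow_eq s y m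
  refine ⟨2 * h' + 2 * n * x * ((m * m - m) * y ^ 2 + s * h') + (n * n - n) * x ^ 2 *
    (2 * (m * y) + s * ((m * m - m) * y ^ 2) + s ^ 2 * h') +
    h * (2 + s * (2 * (m * y)) + s ^ 2 * ((m * m - m) * y ^ 2) + s ^ 3 * h'), ?_⟩
  rw [show (4 : A) * ((1 + s * x) ^ n * (1 + s * y) ^ m) =
    (2 * (1 + s * x) ^ n) * (2 * (1 + s * y) ^ m) by ring, hh, hh']
  ring

/-- The terms of order zero and one cancel since `k` is an affine relation of the exponents: the
curve with coefficients `k i` is singular at `(1, 1)`. -/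
theorem exists_sum_eq_quadratic {k : Fin 4 → ℤ} {p q : Fin 4 → ℕ} (h0 : ∑ i, k i = 0)
    (hp : ∑ i, k i * p i = 0) (hq : ∑ i, k i * q i = 0) (s x y : A) :
    ∃ h, 4 * ∑ i, (k i : A) * ((1 + s * x) ^ p i * (1 + s * y) ^ q i) =
      s ^ 2 * (2 * ((∑ i, k i * p i ^ 2 : ℤ) * x ^ 2 + 2 * (∑ i, k i * (p i * q i) : ℤ) * (x * y) +
        (∑ i, k i * q i ^ 2 : ℤ) * y ^ 2)) + s ^ 3 * h := by
  choose h hh using fun i => exists_one_add_pow_mul_eq s x y (p i) (q i)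
  refine ⟨∑ i, k i * h i, ?_⟩
  have h0' := congrArg (Int.cast : ℤ → A) h0
  have hp' := congrArg (Int.cast : ℤ → A) hp
  have hq' := congrArg (Int.cast : ℤ → A) hq
  simp only [Fin.sum_univ_four] at h0' hp' hq' ⊢
  push_cast at h0' hp' hq' ⊢
  linear_combination (k 0 : A) * hh 0 + (k 1 : A) * hh 1 + (k 2 : A) * hh 2 + (k 3 : A) * hh 3 +
    4 * h0' + (4 * s * x - 2 * s ^ 2 * x ^ 2) * hp' + (4 * s * y - 2 * s ^ 2 * y ^ 2) * hq'

theorem exists_sum_eq_linear {k : Fin 4 → ℤ} {p q : Fin 4 → ℕ} (hq : ∑ i, k i * q i = 0)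
    (s x y : A) :
    ∃ h, 4 * ∑ i, (k i : A) * q i * ((1 + s * x) ^ p i * (1 + s * y) ^ q i) =
      s * (4 * ((∑ i, k i * (p i * q i) : ℤ) * x + (∑ i, k i * q i ^ 2 : ℤ) * y)) + s ^ 2 * h := by
  choose h hh using fun i => exists_one_add_pow_mul_eq s x y (p i) (q i)
  refine ⟨∑ i, k i * q i * ((2 * ((p i * p i - p i) * x ^ 2 + 2 * p i * q i * x * y +
    (q i * q i - q i) * y ^ 2)) + s * h i), ?_⟩
  have hq' := congrArg (Int.cast : ℤ → A) hq
  simp only [Fin.sum_univ_four] at hq' ⊢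
  push_cast at hq' ⊢
  linear_combination (k 0 * q 0 : A) * hh 0 + (k 1 * q 1 : A) * hh 1 + (k 2 * q 2 : A) * hh 2 +
    (k 3 * q 3 : A) * hh 3 + 4 * hq'

end Expansion

/-- A nondegenerate binary quadratic form over an algebraically closed field is hyperbolic. -/
theorem exists_hyperbolic_basis {K : Type*} [Field K] [IsAlgClosed K] [CharZero K] {a b c : K}
    (h : a * c - b ^ 2 ≠ 0) : ∃ α β γ δ : K, α * δ - β * γ ≠ 0 ∧
      a * α ^ 2 + 2 * b * (α * γ) + c * γ ^ 2 = 0 ∧ a * β ^ 2 + 2 * b * (β * δ) + c * δ ^ 2 = 0 ∧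
      a * (α * β) + b * (α * δ + β * γ) + c * (γ * δ) = 1 := by
  by_cases ha : a = 0
  · subst ha
    have hb : b ≠ 0 := by
      rintro rfl
      simp at h
    refine ⟨1, -c / (2 * b ^ 2), 0, 1 / b, ?_, by ring, ?_, ?_⟩
    · simpa using hb
    · field_simp
      ring
    · field_simp
      ring
  -- The isotropic vectors are `(-b + r, a)` and `(-b - r, a)`. Their pairing is `-2 * a * r ^ 2`,
  -- by which the second one is divided.
  · obtain ⟨r, hr⟩ := IsAlgClosed.exists_pow_nat_eq (b ^ 2 - a * c) (n := 2) (by norm_num)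
    have hr0 : r ≠ 0 := by
      rintro rfl
      apply h
      linear_combination hr
    have hm : a * c - b ^ 2 = -r ^ 2 := by linear_combination hr
    refine ⟨-b + r, (-b - r) / (-2 * a * r ^ 2), a, a / (-2 * a * r ^ 2), ?_, ?_, ?_, ?_⟩
    · have : (-b + r) * (a / (-2 * a * r ^ 2)) - (-b - r) / (-2 * a * r ^ 2) * a = -1 / r := by
        field_simp
        ring
      rw [this]
      simpa using hr0
    · linear_combination a * hr
    · field_simp
      linear_combination hr
    · field_simp
      linear_combination -hr

/-! ### Exponents without three collinear points -/

theorem ne_or_ne_of_affineRelation_ne_zero {p q : Fin 4 → ℤ} (hk : ∀ i, affineRelation p q i ≠ 0)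
    (i j : Fin 4) (hij : i ≠ j) : p i ≠ p j ∨ q i ≠ q j := by
  by_contra! h
  obtain ⟨h1, h2⟩ := h
  fin_cases i <;> fin_cases j <;>
    simp only [Fin.zero_eta, Fin.mk_one, Fin.reduceFinMk] at h1 h2 hij <;>
    first
    | exact hij rfl
    | exact hk 0 (by simp only [affineRelation, Matrix.cons_val]; rw [h1, h2]; ring1)
    | exact hk 1 (by simp only [affineRelation, Matrix.cons_val]; rw [h1, h2]; ring1)
    | exact hk 2 (by simp only [affineRelation, Matrix.cons_val]; rw [h1, h2]; ring1)

/-- The determinant of the quadratic form at the singular point `(1, 1)`. It shows that the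
singularity is a node precisely when no three of the points are collinear. -/
theorem discriminant_affineRelation (p q : Fin 4 → ℤ) :
    (∑ i, affineRelation p q i * p i ^ 2) * (∑ i, affineRelation p q i * q i ^ 2) -
      (∑ i, affineRelation p q i * (p i * q i)) ^ 2 = -∏ i, affineRelation p q i := by
  simp only [affineRelation, Fin.sum_univ_four, Fin.prod_univ_four, Matrix.cons_val]
  ring

section

variable {K E : Type*} [Field K] [IsAlgClosed K] [Field E] [Algebra K E]

theorem zpow_ne_algebraMap {z : E} (hz : ∀ a, algebraMap K E a ≠ z) {n : ℤ} (hn : n ≠ 0) (a : K) :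
    z ^ n ≠ algebraMap K E a := by
  intro h
  have h1 : IsAlgebraic K (z ^ n.natAbs) := by
    rcases Int.natAbs_eq n with h2 | h2
    · rw [← zpow_natCast, ← h2, h]
      exact isAlgebraic_algebraMap a
    · rw [h2, zpow_neg, inv_eq_iff_eq_inv, zpow_natCast] at h
      rw [h]
      exact (isAlgebraic_algebraMap a).inv
  exact transcendental_of_notMem_range hz (h1.of_pow (Int.natAbs_pos.2 hn))

/-- All factors but the one of index `0` agree and can be cancelled. A nonzero power of `c 0` is not
constant, since `c 0` is not. -/
theorem prod_zpow_ne {c : Fin 4 → E} {k : Fin 4 → ℤ} (hk : k 0 ≠ 0)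
    (hc0 : ∀ a, algebraMap K E a ≠ c 0) (hc : ∀ i, i ≠ 0 → k i ≠ 0 → c i = k i) [CharZero E] :
    ∏ i, c i ^ k i ≠ ∏ i, (k i : E) ^ k i := by
  rw [Fin.prod_univ_succ, Fin.prod_univ_succ]
  have h1 : ∀ i : Fin 3, c i.succ ^ k i.succ = (k i.succ : E) ^ k i.succ := fun i => by
    by_cases hi : k i.succ = 0
    · simp [hi]
    · rw [hc _ (Fin.succ_ne_zero i) hi]
  simp only [h1]
  intro h
  have h2 : ∏ i : Fin 3, (k i.succ : E) ^ k i.succ ≠ 0 := by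
    refine Finset.prod_ne_zero_iff.2 fun i _ => ?_
    by_cases hi : k i.succ = 0
    · simp [hi]
    · exact zpow_ne_zero _ (by exact_mod_cast hi)
  refine zpow_ne_algebraMap hc0 hk ((k 0 : K) ^ k 0) ?_
  rw [mul_right_cancel₀ h2 h]
  simp

end

/-! ### Degeneration to a node. -/

section Conic

universe v

variable {K E L : Type v} {F : Type*} [Field K] [IsAlgClosed K] [CharZero K] [Field E] [CharZero E]
  [Field F] [Field L] [Algebra K E] [Algebra K F] [Algebra K L] [Algebra E L] [Algebra F L]
  [IsScalarTower K E L] [IsScalarTower K F L]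

/-- A solution of the equation with the coefficients `kᵢ`, the first one perturbed, near `(1, 1)`:
to first order it lies on a hyperbola. -/
theorem exists_hyperbolic_solution {A κ : Type*} [CommRing A] [Field κ] [CharZero κ] [Algebra κ A]
    {I : Ideal A} [IsAdicComplete I A] {ε : A} (hε : ε ∈ I) {k : Fin 4 → ℤ} {p q : Fin 4 → ℕ}
    (h0 : ∑ i, k i = 0) (hp : ∑ i, k i * p i = 0) (hq : ∑ i, k i * q i = 0) {U α β γ δ : κ}
    (hU : U ≠ 0)
    (h1 : (∑ i, k i * p i ^ 2 : ℤ) * α ^ 2 + 2 * (∑ i, k i * (p i * q i) : ℤ) * (α * γ) +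
      (∑ i, k i * q i ^ 2 : ℤ) * γ ^ 2 = 0)
    (h2 : (∑ i, k i * p i ^ 2 : ℤ) * β ^ 2 + 2 * (∑ i, k i * (p i * q i) : ℤ) * (β * δ) +
      (∑ i, k i * q i ^ 2 : ℤ) * δ ^ 2 = 0)
    (h3 : (∑ i, k i * p i ^ 2 : ℤ) * (α * β) + (∑ i, k i * (p i * q i) : ℤ) * (α * δ + β * γ) +
      (∑ i, k i * q i ^ 2 : ℤ) * (γ * δ) = 1) :
    ∃ V W : A, V = algebraMap κ A U⁻¹ + ε * W ∧
      ∑ i, (k i : A) * ((1 + ε * (algebraMap κ A (α * U) + algebraMap κ A β * V)) ^ p i *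
        (1 + ε * (algebraMap κ A (γ * U) + algebraMap κ A δ * V)) ^ q i) =
      ε ^ 2 * ((1 + ε * (algebraMap κ A (α * U) + algebraMap κ A β * V)) ^ p 0 *
        (1 + ε * (algebraMap κ A (γ * U) + algebraMap κ A δ * V)) ^ q 0) := by
  let x : Polynomial A := Polynomial.C (algebraMap κ A (α * U)) +
    Polynomial.C (algebraMap κ A β) * Polynomial.X
  let y : Polynomial A := Polynomial.C (algebraMap κ A (γ * U)) +
    Polynomial.C (algebraMap κ A δ) * Polynomial.X
  obtain ⟨h, hh⟩ := exists_sum_eq_quadratic h0 hp hq (Polynomial.C ε) x y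
  obtain ⟨g, hg⟩ := exists_one_add_pow_mul_eq (Polynomial.C ε) x y (p 0) (q 0)
  set g' := (4 * (p 0 * x + q 0 * y) + Polynomial.C ε * (2 * ((p 0 * p 0 - p 0) * x ^ 2 +
    2 * p 0 * q 0 * x * y + (q 0 * q 0 - q 0) * y ^ 2)) + Polynomial.C ε ^ 2 * g) with hg'
  -- To second order the equation reads `U * V = 1`. The higher terms are divisible by `ε`, so
  -- solving for `V` is a contraction near `U⁻¹`.
  obtain ⟨V, hV⟩ := exists_fixedPoint (I := I) (algebraMap κ A U⁻¹) hε
    (Polynomial.C (algebraMap κ A (U⁻¹ * (1 / 4))) * (g' - h))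
  refine ⟨V, _, hV, ?_⟩
  set X := algebraMap κ A (α * U) + algebraMap κ A β * V with hX
  set Y := algebraMap κ A (γ * U) + algebraMap κ A δ * V with hY
  have hx : x.eval V = X := by simp [x, hX]
  have hy : y.eval V = Y := by simp [y, hY]
  have e1 := congrArg (Polynomial.eval V) hh
  have e2 : 4 * ((1 + ε * X) ^ p 0 * (1 + ε * Y) ^ q 0) = 4 + ε * g'.eval V := by
    have := congrArg (Polynomial.eval V) hg
    rw [hg']
    simp [hx, hy] at this ⊢
    rw [this]
    ring
  have e3 : 4 * (algebraMap κ A U * V) = 4 + ε * (g'.eval V - h.eval V) := by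
    have h4 : algebraMap κ A U * algebraMap κ A U⁻¹ = 1 := by
      rw [← map_mul, mul_inv_cancel₀ hU, map_one]
    have h5 : (4 : A) * algebraMap κ A (1 / 4) = 1 := by
      rw [← map_ofNat (algebraMap κ A) 4, ← map_mul]
      norm_num
    simp only [Polynomial.eval_mul, Polynomial.eval_C, Polynomial.eval_sub, map_mul] at hV
    linear_combination 4 * algebraMap κ A U * hV + (4 + ε * (g'.eval V - h.eval V) * 4 *
      algebraMap κ A (1 / 4)) * h4 + ε * (g'.eval V - h.eval V) * h5
  have e4 : (∑ i, k i * p i ^ 2 : ℤ) * X ^ 2 + 2 * (∑ i, k i * (p i * q i) : ℤ) * (X * Y) +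
      (∑ i, k i * q i ^ 2 : ℤ) * Y ^ 2 = 2 * (algebraMap κ A U * V) := by
    have h1' := congrArg (algebraMap κ A) h1
    have h2' := congrArg (algebraMap κ A) h2
    have h3' := congrArg (algebraMap κ A) h3
    simp only [map_add, map_mul, map_intCast, map_pow, map_zero, map_one, map_ofNat] at h1' h2' h3'
    rw [hX, hY, map_mul, map_mul]
    linear_combination (algebraMap κ A U) ^ 2 * h1' + V ^ 2 * h2' +
      2 * algebraMap κ A U * V * h3'
  simp only [Polynomial.eval_mul, Polynomial.eval_add, Polynomial.eval_pow, Polynomial.eval_finsetSum,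
    Polynomial.eval_C, Polynomial.eval_intCast, Polynomial.eval_one, Polynomial.eval_ofNat, hx, hy]
    at e1
  rw [e4] at e1
  have h6 : IsUnit (4 : A) := by
    rw [← map_ofNat (algebraMap κ A) 4]
    exact (IsUnit.mk0 (4 : κ) (by norm_num)).map _
  apply h6.mul_left_cancel
  linear_combination e1 + ε ^ 2 * e3 - ε ^ 2 * e2

omit [IsAlgClosed K] [CharZero K] in
theorem algebraMap_laurentSeries (a : K) : algebraMap K (LaurentSeries K) a = HahnSeries.C a := by
  rw [HahnSeries.algebraMap_apply', PowerSeries.algebraMap_apply, Algebra.algebraMap_self_apply,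
    HahnSeries.ofPowerSeries_C]

theorem coeffMap_one_add_laurentMap_mul {κ : Type*} [Field κ] [Algebra K κ] {δ : κ →+ κ}
    (hδ : ∀ a b, δ (a * b) = a * δ b + b * δ a) (hδK : ∀ a, δ (algebraMap K κ a) = 0)
    (e : LaurentSeries K) (f : LaurentSeries κ) :
    coeffMap δ (1 + laurentMap (algebraMap K κ) e * f) =
      laurentMap (algebraMap K κ) e * coeffMap δ f := by
  rw [map_add, coeffMap_mul δ hδ, coeffMap_C_algebraMap δ hδK, mul_zero, add_zero,
    ← map_one (laurentMap (algebraMap K κ)), coeffMap_C_algebraMap δ hδK, zero_add]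

set_option maxHeartbeats 1000000 in
/-- If no three of the exponents are collinear and there is an interior lattice point, then the
curve is not obtained from a curve over the constants. -/
theorem not_isInteriorPoint_of_affineRelation_ne_zero (hc : IsConstantExtension K E F L)
    (h1F : Algebra.trdeg K F ≤ 1) {SF : Finset F}
    (hSF : IntermediateField.adjoin K (SF : Set F) = ⊤) (hF : ∃ f : F, ∀ a, algebraMap K F a ≠ f)
    (h1E : Algebra.trdeg K E ≤ 1) {SE : Finset E}
    (hSE : IntermediateField.adjoin K (SE : Set E) = ⊤) {σ : E} (hσ : ∀ a, algebraMap K E a ≠ σ)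
    {p q : Fin 4 → ℕ} (hk : ∀ i, affineRelation (fun i => p i) (fun i => q i) i ≠ 0) {c : Fin 4 → E}
    (hc0 : c 0 = affineRelation (fun i => p i) (fun i => q i) 0 - σ ^ 2)
    (hci : ∀ i, i ≠ 0 → c i = affineRelation (fun i => p i) (fun i => q i) i) {x y : L}
    (hxy : IsFourTermCurve c (fun i => p i) (fun i => q i) x y) (r₁ r₂ : ℤ) :
    ¬ IsInteriorPoint (fun i => p i) (fun i => q i) r₁ r₂ := by
  intro hr
  set k := affineRelation (fun i => (p i : ℤ)) (fun i => (q i : ℤ)) with hkdef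
  -- At a place where `σ` vanishes the coefficients specialize to the affine relation, and the curve
  -- acquires the node `(1, 1)`.
  obtain ⟨θ, hθK, hθσ⟩ := exists_place h1E hSE hσ
  let φ : E →+* LaurentSeries (LaurentSeries K) :=
    (laurentMap (algebraMap K (LaurentSeries K))).comp θ
  let : Algebra E (LaurentSeries (LaurentSeries K)) := φ.toAlgebra
  have hE : ∀ e, algebraMap E (LaurentSeries (LaurentSeries K)) e =
    laurentMap (algebraMap K (LaurentSeries K)) (θ e) := fun _ => rfl
  have hCK : ∀ a, algebraMap K (LaurentSeries K) a = HahnSeries.C a := algebraMap_laurentSeries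
  -- the perturbation parameter as a power series
  have hord : 0 < (laurentMap (algebraMap K (LaurentSeries K)) (θ σ)).orderTop := by
    rwa [orderTop_laurentMap]
  obtain ⟨ε, hε⟩ := exists_powerSeries_of_orderTop_nonneg hord.le
  have hεI : ε ∈ Ideal.span {(PowerSeries.X : PowerSeries (LaurentSeries K))} := by
    rw [Ideal.mem_span_singleton, PowerSeries.X_dvd_iff, ← (hasResidue_ofPowerSeries ε).2, ← hε]
    exact HahnSeries.coeff_eq_zero_of_lt_orderTop hord
  have hε0 : PowerSeries.constantCoeff ε = 0 := by
    rwa [Ideal.mem_span_singleton, PowerSeries.X_dvd_iff] at hεI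
  -- the hyperbola
  have hdisc := discriminant_affineRelation (fun i => (p i : ℤ)) (fun i => (q i : ℤ))
  rw [← hkdef] at hdisc
  set a := ∑ i, k i * (p i : ℤ) ^ 2 with ha
  set b := ∑ i, k i * ((p i : ℤ) * q i) with hb
  set d := ∑ i, k i * (q i : ℤ) ^ 2 with hd
  have hdisc' : (a : K) * d - (b : K) ^ 2 ≠ 0 := by
    have h1 : a * d - b ^ 2 ≠ 0 := by
      rw [hdisc]
      exact neg_ne_zero.2 (Finset.prod_ne_zero_iff.2 fun i _ => hk i)
    exact_mod_cast h1
  obtain ⟨α, β, γ, δ, hΔ, e1, e2, e3⟩ := exists_hyperbolic_basis hdisc'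
  -- The coordinate of the vanishing cycle `U * V = 1`. Here `κ = K((U))`, with `δ` the derivation
  -- `U d/dU`.
  let U : LaurentSeries K := HahnSeries.single 1 1
  have hU : U ≠ 0 := HahnSeries.single_ne_zero one_ne_zero
  let J : K →+* LaurentSeries K := algebraMap K (LaurentSeries K)
  have : CharZero (LaurentSeries K) := charZero_of_injective_ringHom J.injective
  have : CharZero (PowerSeries (LaurentSeries K)) :=
    charZero_of_injective_ringHom (algebraMap (LaurentSeries K) (PowerSeries (LaurentSeries K))).injective
  have hcast : ∀ z : ℤ, (z : LaurentSeries K) = J z := fun z => (map_intCast J z).symm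
  obtain ⟨V, W, hV, hVW⟩ := exists_hyperbolic_solution (κ := LaurentSeries K) hεI
    (k := k) (p := p) (q := q) (U := U) (α := J α) (β := J β) (γ := J γ) (δ := J δ)
    (sum_affineRelation _ _) (sum_affineRelation_mul_left _ _) (sum_affineRelation_mul_right _ _) hU
    (by
      rw [← ha, ← hb, ← hd, hcast, hcast, hcast, ← map_ofNat J 2]
      simp only [← map_mul, ← map_add, ← map_pow]
      rw [e1, map_zero])
    (by
      rw [← ha, ← hb, ← hd, hcast, hcast, hcast, ← map_ofNat J 2]
      simp only [← map_mul, ← map_add, ← map_pow]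
      rw [e2, map_zero])
    (by
      rw [← ha, ← hb, ← hd, hcast, hcast, hcast]
      simp only [← map_mul, ← map_add, ← map_pow]
      rw [e3, map_one])
  set X := algebraMap (LaurentSeries K) (PowerSeries (LaurentSeries K)) (J α * U) + algebraMap (LaurentSeries K) (PowerSeries (LaurentSeries K)) (J β) * V with hX
  set Y := algebraMap (LaurentSeries K) (PowerSeries (LaurentSeries K)) (J γ * U) + algebraMap (LaurentSeries K) (PowerSeries (LaurentSeries K)) (J δ) * V with hY
  have hC0 : ∀ a : LaurentSeries K, PowerSeries.constantCoeff (algebraMap (LaurentSeries K) (PowerSeries (LaurentSeries K)) a) = a := fun a => by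
    simp
  have hV0 : PowerSeries.constantCoeff V = U⁻¹ := by
    rw [hV, map_add, map_mul, hε0, zero_mul, add_zero, hC0]
  have hX0 : PowerSeries.constantCoeff X = J α * U + J β * U⁻¹ := by
    rw [hX, map_add, hC0, map_mul, hC0, hV0]
  have hY0 : PowerSeries.constantCoeff Y = J γ * U + J δ * U⁻¹ := by
    rw [hY, map_add, hC0, map_mul, hC0, hV0]
  have hsingle : ∀ α β : K, J α * U + J β * U⁻¹ = HahnSeries.single 1 α + HahnSeries.single (-1) β := by
    intro α β
    simp only [J, U, hCK]
    rw [HahnSeries.inv_single, HahnSeries.C_apply, HahnSeries.C_apply, HahnSeries.single_mul_single,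
      HahnSeries.single_mul_single]
    simp
  have hnotK : ∀ α β : K, (α ≠ 0 ∨ β ≠ 0) → ∀ a, algebraMap K (LaurentSeries K) a ≠ J α * U + J β * U⁻¹ := by
    intro α β hαβ a h
    rw [hsingle, hCK, HahnSeries.C_apply] at h
    have h1 := congrArg (fun f : LaurentSeries K => f.coeff 1) h
    have h2 := congrArg (fun f : LaurentSeries K => f.coeff (-1)) h
    simp [HahnSeries.coeff_single] at h1 h2
    rcases hαβ with h | h
    exacts [h h1.symm, h h2.symm]
  have heul : euler K (J α * U + J β * U⁻¹) = J α * U + J (-β) * U⁻¹ := by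
    rw [hsingle, hsingle]
    ext n
    rw [coeff_euler, HahnSeries.coeff_add, HahnSeries.coeff_add, HahnSeries.coeff_single,
      HahnSeries.coeff_single, HahnSeries.coeff_single]
    split_ifs with h1 h2 h2 <;> simp_all
  have hαβ : α ≠ 0 ∨ β ≠ 0 := by
    by_contra! h
    rw [h.1, h.2] at hΔ
    simp at hΔ
  have hγδ : γ ≠ 0 ∨ δ ≠ 0 := by
    by_contra! h
    rw [h.1, h.2] at hΔ
    simp at hΔ
  set D₀ := J α * U + J (-β) * U⁻¹ with hD₀
  have hD₀' : D₀ ≠ 0 := fun h => hnotK α (-β) (hαβ.imp id neg_ne_zero.2) 0 (by rw [map_zero, ← hD₀, h])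
  -- the solution in Laurent series and the corresponding embedding
  let co := HahnSeries.ofPowerSeries ℤ (LaurentSeries K)
  have hco : Function.Injective co := HahnSeries.ofPowerSeries_injective
  have hεM : algebraMap E (LaurentSeries (LaurentSeries K)) σ = co ε := by rw [hE, hε]
  have hres : ∀ Z, HasResidue (co (1 + ε * Z)) 1 := fun Z => by
    have h1 : PowerSeries.constantCoeff (1 + ε * Z) = 1 := by simp [hε0]
    exact h1 ▸ hasResidue_ofPowerSeries (1 + ε * Z)
  have hne : ∀ Z, co (1 + ε * Z) ≠ 0 := fun Z h => by
    have := (hres Z).2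
    rw [h] at this
    exact zero_ne_one this
  have hε1 : co ε ≠ 0 := by
    rw [← hεM, map_ne_zero]
    rintro rfl
    exact hσ 0 (map_zero _)
  have hrel : ∑ i, algebraMap E (LaurentSeries (LaurentSeries K)) (c i) *
      (co (1 + ε * X) ^ (p i : ℤ) * co (1 + ε * Y) ^ (q i : ℤ)) = 0 := by
    have h1 := congrArg co hVW
    simp only [Fin.sum_univ_four] at h1 ⊢
    rw [hc0, hci 1 (by decide), hci 2 (by decide), hci 3 (by decide), map_sub, map_pow, hεM]
    simp only [map_add, map_mul, map_pow, map_intCast, map_one] at h1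
    simp only [map_intCast, zpow_natCast, map_add, map_mul, map_one]
    linear_combination h1
  have htr : Transcendental E (co (1 + ε * X)) := by
    have h1 := transcendental_of_hasResidue θ hE
      (by have := hasResidue_ofPowerSeries X; rwa [hX0] at this) (hnotK α β hαβ)
    intro h2
    apply h1
    have h3 : co X = (algebraMap E (LaurentSeries (LaurentSeries K)) σ)⁻¹ * (co (1 + ε * X) - algebraMap E _ 1) := by
      rw [eq_inv_mul_iff_mul_eq₀ (by rwa [hεM]), hεM]
      simp
    change IsAlgebraic E (co X)
    rw [h3]
    exact (isAlgebraic_algebraMap σ).inv.mul (h2.sub (isAlgebraic_algebraMap 1))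
  obtain ⟨ι, hιx, hιy⟩ := hxy.lift (LaurentSeries (LaurentSeries K)) (co (1 + ε * X)) (co (1 + ε * Y)) (hne _) (hne _)
    hrel (Or.inl htr)
  -- the partial derivative
  obtain ⟨h, hh⟩ := exists_sum_eq_linear (A := PowerSeries (LaurentSeries K)) (k := k) (p := p) (q := q)
    (sum_affineRelation_mul_right _ _) ε X Y
  rw [← hb, ← hd] at hh
  set G := (b : PowerSeries (LaurentSeries K)) * X + (d : PowerSeries (LaurentSeries K)) * Y + ε * (algebraMap (LaurentSeries K) _ (1 / 4) * h -
    q 0 * ((1 + ε * X) ^ p 0 * (1 + ε * Y) ^ q 0)) with hG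
  have hιg : ι (∑ i, algebraMap E L (c i) * (q i : ℤ) * (x ^ (p i : ℤ) * y ^ (q i : ℤ))) =
      co ε * co G := by
    rw [map_sum]
    simp only [map_mul, AlgHom.commutes, map_intCast, map_zpow₀, hιx, hιy, Fin.sum_univ_four]
    rw [hc0, hci 1 (by decide), hci 2 (by decide), hci 3 (by decide), map_sub, map_pow, hεM]
    have h4 : (4 : PowerSeries (LaurentSeries K)) * algebraMap (LaurentSeries K) (PowerSeries (LaurentSeries K)) (1 / 4) = 1 := by
      rw [← map_ofNat (algebraMap (LaurentSeries K) (PowerSeries (LaurentSeries K))) 4, ← map_mul]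
      norm_num
    have h5 : (4 : PowerSeries (LaurentSeries K)) ≠ 0 := by norm_num
    have h6 : ∑ i, (k i : PowerSeries (LaurentSeries K)) * q i * ((1 + ε * X) ^ p i * (1 + ε * Y) ^ q i) -
        ε ^ 2 * (q 0 * ((1 + ε * X) ^ p 0 * (1 + ε * Y) ^ q 0)) = ε * G := by
      apply mul_left_cancel₀ h5
      rw [hG]
      linear_combination hh - ε ^ 2 * h * h4
    have h7 := congrArg co h6
    simp only [Fin.sum_univ_four] at h7
    simp only [map_add, map_sub, map_mul, map_pow, map_intCast, map_natCast, map_one] at h7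
    simp only [map_intCast, zpow_natCast, map_add, map_mul, map_one, Int.cast_natCast]
    linear_combination h7
  -- In a hyperbolic basis the linear form `b X + d Y` is, up to the determinant, the Euler
  -- derivative `D₀` of `X` on the hyperbola. Hence `D₀` cancels in the leading coefficient of the
  -- differential.
  have hG0 : PowerSeries.constantCoeff G = J (α * δ - β * γ)⁻¹ * D₀ := by
    have hG' : PowerSeries.constantCoeff G = (b : LaurentSeries K) * (J α * U + J β * U⁻¹) +
        (d : LaurentSeries K) * (J γ * U + J δ * U⁻¹) := by
      rw [hG, map_add, map_add, map_mul, map_mul, map_mul, hX0, hY0, hε0, map_intCast, map_intCast,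
        zero_mul, add_zero]
    rw [hG', hcast, hcast, hD₀]
    have f1 : (b : K) * α + d * γ = (α * δ - β * γ)⁻¹ * α := by
      rw [eq_inv_mul_iff_mul_eq₀ hΔ]
      linear_combination α * e3 - β * e1
    have f2 : (b : K) * β + d * δ = (α * δ - β * γ)⁻¹ * (-β) := by
      rw [eq_inv_mul_iff_mul_eq₀ hΔ]
      linear_combination α * e2 - β * e3
    have f1' := congrArg J f1
    have f2' := congrArg J f2
    simp only [map_add, map_mul] at f1' f2'
    linear_combination U * f1' + U⁻¹ * f2'
  have hΔ' : J (α * δ - β * γ) ≠ 0 := (map_ne_zero J).2 hΔ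
  have hG0' : J (α * δ - β * γ)⁻¹ * D₀ ≠ 0 := by
    rw [map_inv₀]
    exact mul_ne_zero (inv_ne_zero hΔ') hD₀'
  have hGres : HasResidue (co G) (J (α * δ - β * γ)⁻¹ * D₀) := hG0 ▸ hasResidue_ofPowerSeries G
  have hG1 : co G ≠ 0 := by
    intro h
    have := hGres.2
    rw [h] at this
    exact hG0' this.symm
  have hc0' : ∀ a, algebraMap K E a ≠ c 0 := by
    intro a ha
    refine zpow_ne_algebraMap hσ (n := 2) two_ne_zero (k 0 - a) ?_
    rw [map_sub, map_intCast, ha, hc0]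
    norm_cast
    ring
  have hω := mem_regularDifferentials_of_isInteriorPoint hxy.x_ne_zero hxy.y_ne_zero
    (ne_or_ne_of_affineRelation_ne_zero hk) (c := c) (fun i => by
      by_cases hi : i = 0
      · rw [hi]
        intro h0
        exact hc0' 0 (by rw [h0, map_zero])
      · rw [hci i hi]
        exact_mod_cast hk i) hxy.relation
    (by
      rw [← map_ne_zero ι, hιg]
      exact mul_ne_zero hε1 hG1) ⟨0, hk 0⟩
    (prod_zpow_ne (hk 0) hc0' fun i hi _ => hci i hi) hr
  set g := ∑ i, algebraMap E L (c i) * (q i : ℤ) * (x ^ (p i : ℤ) * y ^ (q i : ℤ)) with hgdef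
  have hval : HasResidue (ι (x ^ r₁ * y ^ r₂ * g⁻¹ * x⁻¹) * coeffMap (euler K) (ι x))
      (J (α * δ - β * γ)) := by
    have h1 : coeffMap (euler K) (ι x) = co ε * coeffMap (euler K) (co X) := by
      rw [hιx, map_add, map_mul, map_one, ← hεM, hE]
      exact coeffMap_one_add_laurentMap_mul (δ := euler K) euler_mul (fun a => by
        rw [hCK]
        ext n
        rw [coeff_euler, HahnSeries.C_apply, HahnSeries.coeff_single]
        split_ifs with hn <;> simp [hn]) _ _
    have h2 : ι (x ^ r₁ * y ^ r₂ * g⁻¹ * x⁻¹) * coeffMap (euler K) (ι x) =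
        co (1 + ε * X) ^ r₁ * co (1 + ε * Y) ^ r₂ * (co G)⁻¹ * (co (1 + ε * X))⁻¹ *
          coeffMap (euler K) (co X) := by
      rw [h1]
      simp only [map_mul, map_inv₀, map_zpow₀, hιg, hιx, hιy, mul_inv]
      field_simp
    have h3 : HasResidue (coeffMap (euler K) (co X)) D₀ := by
      have h4 := (hasResidue_ofPowerSeries X).coeffMap (euler K)
      rwa [hX0, heul] at h4
    rw [h2]
    have h4 := (((((hres X).zpow one_ne_zero r₁).mul ((hres Y).zpow one_ne_zero r₂)).mul
      (hGres.inv hG0')).mul ((hres X).inv one_ne_zero)).mul h3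
    convert h4 using 1
    rw [one_zpow, one_zpow, map_inv₀]
    field_simp
  -- The leading coefficient is a nonzero constant, that is, a multiple of `dU / U`. Its coefficient
  -- of index `0` shows that it is not an Euler derivative, and its order is `0`.
  rcases exists_primitive_or_vanishing hc h1F hSF hF θ ι.toRingHom
    (fun e => by rw [← hE]; exact ι.commutes e) hθK (RingHom.id (LaurentSeries K)) hCK (euler K) (fun _ => rfl) hω
    (m := 0) (hval.orderTop_eq hΔ') with ⟨f, hf⟩ | h1
  · have h1 : euler K f = J (α * δ - β * γ) := hf.trans hval.2
    have h2 := congrArg (fun f : LaurentSeries K => f.coeff 0) h1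
    rw [coeff_euler, show J (α * δ - β * γ) = HahnSeries.C _ from hCK _] at h2
    simp at h2
    exact hΔ h2.symm
  · have h2 : (1 : WithTop ℤ) ≤ (J (α * δ - β * γ)).orderTop := hval.2 ▸ h1
    rw [show J (α * δ - β * γ) = HahnSeries.C _ from hCK _, HahnSeries.C_apply,
      HahnSeries.orderTop_single hΔ] at h2
    exact absurd h2 (by decide)

end Conic

/-! ### A first order linear differential equation without algebraic solutions -/

section LinearEquation

theorem leibniz_pow_of_leibniz {M : Type*} [CommRing M] {D : M →+ M}
    (hD : ∀ a b, D (a * b) = a * D b + b * D a) (x : M) (n : ℕ) :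
    D (x ^ n) = n * x ^ (n - 1) * D x := by
  have h1 : D 1 = 0 := by
    have := hD 1 1
    simpa using this
  induction n with
  | zero => simp [h1]
  | succ n ih =>
    rw [pow_succ, hD, ih]
    rcases n with _ | n
    · simp
    · push_cast
      ring

theorem exists_apply_aeval_eq {k M : Type*} [Field k] [Field M] [Algebra k M] {D : M →+ M}
    (hD : ∀ a b, D (a * b) = a * D b + b * D a) {d : k →+ k}
    (hd : ∀ a, D (algebraMap k M a) = algebraMap k M (d a)) (x : M) (p : Polynomial k) :
    ∃ q : Polynomial k, (∀ n, q.coeff n = d (p.coeff n)) ∧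
      D (Polynomial.aeval x p) =
        Polynomial.aeval x q + Polynomial.aeval x (Polynomial.derivative p) * D x := by
  induction p using Polynomial.induction_on' with
  | add p q hp hq =>
    obtain ⟨p', hp1, hp2⟩ := hp
    obtain ⟨q', hq1, hq2⟩ := hq
    refine ⟨p' + q', fun n => by simp [hp1, hq1], ?_⟩
    simp only [map_add, hp2, hq2, Polynomial.derivative_add]
    ring
  | monomial n a =>
    refine ⟨Polynomial.monomial n (d a), fun m => ?_, ?_⟩
    · rw [Polynomial.coeff_monomial, Polynomial.coeff_monomial]
      split_ifs <;> simp
    · rw [Polynomial.aeval_monomial, hD, hd, leibniz_pow_of_leibniz hD,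
        Polynomial.derivative_monomial, Polynomial.aeval_monomial, Polynomial.aeval_monomial]
      simp only [map_mul, map_natCast]
      ring

theorem apply_aeval_eq {k M : Type*} [Field k] [Field M] [Algebra k M] {D : M →+ M}
    (hD : ∀ a b, D (a * b) = a * D b + b * D a) (hd : ∀ a, D (algebraMap k M a) = 0) (x : M)
    (p : Polynomial k) :
    D (Polynomial.aeval x p) = Polynomial.aeval x (Polynomial.derivative p) * D x := by
  obtain ⟨q, hq, h⟩ := exists_apply_aeval_eq hD (d := (0 : k →+ k)) (by simpa using hd) x p
  have : q = 0 := Polynomial.ext fun n => by simp [hq]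
  rw [h, this, map_zero, zero_add]

/-- A first order linear differential equation with an algebraic solution has a rational one. -/
theorem exists_rational_solution {k M : Type*} [Field k] [CharZero k] [Field M] [Algebra k M]
    {D : M →+ M} (hD : ∀ a b, D (a * b) = a * D b + b * D a) {d : k →+ k}
    (hd : ∀ a, D (algebraMap k M a) = algebraMap k M (d a)) {x : M} (hx : IsAlgebraic k x) {b c : k}
    (hxD : D x = algebraMap k M b * x + algebraMap k M c) : ∃ h : k, d h = b * h + c := by
  set m := minpoly k x with hm
  have hint := hx.isIntegral
  have hmonic := minpoly.monic hint
  obtain ⟨q, hq, hqD⟩ := exists_apply_aeval_eq hD hd x m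
  have hdeg : 0 < m.natDegree := minpoly.natDegree_pos hint
  have hd1 : d 1 = 0 := (algebraMap k M).injective (by
    rw [← hd, map_one, map_zero]
    have := hD 1 1
    simpa using this)
  -- Differentiating `m(x) = 0` gives a polynomial relation for `x`. Subtracting `natDegree * b`
  -- times `m` kills its leading term, so the remainder has smaller degree than `m` and is zero. Its
  -- next coefficient is the equation for `-e / natDegree`, the mean of the conjugates of `x`.
  set s := q + Polynomial.derivative m * (Polynomial.C b * Polynomial.X + Polynomial.C c) -
    Polynomial.C (m.natDegree * b) * m with hs
  have hcoeff : ∀ n, s.coeff n = d (m.coeff n) + (n * b - m.natDegree * b) * m.coeff n +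
      (n + 1) * c * m.coeff (n + 1) := by
    intro n
    rw [hs, Polynomial.coeff_sub, Polynomial.coeff_add, hq, mul_add, Polynomial.coeff_add,
      Polynomial.coeff_C_mul, Polynomial.coeff_mul_C, Polynomial.coeff_derivative]
    rcases n with _ | n
    · simp
      ring
    · rw [mul_left_comm, Polynomial.coeff_C_mul, Polynomial.coeff_mul_X,
        Polynomial.coeff_derivative]
      push_cast
      ring
  have hs0 : s = 0 := by
    by_contra h0
    have h1 : Polynomial.aeval x s = 0 := by
      rw [hm, minpoly.aeval, map_zero, hxD] at hqD
      rw [hs, map_sub, map_add, map_mul, map_mul, hm, minpoly.aeval, mul_zero, sub_zero, map_add,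
        map_mul, Polynomial.aeval_C, Polynomial.aeval_C, Polynomial.aeval_X, ← hqD]
    have h2 := minpoly.degree_le_of_ne_zero k x h0 h1
    rw [← hm, Polynomial.degree_eq_natDegree hmonic.ne_zero] at h2
    refine absurd h2 (not_le.2 ((Polynomial.degree_lt_iff_coeff_zero _ _).2 fun n hn => ?_))
    rw [hcoeff, Polynomial.coeff_eq_zero_of_natDegree_lt (Nat.lt_succ_of_le hn), mul_zero, add_zero]
    rcases hn.eq_or_lt with rfl | hn
    · rw [hmonic.coeff_natDegree, hd1, sub_self, zero_mul, zero_add]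
    · rw [Polynomial.coeff_eq_zero_of_natDegree_lt hn, map_zero, mul_zero, zero_add]
  have h1 := hcoeff (m.natDegree - 1)
  rw [hs0, Polynomial.coeff_zero, Nat.sub_add_cancel hdeg, hmonic.coeff_natDegree,
    Nat.cast_sub hdeg] at h1
  have hn : (m.natDegree : k) ≠ 0 := Nat.cast_ne_zero.2 hdeg.ne'
  set e := m.coeff (m.natDegree - 1) with he
  have h2 : d e = m.natDegree * d (e / m.natDegree) := by
    rw [← nsmul_eq_mul, ← map_nsmul, nsmul_eq_mul, mul_div_cancel₀ _ hn]
  rw [h2] at h1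
  refine ⟨-(e / m.natDegree), ?_⟩
  rw [map_neg]
  apply mul_left_cancel₀ hn
  have h3 : e = m.natDegree * (e / m.natDegree) := by rw [mul_div_cancel₀ _ hn]
  push_cast at h1
  linear_combination h1 - b * h3

/-- The equation for `h = p / q` is `(X² - 1) h' + c X h = k`. A pole of `h` of order `n + 1` must
lie at `±1`, the zeros of the leading coefficient, where comparison of principal parts gives `c = 2
(n + 1)`. A polynomial solution has `c = -deg p` by comparison of the top terms, as the right hand
side is constant. -/
theorem linear_equation_ne {K : Type*} [Field K] [IsAlgClosed K] [CharZero K] {p q : Polynomial K}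
    (hpq : IsCoprime p q) (hq : q ≠ 0) {c k : K} (hk : k ≠ 0) (hc : ∀ n : ℕ, c ≠ 2 * (n + 1))
    (hc' : ∀ n : ℕ, c ≠ -n)
    (h : (Polynomial.X ^ 2 - 1) * (Polynomial.derivative p * q - p * Polynomial.derivative q) +
      Polynomial.C c * Polynomial.X * p * q = Polynomial.C k * q ^ 2) : False := by
  by_cases hdeg : q.degree = 0
  · rw [Polynomial.eq_C_of_degree_eq_zero hdeg] at h hq
    set e := q.coeff 0
    have he : e ≠ 0 := by simpa using hq
    rw [Polynomial.derivative_C, mul_zero, sub_zero] at h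
    by_cases hp : p = 0
    · rw [hp] at h
      simp [hk, he] at h
    · have h0 : Polynomial.C e * (Polynomial.X * (Polynomial.X * Polynomial.derivative p)) -
          Polynomial.C e * Polynomial.derivative p + Polynomial.C (c * e) * (Polynomial.X * p) =
          Polynomial.C (k * e ^ 2) := by
        simp only [map_mul, map_pow]
        linear_combination h
      have h1 := congrArg (fun f => Polynomial.coeff f (p.natDegree + 1)) h0
      have h2 : (Polynomial.X * Polynomial.derivative p).coeff p.natDegree =
          p.natDegree * p.leadingCoeff := by
        rcases hn : p.natDegree with _ | n
        · simp
        · rw [Polynomial.coeff_X_mul, Polynomial.coeff_derivative, Polynomial.leadingCoeff, hn]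
          push_cast
          ring
      simp only [Polynomial.coeff_add, Polynomial.coeff_sub, Polynomial.coeff_C_mul,
        Polynomial.coeff_X_mul, h2, Polynomial.coeff_derivative, Polynomial.coeff_C_succ,
        Polynomial.coeff_eq_zero_of_natDegree_lt (show p.natDegree < p.natDegree + 1 + 1 by omega),
        Polynomial.coeff_natDegree] at h1
      have h3 : e * p.leadingCoeff * (p.natDegree + c) = 0 := by linear_combination h1
      rcases mul_eq_zero.1 h3 with h4 | h4
      · exact mul_ne_zero he (Polynomial.leadingCoeff_ne_zero.2 hp) h4
      · exact hc' p.natDegree (by linear_combination h4)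
  · obtain ⟨u, hu⟩ := IsAlgClosed.exists_root q hdeg
    obtain ⟨r, hr, hru⟩ := Polynomial.exists_eq_pow_rootMultiplicity_mul_and_not_dvd q hq u
    have hm : 0 < q.rootMultiplicity u := (Polynomial.rootMultiplicity_pos hq).2 hu
    obtain ⟨n, hn⟩ : ∃ n, q.rootMultiplicity u = n + 1 := ⟨q.rootMultiplicity u - 1, by omega⟩
    rw [hn] at hr
    have hr0 : r.eval u ≠ 0 := fun h0 => hru (Polynomial.dvd_iff_isRoot.2 h0)
    have hp0 : p.eval u ≠ 0 := by
      intro h0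
      obtain ⟨a, b, hab⟩ := hpq
      have := congrArg (Polynomial.eval u) hab
      simp [h0, hu.eq_zero] at this
    have hq' : Polynomial.derivative q = (Polynomial.X - Polynomial.C u) ^ n *
        (((n + 1 : ℕ) : Polynomial K) * r + (Polynomial.X - Polynomial.C u) * Polynomial.derivative r) := by
      rw [hr, Polynomial.derivative_mul, Polynomial.derivative_pow]
      simp
      ring
    have hX : (Polynomial.X - Polynomial.C u : Polynomial K) ≠ 0 := Polynomial.X_sub_C_ne_zero u
    have h1 : (Polynomial.X ^ 2 - 1) * (Polynomial.derivative p * (Polynomial.X - Polynomial.C u) * r -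
        p * (((n + 1 : ℕ) : Polynomial K) * r + (Polynomial.X - Polynomial.C u) * Polynomial.derivative r)) +
      Polynomial.C c * Polynomial.X * p * ((Polynomial.X - Polynomial.C u) * r) =
      Polynomial.C k * (Polynomial.X - Polynomial.C u) ^ (n + 2) * r ^ 2 := by
      apply mul_left_cancel₀ (pow_ne_zero n hX)
      rw [hq', hr] at h
      linear_combination h
    have h2 := congrArg (Polynomial.eval u) h1
    simp only [Polynomial.eval_add, Polynomial.eval_sub, Polynomial.eval_mul, Polynomial.eval_pow,
      Polynomial.eval_X, Polynomial.eval_C, Polynomial.eval_one, Polynomial.eval_natCast, sub_self,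
      zero_mul, mul_zero, add_zero, zero_sub, zero_pow (Nat.succ_ne_zero _)] at h2
    have hn1 : ((n + 1 : ℕ) : K) ≠ 0 := Nat.cast_ne_zero.2 n.succ_ne_zero
    have hu2 : u ^ 2 - 1 = 0 := by
      have h3 : (u ^ 2 - 1) * (p.eval u * (((n + 1 : ℕ) : K) * r.eval u)) = 0 := by
        linear_combination -h2
      exact (mul_eq_zero.1 h3).resolve_right (mul_ne_zero hp0 (mul_ne_zero hn1 hr0))
    have hu0 : u ≠ 0 := by
      rintro rfl
      norm_num at hu2
    have hfac : (Polynomial.X ^ 2 - 1 : Polynomial K) =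
        (Polynomial.X - Polynomial.C u) * (Polynomial.X + Polynomial.C u) := by
      have h3 := congrArg Polynomial.C hu2
      simp only [map_sub, map_pow, map_one, map_zero] at h3
      linear_combination h3
    rw [hfac] at h1
    have h3 : (Polynomial.X + Polynomial.C u) * (Polynomial.derivative p *
        (Polynomial.X - Polynomial.C u) * r - p * (((n + 1 : ℕ) : Polynomial K) * r +
          (Polynomial.X - Polynomial.C u) * Polynomial.derivative r)) +
        Polynomial.C c * Polynomial.X * p * r =
        Polynomial.C k * (Polynomial.X - Polynomial.C u) ^ (n + 1) * r ^ 2 := by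
      apply mul_left_cancel₀ hX
      linear_combination h1
    have h4 := congrArg (Polynomial.eval u) h3
    simp only [Polynomial.eval_add, Polynomial.eval_sub, Polynomial.eval_mul, Polynomial.eval_pow,
      Polynomial.eval_X, Polynomial.eval_C, Polynomial.eval_natCast, sub_self,
      zero_mul, mul_zero, add_zero, zero_sub, zero_pow (Nat.succ_ne_zero _)] at h4
    have h5 : (u * p.eval u * r.eval u) * (c - 2 * (n + 1)) = 0 := by
      push_cast at h4
      linear_combination h4
    exact hc n (sub_eq_zero.1 ((mul_eq_zero.1 h5).resolve_left
      (mul_ne_zero (mul_ne_zero hu0 hp0) hr0)))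

end LinearEquation

/-! ### The field `K(U, Y)` with `Y ^ a = U ^ 2 - 1` -/

section Superelliptic

universe v

theorem exists_pow_eq_of_isAdicComplete {A : Type*} [CommRing A] {I : Ideal A} [IsAdicComplete I A]
    {a : ℕ} (ha : a ≠ 0) (hau : IsUnit (a : A)) {w y : A} (hy : IsUnit y) (h : y ^ a - w ∈ I) :
    ∃ z, z ^ a = w ∧ z - y ∈ I := by
  have : HenselianRing A I := inferInstance
  obtain ⟨z, hz, hzy⟩ := HenselianRing.is_henselian (I := I)
    (Polynomial.X ^ a - Polynomial.C w) (Polynomial.monic_X_pow_sub_C w ha) y (by simpa using h) (by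
      refine IsUnit.map _ ?_
      rw [show (Polynomial.derivative (Polynomial.X ^ a - Polynomial.C w)).eval y =
        a * y ^ (a - 1) by simp [Polynomial.derivative_X_pow]]
      exact hau.mul (hy.pow (a - 1)))
  exact ⟨z, by simpa [Polynomial.IsRoot, sub_eq_zero] using hz, hzy⟩

theorem apply_mem_adjoin {K M : Type*} [Field K] [Field M] [Algebra K M] {D : M →+ M}
    (hD : ∀ a b, D (a * b) = a * D b + b * D a) (hDK : ∀ a, D (algebraMap K M a) = 0) {S : Set M}
    (hS : ∀ s ∈ S, D s ∈ IntermediateField.adjoin K S) {z : M}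
    (hz : z ∈ IntermediateField.adjoin K S) : D z ∈ IntermediateField.adjoin K S := by
  induction hz using IntermediateField.adjoin_induction with
  | mem x hx => exact hS x hx
  | algebraMap x => rw [hDK]; exact zero_mem _
  | add x y _ _ hx hy => rw [map_add]; exact add_mem hx hy
  | mul x y hx' hy' hx hy => rw [hD]; exact add_mem (mul_mem hx' hy) (mul_mem hy' hx)
  | inv x hx' hx =>
    by_cases h0 : x = 0
    · simp [h0]
    · have h1 : D 1 = 0 := by rw [← map_one (algebraMap K M), hDK]
      have h2 := hD x x⁻¹
      rw [mul_inv_cancel₀ h0, h1] at h2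
      have h3 : D x⁻¹ = -(x⁻¹ * x⁻¹ * D x) := by
        apply mul_left_cancel₀ h0
        have h4 := mul_inv_cancel₀ h0
        linear_combination -h2 + x⁻¹ * D x * h4
      rw [h3]
      exact neg_mem (mul_mem (mul_mem (inv_mem hx') (inv_mem hx')) hx)

theorem mul_apply_eq_of_pow_eq {M : Type*} [Field M] [CharZero M] {D : M →+ M}
    (hD : ∀ a b, D (a * b) = a * D b + b * D a) {U Y : M} {a : ℕ} (ha : 0 < a) (hDU : D U = -a * U)
    (hY : Y ^ a = U ^ 2 - 1) : (U ^ 2 - 1) * D Y = -2 * U ^ 2 * Y := by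
  have hDpow := leibniz_pow_of_leibniz hD
  have hD1 : D 1 = 0 := by simpa using hD 1 1
  have h1 := congrArg D hY
  rw [hDpow, map_sub, hDpow, hD1, hDU] at h1
  have h2 : Y ^ a = Y ^ (a - 1) * Y := by rw [← pow_succ, Nat.sub_add_cancel ha]
  apply mul_left_cancel₀ (Nat.cast_ne_zero.2 ha.ne' : (a : M) ≠ 0)
  rw [← hY, h2]
  push_cast at h1
  linear_combination Y * h1

/-- Since `D U = -a U`, the statement says that `Y ^ (r - a) dU` is not exact on `Y ^ a = U ^ 2 -
1`. Dividing a primitive by `Y ^ r` turns the question into a first order linear equation over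
`K(U)`. An algebraic solution yields a rational one, and `linear_equation_ne` with `c = 2 r / a`
excludes that. -/
theorem apply_ne_of_mem_adjoin {K M : Type*} [Field K] [IsAlgClosed K] [CharZero K] [Field M]
    [Algebra K M] {D : M →+ M} (hD : ∀ a b, D (a * b) = a * D b + b * D a)
    (hDK : ∀ a, D (algebraMap K M a) = 0) {U Y : M} (hU : Transcendental K U) {a r : ℕ}
    (hr : 0 < r) (hra : r < a) (hDU : D U = -a * U) (hY : Y ^ a = U ^ 2 - 1) {e : K} (he : e ≠ 0)
    {g : M} (hg : g ∈ IntermediateField.adjoin K {U, Y}) :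
    D g ≠ algebraMap K M e * U * Y ^ ((r : ℤ) - a) := by
  intro hDg
  have : CharZero M := charZero_of_injective_algebraMap (algebraMap K M).injective
  have ha : 0 < a := by omega
  have ha0 : (a : M) ≠ 0 := Nat.cast_ne_zero.2 ha.ne'
  have hU0 : U ≠ 0 := fun h => hU (h ▸ isAlgebraic_zero)
  have hU1 : U ^ 2 - 1 ≠ 0 := by
    intro h
    refine hU ⟨Polynomial.X ^ 2 - Polynomial.C 1, Polynomial.X_pow_sub_C_ne_zero two_pos 1, ?_⟩
    simpa using h
  have hY0 : Y ≠ 0 := by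
    rintro rfl
    rw [zero_pow ha.ne'] at hY
    exact hU1 hY.symm
  have hDpow := leibniz_pow_of_leibniz hD
  have hDY := mul_apply_eq_of_pow_eq hD ha hDU hY
  -- divide by a power of `Y`
  set G := g / Y ^ r with hG
  have hgG : g = G * Y ^ r := by rw [hG, div_mul_cancel₀ _ (pow_ne_zero _ hY0)]
  have hDG : (U ^ 2 - 1) * D G = 2 * r * U ^ 2 * G + algebraMap K M e * U := by
    have h1 : Y ^ ((r : ℤ) - a) = Y ^ r / (U ^ 2 - 1) := by
      rw [zpow_sub₀ hY0, zpow_natCast, zpow_natCast, hY]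
    rw [h1, hgG, hD, hDpow] at hDg
    have h2 : Y ^ r = Y ^ (r - 1) * Y := by rw [← pow_succ, Nat.sub_add_cancel hr]
    have h3 : (U ^ 2 - 1) * (Y ^ r / (U ^ 2 - 1)) = Y ^ r := mul_div_cancel₀ _ hU1
    apply mul_left_cancel₀ (pow_ne_zero r hY0)
    rw [h2] at h3 hDg ⊢
    linear_combination (U ^ 2 - 1) * hDg + algebraMap K M e * U * h3 - G * r * Y ^ (r - 1) * hDY
  -- a solution in `K(U)`
  let k := IntermediateField.adjoin K {U}
  have hUk : U ∈ k := IntermediateField.mem_adjoin_simple_self K U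
  have hDk : ∀ z ∈ k, D z ∈ k := fun z hz => apply_mem_adjoin hD hDK (by
    rintro _ rfl
    rw [hDU]
    exact mul_mem (neg_mem (natCast_mem k a)) hUk) hz
  let d : k →+ k :=
    { toFun := fun z => ⟨D z, hDk z z.2⟩
      map_zero' := Subtype.ext (map_zero D)
      map_add' := fun x y => Subtype.ext (map_add D _ _) }
  have hGalg : IsAlgebraic k G := by
    have h1 : IntermediateField.adjoin K {U, Y} ≤
        (algebraicClosure k M).restrictScalars K := by
      rw [IntermediateField.adjoin_le_iff]
      have hUa : IsAlgebraic k U := isAlgebraic_algebraMap (⟨U, hUk⟩ : k)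
      rintro _ (rfl | rfl)
      · exact mem_algebraicClosure_iff.2 hUa
      · refine mem_algebraicClosure_iff.2 (IsAlgebraic.of_pow ha ?_)
        rw [hY]
        exact (hUa.pow 2).sub isAlgebraic_one
    have h2 : g ∈ algebraicClosure k M := h1 hg
    have h3 : Y ∈ algebraicClosure k M :=
      h1 (IntermediateField.subset_adjoin K _ (Set.mem_insert_of_mem _ rfl))
    exact mem_algebraicClosure_iff.1 (div_mem h2 (pow_mem h3 r))
  have : CharZero k := charZero_of_injective_algebraMap (algebraMap K k).injective
  obtain ⟨H, hH⟩ := exists_rational_solution (k := k) hD (d := d) (fun _ => rfl) hGalg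
    (b := ⟨2 * r * U ^ 2 / (U ^ 2 - 1), div_mem (mul_mem (mul_mem (ofNat_mem k 2) (natCast_mem k r))
      (pow_mem hUk 2)) (sub_mem (pow_mem hUk 2) (one_mem k))⟩)
    (c := ⟨algebraMap K M e * U / (U ^ 2 - 1), div_mem (mul_mem (algebraMap_mem k e) hUk)
      (sub_mem (pow_mem hUk 2) (one_mem k))⟩) (by
      change D G = 2 * r * U ^ 2 / (U ^ 2 - 1) * G + algebraMap K M e * U / (U ^ 2 - 1)
      field_simp
      linear_combination hDG)
  have hH' : (U ^ 2 - 1) * D H = 2 * r * U ^ 2 * H + algebraMap K M e * U := by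
    have h1 : D H = 2 * r * U ^ 2 / (U ^ 2 - 1) * H + algebraMap K M e * U / (U ^ 2 - 1) :=
      congrArg Subtype.val hH
    rw [h1]
    field_simp
  obtain ⟨p, q, hpq, hq, hHq⟩ := exists_isCoprime_div H.2
  have hDp := apply_aeval_eq hD hDK U p
  have hDq := apply_aeval_eq hD hDK U q
  have h1 := congrArg D hHq
  rw [hD, hDp, hDq, hDU] at h1
  have haK : (a : K) ≠ 0 := Nat.cast_ne_zero.2 ha.ne'
  -- As `0 < r < a`, the number `2 * r / a` lies strictly between `0` and `2`, so it is none of the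
  -- exceptional values.
  refine linear_equation_ne hpq (by rintro rfl; simp at hq) (c := 2 * r / a) (k := -(e / a))
    (neg_ne_zero.2 (div_ne_zero he haK)) (fun n hn => ?_) (fun n hn => ?_) ?_
  · rw [div_eq_iff haK, mul_assoc] at hn
    have h2 : (r : K) = ((n + 1) * a : ℕ) := by
      push_cast
      exact mul_left_cancel₀ two_ne_zero hn
    have h3 : r = (n + 1) * a := by exact_mod_cast h2
    nlinarith
  · rw [div_eq_iff haK] at hn
    have h2 : ((2 * r + n * a : ℕ) : K) = 0 := by
      push_cast
      linear_combination hn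
    have h3 : 2 * r + n * a = 0 := by exact_mod_cast h2
    omega
  · apply transcendental_iff_injective.1 hU
    have hc : algebraMap K M (2 * r / a) = 2 * r / a := by simp [map_ofNat]
    have hc' : algebraMap K M (-(e / a)) = -(algebraMap K M e / a) := by simp
    simp only [map_add, map_sub, map_mul, map_pow, Polynomial.aeval_X, Polynomial.aeval_C, map_one,
      hc, hc']
    apply mul_left_cancel₀ (mul_ne_zero ha0 hU0)
    have h2 : (H : M) * Polynomial.aeval U q = Polynomial.aeval U p := hHq
    have h3 : (a : M) * (2 * r / a) = 2 * r := mul_div_cancel₀ _ ha0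
    have h4 : (a : M) * (algebraMap K M e / a) = algebraMap K M e := mul_div_cancel₀ _ ha0
    linear_combination (U ^ 2 - 1) * Polynomial.aeval U q * h1 - Polynomial.aeval U q ^ 2 * hH' +
      ((U ^ 2 - 1) * a * U * Polynomial.aeval U (Polynomial.derivative q) -
        2 * r * U ^ 2 * Polynomial.aeval U q) * h2 +
      U ^ 2 * Polynomial.aeval U p * Polynomial.aeval U q * h3 +
      U * Polynomial.aeval U q ^ 2 * h4

/-- The field is realised inside `K((T))` at a place at infinity: `U = T ^ (-a)` and `Y = T ^ (-2)
Z` with `Z ^ a = 1 - T ^ (2 a)`. The derivation is the restriction of `T d/dT`, so that `j` is the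
inclusion. -/
theorem exists_superelliptic_model (K : Type v) [Field K] [IsAlgClosed K] [CharZero K] {a : ℕ}
    (ha : 0 < a) :
    ∃ (κ : Type v) (_ : Field κ) (_ : Algebra K κ) (j : κ →+* LaurentSeries K) (δ : κ →+ κ)
      (U Y : κ), (∀ b, j (algebraMap K κ b) = HahnSeries.C b) ∧ (∀ u, j (δ u) = euler K (j u)) ∧
      δ U = -a * U ∧ Y ^ a = U ^ 2 - 1 ∧ (j U).orderTop = (-a : ℤ) ∧ (j Y).orderTop = (-2 : ℤ) ∧
      ∀ r : ℕ, 0 < r → r < a → ∀ b : K, b ≠ 0 → ∀ g,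
        δ g ≠ algebraMap K κ b * U * Y ^ ((r : ℤ) - a) := by
  have haK : (a : K) ≠ 0 := Nat.cast_ne_zero.2 ha.ne'
  obtain ⟨Z, hZ, hZ1⟩ := exists_pow_eq_of_isAdicComplete (A := PowerSeries K)
    (I := Ideal.span {PowerSeries.X}) ha.ne' (w := 1 - PowerSeries.X ^ (2 * a)) (y := 1) (by
      rw [← map_natCast (algebraMap K (PowerSeries K))]
      exact (IsUnit.mk0 _ haK).map _) isUnit_one (by
      rw [one_pow, sub_sub_cancel]
      exact Ideal.pow_mem_of_mem _ (Ideal.mem_span_singleton_self _) _ (by omega))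
  set T : LaurentSeries K := HahnSeries.single 1 1 with hT
  have hT0 : T ≠ 0 := HahnSeries.single_ne_zero one_ne_zero
  have hTX : HahnSeries.ofPowerSeries ℤ K PowerSeries.X = T := HahnSeries.ofPowerSeries_X
  set U : LaurentSeries K := T ^ (-a : ℤ) with hU
  set Y : LaurentSeries K := T ^ (-2 : ℤ) * HahnSeries.ofPowerSeries ℤ K Z with hY
  have hTz : ∀ n : ℤ, T ^ n = HahnSeries.single n 1 := fun n => by
    exact (RatFunc.single_zpow n).symm
  have hDK : ∀ b, euler K (algebraMap K (LaurentSeries K) b) = 0 := fun b => by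
    rw [algebraMap_laurentSeries]
    ext n
    rw [coeff_euler, HahnSeries.C_apply, HahnSeries.coeff_single]
    split_ifs with hn <;> simp [hn]
  have hYU : Y ^ a = U ^ 2 - 1 := by
    rw [hY, mul_pow, ← map_pow, hZ, map_sub, map_pow, map_one, hTX, hU, mul_sub, mul_one]
    rw [← zpow_natCast, ← zpow_natCast, ← zpow_natCast, ← zpow_mul, ← zpow_mul, ← zpow_add₀ hT0]
    push_cast
    congr 1
    · congr 1
      ring
    · rw [show -2 * (a : ℤ) + 2 * a = 0 by ring, zpow_zero]
  have hDU : euler K U = -a * U := by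
    rw [hU, hTz]
    ext n
    rw [coeff_euler, HahnSeries.coeff_single, ← map_natCast (HahnSeries.C : K →+* LaurentSeries K),
      ← map_neg, HahnSeries.C_mul_eq_smul, HahnSeries.coeff_smul, HahnSeries.coeff_single]
    split_ifs with hn <;> simp [hn]
  have hUtr : Transcendental K U := by
    refine transcendental_of_notMem_range fun b hb => ?_
    have h1 := congrArg (euler K) hb
    rw [hDK, hDU] at h1
    have : CharZero (LaurentSeries K) :=
      charZero_of_injective_algebraMap (algebraMap K (LaurentSeries K)).injective
    exact mul_ne_zero (neg_ne_zero.2 (Nat.cast_ne_zero.2 ha.ne')) (zpow_ne_zero _ hT0) h1.symm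
  have hU1 : U ^ 2 - 1 ≠ 0 := by
    intro h
    refine hUtr ⟨Polynomial.X ^ 2 - Polynomial.C 1, Polynomial.X_pow_sub_C_ne_zero two_pos 1, ?_⟩
    simpa using h
  let k := IntermediateField.adjoin K {U, Y}
  have hUk : U ∈ k := IntermediateField.subset_adjoin K _ (Set.mem_insert _ _)
  have hYk : Y ∈ k := IntermediateField.subset_adjoin K _ (Set.mem_insert_of_mem _ rfl)
  have hDk : ∀ z ∈ k, euler K z ∈ k := fun z hz => apply_mem_adjoin euler_mul hDK (by
    rintro _ (rfl | rfl)
    · rw [hDU]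
      exact mul_mem (neg_mem (natCast_mem k a)) hUk
    · have : CharZero (LaurentSeries K) :=
        charZero_of_injective_algebraMap (algebraMap K (LaurentSeries K)).injective
      rw [show euler K Y = -2 * U ^ 2 * Y / (U ^ 2 - 1) by
        rw [eq_div_iff hU1, mul_comm]
        exact mul_apply_eq_of_pow_eq euler_mul ha hDU hYU]
      exact div_mem (mul_mem (mul_mem (neg_mem (ofNat_mem k 2)) (pow_mem hUk 2)) hYk)
        (sub_mem (pow_mem hUk 2) (one_mem k))) hz
  let δ : k →+ k :=
    { toFun := fun z => ⟨euler K z, hDk z z.2⟩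
      map_zero' := Subtype.ext (map_zero _)
      map_add' := fun x y => Subtype.ext (map_add _ _ _) }
  refine ⟨k, inferInstance, inferInstance, k.val.toRingHom, δ, ⟨U, hUk⟩, ⟨Y, hYk⟩,
    algebraMap_laurentSeries, fun _ => rfl, Subtype.ext hDU, Subtype.ext hYU, ?_, ?_, ?_⟩
  · change U.orderTop = _
    rw [hU, hTz, HahnSeries.orderTop_single one_ne_zero]
  · change Y.orderTop = _
    have hZ0 : PowerSeries.constantCoeff Z = 1 := by
      rw [Ideal.mem_span_singleton, PowerSeries.X_dvd_iff, map_sub, map_one, sub_eq_zero] at hZ1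
      exact hZ1
    have h1 := (hasResidue_ofPowerSeries Z).orderTop_eq (by rw [hZ0]; exact one_ne_zero)
    rw [hY, HahnSeries.orderTop_mul, h1, add_zero, hTz, HahnSeries.orderTop_single one_ne_zero]
  · intro r hr hra b hb g hg
    refine apply_ne_of_mem_adjoin euler_mul hDK hUtr hr hra hDU hYU hb g.2 ?_
    have h1 := congrArg k.val hg
    rw [map_mul, map_mul, map_zpow₀] at h1
    exact h1

end Superelliptic

/-! ### Exponents with three collinear points -/

section Superelliptic

universe v

theorem affineRelation_collinear (j n b a : ℤ) :
    affineRelation ![0, j, n, b] ![0, 0, 0, a] = ![a * (n - j), -(a * n), a * j, 0] := by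
  ext i
  fin_cases i <;> simp [affineRelation] <;> ring

/-- A solution of `k₀ + s ^ 2 + k₁ x ^ j + k₂ x ^ n + x ^ b z = 0` with `x` close to `1`. -/
theorem exists_parabolic_solution {A κ : Type*} [CommRing A] [Field κ] [CharZero κ] [Algebra κ A]
    {j n a b : ℕ} {ρ U : κ} (hρ : (a * n * j * (n - j) : κ) * ρ ^ 2 = -2) {s x' : A}
    (hx' : (1 + s * algebraMap κ A (ρ * U)) * x' = 1) :
    ∃ h : A, (a * (n - j) : A) + s ^ 2 - a * n * (1 + s * algebraMap κ A (ρ * U)) ^ j +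
      a * j * (1 + s * algebraMap κ A (ρ * U)) ^ n + (1 + s * algebraMap κ A (ρ * U)) ^ b *
        (s ^ 2 * ((algebraMap κ A (U ^ 2 - 1) + s * h) * x' ^ b)) = 0 := by
  obtain ⟨h₁, hh₁⟩ := exists_one_add_pow_eq s (algebraMap κ A (ρ * U)) j
  obtain ⟨h₂, hh₂⟩ := exists_one_add_pow_eq s (algebraMap κ A (ρ * U)) n
  -- The polynomial `a (n - j) - a n x ^ j + a j x ^ n` has the double root `x = 1`. With the given
  -- `ρ` its quadratic term at `1 + s ρ U` is `-s ^ 2 U ^ 2`, which combines with `s ^ 2` to `-s ^ 2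
  -- (U ^ 2 - 1)`.
  refine ⟨algebraMap κ A (1 / 2) * (a * n * h₁ - a * j * h₂), ?_⟩
  have h2 : (2 : A) * algebraMap κ A (1 / 2) = 1 := by
    rw [← map_ofNat (algebraMap κ A) 2, ← map_mul]
    norm_num
  have hu : IsUnit (2 : A) := IsUnit.of_mul_eq_one _ h2
  apply hu.mul_left_cancel
  have hb : (1 + s * algebraMap κ A (ρ * U)) ^ b * x' ^ b = 1 := by rw [← mul_pow, hx', one_pow]
  have hρ' := congrArg (algebraMap κ A) hρ
  simp only [map_mul, map_natCast, map_sub, map_pow, map_neg, map_ofNat, map_one] at hρ' hh₁ hh₂ hb ⊢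
  set r := algebraMap κ A ρ
  set u := algebraMap κ A U
  linear_combination -(a * n : A) * hh₁ + (a * j : A) * hh₂ + s ^ 2 * u ^ 2 * hρ' +
    2 * s ^ 2 * (u ^ 2 - 1 + s * (algebraMap κ A (1 / 2) * (a * n * h₁ - a * j * h₂))) * hb +
    s ^ 3 * (a * n * h₁ - a * j * h₂) * h2

variable {K E L : Type v} {F : Type*} [Field K] [IsAlgClosed K] [CharZero K] [Field E] [CharZero E]
  [Field F] [Field L] [Algebra K E] [Algebra K F] [Algebra K L] [Algebra E L] [Algebra F L]
  [IsScalarTower K E L] [IsScalarTower K F L]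

set_option maxHeartbeats 1000000 in
/-- If three of the exponents are collinear and there is an interior lattice point which is not
closer to their line than to the fourth point, then the curve is not obtained from a curve over the
constants. -/
theorem not_isInteriorPoint_of_collinear (hc : IsConstantExtension K E F L)
    (h1F : Algebra.trdeg K F ≤ 1) {SF : Finset F}
    (hSF : IntermediateField.adjoin K (SF : Set F) = ⊤) (hF : ∃ f : F, ∀ a, algebraMap K F a ≠ f)
    (h1E : Algebra.trdeg K E ≤ 1) {SE : Finset E}
    (hSE : IntermediateField.adjoin K (SE : Set E) = ⊤) {σ : E} (hσ : ∀ a, algebraMap K E a ≠ σ)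
    {j n b a : ℕ} (hj : 0 < j) (hjn : j < n) (ha : 0 < a) {x y : L}
    (hxy : IsFourTermCurve ![a * (n - j) + σ ^ (2 * a), -(a * n), a * j, 1]
      ![0, (j : ℤ), n, b] ![0, 0, 0, (a : ℤ)] x y) {r₁ r₂ : ℤ} (hr₂ : (a : ℤ) ≤ 2 * r₂) :
    ¬ IsInteriorPoint ![0, (j : ℤ), n, b] ![0, 0, 0, (a : ℤ)] r₁ r₂ := by
  intro hr
  have hr0 : 0 < r₂ := by omega
  have hra : r₂ < a := by
    obtain ⟨i, hi⟩ := hr 0 (-1) (by norm_num)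
    fin_cases i <;> simp at hi <;> omega
  obtain ⟨θ, hθK, hθσ⟩ := exists_place h1E hSE hσ
  obtain ⟨κ, _, _, j', δ, U, Y₀, hjK, hjδ, hδU, hY₀, hoU, hoY, hexact⟩ :=
    exists_superelliptic_model K ha
  let φ : E →+* LaurentSeries κ := (laurentMap (algebraMap K κ)).comp θ
  let : Algebra E (LaurentSeries κ) := φ.toAlgebra
  have hE : ∀ e, algebraMap E (LaurentSeries κ) e = laurentMap (algebraMap K κ) (θ e) := fun _ => rfl
  let J : K →+* κ := algebraMap K κ
  have : CharZero κ := charZero_of_injective_ringHom J.injective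
  have hδ : ∀ a b, δ (a * b) = a * δ b + b * δ a := fun a b => j'.injective (by
    rw [hjδ, map_mul, euler_mul, map_add, map_mul, map_mul, hjδ, hjδ])
  have hδK : ∀ a, δ (algebraMap K κ a) = 0 := fun a => j'.injective (by
    rw [hjδ, hjK, map_zero]
    ext n
    rw [coeff_euler, HahnSeries.C_apply, HahnSeries.coeff_single]
    split_ifs with hn <;> simp [hn])
  have hjU0 : j' U ≠ 0 := by
    intro h
    rw [h, HahnSeries.orderTop_zero] at hoU
    exact WithTop.top_ne_coe hoU
  have hU0 : U ≠ 0 := fun h => hjU0 (by rw [h, map_zero])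
  have hYY : Y₀ ≠ 0 := by
    rintro rfl
    rw [map_zero, HahnSeries.orderTop_zero] at hoY
    exact WithTop.top_ne_coe hoY
  have haκ : (a : κ) ≠ 0 := Nat.cast_ne_zero.2 ha.ne'
  have hord : 0 < (laurentMap (algebraMap K κ) (θ σ)).orderTop := by
    rwa [orderTop_laurentMap]
  obtain ⟨ε, hε⟩ := exists_powerSeries_of_orderTop_nonneg hord.le
  have hε0 : PowerSeries.constantCoeff ε = 0 := by
    rw [← (hasResidue_ofPowerSeries ε).2, ← hε]
    exact HahnSeries.coeff_eq_zero_of_lt_orderTop hord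
  obtain ⟨ρ, hρ⟩ := IsAlgClosed.exists_pow_nat_eq (-2 / (a * n * j * (n - j)) : K) (n := 2) two_pos
  have hnj : (a * n * j * (n - j) : K) ≠ 0 := by
    have h1 : (n : K) - j ≠ 0 := sub_ne_zero.2 (Nat.cast_injective.ne hjn.ne')
    have h2 : (n : K) ≠ 0 := Nat.cast_ne_zero.2 (by omega)
    have h3 : (j : K) ≠ 0 := Nat.cast_ne_zero.2 hj.ne'
    have h4 : (a : K) ≠ 0 := Nat.cast_ne_zero.2 ha.ne'
    exact mul_ne_zero (mul_ne_zero (mul_ne_zero h4 h2) h3) h1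
  have hρ' : (a * n * j * (n - j) : K) * ρ ^ 2 = -2 := by rw [hρ, mul_div_cancel₀ _ hnj]
  have hρ0 : ρ ≠ 0 := by
    rintro rfl
    norm_num at hρ'
  have hρκ : (a * n * j * (n - j) : κ) * J ρ ^ 2 = -2 := by
    have := congrArg J hρ'
    simpa only [map_mul, map_sub, map_natCast, map_pow, map_neg, map_ofNat] using this
  have hC0 : ∀ a : κ, PowerSeries.constantCoeff (algebraMap κ (PowerSeries κ) a) = a := fun a => by
    simp
  -- With `s = ε ^ a` the last term must be `y ^ a = ε ^ (2 a) (U ^ 2 - 1 + …) x ^ (-b)`, so `y = ε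
  -- ^ 2 Y` needs no further root of `ε`. This is why the perturbation is `σ ^ (2 * a)`.
  have hpar := @exists_parabolic_solution (PowerSeries κ) κ _ _ _ _ j n a b _ U hρκ (ε ^ a)
  obtain ⟨X, hX⟩ : ∃ X, X = algebraMap κ (PowerSeries κ) (J ρ * U) := ⟨_, rfl⟩
  rw [← hX] at hpar
  have hx0 : PowerSeries.constantCoeff (1 + ε ^ a * X) = 1 := by
    rw [map_add, map_mul, map_pow, hε0, zero_pow ha.ne', zero_mul, add_zero, map_one]
  obtain ⟨x', hx'⟩ := (PowerSeries.isUnit_iff_constantCoeff.2 (hx0 ▸ isUnit_one) :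
    IsUnit (1 + ε ^ a * X)).exists_right_inv
  obtain ⟨h, hh⟩ := hpar hx'
  have hx'0 : PowerSeries.constantCoeff x' = 1 := by
    have := congrArg PowerSeries.constantCoeff hx'
    rwa [map_mul, hx0, one_mul, map_one] at this
  obtain ⟨Y, hY, hYI⟩ := exists_pow_eq_of_isAdicComplete (A := PowerSeries κ)
    (I := Ideal.span {PowerSeries.X}) ha.ne'
    (w := (algebraMap κ (PowerSeries κ) (U ^ 2 - 1) + ε ^ a * h) * x' ^ b)
    (y := algebraMap κ (PowerSeries κ) Y₀) (by
      rw [← map_natCast (algebraMap κ (PowerSeries κ))]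
      exact (IsUnit.mk0 _ haκ).map _) ((IsUnit.mk0 _ hYY).map _) (by
      rw [Ideal.mem_span_singleton, PowerSeries.X_dvd_iff, map_sub, map_pow, hC0, map_mul, map_add,
        hC0, map_mul, map_pow, hε0, zero_pow ha.ne', map_pow, hx'0, hY₀]
      ring)
  have hY0 : PowerSeries.constantCoeff Y = Y₀ := by
    rw [Ideal.mem_span_singleton, PowerSeries.X_dvd_iff, map_sub, hC0, sub_eq_zero] at hYI
    exact hYI
  rw [← hY] at hh
  -- the solution in Laurent series and the corresponding embedding
  let co := HahnSeries.ofPowerSeries ℤ κ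
  have hεM : algebraMap E (LaurentSeries κ) σ = co ε := by rw [hE, hε]
  have hε1 : co ε ≠ 0 := by
    rw [← hεM, map_ne_zero]
    rintro rfl
    exact hσ 0 (map_zero _)
  have hxres : HasResidue (co (1 + ε ^ a * X)) 1 := hx0 ▸ hasResidue_ofPowerSeries _
  have hYres : HasResidue (co Y) Y₀ := hY0 ▸ hasResidue_ofPowerSeries _
  have hxne : co (1 + ε ^ a * X) ≠ 0 := by
    intro h
    have := hxres.2
    rw [h] at this
    exact zero_ne_one this
  have hYne : co Y ≠ 0 := by
    intro h
    have := hYres.2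
    rw [h] at this
    exact hYY this.symm
  obtain ⟨ι, hιx, hιy⟩ := hxy.lift (LaurentSeries κ) (co (1 + ε ^ a * X)) (co ε ^ 2 * co Y) hxne
    (mul_ne_zero (pow_ne_zero 2 hε1) hYne) (by
      have h1 := congrArg co hh
      simp only [map_add, map_sub, map_mul, map_pow, map_natCast, map_zero, map_one] at h1
      simp only [Fin.sum_univ_four, Matrix.cons_val, zpow_natCast, zpow_zero, mul_one, map_add,
        map_mul, map_pow, map_natCast, map_neg, map_sub, hεM, map_one]
      linear_combination h1) (by
      left
      have h1 := transcendental_of_hasResidue θ hE (hasResidue_ofPowerSeries X) (by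
        rw [hX, hC0]
        intro e he
        have h1 := congrArg δ he
        rw [hδK, hδ, hδK, hδU, mul_zero, add_zero] at h1
        exact mul_ne_zero ((map_ne_zero J).2 hρ0) (mul_ne_zero (neg_ne_zero.2 haκ) hU0) h1.symm)
      intro h2
      apply h1
      have h3 : co X = (algebraMap E (LaurentSeries κ) (σ ^ a))⁻¹ *
          (co (1 + ε ^ a * X) - algebraMap E _ 1) := by
        rw [map_pow, eq_inv_mul_iff_mul_eq₀ (by rw [hεM]; exact pow_ne_zero _ hε1), hεM]
        simp
      change IsAlgebraic E (co X)
      rw [h3]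
      exact (isAlgebraic_algebraMap _).inv.mul (h2.sub (isAlgebraic_algebraMap 1)))
  -- the differential
  have hσ' : ∀ e, algebraMap K E e ≠ a * (n - j) + σ ^ (2 * a) := by
    intro e he
    refine zpow_ne_algebraMap hσ (n := (2 * a : ℕ)) (by exact_mod_cast (by omega : 2 * a ≠ 0))
      (e - a * (n - j)) ?_
    rw [zpow_natCast, map_sub, he]
    simp
  have haL : (a : L) ≠ 0 := by
    have : CharZero L := charZero_of_injective_algebraMap (algebraMap E L).injective
    exact Nat.cast_ne_zero.2 ha.ne'
  have hω := mem_regularDifferentials_of_isInteriorPoint hxy.x_ne_zero hxy.y_ne_zero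
    (fun i i' hii => by
      fin_cases i <;> fin_cases i' <;> simp at hii ⊢ <;> omega) (fun i => by
      fin_cases i
      · exact fun h => hσ' 0 (by rw [map_zero]; exact h.symm)
      · simp
        omega
      · simp
        omega
      · simp) hxy.relation
    (by
      simp only [Fin.sum_univ_four, Matrix.cons_val]
      simp [haL, hxy.x_ne_zero, hxy.y_ne_zero])
    (by
      rw [affineRelation_collinear]
      refine ⟨0, ?_⟩
      simp
      omega)
    (by
      rw [affineRelation_collinear]
      refine prod_zpow_ne ?_ hσ' ?_
      · simp
        omega
      · intro i hi hki
        fin_cases i <;> simp at hi hki ⊢) hr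
  have hg : ∑ i, algebraMap E L (![a * (n - j) + σ ^ (2 * a), -(a * n), a * j, 1] i) *
      ((![0, 0, 0, (a : ℤ)] i : ℤ) : L) * (x ^ ![0, (j : ℤ), n, b] i * y ^ ![0, 0, 0, (a : ℤ)] i) =
      a * x ^ b * y ^ a := by
    simp only [Fin.sum_univ_four, Matrix.cons_val]
    simp [mul_assoc]
  rw [hg] at hω
  -- `dx` contributes `σ ^ a` and `y ^ (r₂ - a)` contributes `σ ^ (2 * (r₂ - a))`. The rest of the
  -- differential has a nonzero residue.
  obtain ⟨f, hf⟩ : ∃ f, f = θ (σ ^ (2 * r₂ - a)) := ⟨_, rfl⟩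
  have hf0 : f ≠ 0 := by
    rw [hf, map_ne_zero]
    refine zpow_ne_zero _ ?_
    rintro rfl
    exact hσ 0 (map_zero _)
  have hval : ι (x ^ r₁ * y ^ r₂ * (a * x ^ b * y ^ a)⁻¹ * x⁻¹) * coeffMap δ (ι x) =
      laurentMap (algebraMap K κ) f * (co (1 + ε ^ a * X) ^ r₁ * co Y ^ (r₂ - a) *
        (co (1 + ε ^ a * X))⁻¹ ^ (b + 1) * (co (algebraMap κ (PowerSeries κ) a))⁻¹ *
          coeffMap δ (co X)) := by
    have h1 : coeffMap δ (ι x) = co ε ^ a * coeffMap δ (co X) := by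
      rw [hιx, map_add, map_mul, map_one, map_pow, ← hεM, hE, ← map_pow, ← map_pow]
      exact coeffMap_one_add_laurentMap_mul (δ := δ) hδ hδK _ _
    have h2 : laurentMap (algebraMap K κ) f = co ε ^ (2 * r₂ - a) := by
      rw [hf, ← hE, map_zpow₀, hεM]
    rw [h1, h2]
    simp only [map_mul, map_inv₀, map_zpow₀, map_pow, hιx, hιy, mul_inv, map_natCast]
    rw [zpow_sub₀ hε1, zpow_sub₀ hYne, zpow_mul, mul_zpow, zpow_ofNat, zpow_natCast, zpow_natCast, inv_pow]
    field_simp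
    ring
  have hres : HasResidue (co (1 + ε ^ a * X) ^ r₁ * co Y ^ (r₂ - a) *
        (co (1 + ε ^ a * X))⁻¹ ^ (b + 1) * (co (algebraMap κ (PowerSeries κ) a))⁻¹ *
          coeffMap δ (co X)) (-(J ρ) * U * Y₀ ^ (r₂ - a)) := by
    have h1 : HasResidue (co (algebraMap κ (PowerSeries κ) a)) (a : κ) := by
      have := hasResidue_ofPowerSeries (algebraMap κ (PowerSeries κ) a)
      rwa [hC0] at this
    have h2 : HasResidue (co X) (J ρ * U) := by
      have := hasResidue_ofPowerSeries X
      rwa [hX, hC0, ← hX] at this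
    have h3 := (((((hxres.zpow one_ne_zero r₁).mul (hYres.zpow hYY (r₂ - a))).mul
      ((hxres.inv one_ne_zero).pow (b + 1))).mul (h1.inv haκ)).mul (h2.coeffMap δ))
    convert h3 using 1
    rw [hδ, hδK, hδU, one_zpow, inv_one, one_pow]
    field_simp
    ring
  have hres0 : -(J ρ) * U * Y₀ ^ (r₂ - a) ≠ 0 :=
    mul_ne_zero (mul_ne_zero (neg_ne_zero.2 ((map_ne_zero J).2 hρ0)) hU0) (zpow_ne_zero _ hYY)
  have hlead : f.coeff f.order ≠ 0 := HahnSeries.coeff_order_eq_zero.not.2 hf0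
  have hm : (laurentMap (algebraMap K κ) f).orderTop = (f.order : WithTop ℤ) := by
    rw [orderTop_laurentMap, HahnSeries.order_eq_orderTop_of_ne_zero hf0]
  have hcoeff := coeff_mul_of_le_orderTop hm.ge (b := 0) hres.1
  rw [add_zero, hres.2, coeff_laurentMap] at hcoeff
  have hcore := exists_primitive_or_vanishing hc h1F hSF hF θ ι.toRingHom
    (fun e => by rw [← hE]; exact ι.commutes e) hθK j' hjK δ hjδ hω (m := f.order) (by
      change (ι _ * coeffMap δ (ι x)).orderTop = _
      rw [hval, HahnSeries.orderTop_mul, hm, hres.orderTop_eq hres0, add_zero])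
  change (∃ g, δ g = (ι _ * coeffMap δ (ι x)).coeff f.order) ∨
    1 ≤ (j' ((ι _ * coeffMap δ (ι x)).coeff f.order)).orderTop at hcore
  rw [hval, hcoeff] at hcore
  have hconst : -(f.coeff f.order * ρ) ≠ 0 := neg_ne_zero.2 (mul_ne_zero hlead hρ0)
  obtain ⟨r, rfl⟩ := Int.eq_ofNat_of_zero_le hr0.le
  rcases hcore with ⟨u, hu⟩ | h1
  · refine hexact r (by omega) (by omega) _ hconst u ?_
    rw [hu, map_neg, map_mul]
    ring
  -- At infinity `U` has order `-a` and `Y₀` has order `-2`, so the leading coefficient has order `a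
  -- - 2 * r ≤ 0`. The power `Y₀ ^ e` clears the negative exponent.
  · obtain ⟨e, he⟩ := Int.eq_ofNat_of_zero_le (sub_nonneg.2 hra.le)
    have h2 : J (f.coeff f.order) * (-(J ρ) * U * Y₀ ^ ((r : ℤ) - a)) * Y₀ ^ e =
        J (-(f.coeff f.order * ρ)) * U := by
      rw [← zpow_natCast, ← he, ← neg_sub, zpow_neg, map_neg, map_mul]
      have := zpow_ne_zero ((a : ℤ) - r) hYY
      field_simp
    have h3 := le_orderTop_mul (a := 1) (b := e * (-2)) h1 (le_orderTop_pow (a := -2) hoY.ge e)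
    rw [← map_pow, ← map_mul, h2, map_mul, hjK, HahnSeries.orderTop_mul, hoU, HahnSeries.C_apply,
      HahnSeries.orderTop_single hconst, ← WithTop.coe_add, WithTop.coe_le_coe] at h3
    omega

end Superelliptic

/-! ### Polynomials over an extension of the field of constants -/

section Coefficientwise

variable {R A σ : Type*} [CommRing R] [CommRing A] [Algebra R A]

/-- Apply a linear map to the coefficients of a polynomial. -/
noncomputable def mapCoeffLinear (l : A →ₗ[R] R) (f : MvPolynomial σ A) : MvPolynomial σ R :=
  ∑ m ∈ f.support, monomial m (l (f.coeff m))

theorem coeff_mapCoeffLinear (l : A →ₗ[R] R) (f : MvPolynomial σ A) (m : σ →₀ ℕ) :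
    (mapCoeffLinear l f).coeff m = l (f.coeff m) := by
  classical
  simp only [mapCoeffLinear, coeff_sum, coeff_monomial, Finset.sum_ite_eq', mem_support_iff]
  split_ifs with h
  · rfl
  · rw [not_not.1 h, map_zero]

theorem mapCoeffLinear_map_mul (l : A →ₗ[R] R) (a : MvPolynomial σ R) (f : MvPolynomial σ A) :
    mapCoeffLinear l (map (algebraMap R A) a * f) = a * mapCoeffLinear l f := by
  classical
  ext m
  simp only [coeff_mapCoeffLinear, coeff_mul, coeff_map, map_sum, ← Algebra.smul_def, map_smul,
    smul_eq_mul]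

theorem mapCoeffLinear_sum_C_mul_map {n : ℕ} (l : A →ₗ[R] R) (u : Fin n → A)
    (a : Fin n → MvPolynomial σ R) :
    mapCoeffLinear l (∑ i, C (u i) * map (algebraMap R A) (a i)) = ∑ i, C (l (u i)) * a i := by
  ext m
  simp only [coeff_mapCoeffLinear, coeff_sum, coeff_C_mul, coeff_map, map_sum]
  refine Finset.sum_congr rfl fun i _ => ?_
  rw [mul_comm, ← Algebra.smul_def, map_smul, smul_eq_mul, mul_comm]

theorem mapCoeffLinear_map {l : A →ₗ[R] R} (hl : l 1 = 1) (a : MvPolynomial σ R) :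
    mapCoeffLinear l (map (algebraMap R A) a) = a := by
  ext m
  rw [coeff_mapCoeffLinear, coeff_map, Algebra.algebraMap_eq_smul_one, map_smul, hl, smul_eq_mul,
    mul_one]

end Coefficientwise

/-! ### Irreducibility and linear disjointness under extension of constants. -/

section FieldExtension

variable {K Ω : Type*} {σ : Type*} [Field K] [Field Ω] [Algebra K Ω]

/-- A `K`-linear retraction of `Ω` onto `K`, applied to the coefficients, carries a quotient over
`Ω` to one over `K`. -/
theorem dvd_of_map_dvd_map {a b : MvPolynomial σ K}
    (h : map (algebraMap K Ω) a ∣ map (algebraMap K Ω) b) : a ∣ b := by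
  obtain ⟨l, hl⟩ := (Algebra.linearMap K Ω).exists_leftInverse_of_injective
    (LinearMap.ker_eq_bot.2 (algebraMap K Ω).injective)
  have hl1 : l 1 = 1 := by simpa using LinearMap.congr_fun hl 1
  obtain ⟨t, ht⟩ := h
  refine ⟨mapCoeffLinear l t, ?_⟩
  rw [← mapCoeffLinear_map_mul, ← ht, mapCoeffLinear_map hl1]

/-- The rational functions on a curve over `K` and the constants of an extension of `K` are linearly
disjoint. -/
theorem linearIndependent_of_mem_adjoin_range {N : Type*} [Field N] [Algebra K N] [Algebra Ω N]
    [IsScalarTower K Ω N] {g : MvPolynomial σ K} {X : σ → N} (hX : aeval X g = 0)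
    (hker : ∀ r : MvPolynomial σ Ω, aeval X r = 0 → map (algebraMap K Ω) g ∣ r) {n : ℕ}
    {f : Fin n → N} (hf : ∀ i, f i ∈ IntermediateField.adjoin K (Set.range X))
    (hli : LinearIndependent K f) : LinearIndependent Ω f := by
  classical
  choose r s hrs using fun i => (IntermediateField.mem_adjoin_range_iff K X (f i)).1 (hf i)
  have hs : ∀ i, aeval X (s i) ≠ 0 := fun i h => hli.ne_zero i (by rw [hrs, h, div_zero])
  have hd : ∏ i, aeval X (s i) ≠ 0 := Finset.prod_ne_zero_iff.2 fun i _ => hs i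
  let a : Fin n → MvPolynomial σ K := fun i => r i * ∏ k ∈ Finset.univ.erase i, s k
  have ha : ∀ i, aeval X (a i) = f i * ∏ k, aeval X (s k) := by
    intro i
    rw [← Finset.mul_prod_erase Finset.univ _ (Finset.mem_univ i), ← mul_assoc, map_mul, map_prod]
    congr 1
    exact ((div_eq_iff (hs i)).1 (hrs i).symm)
  rw [Fintype.linearIndependent_iff] at hli ⊢
  intro u hu i
  -- After clearing denominators the relation says that `g` divides a polynomial over `Ω`. A
  -- `K`-linear functional applied to coefficients commutes with multiplication by `g`, so it
  -- produces a relation over `K`.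
  rw [← Module.forall_dual_apply_eq_zero_iff K]
  intro l
  obtain ⟨t, ht⟩ := hker (∑ i, C (u i) * map (algebraMap K Ω) (a i)) (by
    simp only [map_sum, map_mul, aeval_map_algebraMap, ha, aeval_C, ← Algebra.smul_def]
    rw [← zero_mul (∏ k, aeval X (s k)), ← hu, Finset.sum_mul]
    exact Finset.sum_congr rfl fun i _ => (smul_mul_assoc _ _ _).symm)
  have h1 := congrArg (mapCoeffLinear l) ht
  rw [mapCoeffLinear_sum_C_mul_map, mapCoeffLinear_map_mul] at h1
  refine hli (fun i => l (u i)) ?_ i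
  apply mul_right_cancel₀ hd
  have h2 := congrArg (aeval X) h1
  rw [map_mul, hX, zero_mul] at h2
  simp only [map_sum, map_mul, ha, aeval_C, ← Algebra.smul_def] at h2
  rw [zero_mul, ← h2, Finset.sum_mul]
  exact Finset.sum_congr rfl fun i _ => smul_mul_assoc _ _ _

theorem isUnit_iff_forall_coeff_eq_zero {f : MvPolynomial σ K} (hf : f ≠ 0) :
    IsUnit f ↔ ∀ m ≠ 0, f.coeff m = 0 := by
  rw [isUnit_iff]
  simp only [isNilpotent_iff_eq_zero, and_iff_right_iff_imp]
  intro h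
  rw [isUnit_iff_ne_zero]
  intro h0
  refine hf (MvPolynomial.ext _ _ fun m => ?_)
  by_cases hm : m = 0
  · rw [hm, h0, coeff_zero]
  · rw [h m hm, coeff_zero]

theorem exists_algHom_of_finiteType [IsAlgClosed K] (R : Type*) [CommRing R] [Nontrivial R]
    [Algebra K R] [Algebra.FiniteType K R] : Nonempty (R →ₐ[K] K) := by
  obtain ⟨m, hm⟩ := Ideal.exists_maximal R
  let : Field (R ⧸ m) := Ideal.Quotient.field m
  have := finite_of_finite_type_of_isJacobsonRing K (R ⧸ m)
  exact ⟨((AlgEquiv.ofBijective (Algebra.ofId K (R ⧸ m))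
    (IsAlgClosed.algebraMap_bijective_of_isIntegral)).symm : R ⧸ m →ₐ[K] K).comp
      (Ideal.Quotient.mkₐ K m)⟩

/-- Over an algebraically closed field irreducible polynomials are absolutely irreducible. -/
theorem irreducible_map_of_isAlgClosed [IsAlgClosed K] {g : MvPolynomial σ K} (hg : Irreducible g) :
    Irreducible (map (algebraMap K Ω) g) := by
  classical
  have hinj : Function.Injective (map (algebraMap K Ω) : MvPolynomial σ K → _) :=
    map_injective _ (algebraMap K Ω).injective
  have hg0 : map (algebraMap K Ω) g ≠ 0 := (map_ne_zero_iff _ hinj).2 hg.ne_zero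
  refine ⟨fun h => hg.not_isUnit ?_, fun a b hab => ?_⟩
  · rw [isUnit_iff_forall_coeff_eq_zero hg.ne_zero]
    rw [isUnit_iff_forall_coeff_eq_zero hg0] at h
    intro m hm
    have := h m hm
    rwa [coeff_map, map_eq_zero] at this
  · by_contra! hcon
    have ha0 : a ≠ 0 := left_ne_zero_of_mul (hab ▸ hg0)
    have hb0 : b ≠ 0 := right_ne_zero_of_mul (hab ▸ hg0)
    obtain ⟨ha, hb⟩ := hcon
    rw [isUnit_iff_forall_coeff_eq_zero ha0] at ha
    rw [isUnit_iff_forall_coeff_eq_zero hb0] at hb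
    push Not at ha hb
    obtain ⟨m₁, hm₁, ha⟩ := ha
    obtain ⟨m₂, hm₂, hb⟩ := hb
    -- A factorization over `Ω` is specialized at a `K`-point of the finitely generated algebra of
    -- its coefficients. Adjoining the inverse of one nonconstant coefficient of each factor keeps
    -- the factors nonconstant.
    let T : Finset Ω := a.coeffs ∪ b.coeffs ∪ {(a.coeff m₁)⁻¹, (b.coeff m₂)⁻¹}
    let R := Algebra.adjoin K (T : Set Ω)
    have hT : ∀ u ∈ T, u ∈ R := fun u hu => Algebra.subset_adjoin hu
    have : Algebra.FiniteType K R := (Subalgebra.fg_iff_finiteType R).1 ⟨T, rfl⟩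
    obtain ⟨θ⟩ := exists_algHom_of_finiteType (K := K) R
    have hlift : ∀ f : MvPolynomial σ Ω, f.coeffs ⊆ T → ∃ f₀ : MvPolynomial σ R,
        map (algebraMap R Ω) f₀ = f := fun f hf => by
      apply mem_range_map_iff_coeffs_subset.2
      exact fun u hu => ⟨⟨u, hT u (hf hu)⟩, rfl⟩
    obtain ⟨a₀, ha₀⟩ := hlift a fun u hu => by simp [T, hu]
    obtain ⟨b₀, hb₀⟩ := hlift b fun u hu => by simp [T, hu]
    have hinj' : Function.Injective (map (algebraMap R Ω) : MvPolynomial σ R → _) :=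
      map_injective _ Subtype.val_injective
    have hab₀ : map (algebraMap K R) g = a₀ * b₀ := by
      apply hinj'
      rw [map_mul, ha₀, hb₀, ← hab, map_map, ← IsScalarTower.algebraMap_eq]
    have hθ : g = map (θ : R →+* K) a₀ * map (θ : R →+* K) b₀ := by
      rw [← map_mul, ← hab₀, map_map, AlgHom.comp_algebraMap]
      simp [map_id]
    have hunit : ∀ (u₀ : MvPolynomial σ R) (m : σ →₀ ℕ), m ≠ 0 →
        (map (algebraMap R Ω) u₀).coeff m ≠ 0 → ((map (algebraMap R Ω) u₀).coeff m)⁻¹ ∈ T →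
        ¬ IsUnit (map (θ : R →+* K) u₀) := by
      intro u₀ m hm hu hinv h
      have h1 : u₀.coeff m * ⟨_, hT _ hinv⟩ = 1 := Subtype.val_injective (by
        rw [coeff_map] at hu
        simp only [coeff_map]
        exact mul_inv_cancel₀ hu)
      have h2 := congrArg θ h1
      rw [map_mul, map_one] at h2
      have h3 : map (θ : R →+* K) u₀ ≠ 0 := h.ne_zero
      have h4 := (isUnit_iff_forall_coeff_eq_zero h3).1 h m hm
      rw [coeff_map] at h4
      exact left_ne_zero_of_mul_eq_one h2 h4
    rcases hg.isUnit_or_isUnit hθ with h | h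
    · exact hunit a₀ m₁ hm₁ (ha₀ ▸ ha) (by simp [T, ha₀]) h
    · exact hunit b₀ m₂ hm₂ (hb₀ ▸ hb) (by simp [T, hb₀]) h

end FieldExtension

/-! ### Descent to a finitely generated field of constants -/

section Descent

universe v

/-- An element of a generated field involves only finitely many constants; any field containing
these suffices. -/
theorem exists_finset_forall_mem_adjoin {K Ω N : Type*} [Field K] [Field Ω] [Field N] [Algebra K Ω]
    [Algebra Ω N] {V : Set N} {z : N} (hz : z ∈ IntermediateField.adjoin Ω V) :
    ∃ T : Finset Ω, ∀ E : IntermediateField K Ω, (∀ u ∈ T, u ∈ E) →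
      z ∈ IntermediateField.adjoin E V := by
  classical
  induction hz using IntermediateField.adjoin_induction with
  | mem z hz => exact ⟨∅, fun E _ => IntermediateField.subset_adjoin _ _ hz⟩
  | algebraMap u =>
    exact ⟨{u}, fun E hE => (IntermediateField.adjoin E V).algebraMap_mem ⟨u, hE u (by simp)⟩⟩
  | add z w _ _ hz hw =>
    obtain ⟨T, hT⟩ := hz
    obtain ⟨T', hT'⟩ := hw
    exact ⟨T ∪ T', fun E hE => add_mem (hT E fun u hu => hE u (by simp [hu]))
      (hT' E fun u hu => hE u (by simp [hu]))⟩
  | mul z w _ _ hz hw =>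
    obtain ⟨T, hT⟩ := hz
    obtain ⟨T', hT'⟩ := hw
    exact ⟨T ∪ T', fun E hE => mul_mem (hT E fun u hu => hE u (by simp [hu]))
      (hT' E fun u hu => hE u (by simp [hu]))⟩
  | inv z _ hz =>
    obtain ⟨T, hT⟩ := hz
    exact ⟨T, fun E hE => inv_mem (hT E hE)⟩

theorem adjoin_eq_top_of_le_adjoin_image {E N : Type*} [Field E] [Field N] [Algebra E N]
    {L : IntermediateField E N} {S : Set L}
    (h : L ≤ IntermediateField.adjoin E (Subtype.val '' S)) : IntermediateField.adjoin E S = ⊤ := by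
  rw [eq_top_iff]
  intro z _
  have h1 : (z : N) ∈ (IntermediateField.adjoin E S).map L.val := by
    rw [IntermediateField.adjoin_map]
    exact h z.2
  obtain ⟨w, hw, hwz⟩ := h1
  rwa [← Subtype.val_injective hwz]

theorem isUnit_of_dvd_X_sub_C {K : Type*} [Field K] {g : MvPolynomial (Fin 2) K} {a b : K}
    (h0 : g ∣ X 0 - C a) (h1 : g ∣ X 1 - C b) : IsUnit g := by
  have key : ∀ (i k : Fin 2) (a : K), i ≠ k → g ∣ X i - C a → g.degreeOf k = 0 := by
    intro i k a hik h
    obtain ⟨t, ht⟩ := h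
    have h2 : (X i - C a : MvPolynomial (Fin 2) K) ≠ 0 := by
      intro h
      have := congrArg (eval fun _ => a + 1) h
      simp at this
    rw [ht] at h2
    have h3 := degreeOf_mul_eq (n := k) (left_ne_zero_of_mul h2) (right_ne_zero_of_mul h2)
    have h4 : degreeOf k (X i - C a : MvPolynomial (Fin 2) K) ≤ 0 :=
      (degreeOf_sub_le _ _ _).trans (by
        rw [degreeOf_C, degreeOf_X, if_neg hik.symm]
        simp)
    rw [← ht] at h3
    omega
  have hg0 : g ≠ 0 := by
    rintro rfl
    have := congrArg (eval fun _ => a + 1) (zero_dvd_iff.1 h0)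
    simp at this
  rw [isUnit_iff_forall_coeff_eq_zero hg0]
  intro m hm
  by_contra hgm
  apply hm
  ext i
  have h3 : degreeOf i g = 0 := by
    fin_cases i
    exacts [key 1 0 b (by decide) h1, key 0 1 a (by decide) h0]
  have h4 := monomial_le_degreeOf i (mem_support_iff.2 hgm)
  simp only [Finsupp.coe_zero, Pi.zero_apply]
  omega

/-- An isotrivial curve given by four monomials is defined, together with finitely many constants
and the isomorphism with a curve over `K`, over a finitely generated extension of `K`. -/
theorem exists_isFourTermCurve_descent {K Ω N : Type v} [Field K] [Field Ω] [Field N]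
    [Algebra K Ω] [Algebra Ω N] (h1 : Algebra.trdeg K Ω ≤ 1) {g : MvPolynomial (Fin 2) K}
    (hg : Irreducible g) {Z : Fin 2 → N} (hZ : IntermediateField.adjoin Ω (Set.range Z) = ⊤)
    (hZg : aeval Z (map (algebraMap K Ω) g) = 0)
    (hkerZ : ∀ r : MvPolynomial (Fin 2) Ω, aeval Z r = 0 → map (algebraMap K Ω) g ∣ r)
    {c : Fin 4 → Ω} {p q : Fin 4 → ℕ} {x y : N} (hx : x ≠ 0) (hy : y ≠ 0)
    (hxy : IntermediateField.adjoin Ω {x, y} = ⊤)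
    (hP : (∑ i, C (c i) * (X 0 ^ p i * X 1 ^ q i) : MvPolynomial (Fin 2) Ω) ≠ 0)
    (hrel : ∑ i, algebraMap Ω N (c i) * (x ^ p i * y ^ q i) = 0)
    (hker : ∀ r : MvPolynomial (Fin 2) Ω, aeval ![x, y] r = 0 →
      (∑ i, C (c i) * (X 0 ^ p i * X 1 ^ q i)) ∣ r) (T : Finset Ω) :
    ∃ (E F L : Type v) (_ : Field E) (_ : Field F) (_ : Field L) (_ : Algebra K E) (_ : Algebra K F)
      (_ : Algebra K L) (_ : Algebra E L) (_ : Algebra F L) (_ : IsScalarTower K E L)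
      (_ : IsScalarTower K F L) (j : E →ₐ[K] Ω) (SF : Finset F) (SE : Finset E) (c' : Fin 4 → E)
      (x' y' : L), IsConstantExtension K E F L ∧ Algebra.trdeg K F ≤ 1 ∧
        IntermediateField.adjoin K (SF : Set F) = ⊤ ∧ (∃ f : F, ∀ a, algebraMap K F a ≠ f) ∧
        Algebra.trdeg K E ≤ 1 ∧ IntermediateField.adjoin K (SE : Set E) = ⊤ ∧
        (∀ u ∈ T, ∃ e, j e = u) ∧ (∀ i, j (c' i) = c i) ∧
        IsFourTermCurve c' (fun i => (p i : ℤ)) (fun i => (q i : ℤ)) x' y' := by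
  classical
  let : Algebra K N := ((algebraMap Ω N).comp (algebraMap K Ω)).toAlgebra
  have : IsScalarTower K Ω N := IsScalarTower.of_algebraMap_eq fun _ => rfl
  have hxyZ : ∀ i, ∃ T : Finset Ω, ∀ E : IntermediateField K Ω, (∀ u ∈ T, u ∈ E) →
      Z i ∈ IntermediateField.adjoin E {x, y} := fun i =>
    exists_finset_forall_mem_adjoin (hxy ▸ IntermediateField.mem_top)
  choose T₁ hT₁ using hxyZ
  obtain ⟨T₂, hT₂⟩ := exists_finset_forall_mem_adjoin (K := K) (Ω := Ω) (z := x)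
    (hZ ▸ IntermediateField.mem_top)
  obtain ⟨T₃, hT₃⟩ := exists_finset_forall_mem_adjoin (K := K) (Ω := Ω) (z := y)
    (hZ ▸ IntermediateField.mem_top)
  -- The constants that occur in the equation and in the expressions of `Z` by `x`, `y` and of `x`,
  -- `y` by `Z`. Over the field they generate, both pairs generate the same field `L`.
  obtain ⟨T', hT'⟩ : ∃ T', T' = T ∪ Finset.univ.image c ∪ T₁ 0 ∪ T₁ 1 ∪ T₂ ∪ T₃ := ⟨_, rfl⟩
  let E : IntermediateField K Ω := IntermediateField.adjoin K (T' : Set Ω)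
  have hE : ∀ u ∈ T', u ∈ E := fun u hu => IntermediateField.subset_adjoin K _ hu
  let L : IntermediateField E N := IntermediateField.adjoin E {x, y}
  let F : IntermediateField K N := IntermediateField.adjoin K (Set.range Z)
  have hZL : ∀ i, Z i ∈ L := by
    intro i
    refine hT₁ i E fun u hu => hE u ?_
    fin_cases i <;> simp at hu <;> simp [hT', hu]
  have hFL : ∀ f : F, algebraMap F N f ∈ L := by
    have : F ≤ L.restrictScalars K := IntermediateField.adjoin_le_iff.2 (by
      rintro _ ⟨i, rfl⟩
      exact hZL i)
    exact fun f => this f.2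
  let : Algebra F L := ((algebraMap F N).codRestrict L hFL).toAlgebra
  have hFLN : ∀ f : F, ((algebraMap F L f : L) : N) = f := fun f => rfl
  have : IsScalarTower K F L := IsScalarTower.of_algebraMap_eq fun a => rfl
  have hxL : x ∈ L := IntermediateField.subset_adjoin _ _ (by simp)
  have hyL : y ∈ L := IntermediateField.subset_adjoin _ _ (by simp)
  have hcE : ∀ i, c i ∈ E := fun i => hE _ (by simp [hT'])
  have hZF : ∀ i, Z i ∈ F := fun i => IntermediateField.subset_adjoin _ _ ⟨i, rfl⟩
  have hFZ : IntermediateField.adjoin K ({⟨Z 0, hZF 0⟩, ⟨Z 1, hZF 1⟩} : Set F) = ⊤ := by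
    apply adjoin_eq_top_of_le_adjoin_image
    rw [Set.image_pair]
    refine IntermediateField.adjoin.mono _ _ _ ?_
    rintro _ ⟨i, rfl⟩
    fin_cases i <;> simp
  have hLxy : IntermediateField.adjoin E ({⟨x, hxL⟩, ⟨y, hyL⟩} : Set L) = ⊤ := by
    apply adjoin_eq_top_of_le_adjoin_image
    rw [Set.image_pair]
  have hZg' : aeval Z g = 0 := by rwa [aeval_map_algebraMap] at hZg
  have hPmap : map (algebraMap E Ω) (∑ i, C (⟨c i, hcE i⟩ : E) * (X 0 ^ p i * X 1 ^ q i)) =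
      (∑ i, C (c i) * (X 0 ^ p i * X 1 ^ q i) : MvPolynomial (Fin 2) Ω) := by
    simp only [map_sum, map_mul, map_C, map_pow, map_X]
    rfl
  have hrelL : ∑ i, algebraMap E L ⟨c i, hcE i⟩ * ((⟨x, hxL⟩ : L) ^ p i * (⟨y, hyL⟩ : L) ^ q i) = 0 := by
    apply Subtype.val_injective
    rw [AddSubmonoidClass.coe_finsetSum]
    exact hrel
  refine ⟨E, F, L, inferInstance, inferInstance, inferInstance, inferInstance, inferInstance,
    inferInstance, inferInstance, inferInstance, inferInstance, inferInstance, E.val,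
    {⟨Z 0, hZF 0⟩, ⟨Z 1, hZF 1⟩}, T'.attach.image fun u : T' => (⟨u.1, hE _ u.2⟩ : E), fun i => ⟨c i, hcE i⟩,
    ⟨x, hxL⟩, ⟨y, hyL⟩, ⟨?_, ?_⟩, ?_, ?_, ?_, ?_, ?_, ?_, ?_, ?_⟩
  · intro n f hf
    have h2 : LinearIndependent K fun i => (f i : N) :=
      hf.map' F.val.toLinearMap (LinearMap.ker_eq_bot.2 Subtype.val_injective)
    have h3 : LinearIndependent Ω fun i => (f i : N) :=
      linearIndependent_of_mem_adjoin_range hZg' hkerZ (fun i => (f i).2) h2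
    have h4 : LinearIndependent E fun i => (f i : N) := h3.restrict_scalars (by
      intro a b hab
      simpa [Algebra.smul_def] using hab)
    exact LinearIndependent.of_comp L.val.toLinearMap h4
  · apply adjoin_eq_top_of_le_adjoin_image
    have h2 : IntermediateField.adjoin E (Set.range Z) ≤
        IntermediateField.adjoin E (Subtype.val '' Set.range (algebraMap F L)) := by
      refine IntermediateField.adjoin.mono _ _ _ ?_
      rintro _ ⟨i, rfl⟩
      exact ⟨_, ⟨⟨Z i, hZF i⟩, rfl⟩, rfl⟩
    refine (IntermediateField.adjoin_le_iff.2 ?_ : L ≤ _)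
    rintro _ (rfl | rfl)
    · exact h2 (hT₂ E fun u hu => hE u (by simp [hT', hu]))
    · exact h2 (hT₃ E fun u hu => hE u (by simp [hT', hu]))
  · refine trdeg_le_one_of_pair hFZ fun h => hg.ne_zero ?_
    refine (injective_iff_map_eq_zero _).1 h g ?_
    apply Subtype.val_injective
    have h2 : ∀ r : MvPolynomial (Fin 2) K,
        ((aeval (![⟨Z 0, hZF 0⟩, ⟨Z 1, hZF 1⟩] : Fin 2 → F) r : F) : N) = aeval Z r := by
      intro r
      change F.val _ = _
      rw [← AlgHom.comp_apply]
      congr 1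
      ext i
      fin_cases i <;> simp
    rw [h2, hZg']
    rfl
  · rw [Finset.coe_pair, hFZ]
  -- If both coordinates were constant, `g` would divide `X 0 - a` and `X 1 - b`, and so be a unit.
  · by_contra! hcon
    obtain ⟨a, ha⟩ := hcon ⟨Z 0, hZF 0⟩
    obtain ⟨b, hb⟩ := hcon ⟨Z 1, hZF 1⟩
    have key : ∀ i a, algebraMap K F a = ⟨Z i, hZF i⟩ → g ∣ X i - C a := by
      intro i a h
      apply dvd_of_map_dvd_map (Ω := Ω)
      apply hkerZ
      rw [aeval_map_algebraMap, map_sub, aeval_X, aeval_C, sub_eq_zero]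
      exact (congrArg Subtype.val h).symm
    exact hg.not_isUnit (isUnit_of_dvd_X_sub_C (key 0 a ha) (key 1 b hb))
  · exact (trdeg_le_of_injective E.val Subtype.val_injective).trans h1
  · apply adjoin_eq_top_of_le_adjoin_image
    refine IntermediateField.adjoin.mono _ _ _ fun u hu => ?_
    exact ⟨⟨u, hE u hu⟩, by simpa using hu, rfl⟩
  · exact fun u hu => ⟨⟨u, hE u (by simp [hT', hu])⟩, rfl⟩
  · exact fun i => rfl
  · have h2 : ∀ r : MvPolynomial (Fin 2) E, ((aeval ![(⟨x, hxL⟩ : L), ⟨y, hyL⟩] r : L) : N) =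
        aeval ![x, y] (map (algebraMap E Ω) r) := by
      intro r
      rw [aeval_map_algebraMap]
      change L.val _ = _
      rw [← AlgHom.comp_apply]
      congr 1
      ext i
      fin_cases i <;> simp
    refine isFourTermCurve_of_ker (trdeg_le_one_of_pair hLxy fun h => hP ?_)
      (fun h => hx (congrArg Subtype.val h)) (fun h => hy (congrArg Subtype.val h)) hLxy hrelL
      fun r hr => ?_
    · refine hPmap.symm.trans ?_
      refine (congrArg _ ((injective_iff_map_eq_zero _).1 h _ ?_)).trans (map_zero _)
      simpa using hrelL
    · apply dvd_of_map_dvd_map (Ω := Ω)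
      refine (Eq.dvd hPmap).trans (hker _ ?_)
      rw [← h2, hr]
      rfl

end Descent

/-! ### Isotrivial curves with four monomials -/

section Isotrivial

universe v

/-- A system of binomial equations with nonzero determinant is solvable. -/
theorem exists_prod_zpow_eq {k ι : Type*} [Field k] [IsAlgClosed k] [CharZero k] [Fintype ι]
    [DecidableEq ι] (A : Matrix ι ι ℤ) (hA : A.det ≠ 0) {u : ι → k} (hu : ∀ i, u i ≠ 0) :
    ∃ v : ι → k, (∀ j, v j ≠ 0) ∧ ∀ i, ∏ j, v j ^ A i j = u i := by
  have hroot : ∀ i, ∃ w : k, w ≠ 0 ∧ w ^ A.det = u i := by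
    intro i
    obtain ⟨w, hw⟩ := IsAlgClosed.exists_pow_nat_eq (u i) (Int.natAbs_pos.2 hA)
    have hw0 : w ≠ 0 := by
      rintro rfl
      rw [zero_pow (Int.natAbs_pos.2 hA).ne'] at hw
      exact hu i hw.symm
    rcases Int.natAbs_eq A.det with h | h
    · exact ⟨w, hw0, by rw [h, zpow_natCast, hw]⟩
    · exact ⟨w⁻¹, inv_ne_zero hw0, by rw [h, zpow_neg, inv_zpow, inv_inv, zpow_natCast, hw]⟩
  choose w hw0 hw using hroot
  -- The identity `A * adjugate A = det A` reduces the system to extracting roots of order `det A`.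
  refine ⟨fun j => ∏ i, w i ^ A.adjugate j i,
    fun j => Finset.prod_ne_zero_iff.2 fun i _ => zpow_ne_zero _ (hw0 i), fun i => ?_⟩
  have h1 : ∀ j, (∏ i, w i ^ A.adjugate j i) ^ A i j = ∏ i', w i' ^ (A i j * A.adjugate j i') := by
    intro j
    rw [← Finset.prod_zpow]
    exact Finset.prod_congr rfl fun i' _ => by rw [← zpow_mul, mul_comm]
  simp only [h1]
  rw [Finset.prod_comm]
  have h2 : ∀ i', ∏ j, w i' ^ (A i j * A.adjugate j i') = w i' ^ (A * A.adjugate) i i' := by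
    intro i'
    rw [Matrix.mul_apply]
    induction (Finset.univ : Finset ι) using Finset.induction_on with
    | empty => simp
    | insert j s hj ih => rw [Finset.prod_insert hj, Finset.sum_insert hj, ih, zpow_add₀ (hw0 i')]
  simp only [h2]
  rw [Matrix.mul_adjugate, Finset.prod_eq_single i]
  · simp [hw]
  · intro i' _ hi
    simp [hi.symm]
  · simp

/-- The product is invariant because `k` annihilates `p`, `q` and the constant vector; the three
scalings drop out one by one. -/
theorem prod_rescale_zpow_affineRelation {k : Type*} [Field k] {p q : Fin 4 → ℤ} {a b m : k}
    (ha : a ≠ 0) (hb : b ≠ 0) (hm : m ≠ 0) (c : Fin 4 → k) :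
    ∏ i, (m * (a ^ p i * b ^ q i) * c i) ^ affineRelation p q i =
      ∏ i, c i ^ affineRelation p q i := by
  have key : ∀ (z : k) (f : Fin 4 → ℤ), z ≠ 0 → ∑ i, affineRelation p q i * f i = 0 →
      ∏ i, z ^ (f i * affineRelation p q i) = 1 := by
    intro z f hz hf
    rw [Fin.prod_univ_four, ← zpow_add₀ hz, ← zpow_add₀ hz, ← zpow_add₀ hz, ← zpow_zero z]
    congr 1
    rw [Fin.sum_univ_four] at hf
    linarith
  simp only [mul_zpow, ← zpow_mul, Finset.prod_mul_distrib]
  rw [key a p ha (sum_affineRelation_mul_left p q), key b q hb (sum_affineRelation_mul_right p q)]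
  have h1 := key m (fun _ => 1) hm (by simpa using sum_affineRelation p q)
  simp only [one_mul] at h1
  rw [h1, one_mul, one_mul, one_mul]

/-- Three of the four coefficients can be prescribed if the corresponding exponents are not
collinear. -/
theorem exists_rescale {k : Type*} [Field k] [IsAlgClosed k] [CharZero k] {p q : Fin 4 → ℤ}
    (hk : affineRelation p q 0 ≠ 0) {c u : Fin 4 → k} (hc : ∀ i, c i ≠ 0)
    (hu : ∀ i, i ≠ 0 → u i ≠ 0) :
    ∃ a b m : k, a ≠ 0 ∧ b ≠ 0 ∧ m ≠ 0 ∧ ∀ i, i ≠ 0 → m * (a ^ p i * b ^ q i) * c i = u i := by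
  obtain ⟨v, hv, hvu⟩ := exists_prod_zpow_eq
    (Matrix.of fun i : Fin 3 => ![p i.succ, q i.succ, 1]) (by
      rw [Matrix.det_fin_three]
      simp only [affineRelation, Matrix.cons_val] at hk
      simp only [Matrix.of_apply, Matrix.cons_val, Fin.succ_zero_eq_one, Fin.succ_one_eq_two,
        show (2 : Fin 3).succ = 3 from rfl]
      convert hk using 1
      ring) (u := fun i => u i.succ * (c i.succ)⁻¹)
      fun i => mul_ne_zero (hu _ (Fin.succ_ne_zero i)) (inv_ne_zero (hc _))
  refine ⟨v 0, v 1, v 2, hv 0, hv 1, hv 2, fun i hi => ?_⟩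
  obtain ⟨i, rfl⟩ := Fin.exists_succ_eq.2 hi
  have h1 := hvu i
  simp only [Fin.prod_univ_three, Matrix.of_apply, Matrix.cons_val, zpow_one] at h1
  rw [mul_comm (v 2), h1, inv_mul_cancel_right₀ (hc _)]

theorem X_pow_mul_X_pow_eq_monomial {R : Type*} [CommSemiring R] (a b : ℕ) :
    (X 0 ^ a * X 1 ^ b : MvPolynomial (Fin 2) R) =
      monomial (Finsupp.single 0 a + Finsupp.single 1 b) 1 := by
  rw [X_pow_eq_monomial, X_pow_eq_monomial, monomial_mul, one_mul]

theorem single_add_single_injective {a b a' b' : ℕ}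
    (h : (Finsupp.single 0 a + Finsupp.single 1 b : Fin 2 →₀ ℕ) =
      Finsupp.single 0 a' + Finsupp.single 1 b') : a = a' ∧ b = b' :=
  ⟨by simpa using DFunLike.congr_fun h 0, by simpa using DFunLike.congr_fun h 1⟩

theorem coeff_sum_C_mul_X_pow {R : Type*} [CommSemiring R] {c : Fin 4 → R} {p q : Fin 4 → ℕ}
    (hpq : ∀ i j, i ≠ j → p i ≠ p j ∨ q i ≠ q j) (i : Fin 4) :
    (∑ i, C (c i) * (X 0 ^ p i * X 1 ^ q i) : MvPolynomial (Fin 2) R).coeff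
      (Finsupp.single 0 (p i) + Finsupp.single 1 (q i)) = c i := by
  classical
  rw [coeff_sum, Finset.sum_eq_single i]
  · rw [coeff_C_mul, X_pow_mul_X_pow_eq_monomial, coeff_monomial, if_pos rfl, mul_one]
  · intro j _ hj
    rw [coeff_C_mul, X_pow_mul_X_pow_eq_monomial, coeff_monomial, if_neg, mul_zero]
    intro h
    obtain ⟨h1, h2⟩ := single_add_single_injective h
    exact (hpq j i hj).elim (fun h => h h1) (fun h => h h2)
  · simp

theorem not_sum_dvd_X {k : Type*} [Field k] {c : Fin 4 → k} (hc : ∀ i, c i ≠ 0) {p q : Fin 4 → ℕ}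
    (hpq : ∀ i j, i ≠ j → p i ≠ p j ∨ q i ≠ q j) (l : Fin 2) :
    ¬ (∑ i, C (c i) * (X 0 ^ p i * X 1 ^ q i) : MvPolynomial (Fin 2) k) ∣ X l := by
  classical
  intro h
  obtain ⟨m, b, -, -, hm⟩ := (dvd_monomial_iff_exists one_ne_zero).1 h
  have h1 : ∀ i, m = Finsupp.single 0 (p i) + Finsupp.single 1 (q i) := by
    intro i
    by_contra hmi
    have h2 := coeff_sum_C_mul_X_pow (c := c) hpq i
    rw [hm, coeff_monomial, if_neg hmi] at h2
    exact hc i h2.symm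
  obtain ⟨h2, h3⟩ := single_add_single_injective ((h1 0).symm.trans (h1 1))
  exact (hpq 0 1 (by decide)).elim (fun h => h h2) (fun h => h h3)

/-- Replaces a function field by a pair of generators with known kernel. In this way the constant
curve and the four term curve are both described inside one field. -/
theorem PlaneFunctionField.exists_generators {Ω N : Type*} [Field Ω] [Field N] [Algebra Ω N]
    (P : MvPolynomial (Fin 2) Ω) (e : PlaneFunctionField P ≃ₐ[Ω] N) :
    ∃ Z : Fin 2 → N, IntermediateField.adjoin Ω (Set.range Z) = ⊤ ∧
      ∀ r : MvPolynomial (Fin 2) Ω, aeval Z r = 0 ↔ P ∣ r := by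
  let A := MvPolynomial (Fin 2) Ω ⧸ Ideal.span {P}
  let φ : MvPolynomial (Fin 2) Ω →ₐ[Ω] N :=
    (e : PlaneFunctionField P →ₐ[Ω] N).comp ((Algebra.algHom Ω A (PlaneFunctionField P)).comp
      (Ideal.Quotient.mkₐ Ω (Ideal.span {P})))
  have hφ : ∀ r, φ r = e (algebraMap A (PlaneFunctionField P) (Ideal.Quotient.mk _ r)) := fun r => rfl
  have hZ : aeval (fun i => φ (X i)) = φ := by
    ext i
    simp
  refine ⟨fun i => φ (X i), ?_, fun r => ?_⟩
  · rw [eq_top_iff]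
    intro z _
    obtain ⟨⟨a, s⟩, has⟩ := IsLocalization.surj (nonZeroDivisors A) (e.symm z)
    obtain ⟨a, rfl⟩ := Ideal.Quotient.mk_surjective a
    obtain ⟨s', hs'⟩ := Ideal.Quotient.mk_surjective (s : A)
    have h1 : z * φ s' = φ a := by
      rw [hφ, hφ, ← has, map_mul, AlgEquiv.apply_symm_apply, hs']
    have h2 : φ s' ≠ 0 := by
      rw [hφ, hs']
      exact ((IsLocalization.map_units (PlaneFunctionField P) s).map e).ne_zero
    have h3 : ∀ r, φ r ∈ IntermediateField.adjoin Ω (Set.range fun i => φ (X i)) := by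
      intro r
      refine (IntermediateField.algebra_adjoin_le_adjoin Ω _) ?_
      rw [Algebra.adjoin_range_eq_range_aeval, hZ]
      exact ⟨r, rfl⟩
    rw [← eq_div_iff h2] at h1
    rw [h1]
    exact div_mem (h3 a) (h3 s')
  · rw [hZ, hφ, map_eq_zero_iff e e.injective, map_eq_zero_iff _ (IsLocalization.injective
      (PlaneFunctionField P) le_rfl), Ideal.Quotient.eq_zero_iff_mem, Ideal.mem_span_singleton]

/-- Over a finitely generated field of constants an isotrivial curve given by four monomials can be
brought to a normal form, in which all coefficients except the first one are prescribed. -/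
theorem exists_normalized_descent {K Ω : Type v} [Field K] [Field Ω] [IsAlgClosed K] [CharZero K]
    [IsAlgClosed Ω] [Algebra K Ω] (h1 : Algebra.trdeg K Ω ≤ 1) {c : Fin 4 → Ω} (hc : ∀ i, c i ≠ 0)
    {p q : Fin 4 → ℕ} (hpq : ∀ i j, i ≠ j → p i ≠ p j ∨ q i ≠ q j)
    (hiso : ∃ g : MvPolynomial (Fin 2) K, Irreducible g ∧ Nonempty (PlaneFunctionField
      (∑ i, C (c i) * (X 0 ^ p i * X 1 ^ q i)) ≃ₐ[Ω] PlaneFunctionField (map (algebraMap K Ω) g)))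
    {p' q' : Fin 4 → ℤ} {α β γ δ ε a b : ℤ} (hε : ε * (α * δ - β * γ) = 1)
    (hp : ∀ i, p i = α * p' i + γ * q' i + a) (hq : ∀ i, q i = β * p' i + δ * q' i + b)
    (hk : affineRelation p' q' 0 ≠ 0)
    (hprod : ∀ a, algebraMap K Ω a ≠ ∏ i, c i ^ affineRelation p' q' i) {u : Fin 4 → K}
    (hu : ∀ i, i ≠ 0 → u i ≠ 0) {n : ℕ} (hn : 0 < n) :
    ∃ (E F L : Type v) (_ : Field E) (_ : Field F) (_ : Field L) (_ : Algebra K E) (_ : Algebra K F)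
      (_ : Algebra K L) (_ : Algebra E L) (_ : Algebra F L) (_ : IsScalarTower K E L)
      (_ : IsScalarTower K F L) (SF : Finset F) (SE : Finset E) (σ : E) (c' : Fin 4 → E)
      (x' y' : L), IsConstantExtension K E F L ∧ Algebra.trdeg K F ≤ 1 ∧
        IntermediateField.adjoin K (SF : Set F) = ⊤ ∧ (∃ f : F, ∀ a, algebraMap K F a ≠ f) ∧
        Algebra.trdeg K E ≤ 1 ∧ IntermediateField.adjoin K (SE : Set E) = ⊤ ∧
        (∀ a, algebraMap K E a ≠ σ) ∧ c' 0 = algebraMap K E (u 0) + σ ^ n ∧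
        (∀ i, i ≠ 0 → c' i = algebraMap K E (u i)) ∧ IsFourTermCurve c' p' q' x' y' := by
  classical
  have : CharZero Ω := charZero_of_injective_algebraMap (algebraMap K Ω).injective
  obtain ⟨g, hg, ⟨e⟩⟩ := hiso
  have hgΩ := irreducible_map_of_isAlgClosed (Ω := Ω) hg
  have := isDomain_planeCoordinateRing hgΩ
  obtain ⟨Z, hZ, hZg⟩ := PlaneFunctionField.exists_generators
    (N := PlaneFunctionField (map (algebraMap K Ω) g)) (map (algebraMap K Ω) g) AlgEquiv.refl
  obtain ⟨W, hW, hWP⟩ := PlaneFunctionField.exists_generators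
    (N := PlaneFunctionField (map (algebraMap K Ω) g)) _ e
  have hW' : ![W 0, W 1] = W := by
    ext i
    fin_cases i <;> rfl
  have hWne : ∀ i, W i ≠ 0 := fun i h =>
    not_sum_dvd_X hc hpq i ((hWP (X i)).1 (by rwa [aeval_X]))
  obtain ⟨v, w, m, hv, hw, hm, hvwm⟩ := exists_rescale hk hc (u := fun i => algebraMap K Ω (u i))
    fun i hi => (map_ne_zero _).2 (hu i hi)
  -- Scaling disposes of three coefficients; `σ ^ n` is the deviation of the remaining one from its
  -- prescribed value.
  obtain ⟨σ, hσ⟩ := IsAlgClosed.exists_pow_nat_eq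
    (m * (v ^ p' 0 * w ^ q' 0) * c 0 - algebraMap K Ω (u 0)) hn
  obtain ⟨E, F, L, iE, iF, iL, iKE, iKF, iKL, iEL, iFL, iKEL, iKFL, j, SF, SE, d, x, y, hcE, h1F,
    hSF, hF, h1E, hSE, hT, hd, hxy⟩ := exists_isFourTermCurve_descent h1 hg hZ ((hZg _).2 dvd_rfl)
      (fun r hr => (hZg r).1 hr) (c := c) (p := p) (q := q) (hWne 0) (hWne 1) (by
        rw [← hW, ← hW']
        congr 1
        ext z
        simp [eq_comm, or_comm]) (by
        intro h
        have h2 := coeff_sum_C_mul_X_pow (c := c) hpq 0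
        rw [h, coeff_zero] at h2
        exact hc 0 h2.symm) (by
        have := (hWP _).2 dvd_rfl
        simpa using this) (fun r hr => (hWP r).1 (by rwa [hW'] at hr)) {v, w, m, σ}
  obtain ⟨v', rfl⟩ := hT v (by simp)
  obtain ⟨w', rfl⟩ := hT w (by simp)
  obtain ⟨m', rfl⟩ := hT m (by simp)
  obtain ⟨σ', rfl⟩ := hT σ (by simp)
  have hj : ∀ {z : E}, j z ≠ 0 → z ≠ 0 := fun h h0 => h (by rw [h0, map_zero])
  have hinj : Function.Injective j := j.toRingHom.injective
  have hc' : ∀ i, j (m' * (v' ^ p' i * w' ^ q' i) * d i) = j m' * (j v' ^ p' i * j w' ^ q' i) * c i := by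
    intro i
    rw [map_mul, map_mul, map_mul, map_zpow₀, map_zpow₀, hd]
  refine ⟨E, F, L, iE, iF, iL, iKE, iKF, iKL, iEL, iFL, iKEL, iKFL, SF, SE, σ', _, _, _, hcE, h1F,
    hSF, hF, h1E, hSE, ?_, ?_, ?_, (hxy.monomialChange hε hp hq).rescale (hj hv) (hj hw) (hj hm)⟩
  -- If `σ` were constant, all normalized coefficients and with them the invariant product would be
  -- constant, against `hprod`.
  · rintro z rfl
    apply hprod ((u 0 + z ^ n) ^ affineRelation p' q' 0 *
      ∏ i : Fin 3, u i.succ ^ affineRelation p' q' i.succ)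
    rw [← prod_rescale_zpow_affineRelation hv hw hm c, map_mul, map_prod, Fin.prod_univ_succ (n := 3)]
    congr 1
    · rw [map_zpow₀, map_add, map_pow]
      congr 1
      rw [AlgHom.commutes] at hσ
      rw [hσ]
      ring
    · refine Finset.prod_congr rfl fun i _ => ?_
      rw [hvwm _ (Fin.succ_ne_zero i), map_zpow₀]
  · apply hinj
    rw [hc', map_add, map_pow, hσ, AlgHom.commutes]
    ring
  · intro i hi
    apply hinj
    rw [hc', hvwm i hi, AlgHom.commutes]

end Isotrivial

/-! ### Isotrivial Delsarte fibrations -/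

namespace DelsarteSurface

universe v

variable {K : Type v} [Field K]

theorem equation_eq_sum (S : DelsarteSurface K) : S.equation =
    ∑ i, C (S.c i) * (X 0 ^ S.A i 0 * X 1 ^ S.A i 1 * X 2 ^ S.A i 2 * X 3 ^ S.A i 3) := by
  simp only [equation, Fin.prod_univ_four]

theorem fibre_eq_sum (S : DelsarteSurface K) {E : Type*} [Field E] [Algebra K E] (u : E) :
    S.fibre u = ∑ i, C (algebraMap K E (S.c i) * u ^ S.A i 2) * (X 0 ^ S.A i 0 * X 1 ^ S.A i 1) := by
  rw [fibre, equation_eq_sum, map_sum]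
  refine Finset.sum_congr rfl fun i _ => ?_
  simp only [map_mul, map_pow, aeval_X, aeval_C, Matrix.cons_val, one_pow, mul_one]
  rw [IsScalarTower.algebraMap_apply K E, algebraMap_eq]
  ring

/-- The exponents of the first affine coordinate. -/
def xExp (S : DelsarteSurface K) (i : Fin 4) : ℤ := S.A i 0

/-- The exponents of the second affine coordinate. -/
def yExp (S : DelsarteSurface K) (i : Fin 4) : ℤ := S.A i 1

/-- The exponents of the parameter of the standard fibration. -/
def tExp (S : DelsarteSurface K) (i : Fin 4) : ℤ := S.A i 2

/-- As all rows have sum `d`, the last column may be replaced by the constant `d`. Expansion along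
the column of the `t`-exponents then produces the minors in `affineRelation`. -/
theorem det_eq (S : DelsarteSurface K) : (S.A.map (Nat.cast : ℕ → ℤ)).det =
    S.d * ∑ i, affineRelation S.xExp S.yExp i * S.tExp i := by
  have h : ∀ i, (S.A i 3 : ℤ) = S.d - S.A i 0 - S.A i 1 - S.A i 2 := fun i => by
    rw [← S.row_sum i, Fin.sum_univ_four]
    push_cast
    ring
  rw [Matrix.det_succ_row_zero]
  simp only [Fin.sum_univ_four, Matrix.det_fin_three, Matrix.submatrix_apply, Matrix.map_apply,
    affineRelation, Matrix.cons_val, xExp, yExp, tExp, Fin.succ_zero_eq_one, Fin.succ_one_eq_two,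
    show (2 : Fin 3).succ = 3 from rfl, Fin.succAbove, h]
  simp [Fin.lt_def]
  simp only [h]
  ring

theorem sum_tExp_ne_zero (S : DelsarteSurface K) (hA : (S.A.map (Nat.cast : ℕ → ℤ)).det ≠ 0) :
    ∑ i, affineRelation S.xExp S.yExp i * S.tExp i ≠ 0 := by
  intro h
  rw [det_eq, h, mul_zero] at hA
  exact hA rfl

theorem prod_ne_algebraMap [IsAlgClosed K] (S : DelsarteSurface K) {E : Type*} [Field E]
    [Algebra K E] {t : E} (ht : ∀ a, algebraMap K E a ≠ t) {k : Fin 4 → ℤ}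
    (hk : ∑ i, k i * S.tExp i ≠ 0) (a : K) :
    algebraMap K E a ≠ ∏ i, (algebraMap K E (S.c i) * t ^ S.A i 2) ^ k i := by
  intro h
  have ht0 : t ≠ 0 := fun h => ht 0 (by rw [h, map_zero])
  have hc : algebraMap K E (∏ i, S.c i ^ k i) ≠ 0 :=
    (map_ne_zero _).2 (Finset.prod_ne_zero_iff.2 fun i _ => zpow_ne_zero _ (S.c_ne_zero i))
  refine zpow_ne_algebraMap ht hk (a * (∏ i, S.c i ^ k i)⁻¹) ?_
  rw [map_mul, map_inv₀, eq_mul_inv_iff_mul_eq₀ hc, h, map_prod]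
  simp only [mul_zpow, Finset.prod_mul_distrib, map_zpow₀, ← zpow_natCast t, ← zpow_mul]
  rw [mul_comm]
  congr 1
  simp only [Fin.sum_univ_four, Fin.prod_univ_four, zpow_add₀ ht0, tExp, mul_comm (k _)]

theorem affineRelation_of_change {p q p' q' : Fin 4 → ℤ} {α β γ δ a b : ℤ}
    (hp : ∀ i, p i = α * p' i + γ * q' i + a) (hq : ∀ i, q i = β * p' i + δ * q' i + b)
    (i : Fin 4) : affineRelation p q i = (α * δ - β * γ) * affineRelation p' q' i := by
  fin_cases i <;> simp only [affineRelation, hp, hq, Fin.zero_eta, Fin.mk_one, Fin.reduceFinMk,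
    Matrix.cons_val] <;> ring

theorem ne_generator (K : Type v) [Field K] (a : K) :
    algebraMap K (AlgebraicClosure (RatFunc K)) a ≠
      algebraMap (RatFunc K) (AlgebraicClosure (RatFunc K)) RatFunc.X := by
  intro h
  have h1 : algebraMap K (RatFunc K) a = RatFunc.X := by
    apply (algebraMap (RatFunc K) (AlgebraicClosure (RatFunc K))).injective
    rw [← IsScalarTower.algebraMap_apply, h]
  exact RatFunc.transcendental_X (h1 ▸ isAlgebraic_algebraMap a)

theorem trdeg_algebraicClosure_ratFunc_le_one (K : Type v) [Field K] :
    Algebra.trdeg K (AlgebraicClosure (RatFunc K)) ≤ 1 := by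
  have : Algebra.IsAlgebraic (IntermediateField.adjoin K {algebraMap (RatFunc K)
      (AlgebraicClosure (RatFunc K)) RatFunc.X}) (AlgebraicClosure (RatFunc K)) := by
    let f : RatFunc K →ₐ[K] AlgebraicClosure (RatFunc K) := IsScalarTower.toAlgHom _ _ _
    have hf : ∀ r, f r ∈ IntermediateField.adjoin K {algebraMap (RatFunc K)
        (AlgebraicClosure (RatFunc K)) RatFunc.X} := by
      intro r
      have h1 : r ∈ IntermediateField.adjoin K {(RatFunc.X : RatFunc K)} :=
        RatFunc.adjoin_X (K := K) ▸ IntermediateField.mem_top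
      have h2 : f r ∈ (IntermediateField.adjoin K {(RatFunc.X : RatFunc K)}).map f := ⟨r, h1, rfl⟩
      rwa [IntermediateField.adjoin_map, Set.image_singleton] at h2
    let : Algebra (RatFunc K) (IntermediateField.adjoin K {algebraMap (RatFunc K)
        (AlgebraicClosure (RatFunc K)) RatFunc.X}) := (f.toRingHom.codRestrict _ hf).toAlgebra
    have : IsScalarTower (RatFunc K) (IntermediateField.adjoin K {algebraMap (RatFunc K)
        (AlgebraicClosure (RatFunc K)) RatFunc.X}) (AlgebraicClosure (RatFunc K)) :=
      IsScalarTower.of_algebraMap_eq fun _ => rfl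
    exact Algebra.IsAlgebraic.tower_top (K := RatFunc K) _
  exact trdeg_le_one_of_isAlgebraic_adjoin (algebraMap (RatFunc K)
    (AlgebraicClosure (RatFunc K)) RatFunc.X)

variable [IsAlgClosed K] [CharZero K]

theorem not_isInteriorPoint_of_isIsotrivial (S : DelsarteSurface K) (hiso : S.IsIsotrivial)
    (hT : ∑ i, affineRelation S.xExp S.yExp i * S.tExp i ≠ 0)
    (hk : ∀ i, affineRelation S.xExp S.yExp i ≠ 0) (r₁ r₂ : ℤ) :
    ¬ IsInteriorPoint S.xExp S.yExp r₁ r₂ := by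
  obtain ⟨I, hI⟩ := IsAlgClosed.exists_pow_nat_eq (-1 : K) (n := 2) two_pos
  rw [IsIsotrivial, fibre_eq_sum] at hiso
  obtain ⟨E, F, L, iE, iF, iL, iKE, iKF, iKL, iEL, iFL, iKEL, iKFL, SF, SE, σ, c, x, y, hcE, h1F,
    hSF, hF, h1E, hSE, hσ, hc0, hc, hxy⟩ := exists_normalized_descent
    (trdeg_algebraicClosure_ratFunc_le_one K) (fun i => mul_ne_zero ((map_ne_zero _).2
      (S.c_ne_zero i)) (pow_ne_zero _ fun h => ne_generator K 0 (by rw [h, map_zero])))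
    (fun i j hij => by
      have := ne_or_ne_of_affineRelation_ne_zero hk i j hij
      simpa only [xExp, yExp, ne_eq, Nat.cast_inj] using this) hiso (p' := S.xExp) (q' := S.yExp)
    (α := 1) (β := 0) (γ := 0) (δ := 1) (ε := 1) (a := 0) (b := 0) (by norm_num)
    (fun i => by simp [xExp]) (fun i => by simp [yExp]) (hk 0)
    (S.prod_ne_algebraMap (ne_generator K) hT)
    (u := fun i => (affineRelation S.xExp S.yExp i : K))
    (fun i _ => Int.cast_ne_zero.2 (hk i)) two_pos
  have : CharZero E := charZero_of_injective_algebraMap (algebraMap K E).injective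
  have hI0 : I ≠ 0 := by
    rintro rfl
    norm_num at hI
  refine not_isInteriorPoint_of_affineRelation_ne_zero hcE h1F hSF hF h1E hSE
    -- The normal form has first coefficient `k₀ + σ ^ 2`, while `k₀ - σ ^ 2` is needed; the square
    -- root `I` of `-1` changes the sign.
    (σ := algebraMap K E I * σ) (fun z hz => hσ (I⁻¹ * z) ?_) (p := fun i => S.A i 0)
    (q := fun i => S.A i 1) hk (c := c) ?_ (fun i hi => ?_) hxy r₁ r₂
  · rw [map_mul, hz, ← mul_assoc, ← map_mul, inv_mul_cancel₀ hI0, map_one, one_mul]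
  · rw [hc0, mul_pow, ← map_pow, hI, map_intCast, map_neg, map_one]
    change _ = ((affineRelation S.xExp S.yExp 0 : ℤ) : E) - _
    ring
  · rw [hc i hi, map_intCast]
    rfl

/-- The fourth entry of the affine relation is zero here, so the fourth coefficient is normalized to
`1` and the first three to the relation between the collinear points, which gives the face
polynomial a double root. -/
theorem not_isInteriorPoint_of_isIsotrivial_of_collinear (S : DelsarteSurface K)
    (hiso : S.IsIsotrivial) (hT : ∑ i, affineRelation S.xExp S.yExp i * S.tExp i ≠ 0)
    {α β γ δ ε u v : ℤ} (hε : ε * (α * δ - β * γ) = 1) {j n b a : ℕ} (hj : 0 < j) (hjn : j < n)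
    (ha : 0 < a)
    (hp : ∀ i, S.xExp i = α * ![0, (j : ℤ), n, b] i + γ * ![0, 0, 0, (a : ℤ)] i + u)
    (hq : ∀ i, S.yExp i = β * ![0, (j : ℤ), n, b] i + δ * ![0, 0, 0, (a : ℤ)] i + v)
    {r₁ r₂ : ℤ} (hr₂ : (a : ℤ) ≤ 2 * r₂) :
    ¬ IsInteriorPoint ![0, (j : ℤ), n, b] ![0, 0, 0, (a : ℤ)] r₁ r₂ := by
  rw [IsIsotrivial, fibre_eq_sum] at hiso
  have hdet : α * δ - β * γ ≠ 0 := right_ne_zero_of_mul (hε ▸ one_ne_zero)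
  obtain ⟨E, F, L, iE, iF, iL, iKE, iKF, iKL, iEL, iFL, iKEL, iKFL, SF, SE, σ, c, x, y, hcE, h1F,
    hSF, hF, h1E, hSE, hσ, hc0, hc, hxy⟩ := exists_normalized_descent
    (trdeg_algebraicClosure_ratFunc_le_one K) (fun i => mul_ne_zero ((map_ne_zero _).2
      (S.c_ne_zero i)) (pow_ne_zero _ fun h => ne_generator K 0 (by rw [h, map_zero])))
    (fun i l hil => by
      by_contra! hcon
      have h1 : S.xExp i = S.xExp l := by simp only [xExp, hcon.1]
      have h2 : S.yExp i = S.yExp l := by simp only [yExp, hcon.2]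
      rw [hp, hp] at h1
      rw [hq, hq] at h2
      have h3 : (![0, (j : ℤ), n, b] i - ![0, (j : ℤ), n, b] l) = 0 := by
        apply mul_left_cancel₀ hdet
        linear_combination δ * h1 - γ * h2
      have h4 : (![0, 0, 0, (a : ℤ)] i - ![0, 0, 0, (a : ℤ)] l) = 0 := by
        apply mul_left_cancel₀ hdet
        linear_combination α * h2 - β * h1
      revert hil h3 h4
      fin_cases i <;> fin_cases l <;> simp <;> omega) hiso hε hp hq
    (by
      rw [affineRelation_collinear]
      simp only [Matrix.cons_val]
      exact mul_ne_zero (by omega) (by omega))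
    (S.prod_ne_algebraMap (ne_generator K) (by
      intro h
      apply hT
      simp only [affineRelation_of_change hp hq, mul_assoc, ← Finset.mul_sum, h, mul_zero]))
    (u := ![a * (n - j), -(a * n), a * j, 1])
    (fun i hi => by
      fin_cases i
      · exact absurd rfl hi
      · simp
        omega
      · simp
        omega
      · simp) (n := 2 * a) (by omega)
  have : CharZero E := charZero_of_injective_algebraMap (algebraMap K E).injective
  have hcc : c = ![a * (n - j) + σ ^ (2 * a), -(a * n), a * j, 1] := by
    ext i
    fin_cases i
    · simp [hc0]
    · simp [hc 1]
    · simp [hc 2]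
    · simp [hc 3]
  rw [hcc] at hxy
  exact not_isInteriorPoint_of_collinear hcE h1F hSF hF h1E hSE hσ hj hjn ha hxy hr₂

/-- The invariant product of the coefficients is not constant in `t`, in particular not `1` or `-1`.
So the curve is rational and has no nonzero regular differentials. -/
theorem planeCurveGenus_eq_zero_of_hasWidthOne (S : DelsarteSurface K)
    (h : Irreducible S.genericFibre) (hw : HasWidthOne S.xExp S.yExp)
    (hpq : ∀ i j, i ≠ j → S.xExp i ≠ S.xExp j ∨ S.yExp i ≠ S.yExp j)
    (hT : ∑ i, affineRelation S.xExp S.yExp i * S.tExp i ≠ 0) :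
    planeCurveGenus S.genericFibre h = 0 := by
  have hdom := isDomain_planeCoordinateRing h
  have : CharZero (RatFunc K) := charZero_of_injective_algebraMap (algebraMap K (RatFunc K)).injective
  obtain ⟨W, hW, hWP⟩ := PlaneFunctionField.exists_generators
    (N := PlaneFunctionField S.genericFibre) _ AlgEquiv.refl
  have ht : ∀ a, algebraMap K (RatFunc K) a ≠ RatFunc.X := fun a h =>
    RatFunc.transcendental_X (h ▸ isAlgebraic_algebraMap a)
  have hc : ∀ i, algebraMap K (RatFunc K) (S.c i) * RatFunc.X ^ S.A i 2 ≠ 0 := fun i =>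
    mul_ne_zero ((map_ne_zero _).2 (S.c_ne_zero i)) (pow_ne_zero _ RatFunc.X_ne_zero)
  have hWne : ∀ i, W i ≠ 0 := by
    intro i hi
    have h1 := (hWP (X i)).1 (by rwa [aeval_X])
    change S.fibre RatFunc.X ∣ _ at h1
    rw [fibre_eq_sum] at h1
    refine not_sum_dvd_X hc ?_ i h1
    simpa only [xExp, yExp, ne_eq, Nat.cast_inj] using hpq
  obtain ⟨w, hw⟩ := exists_adjoin_eq_top_of_hasWidthOne (hWne 0) (hWne 1) (by
      rw [← hW]
      congr 1
      ext z
      simp [eq_comm, or_comm]) hw hc (by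
      have h1 := (hWP _).2 dvd_rfl
      change aeval W (S.fibre RatFunc.X) = 0 at h1
      rw [fibre_eq_sum] at h1
      simpa [xExp, yExp] using h1) (by
      by_contra! hcon
      simp [hcon] at hT) (by
      have := S.prod_ne_algebraMap ht hT 1
      rw [map_one] at this
      exact this.symm) (by
      have := S.prod_ne_algebraMap ht hT (-1)
      rw [map_neg, map_one] at this
      exact this.symm)
  rw [planeCurveGenus, functionFieldGenus]
  have h1 := regularDifferentials_eq_bot hw
  exact (congrArg (fun V : Submodule _ _ => Module.finrank (RatFunc K) V) h1).trans
    (finrank_bot _ _)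

end DelsarteSurface

/-! ### Construction of Delsarte surfaces and Delsarte birational maps -/

/-- `(p', q')` arises from `(p, q)` by an invertible affine change of coordinates. -/
def IsAffineChange (p q p' q' : Fin 4 → ℤ) : Prop :=
  ∃ α β γ δ ε a b : ℤ, ε * (α * δ - β * γ) = 1 ∧ (∀ i, p i = α * p' i + γ * q' i + a) ∧
    ∀ i, q i = β * p' i + δ * q' i + b

namespace DelsarteSurface

variable {K : Type*} [Field K]

/-- The Delsarte surface with given affine exponents and all coefficients equal to one. -/
def ofExponents (K : Type*) [Field K] (p q T : Fin 4 → ℕ) : DelsarteSurface K where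
  -- The last column pads all rows to the common degree, the sum of all affine exponents.
  A := Matrix.of fun i => ![p i, q i, T i, ∑ l, (p l + q l + T l) - (p i + q i + T i)]
  d := ∑ l, (p l + q l + T l)
  row_sum i := by
    have := Finset.single_le_sum (f := fun l => p l + q l + T l) (fun _ _ => Nat.zero_le _)
      (Finset.mem_univ i)
    simp only [Fin.sum_univ_four, Matrix.of_apply, Matrix.cons_val] at this ⊢
    omega
  c := 1
  c_ne_zero _ := one_ne_zero

theorem exists_isRescaling [IsAlgClosed K] [CharZero K] (S : DelsarteSurface K)
    (hA : (S.A.map (Nat.cast : ℕ → ℤ)).det ≠ 0) :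
    ∃ S₁ : DelsarteSurface K, S.IsRescaling S₁ ∧ S₁.A = S.A ∧ S₁.c = 1 := by
  obtain ⟨l, hl, hlc⟩ := exists_prod_zpow_eq _ hA (u := fun i => (S.c i)⁻¹)
    fun i => inv_ne_zero (S.c_ne_zero i)
  refine ⟨⟨S.A, S.d, S.row_sum, 1, fun _ => one_ne_zero⟩, ⟨l, 1, hl, one_ne_zero, ?_⟩, rfl, rfl⟩
  simp only [equation, map_sum, map_mul, aeval_C, algebraMap_eq, map_prod, map_pow, aeval_X,
    mul_pow, Finset.prod_mul_distrib, map_one, one_mul, Pi.one_apply]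
  refine Finset.sum_congr rfl fun i _ => ?_
  simp only [← map_pow, ← map_prod]
  rw [← mul_assoc, ← map_mul]
  have h := hlc i
  simp only [Matrix.map_apply, zpow_natCast] at h
  rw [h, mul_inv_cancel₀ (S.c_ne_zero i), map_one, one_mul]

/-- A common vector `w` in all rows is a monomial factor of the equation. Its negative and positive
parts are moved to the two sides. -/
theorem mapsSurface_of_exponents {S S' : DelsarteSurface K} (hc : S.c = 1) (hc' : S'.c = 1)
    {B : Matrix (Fin 4) (Fin 4) ℕ} (w : Fin 4 → ℤ)
    (hw : ∀ i j, ∑ l, (S'.A i l : ℤ) * B l j = S.A i j + w j) : MapsSurface B S S' := by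
  refine ⟨fun j => (-w j).toNat, fun j => (w j).toNat, ?_⟩
  simp only [equation, hc, hc', map_sum, map_mul, map_prod, map_pow, aeval_X, Finset.mul_sum,
    Pi.one_apply, map_one, one_mul]
  refine Finset.sum_congr rfl fun i _ => ?_
  simp only [← Finset.prod_pow, ← pow_mul]
  rw [Finset.prod_comm, ← Finset.prod_mul_distrib, ← Finset.prod_mul_distrib]
  refine Finset.prod_congr rfl fun j _ => ?_
  rw [Finset.prod_pow_eq_pow_sum, ← pow_add, ← pow_add]
  congr 1
  have h1 := hw i j
  simp only [Fin.sum_univ_four] at h1 ⊢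
  simp only [mul_comm (B _ j)]
  zify
  have h2 : (((-w j).toNat : ℕ) : ℤ) - ((w j).toNat : ℕ) = -w j := by omega
  linarith

/-- The monomial map `(x, y, t) ↦ (x ^ α y ^ β t ^ μ, x ^ γ y ^ δ t ^ ν, t)`. -/
theorem exists_isDelsarteBirationalMap {α β γ δ ε : ℤ} (hε : ε * (α * δ - β * γ) = 1) (μ ν : ℤ) :
    ∃ (B : Matrix (Fin 4) (Fin 4) ℕ) (G : ℤ), (∀ i j, (B i j : ℤ) = G +
      (!![α, β, μ, -(α + β + μ); γ, δ, ν, -(γ + δ + ν); 0, 0, 1, -1; 0, 0, 0, 0] :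
        Matrix (Fin 4) (Fin 4) ℤ) i j) ∧ IsDelsarteBirationalMap B ∧
      RespectsStandardFibration B := by
  -- Adding a constant to all entries of an exponent matrix multiplies the four monomials by a
  -- common factor. A large constant `G` makes all exponents, and later the common factor of the
  -- composite, nonnegative.
  have key : ∀ M : Matrix (Fin 4) (Fin 4) ℤ, ∃ (B : Matrix (Fin 4) (Fin 4) ℕ) (G : ℕ), 0 < G ∧
      (∀ i j, (B i j : ℤ) = G + M i j) ∧ ∀ j, |∑ l, M l j| ≤ G := by
    intro M
    have h1 : ∀ i j, |M i j| ≤ ∑ i, ∑ j, |M i j| := fun i j =>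
      (Finset.single_le_sum (f := fun j => |M i j|) (fun _ _ => abs_nonneg _)
        (Finset.mem_univ j)).trans (Finset.single_le_sum (f := fun i => ∑ j, |M i j|)
          (fun _ _ => Finset.sum_nonneg fun _ _ => abs_nonneg _) (Finset.mem_univ i))
    have h0 : 0 ≤ ∑ i, ∑ j, |M i j| :=
      Finset.sum_nonneg fun _ _ => Finset.sum_nonneg fun _ _ => abs_nonneg _
    obtain ⟨G, hG⟩ := Int.eq_ofNat_of_zero_le h0
    refine ⟨fun i j => ((G + 1 : ℤ) + M i j).toNat, G + 1, Nat.succ_pos _, fun i j => ?_, fun j => ?_⟩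
    · have := h1 i j
      have := neg_abs_le (M i j)
      rw [Int.toNat_of_nonneg (by omega)]
      push_cast
      ring
    · refine (Finset.abs_sum_le_sum_abs _ _).trans ?_
      have : ∑ l, |M l j| ≤ ∑ i, ∑ j, |M i j| := Finset.sum_le_sum fun i _ =>
        Finset.single_le_sum (f := fun j => |M i j|) (fun _ _ => abs_nonneg _) (Finset.mem_univ j)
      push_cast
      omega
  have hmul : ∀ (M M' : Matrix (Fin 4) (Fin 4) ℤ) (B B' : Matrix (Fin 4) (Fin 4) ℕ) (G G' : ℕ),
      0 < G → 0 < G' → (∀ i j, (B i j : ℤ) = G + M i j) → (∀ i j, (B' i j : ℤ) = G' + M' i j) →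
      (∀ j, |∑ l, M' l j| ≤ G') → (∀ i, ∑ l, M i l = 0) →
      (∀ i j, (M * M') i j = (if i = j then 1 else 0) - (if j = 3 then 1 else 0)) →
      IsIdentityMap (B * B') := by
    intro M M' B B' G G' hG hG' hB hB' hcol hrow hMM
    -- The common monomial factor of the composite. The term for `j = 3` appears because the Laurent
    -- exponents are normalized by a zero last row.
    have hnn : ∀ j, 0 ≤ 4 * (G : ℤ) * G' + G * ∑ l, M' l j - (if j = 3 then 1 else 0) := by
      intro j
      have h1 := neg_le_of_abs_le (hcol j)
      have h2 : (1 : ℤ) ≤ G := by exact_mod_cast hG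
      have h3 : (1 : ℤ) ≤ G' := by exact_mod_cast hG'
      split_ifs <;> nlinarith
    choose w hw using fun j => Int.eq_ofNat_of_zero_le (hnn j)
    refine ⟨w, fun i j => ?_⟩
    zify
    rw [← hw, Matrix.mul_apply]
    push_cast
    simp only [hB, hB']
    have h1 := hMM i j
    have h2 := hrow i
    rw [Matrix.mul_apply] at h1
    simp only [Fin.sum_univ_four] at h1 h2 ⊢
    linear_combination h1 + G' * h2
  have hmon : ∀ (M : Matrix (Fin 4) (Fin 4) ℤ) (B : Matrix (Fin 4) (Fin 4) ℕ) (G : ℕ),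
      (∀ i j, (B i j : ℤ) = G + M i j) → (∀ i, ∑ l, M i l = 0) → IsMonomialMap B := by
    intro M B G hB hrow
    refine ⟨4 * G, fun i => ?_⟩
    have h2 := hrow i
    zify
    simp only [hB, Fin.sum_univ_four] at h2 ⊢
    linear_combination h2
  obtain ⟨M, hM⟩ : ∃ M, M = (!![α, β, μ, -(α + β + μ); γ, δ, ν, -(γ + δ + ν); 0, 0, 1, -1;
    0, 0, 0, 0] : Matrix (Fin 4) (Fin 4) ℤ) := ⟨_, rfl⟩
  obtain ⟨M', hM'⟩ : ∃ M', M' = (!![ε * δ, -(ε * β), ε * (β * ν - δ * μ),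
      -(ε * δ - ε * β + ε * (β * ν - δ * μ)); -(ε * γ), ε * α, ε * (γ * μ - α * ν),
      -(ε * α - ε * γ + ε * (γ * μ - α * ν)); 0, 0, 1, -1; 0, 0, 0, 0] :
        Matrix (Fin 4) (Fin 4) ℤ) := ⟨_, rfl⟩
  obtain ⟨B, G, hG, hB, hcol⟩ := key M
  obtain ⟨B', G', hG', hB', hcol'⟩ := key M'
  have hrow : ∀ i, ∑ l, M i l = 0 := by
    intro i
    rw [hM]
    fin_cases i <;> simp [Fin.sum_univ_four] <;> ring
  have hrow' : ∀ i, ∑ l, M' i l = 0 := by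
    intro i
    rw [hM']
    fin_cases i <;> simp [Fin.sum_univ_four] <;> ring
  have hMM : ∀ i j, (M * M') i j = (if i = j then 1 else 0) - (if j = 3 then 1 else 0) := by
    intro i j
    rw [hM, hM', Matrix.mul_apply]
    fin_cases i <;> fin_cases j <;> simp [Fin.sum_univ_four] <;>
      first
      | ring1
      | linear_combination hε
      | linear_combination -hε
      | linear_combination μ * hε
      | linear_combination -μ * hε
      | linear_combination ν * hε
      | linear_combination -ν * hε
      | linear_combination (-1 - μ) * hε
      | linear_combination (-1 + μ) * hε
      | linear_combination (-1 - ν) * hε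
      | linear_combination (-1 + ν) * hε
  have hMM' : ∀ i j, (M' * M) i j = (if i = j then 1 else 0) - (if j = 3 then 1 else 0) := by
    intro i j
    rw [hM, hM', Matrix.mul_apply]
    fin_cases i <;> fin_cases j <;> simp [Fin.sum_univ_four] <;>
      first
      | ring1
      | linear_combination hε
      | linear_combination -hε
  refine ⟨B, G, fun i j => by rw [hB, hM], ⟨hmon M B G hB hrow, B', hmon M' B' G' hB' hrow',
    hmul M M' B B' G G' hG hG' hB hB' hcol' hrow hMM,
    hmul M' M B' B G' G hG' hG hB' hB hcol hrow' hMM'⟩, fun j => ?_⟩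
  zify
  rw [hB, hB, hM]
  fin_cases j <;> simp

theorem genericFibre_ofExponents (p q T : Fin 4 → ℕ) : (ofExponents K p q T).genericFibre =
    ∑ i, C (RatFunc.X ^ T i) * (X 0 ^ p i * X 1 ^ q i) := by
  rw [genericFibre, fibre_eq_sum]
  refine Finset.sum_congr rfl fun i _ => ?_
  simp [ofExponents]

/-- After a base change and a Delsarte birational map the fibration has a given affine equation,
provided that the exponents correspond. -/
theorem exists_baseChange_and_birationalMap [IsAlgClosed K] [CharZero K] (S : DelsarteSurface K)
    (hA : (S.A.map (Nat.cast : ℕ → ℤ)).det ≠ 0) {p' q' : Fin 4 → ℕ}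
    (hch : IsAffineChange S.xExp S.yExp (fun i => p' i) (fun i => q' i))
    (hk : affineRelation (fun i => p' i) (fun i => q' i) 0 ≠ 0) :
    ∃ S₁ : DelsarteSurface K, S.IsRescaling S₁ ∧
    ∃ (S₂ : DelsarteSurface K) (N : ℤ), S₁.IsDelsarteBaseChange S₂ N ∧
    ∃ (S' : DelsarteSurface K) (B : Matrix (Fin 4) (Fin 4) ℕ),
      IsDelsarteBirationalMap B ∧ RespectsStandardFibration B ∧ MapsSurface B S₂ S' ∧
      ∃ n : ℕ, 1 ≤ n ∧ S'.genericFibre = C (RatFunc.X ^ n) * (X 0 ^ p' 0 * X 1 ^ q' 0) +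
        ∑ i : Fin 3, X 0 ^ p' i.succ * X 1 ^ q' i.succ := by
  obtain ⟨S₁, hS₁, hA₁, hc₁⟩ := S.exists_isRescaling hA
  obtain ⟨α, β, γ, δ, ε, a, b, hε, hp, hq⟩ := hch
  obtain ⟨k, hkdef⟩ : ∃ k, k = affineRelation (fun i => p' i) (fun i => q' i) := ⟨_, rfl⟩
  have hT : ∑ i, k i * S.tExp i ≠ 0 := by
    intro h
    apply S.sum_tExp_ne_zero hA
    simp only [affineRelation_of_change hp hq, mul_assoc, ← Finset.mul_sum, ← hkdef, h, mul_zero]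
  -- The sign `s` is absorbed in the base change `t = s ^ N`, which makes the final exponent `n`
  -- positive.
  obtain ⟨s, n, hs, hn, hsn⟩ : ∃ (s : ℤ) (n : ℕ), s ≠ 0 ∧ 1 ≤ n ∧ (n : ℤ) = s * ∑ i, k i * S.tExp i := by
    refine ⟨(∑ i, k i * S.tExp i).sign, (∑ i, k i * S.tExp i).natAbs,
      fun h => hT (Int.sign_eq_zero_iff_zero.1 h), Int.natAbs_pos.2 hT, ?_⟩
    rw [Int.sign_mul_self_eq_abs, Int.natCast_natAbs]
  let T := S.tExp
  -- By Cramer's rule `μ` and `ν` are the slopes of the affine function that interpolates `s * k 0 *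
  -- T` at the points of index `1`, `2`, `3`; the factor `k 0`, the area of their triangle, makes
  -- the slopes integral. The monomial map removes this function, and the defect at the remaining
  -- point is `n`.
  obtain ⟨μ, hμ⟩ : ∃ μ, μ = s * ((T 2 - T 1) * ((q' 3 : ℤ) - q' 1) - (T 3 - T 1) * (q' 2 - q' 1)) :=
    ⟨_, rfl⟩
  obtain ⟨ν, hν⟩ : ∃ ν, ν = s * (((p' 2 : ℤ) - p' 1) * (T 3 - T 1) - (p' 3 - p' 1) * (T 2 - T 1)) :=
    ⟨_, rfl⟩
  have hexp : ∀ i, s * k 0 * T i = μ * p' i + ν * q' i + ((if i = 0 then n else 0 : ℕ) : ℤ) +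
      (s * k 0 * T 1 - μ * p' 1 - ν * q' 1) := by
    intro i
    have hni : ((if i = 0 then n else 0 : ℕ) : ℤ) = if i = 0 then s * ∑ i, k i * T i else 0 := by
      split_ifs
      · exact hsn
      · rfl
    rw [hni, hkdef, hμ, hν]
    fin_cases i <;> simp [affineRelation, Fin.sum_univ_four] <;> ring
  obtain ⟨B, G, hB, hBbir, hBfib⟩ := exists_isDelsarteBirationalMap hε μ ν
  -- The admissible power of the parameter that makes all exponents nonnegative.
  obtain ⟨e, he⟩ : ∃ e : ℕ, ∀ i, 0 ≤ s * k 0 * T i + e := by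
    refine ⟨(∑ i, |s * k 0 * T i|).toNat, fun i => ?_⟩
    have h1 : |s * k 0 * T i| ≤ ∑ i, |s * k 0 * T i| :=
      Finset.single_le_sum (f := fun i => |s * k 0 * T i|) (fun _ _ => abs_nonneg _)
        (Finset.mem_univ i)
    have h2 := neg_abs_le (s * k 0 * T i)
    omega
  choose T₂ hT₂ using fun i => Int.eq_ofNat_of_zero_le (he i)
  have hN : s * k 0 ≠ 0 := mul_ne_zero hs (hkdef ▸ hk)
  refine ⟨S₁, hS₁, ofExponents K (fun i => S.A i 0) (fun i => S.A i 1) T₂, s * k 0, ⟨hN, e, ?_⟩,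
    ofExponents K p' q' (fun i => if i = 0 then n else 0), B, hBbir, hBfib, ?_, n, hn, ?_⟩
  · rw [genericFibre_ofExponents, fibre_eq_sum, Finset.mul_sum]
    refine Finset.sum_congr rfl fun i _ => ?_
    rw [hA₁, hc₁, Pi.one_apply, map_one, one_mul, ← mul_assoc (C (RatFunc.X ^ (e : ℤ))), ← map_mul]
    congr 2
    rw [← zpow_natCast, ← zpow_natCast, ← zpow_mul, ← zpow_add₀ RatFunc.X_ne_zero]
    congr 1
    have := hT₂ i
    simp only [T, tExp] at this
    linarith
  · obtain ⟨d₂, hd₂⟩ : ∃ d₂, d₂ = (ofExponents K (fun i => S.A i 0) (fun i => S.A i 1) T₂).d := ⟨_, rfl⟩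
    obtain ⟨d', hd'⟩ : ∃ d', d' = (ofExponents K p' q' (fun i => if i = 0 then n else 0)).d := ⟨_, rfl⟩
    obtain ⟨c₃, hc₃⟩ : ∃ c₃, c₃ = e + (s * k 0 * T 1 - μ * p' 1 - ν * q' 1) := ⟨_, rfl⟩
    -- The first three entries are the translations of the exponents of `x`, `y` and `t`, shifted by
    -- `d' * G` because `B` contains the constant `G`. The last one is forced by the row sums.
    refine mapsSurface_of_exponents rfl rfl ![d' * G - a, d' * G - b, d' * G - c₃,
      d' * G - d₂ + a + b + c₃] fun i j => ?_
    have h1 := (ofExponents K p' q' (fun i => if i = 0 then n else 0)).row_sum i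
    have h2 := (ofExponents K (fun i => S.A i 0) (fun i => S.A i 1) T₂).row_sum i
    rw [← hd'] at h1
    rw [← hd₂] at h2
    have e1 : ∀ j, (ofExponents K p' q' (fun i => if i = 0 then n else 0)).A i j =
      ![p' i, q' i, if i = 0 then n else 0,
        (ofExponents K p' q' (fun i => if i = 0 then n else 0)).A i 3] j := by
      intro j
      fin_cases j <;> rfl
    have e2 : ∀ j, (ofExponents K (fun i => S.A i 0) (fun i => S.A i 1) T₂).A i j =
      ![S.A i 0, S.A i 1, T₂ i, (ofExponents K (fun i => S.A i 0) (fun i => S.A i 1) T₂).A i 3] j := by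
      intro j
      fin_cases j <;> rfl
    rw [Fin.sum_univ_four, e1 0, e1 1, e1 2] at h1
    rw [Fin.sum_univ_four, e2 0, e2 1, e2 2] at h2
    obtain ⟨z₁, hz₁⟩ : ∃ z₁ : ℕ, z₁ = if i = 0 then n else 0 := ⟨_, rfl⟩
    have hpi := hp i
    have hqi := hq i
    have hTi := hexp i
    have hT2i := hT₂ i
    rw [Fin.sum_univ_four, e1 0, e1 1, e1 2, e2 j, ← hz₁]
    rw [← hz₁] at h1 hTi
    generalize (ofExponents K p' q' (fun i => if i = 0 then n else 0)).A i 3 = z at *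
    generalize (ofExponents K (fun i => S.A i 0) (fun i => S.A i 1) T₂).A i 3 = z₂ at *
    simp only [Matrix.cons_val, xExp, yExp] at h1 h2 hpi hqi ⊢
    zify at h1 h2
    simp only [hB]
    fin_cases j <;> simp only [Fin.zero_eta, Fin.mk_one, Fin.reduceFinMk, Matrix.of_apply,
      Matrix.cons_val]
    · linear_combination G * h1 - hpi
    · linear_combination G * h1 - hqi
    · linear_combination G * h1 - hTi + hT2i + hc₃
    · linear_combination G * h1 + hpi + hqi + hTi - hT2i - hc₃ - h2
  · rw [genericFibre_ofExponents, Fin.sum_univ_succ]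
    simp [Fin.succ_ne_zero]

end DelsarteSurface

/-! ### Four lattice points in the plane -/

/-- Twice the signed area of a triangle. -/
def triangleArea (p q : Fin 4 → ℤ) (i j l : Fin 4) : ℤ :=
  (p j - p i) * (q l - q i) - (p l - p i) * (q j - q i)

/-- A functional that is nowhere smaller at the vertices than at the point is equal to its value
there at every vertex of positive weight, so it is constant on a nondegenerate triangle and
vanishes. -/
theorem isInteriorPoint_of_weights {p q : Fin 4 → ℤ} {r₁ r₂ : ℤ} (m : Fin 4 → ℤ)
    (hm : ∀ i, 0 ≤ m i) (h₁ : ∑ i, m i * (p i - r₁) = 0) (h₂ : ∑ i, m i * (q i - r₂) = 0)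
    (i j l : Fin 4) (hi : 0 < m i) (hj : 0 < m j) (hl : 0 < m l) (h : triangleArea p q i j l ≠ 0) :
    IsInteriorPoint p q r₁ r₂ := by
  intro u v huv
  by_contra! hcon
  have h0 : ∑ i, m i * (u * p i + v * q i - (u * r₁ + v * r₂)) = 0 := by
    simp only [Fin.sum_univ_four] at h₁ h₂ ⊢
    linear_combination u * h₁ + v * h₂
  rw [Finset.sum_eq_zero_iff_of_nonneg fun i _ => mul_nonneg (hm i) (sub_nonneg.2 (hcon i))] at h0
  have key : ∀ i, 0 < m i → u * p i + v * q i = u * r₁ + v * r₂ := fun i hi =>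
    sub_eq_zero.1 ((mul_eq_zero.1 (h0 i (Finset.mem_univ i))).resolve_left hi.ne')
  have e1 := key i hi
  have e2 := key j hj
  have e3 := key l hl
  have hu : u * triangleArea p q i j l = 0 := by
    rw [triangleArea]
    linear_combination (q l - q i) * (e2 - e1) - (q j - q i) * (e3 - e1)
  have hv : v * triangleArea p q i j l = 0 := by
    rw [triangleArea]
    linear_combination (p j - p i) * (e3 - e1) - (p l - p i) * (e2 - e1)
  exact huv.elim (fun h' => h' ((mul_eq_zero.1 hu).resolve_right h))
    fun h' => h' ((mul_eq_zero.1 hv).resolve_right h)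

theorem IsAffineChange.trans {p q p' q' p'' q'' : Fin 4 → ℤ} (h : IsAffineChange p q p' q')
    (h' : IsAffineChange p' q' p'' q'') : IsAffineChange p q p'' q'' := by
  obtain ⟨α, β, γ, δ, ε, a, b, hε, hp, hq⟩ := h
  obtain ⟨α', β', γ', δ', ε', a', b', hε', hp', hq'⟩ := h'
  refine ⟨α * α' + γ * β', β * α' + δ * β', α * γ' + γ * δ', β * γ' + δ * δ', ε * ε',
    α * a' + γ * b' + a, β * a' + δ * b' + b, ?_, fun i => ?_, fun i => ?_⟩
  · linear_combination ε' * (α' * δ' - β' * γ') * hε + hε'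
  · rw [hp, hp', hq']
    ring
  · rw [hq, hp', hq']
    ring

theorem IsAffineChange.comp {p q p' q' : Fin 4 → ℤ} (h : IsAffineChange p q p' q')
    (e : Fin 4 → Fin 4) : IsAffineChange (p ∘ e) (q ∘ e) (p' ∘ e) (q' ∘ e) := by
  obtain ⟨α, β, γ, δ, ε, a, b, hε, hp, hq⟩ := h
  exact ⟨α, β, γ, δ, ε, a, b, hε, fun i => hp _, fun i => hq _⟩

theorem IsInteriorPoint.of_isAffineChange {p q p' q' : Fin 4 → ℤ} (h : IsAffineChange p q p' q')
    {r₁ r₂ : ℤ} (hr : IsInteriorPoint p' q' r₁ r₂) : ∃ r₁ r₂, IsInteriorPoint p q r₁ r₂ := by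
  obtain ⟨α, β, γ, δ, ε, a, b, hε, hp, hq⟩ := h
  refine ⟨α * r₁ + γ * r₂ + a, β * r₁ + δ * r₂ + b, fun u v huv => ?_⟩
  obtain ⟨i, hi⟩ := hr (u * α + v * β) (u * γ + v * δ) (by
    by_contra! hcon
    have hu : u = 0 := by linear_combination -u * hε + ε * δ * hcon.1 - ε * β * hcon.2
    have hv : v = 0 := by linear_combination -v * hε + ε * α * hcon.2 - ε * γ * hcon.1
    exact huv.elim (fun h => h hu) fun h => h hv)
  refine ⟨i, ?_⟩
  rw [hp, hq]
  linarith

theorem HasWidthOne.of_isAffineChange {p q p' q' : Fin 4 → ℤ} (h : IsAffineChange p q p' q')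
    (hw : HasWidthOne p' q') : HasWidthOne p q := by
  obtain ⟨α, β, γ, δ, ε, a, b, hε, hp, hq⟩ := h
  obtain ⟨w₁, w₂, c, ⟨s, t, hst⟩, hw⟩ := hw
  have h1 : ∀ i, ε * (δ * w₁ - β * w₂) * p i + ε * (α * w₂ - γ * w₁) * q i =
      w₁ * p' i + w₂ * q' i + (ε * (δ * w₁ - β * w₂) * a + ε * (α * w₂ - γ * w₁) * b) := by
    intro i
    rw [hp, hq]
    linear_combination (w₁ * p' i + w₂ * q' i) * hε
  refine ⟨ε * (δ * w₁ - β * w₂), ε * (α * w₂ - γ * w₁),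
    c + (ε * (δ * w₁ - β * w₂) * a + ε * (α * w₂ - γ * w₁) * b),
    ⟨s * α + t * γ, s * β + t * δ, ?_⟩, fun i => ?_⟩
  · linear_combination (s * w₁ + t * w₂) * hε + hst
  · rw [h1]
    rcases hw i with h | h
    · left
      rw [h]
    · right
      rw [h]
      ring

/-- An affine change of coordinates that maps two given points to the first axis. -/
theorem exists_isAffineChange {p q : Fin 4 → ℤ} {i j : Fin 4} (h : p i ≠ p j ∨ q i ≠ q j) :
    ∃ p' q' : Fin 4 → ℤ, IsAffineChange p q p' q' ∧ p' i = 0 ∧ q' i = 0 ∧ q' j = 0 ∧ 0 < p' j ∧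
      ∀ l, triangleArea p q i j l = p' j * q' l := by
  have hg : 0 < Int.gcd (p j - p i) (q j - q i) := Nat.pos_of_ne_zero fun h0 => by
    rw [Int.gcd_eq_zero_iff] at h0
    omega
  obtain ⟨x, hx⟩ := Int.gcd_dvd_left (a := p j - p i) (b := q j - q i)
  obtain ⟨y, hy⟩ := Int.gcd_dvd_right (a := p j - p i) (b := q j - q i)
  have hbez := Int.gcd_eq_gcd_ab (p j - p i) (q j - q i)
  generalize Int.gcdA (p j - p i) (q j - q i) = u at hbez
  generalize Int.gcdB (p j - p i) (q j - q i) = v at hbez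
  generalize Int.gcd (p j - p i) (q j - q i) = n at hg hx hy hbez
  have hn0 : (0 : ℤ) < n := by exact_mod_cast hg
  have huv : x * u + y * v = 1 := by
    apply mul_left_cancel₀ hn0.ne'
    linear_combination -u * hx - v * hy - hbez
  -- `(x, y)` is the primitive direction of the segment and `(u, v)` a Bézout pair for it.
  refine ⟨fun l => u * (p l - p i) + v * (q l - q i), fun l => x * (q l - q i) - y * (p l - p i),
    ⟨x, y, -v, u, 1, p i, q i, ?_, fun l => ?_, fun l => ?_⟩, ?_, ?_, ?_, ?_, fun l => ?_⟩
  · linear_combination huv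
  · linear_combination -(p l - p i) * huv
  · linear_combination -(q l - q i) * huv
  · ring
  · ring
  · linear_combination x * hy - y * hx
  · have : u * (p j - p i) + v * (q j - q i) = (n : ℤ) := by linear_combination -hbez
    simpa only [this] using hn0
  · rw [triangleArea]
    have : u * (p j - p i) + v * (q j - q i) = (n : ℤ) := by linear_combination -hbez
    simp only [this]
    linear_combination (q l - q i) * hx - (p l - p i) * hy

theorem exists_perm_of_ne {i j l m : Fin 4} (hij : i ≠ j) (hil : i ≠ l) (him : i ≠ m) (hjl : j ≠ l)
    (hjm : j ≠ m) (hlm : l ≠ m) :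
    ∃ e : Equiv.Perm (Fin 4), e 0 = i ∧ e 1 = j ∧ e 2 = l ∧ e 3 = m := by
  refine ⟨Equiv.ofBijective ![i, j, l, m] (Finite.injective_iff_bijective.1 fun a b h => ?_),
    rfl, rfl, rfl, rfl⟩
  revert h
  fin_cases a <;> fin_cases b <;> simp [hij, hil, him, hjl, hjm, hlm, hij.symm, hil.symm, him.symm,
    hjl.symm, hjm.symm, hlm.symm]

/-! ### Four lattice points without three on a line. -/

section NoThreeCollinear

/-- The first edge lies on the axis, the third point is the highest and is reduced by a shear.
Unless `h = 1`, the point `(1, 1)` lies inside the triangle of the first three points, or this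
triangle is one of three small ones. For those, the position of the fourth point decides. -/
theorem hasWidthOne_or_exists_isInteriorPoint_of_normalForm {n b h b' h' : ℤ} (hn : 0 < n)
    (hb : 0 ≤ b) (hbh : b < h) (hh' : 0 < h') (hh : h' ≤ h) (h023 : b * h' - b' * h ≠ 0)
    (h123 : (b - n) * h' - (b' - n) * h ≠ 0) :
    HasWidthOne ![0, n, b, b'] ![0, 0, h, h'] ∨
      ∃ r₁ r₂, IsInteriorPoint ![0, n, b, b'] ![0, 0, h, h'] r₁ r₂ := by
  have hD : ∀ i j l : Fin 4, triangleArea ![0, n, b, b'] ![0, 0, h, h'] i j l =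
      (![0, n, b, b'] j - ![0, n, b, b'] i) * (![0, 0, h, h'] l - ![0, 0, h, h'] i) -
      (![0, n, b, b'] l - ![0, n, b, b'] i) * (![0, 0, h, h'] j - ![0, 0, h, h'] i) :=
    fun _ _ _ => rfl
  have d012 : triangleArea ![0, n, b, b'] ![0, 0, h, h'] 0 1 2 ≠ 0 := by
    simp only [hD, Matrix.cons_val]
    have := mul_pos hn (hb.trans_lt hbh)
    intro h0
    linarith
  have d013 : triangleArea ![0, n, b, b'] ![0, 0, h, h'] 0 1 3 ≠ 0 := by
    simp only [hD, Matrix.cons_val]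
    have := mul_pos hn hh'
    intro h0
    linarith
  have d023 : triangleArea ![0, n, b, b'] ![0, 0, h, h'] 0 2 3 ≠ 0 := by
    simp only [hD, Matrix.cons_val]
    intro h0
    exact h023 (by linarith)
  have d123 : triangleArea ![0, n, b, b'] ![0, 0, h, h'] 1 2 3 ≠ 0 := by
    simp only [hD, Matrix.cons_val]
    intro h0
    exact h123 (by linarith)
  have hw : ∀ (r₁ r₂ m₀ m₁ m₂ m₃ : ℤ) (i j l : Fin 4), 0 ≤ m₀ → 0 ≤ m₁ → 0 ≤ m₂ → 0 ≤ m₃ →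
      m₀ * (0 - r₁) + m₁ * (n - r₁) + m₂ * (b - r₁) + m₃ * (b' - r₁) = 0 →
      m₀ * (0 - r₂) + m₁ * (0 - r₂) + m₂ * (h - r₂) + m₃ * (h' - r₂) = 0 →
      0 < ![m₀, m₁, m₂, m₃] i → 0 < ![m₀, m₁, m₂, m₃] j → 0 < ![m₀, m₁, m₂, m₃] l →
      triangleArea ![0, n, b, b'] ![0, 0, h, h'] i j l ≠ 0 →
      HasWidthOne ![0, n, b, b'] ![0, 0, h, h'] ∨
        ∃ r₁ r₂, IsInteriorPoint ![0, n, b, b'] ![0, 0, h, h'] r₁ r₂ := by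
    intro r₁ r₂ m₀ m₁ m₂ m₃ i j l h0 h1 h2 h3 e1 e2 hi hj hl hijl
    refine Or.inr ⟨r₁, r₂, isInteriorPoint_of_weights ![m₀, m₁, m₂, m₃] (fun i => ?_) ?_ ?_ i j l
      hi hj hl hijl⟩
    · fin_cases i <;> assumption
    · simpa [Fin.sum_univ_four] using e1
    · simpa [Fin.sum_univ_four] using e2
  rcases (by omega : h = 1 ∨ 2 ≤ h) with rfl | h2
  · obtain rfl : h' = 1 := by omega
    refine Or.inl ⟨0, 1, 0, isCoprime_one_right, fun i => ?_⟩
    fin_cases i <;> simp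
  by_cases hin : 0 < n * h - n - h + b
  · exact hw 1 1 (n * h - n - h + b) (h - b) n 0 0 1 2 hin.le (by omega) hn.le le_rfl (by ring)
      (by ring) (by simpa using hin) (by simp; omega) (by simpa using hn) d012
  -- What remains is `(n - 1) * (h - 1) + b ≤ 1`. In each case the lattice point found for a fourth
  -- point that is not on the lines in question is `(0, 1)` or `(1, 1)`.
  have hcase : (n = 1 ∧ b = 0) ∨ (n = 1 ∧ b = 1) ∨ (n = 2 ∧ h = 2 ∧ b = 0) := by
    have h3 : (n - 1) * (h - 1) + b ≤ 1 := by linarith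
    rcases (by omega : n = 1 ∨ n = 2 ∨ 3 ≤ n) with rfl | rfl | h4
    · omega
    · omega
    · nlinarith
  rcases hcase with ⟨rfl, rfl⟩ | ⟨rfl, rfl⟩ | ⟨rfl, rfl, rfl⟩
  · rcases (by omega : b' < 0 ∨ b' = 0 ∨ b' = 1 ∨ 2 ≤ b') with h3 | rfl | rfl | h3
    -- Here and below, the lattice point lies on a segment between two vertices. A multiple of its
    -- weights there, given by an absolute value plus one, is added to keep all weights nonnegative.
    · have h4 := mul_pos (by omega : 0 < h - 1) (by positivity : 0 < |b' + (h' - 1)| + 1)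
      have h5 := neg_abs_le (b' + (h' - 1))
      have h6 : |b' + (h' - 1)| + 1 ≤ (h - 1) * (|b' + (h' - 1)| + 1) := by nlinarith
      exact hw 0 1 (b' + (h' - 1) + (h - 1) * (|b' + (h' - 1)| + 1)) (-b')
        (|b' + (h' - 1)| + 1) 1 0 1 3 (by linarith) (by omega) (by positivity) zero_le_one (by ring)
        (by ring) (by simp; linarith) (by simpa using h3) (by simp) d013
    · simp at h023
    · refine Or.inl ⟨1, 0, 0, isCoprime_one_left, fun i => ?_⟩
      fin_cases i <;> simp
    · have h4 : 0 < (b' - 1) * (h - 1) := mul_pos (by omega) (by omega)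
      exact hw 1 1 0 ((b' - 1) * (h - 1) + (h' - 1)) (b' - 1) 1 1 2 3 le_rfl (by omega) (by omega)
        zero_le_one (by ring) (by ring) (by simp; omega) (by simp; omega) (by simp) d123
  · rcases (by omega : b' < 0 ∨ b' = 0 ∨ b' = 1 ∨ 2 ≤ b') with h3 | rfl | rfl | h3
    · have h4 : 0 < -b' * (h - 1) := mul_pos (by omega) (by omega)
      exact hw 0 1 (-b' * (h - 1) + (h' - 1)) 0 (-b') 1 0 2 3 (by omega) le_rfl (by omega)
        zero_le_one (by ring) (by ring) (by simp; simp at h4; omega) (by simp; omega) (by simp) d023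
    · refine Or.inl ⟨1, 0, 0, isCoprime_one_left, fun i => ?_⟩
      fin_cases i <;> simp
    · simp at h123
    · have h4 := mul_pos (by omega : 0 < h - 1) (by positivity : 0 < |h' - b'| + 1)
      have h5 := neg_abs_le (h' - b')
      have h6 : |h' - b'| + 1 ≤ (h - 1) * (|h' - b'| + 1) := by nlinarith
      exact hw 1 1 (b' - 1) (h' - b' + (h - 1) * (|h' - b'| + 1)) (|h' - b'| + 1) 1 0 1 3 (by omega)
        (by linarith) (by positivity) zero_le_one (by ring) (by ring) (by simp; omega)
        (by simp; linarith) (by simp) d013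
  · rcases (by omega : b' < 0 ∨ b' = 0 ∨ 0 < b') with h3 | rfl | h3
    · have h5 := neg_abs_le (b' + 2 * (h' - 1))
      exact hw 0 1 (b' + 2 * (h' - 1) + (|b' + 2 * (h' - 1)| + 1)) (-b')
        (|b' + 2 * (h' - 1)| + 1) 2 0 1 3 (by linarith) (by omega) (by positivity) zero_le_two
        (by ring) (by ring) (by simp; linarith) (by simpa using h3) (by simp) d013
    · simp at h023
    · have h4 : 0 < b' + h' - 2 := by omega
      have h5 := neg_abs_le (b' - h')
      exact hw 1 1 (b' + h' - 2) (|b' - h'| + 1) (b' - h' + (|b' - h'| + 1)) 2 0 1 3 h4.le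
        (by positivity) (by linarith) zero_le_two (by ring) (by ring) (by simpa using h4)
        (Int.lt_add_one_of_le (abs_nonneg (b' - h'))) (by simp) d013

theorem hasWidthOne_or_exists_isInteriorPoint_of_isAffineChange {p q p' q' : Fin 4 → ℤ}
    (h : IsAffineChange p q p' q')
    (h' : HasWidthOne p' q' ∨ ∃ r₁ r₂, IsInteriorPoint p' q' r₁ r₂) :
    HasWidthOne p q ∨ ∃ r₁ r₂, IsInteriorPoint p q r₁ r₂ := by
  rcases h' with h' | ⟨r₁, r₂, h'⟩
  · exact Or.inl (h'.of_isAffineChange h)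
  · exact Or.inr (h'.of_isAffineChange h)

theorem HasWidthOne.of_perm {p q : Fin 4 → ℤ} (e : Equiv.Perm (Fin 4))
    (h : HasWidthOne (p ∘ e) (q ∘ e)) : HasWidthOne p q := by
  obtain ⟨w₁, w₂, c, hw, h⟩ := h
  exact ⟨w₁, w₂, c, hw, fun i => by simpa using h (e.symm i)⟩

theorem hasWidthOne_or_exists_isInteriorPoint_of_perm {p q : Fin 4 → ℤ} (e : Equiv.Perm (Fin 4))
    (h : HasWidthOne (p ∘ e) (q ∘ e) ∨ ∃ r₁ r₂, IsInteriorPoint (p ∘ e) (q ∘ e) r₁ r₂) :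
    HasWidthOne p q ∨ ∃ r₁ r₂, IsInteriorPoint p q r₁ r₂ := by
  rcases h with h | ⟨r₁, r₂, h⟩
  · exact Or.inl (h.of_perm e)
  · refine Or.inr ⟨r₁, r₂, fun u v huv => ?_⟩
    obtain ⟨i, hi⟩ := h u v huv
    exact ⟨e i, hi⟩

/-- If the line through `0`, `1` separates the other two points and so does the line through `0`,
`2`, then the additive relation between the four areas shows that the line through `1`, `2` does
not. -/
theorem exists_perm_supporting_edge {p q : Fin 4 → ℤ}
    (hD : ∀ i j l, i ≠ j → i ≠ l → j ≠ l → triangleArea p q i j l ≠ 0) :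
    ∃ i j l m : Fin 4, i ≠ j ∧ i ≠ l ∧ i ≠ m ∧ j ≠ l ∧ j ≠ m ∧ l ≠ m ∧
      0 < triangleArea p q i j l ∧ 0 < triangleArea p q i j m := by
  have hswap : ∀ i j l, triangleArea p q j i l = -triangleArea p q i j l := fun i j l => by
    simp only [triangleArea]
    ring
  have hrot : ∀ i j l, triangleArea p q j l i = triangleArea p q i j l := fun i j l => by
    simp only [triangleArea]
    ring
  have hrel : triangleArea p q 1 2 3 = triangleArea p q 0 1 2 - triangleArea p q 0 1 3 +
      triangleArea p q 0 2 3 := by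
    simp only [triangleArea]
    ring
  have key : ∀ i j l m : Fin 4, i ≠ j → i ≠ l → i ≠ m → j ≠ l → j ≠ m → l ≠ m →
      0 < triangleArea p q i j l * triangleArea p q i j m →
      ∃ i j l m : Fin 4, i ≠ j ∧ i ≠ l ∧ i ≠ m ∧ j ≠ l ∧ j ≠ m ∧ l ≠ m ∧
      0 < triangleArea p q i j l ∧ 0 < triangleArea p q i j m := by
    intro i j l m hij hil him hjl hjm hlm h
    rcases mul_pos_iff.1 h with h | h
    · exact ⟨i, j, l, m, hij, hil, him, hjl, hjm, hlm, h⟩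
    · exact ⟨j, i, l, m, hij.symm, hjl, hjm, hil, him, hlm, by rw [hswap]; linarith,
        by rw [hswap]; linarith⟩
  have h1 := hD 0 1 2 (by decide) (by decide) (by decide)
  have h2 := hD 0 1 3 (by decide) (by decide) (by decide)
  have h3 := hD 0 2 3 (by decide) (by decide) (by decide)
  have e1 : triangleArea p q 0 2 1 = -triangleArea p q 0 1 2 := by
    simp only [triangleArea]
    ring
  have e2 : triangleArea p q 1 2 0 = triangleArea p q 0 1 2 := hrot 0 1 2
  by_cases c1 : 0 < triangleArea p q 0 1 2 * triangleArea p q 0 1 3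
  · exact key 0 1 2 3 (by decide) (by decide) (by decide) (by decide) (by decide) (by decide) c1
  by_cases c2 : 0 < triangleArea p q 0 2 1 * triangleArea p q 0 2 3
  · exact key 0 2 1 3 (by decide) (by decide) (by decide) (by decide) (by decide) (by decide) c2
  · refine key 1 2 0 3 (by decide) (by decide) (by decide) (by decide) (by decide) (by decide) ?_
    rw [e1] at c2
    rw [e2, hrel]
    nlinarith [mul_self_pos.2 h1]

/-- Four lattice points, no three of which are collinear, have lattice width one, or their convex
hull has an interior lattice point. -/
theorem hasWidthOne_or_exists_isInteriorPoint {p q : Fin 4 → ℤ}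
    (hD : ∀ i j l, i ≠ j → i ≠ l → j ≠ l → triangleArea p q i j l ≠ 0) :
    HasWidthOne p q ∨ ∃ r₁ r₂, IsInteriorPoint p q r₁ r₂ := by
  have main : ∀ p q : Fin 4 → ℤ, (∀ i j l, i ≠ j → i ≠ l → j ≠ l → triangleArea p q i j l ≠ 0) →
      p 0 = 0 → q 0 = 0 → q 1 = 0 → 0 < p 1 → 0 < q 3 → q 3 ≤ q 2 →
      HasWidthOne p q ∨ ∃ r₁ r₂, IsInteriorPoint p q r₁ r₂ := by
    intro p q hD hp0 hq0 hq1 hp1 hq3 hq2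
    have hq : q = ![0, 0, q 2, q 3] := by
      ext i
      fin_cases i <;> simp [hq0, hq1]
    -- A shear along the axis reduces the third point modulo its height.
    have hch : IsAffineChange p q ![0, p 1, p 2 % q 2, p 3 - p 2 / q 2 * q 3] ![0, 0, q 2, q 3] := by
      refine ⟨1, 0, p 2 / q 2, 1, 1, 0, 0, by ring, fun i => ?_, fun i => ?_⟩
      · have := Int.mul_ediv_add_emod (p 2) (q 2)
        fin_cases i <;> simp [hp0] <;> linarith
      · rw [← hq]
        ring
    refine hasWidthOne_or_exists_isInteriorPoint_of_isAffineChange hch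
      (hasWidthOne_or_exists_isInteriorPoint_of_normalForm hp1 (Int.emod_nonneg _ (by omega))
        (Int.emod_lt_of_pos _ (by omega)) hq3 hq2 ?_ ?_)
    · have h := hD 0 2 3 (by decide) (by decide) (by decide)
      rw [triangleArea, hp0, hq0] at h
      intro h0
      apply h
      linear_combination h0 - q 3 * Int.mul_ediv_add_emod (p 2) (q 2)
    · have h := hD 1 2 3 (by decide) (by decide) (by decide)
      rw [triangleArea, hq1] at h
      intro h0
      apply h
      linear_combination h0 - q 3 * Int.mul_ediv_add_emod (p 2) (q 2)
  obtain ⟨i, j, l, m, hij, hil, him, hjl, hjm, hlm, hl, hm⟩ := exists_perm_supporting_edge hD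
  obtain ⟨p', q', hch, hpi, hqi, hqj, hpj, harea⟩ := exists_isAffineChange (p := p) (q := q) (i := i)
    (j := j) (by
      by_contra! hcon
      rw [triangleArea, hcon.1, hcon.2] at hl
      simp at hl)
  have hD' : ∀ i j l, i ≠ j → i ≠ l → j ≠ l → triangleArea p' q' i j l ≠ 0 := by
    intro i j l hij hil hjl h
    obtain ⟨α, β, γ, δ, ε, a, b, hε, hp, hq⟩ := hch
    apply hD i j l hij hil hjl
    simp only [triangleArea, hp, hq] at h ⊢
    linear_combination (α * δ - β * γ) * h
  rw [harea] at hl hm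
  have hql := pos_of_mul_pos_right hl hpj.le
  have hqm := pos_of_mul_pos_right hm hpj.le
  apply hasWidthOne_or_exists_isInteriorPoint_of_isAffineChange hch
  rcases le_total (q' m) (q' l) with hml | hml
  · obtain ⟨e, rfl, rfl, rfl, rfl⟩ := exists_perm_of_ne hij hil him hjl hjm hlm
    exact hasWidthOne_or_exists_isInteriorPoint_of_perm e (main _ _ (fun i j l h1 h2 h3 =>
      hD' _ _ _ (e.injective.ne h1) (e.injective.ne h2) (e.injective.ne h3)) hpi hqi hqj hpj hqm hml)
  · obtain ⟨e, rfl, rfl, rfl, rfl⟩ := exists_perm_of_ne hij him hil hjm hjl hlm.symm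
    exact hasWidthOne_or_exists_isInteriorPoint_of_perm e (main _ _ (fun i j l h1 h2 h3 =>
      hD' _ _ _ (e.injective.ne h1) (e.injective.ne h2) (e.injective.ne h3)) hpi hqi hqj hpj hql hml)

end NoThreeCollinear

/-! ### Four lattice points, three of them on a line. -/

section Collinear

/-- At depth `s` below the vertex `(b, a)` of the triangle with base from `(0, 0)` to `(n, 0)`, the
point `(b - m, a - s)` is interior precisely under the two strict inequalities. The bound `2 * s ≤
a` keeps it in the upper half. In the boundary cases `b = 0` and `b = n` the depth `a / 2` rounded
down is used, and this fails only for the listed exceptions. -/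
theorem exists_multiple_between {a b n : ℤ} (ha : 2 ≤ a) (hb : 0 ≤ b) (hba : b < a) (hn : 2 ≤ n) :
    (∃ s m : ℤ, 0 < s ∧ 2 * s ≤ a ∧ (b - n) * s < a * m ∧ a * m < b * s) ∨
      (n = 2 ∧ (b = 0 ∨ b = 2)) ∨ (n = 3 ∧ a = 3 ∧ b = 0) := by
  have hodd : ∀ k : ℤ, a = 2 * k + 1 → 3 ≤ n → ¬ (n = 3 ∧ a = 3) → a < n * k := by
    rintro k rfl h3 h4
    rcases (by omega : k = 1 ∨ 2 ≤ k) with rfl | hk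
    · omega
    · nlinarith
  obtain ⟨k, hk⟩ := Int.even_or_odd' a
  rcases (by omega : b = 0 ∨ (0 < b ∧ b < n) ∨ b = n ∨ n < b) with rfl | ⟨h0, h1⟩ | rfl | h1
  · by_cases hn2 : n = 2
    · exact Or.inr (Or.inl ⟨hn2, Or.inl rfl⟩)
    by_cases h33 : n = 3 ∧ a = 3
    · exact Or.inr (Or.inr ⟨h33.1, h33.2, rfl⟩)
    refine Or.inl ⟨k, -1, by omega, by omega, ?_, by omega⟩
    rcases hk with hk | hk
    · nlinarith [mul_nonneg (by omega : 0 ≤ n - 3) (by omega : 0 ≤ k)]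
    · linarith [hodd k hk (by omega) h33]
  · exact Or.inl ⟨1, 0, one_pos, by omega, by linarith, by linarith⟩
  · by_cases hn2 : b = 2
    · exact Or.inr (Or.inl ⟨hn2, Or.inr hn2⟩)
    refine Or.inl ⟨k, 1, by omega, by omega, by linarith, ?_⟩
    rcases hk with hk | hk
    · nlinarith [mul_nonneg (by omega : 0 ≤ b - 3) (by omega : 0 ≤ k)]
    · linarith [hodd k hk (by omega) (by omega)]
  · left
    obtain ⟨l, hl⟩ := Int.even_or_odd' (b - n)
    rcases hl with hl | hl <;> rcases hk with hk | hk
    · refine ⟨k - 1, l, by omega, by omega, ?_, ?_⟩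
      · rw [hl, hk]
        nlinarith
      · rw [hk]
        nlinarith [mul_nonneg (by omega : 0 ≤ b - (2 * l + 2)) (by omega : 0 ≤ k - 1)]
    · refine ⟨k, l, by omega, by omega, ?_, ?_⟩
      · rw [hl, hk]
        nlinarith
      · rw [hk]
        nlinarith [mul_nonneg (by omega : 0 ≤ b - (2 * l + 2)) (by omega : 0 ≤ k)]
    · refine ⟨k, l + 1, by omega, by omega, ?_, ?_⟩
      · rw [hl, hk]
        nlinarith
      · rw [hk]
        nlinarith [mul_nonneg (by omega : 0 ≤ b - (2 * l + 3)) (by omega : 0 ≤ k)]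
    · refine ⟨k, l + 1, by omega, by omega, ?_, ?_⟩
      · rw [hl, hk]
        nlinarith
      · rw [hk]
        nlinarith [mul_nonneg (by omega : 0 ≤ b - (2 * l + 3)) (by omega : 0 ≤ k)]

/-- Either the curve has an interior lattice point close to the fourth point or it is one of three
exceptional curves. -/
theorem exists_isInteriorPoint_of_collinear {j n b a : ℤ} (ha : 2 ≤ a) (hb : 0 ≤ b) (hba : b < a)
    (hn : 2 ≤ n) :
    (∃ r₁ r₂, a ≤ 2 * r₂ ∧ IsInteriorPoint ![0, j, n, b] ![0, 0, 0, a] r₁ r₂) ∨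
      (n = 2 ∧ (b = 0 ∨ b = 2)) ∨ (n = 3 ∧ a = 3 ∧ b = 0) := by
  refine (exists_multiple_between ha hb hba hn).imp_left ?_
  rintro ⟨s, m, hs, hsa, h1, h2⟩
  have hpos : 0 < n * (a - s) := mul_pos (by omega) (by omega)
  -- Barycentric weights, multiplied by `n * a`, with respect to the triangle of the points `0`,
  -- `2`, `3`; the middle point of the base plays no role.
  refine ⟨b - m, a - s, by omega, isInteriorPoint_of_weights
    ![n * a - n * (a - s) - a * (b - m) + b * (a - s), 0, a * (b - m) - b * (a - s), n * (a - s)]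
    (fun i => ?_) ?_ ?_ 0 2 3 ?_ ?_ ?_ ?_⟩
  · fin_cases i <;> simp <;> linarith
  · simp [Fin.sum_univ_four]
    ring
  · simp [Fin.sum_univ_four]
    ring
  · simp
    linarith
  · simp
    linarith
  · simpa using hpos
  · simp [triangleArea]
    omega

theorem exists_sort_three {x : Fin 4 → ℤ} {i j l : Fin 4} (hij : x i ≠ x j) (hil : x i ≠ x l)
    (hjl : x j ≠ x l) : ∃ i' j' l', (∀ r, (r = i' ∨ r = j' ∨ r = l') ↔ (r = i ∨ r = j ∨ r = l)) ∧
      x i' < x j' ∧ x j' < x l' := by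
  rcases lt_or_gt_of_ne hij with h1 | h1 <;> rcases lt_or_gt_of_ne hil with h2 | h2 <;>
    rcases lt_or_gt_of_ne hjl with h3 | h3
  · exact ⟨i, j, l, fun r => by tauto, h1, h3⟩
  · exact ⟨i, l, j, fun r => by tauto, h2, h3⟩
  · omega
  · exact ⟨l, i, j, fun r => by tauto, h2, h1⟩
  · exact ⟨j, i, l, fun r => by tauto, h1, h2⟩
  · omega
  · exact ⟨j, l, i, fun r => by tauto, h3, h2⟩
  · exact ⟨l, j, i, fun r => by tauto, h3, h1⟩

/-- The normal form of four different lattice points, three of which are collinear. -/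
theorem exists_collinear_normalForm {p q : Fin 4 → ℤ}
    (hpq : ∀ i j, i ≠ j → p i ≠ p j ∨ q i ≠ q j) (hk : ∃ i, affineRelation p q i ≠ 0)
    {i j l : Fin 4} (hij : i ≠ j) (hil : i ≠ l) (hjl : j ≠ l) (h0 : triangleArea p q i j l = 0) :
    ∃ (e : Equiv.Perm (Fin 4)) (j n b a : ℕ), 0 < j ∧ j < n ∧ b < a ∧
      IsAffineChange (p ∘ e) (q ∘ e) ![0, (j : ℤ), n, b] ![0, 0, 0, (a : ℤ)] := by
  obtain ⟨p', q', hch, hpi, hqi, hqj, hpj, harea⟩ := exists_isAffineChange (hpq i j hij)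
  have hql : q' l = 0 := by
    rw [harea] at h0
    exact (mul_eq_zero.1 h0).resolve_left hpj.ne'
  have hne : ∀ r s, r ≠ s → q' r = 0 → q' s = 0 → p' r ≠ p' s := by
    intro r s hrs hr hs h
    obtain ⟨α, β, γ, δ, ε, a, b, -, hp, hq⟩ := hch
    have := hpq r s hrs
    rw [hp, hp, hq, hq, h, hr, hs] at this
    simp at this
  obtain ⟨i', j', l', hset, hij', hjl'⟩ := exists_sort_three (hne i j hij hqi hqj)
    (hne i l hil hqi hql) (hne j l hjl hqj hql)
  have hq0 : ∀ r, (r = i' ∨ r = j' ∨ r = l') → q' r = 0 := by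
    intro r hr
    rcases (hset r).1 hr with rfl | rfl | rfl <;> assumption
  have hij2 : i' ≠ j' := fun h => by simp [h] at hij'
  have hjl2 : j' ≠ l' := fun h => by simp [h] at hjl'
  have hil2 : i' ≠ l' := fun h => by
    rw [h] at hij'
    omega
  obtain ⟨m, him, hjm, hlm⟩ : ∃ m, i' ≠ m ∧ j' ≠ m ∧ l' ≠ m := by
    have : ∀ i j l : Fin 4, ∃ m, i ≠ m ∧ j ≠ m ∧ l ≠ m := by decide
    exact this i' j' l'
  obtain ⟨e, he0, he1, he2, he3⟩ := exists_perm_of_ne hij2 hil2 him hjl2 hjm hlm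
  have hqm : q' m ≠ 0 := by
    intro hqm
    obtain ⟨r, hr⟩ := hk
    obtain ⟨α, β, γ, δ, ε, a, b, -, hp, hq⟩ := hch
    have hall : ∀ r, q' r = 0 := by
      intro r
      obtain ⟨s, rfl⟩ := e.surjective r
      fin_cases s
      · exact (congrArg q' he0).trans (hq0 _ (by simp))
      · exact (congrArg q' he1).trans (hq0 _ (by simp))
      · exact (congrArg q' he2).trans (hq0 _ (by simp))
      · exact (congrArg q' he3).trans hqm
    rw [DelsarteSurface.affineRelation_of_change hp hq] at hr
    apply hr
    fin_cases r <;> simp [affineRelation, hall]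
  have ha : 0 < |q' m| := abs_pos.2 hqm
  obtain ⟨a, hadef⟩ := Int.eq_ofNat_of_zero_le ha.le
  obtain ⟨b, hbdef⟩ := Int.eq_ofNat_of_zero_le (Int.emod_nonneg (p' m - p' i') ha.ne')
  obtain ⟨jj, hjdef⟩ := Int.eq_ofNat_of_zero_le (sub_nonneg.2 hij'.le)
  obtain ⟨n, hndef⟩ := Int.eq_ofNat_of_zero_le (sub_nonneg.2 (hij'.trans hjl').le)
  have hb := Int.emod_lt_of_pos (p' m - p' i') ha
  -- Translation moves the leftmost collinear point to the origin, a reflection makes the height of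
  -- the fourth point positive, and a shear reduces its first coordinate modulo this height.
  refine ⟨e, jj, n, b, a, by omega, by omega, by omega, (hch.comp e).trans
    ⟨1, 0, (p' m - p' i') / |q' m|, (q' m).sign, (q' m).sign, p' i', 0, ?_, fun r => ?_,
      fun r => ?_⟩⟩
  · rw [zero_mul, sub_zero, one_mul, ← Int.sign_mul, Int.sign_eq_one_of_pos (mul_self_pos.2 hqm)]
  · have := Int.mul_ediv_add_emod (p' m - p' i') |q' m|
    fin_cases r <;> simp [he0, he1, he2, he3, ← hjdef, ← hndef, ← hbdef, ← hadef, -Int.emod_abs]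
    linarith
  · fin_cases r <;> simp [he0, he1, he2, he3, ← hadef, hq0, Int.sign_mul_abs]

end Collinear

/-! ### Exponents of isotrivial fibrations of positive genus. -/

namespace DelsarteSurface

universe v

variable {K : Type v} [Field K]

/-- The same surface with the monomials in another order. -/
def permRows (S : DelsarteSurface K) (e : Equiv.Perm (Fin 4)) : DelsarteSurface K where
  A := S.A.submatrix e id
  d := S.d
  row_sum i := S.row_sum (e i)
  c := S.c ∘ e
  c_ne_zero i := S.c_ne_zero (e i)

theorem equation_permRows (S : DelsarteSurface K) (e : Equiv.Perm (Fin 4)) :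
    (S.permRows e).equation = S.equation :=
  Equiv.sum_comp e fun i => C (S.c i) * ∏ j, X j ^ S.A i j

theorem det_permRows (S : DelsarteSurface K) (e : Equiv.Perm (Fin 4))
    (hA : (S.A.map (Nat.cast : ℕ → ℤ)).det ≠ 0) :
    ((S.permRows e).A.map (Nat.cast : ℕ → ℤ)).det ≠ 0 := by
  have h : (S.permRows e).A.map (Nat.cast : ℕ → ℤ) =
      (S.A.map (Nat.cast : ℕ → ℤ)).submatrix e id := rfl
  rw [h, Matrix.det_permute]
  exact mul_ne_zero (by simp) hA

theorem xExp_permRows (S : DelsarteSurface K) (e : Equiv.Perm (Fin 4)) :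
    (S.permRows e).xExp = S.xExp ∘ e := rfl

theorem yExp_permRows (S : DelsarteSurface K) (e : Equiv.Perm (Fin 4)) :
    (S.permRows e).yExp = S.yExp ∘ e := rfl

theorem isIsotrivial_permRows {S : DelsarteSurface K} (e : Equiv.Perm (Fin 4))
    (h : S.IsIsotrivial) : (S.permRows e).IsIsotrivial := by
  rw [IsIsotrivial, fibre, equation_permRows]
  exact h

variable [IsAlgClosed K] [CharZero K]

/-- The version of `exists_baseChange_and_birationalMap` for another order of the monomials. -/
theorem exists_baseChange_and_birationalMap_of_perm (S : DelsarteSurface K)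
    (hA : (S.A.map (Nat.cast : ℕ → ℤ)).det ≠ 0) (e : Equiv.Perm (Fin 4)) {p' q' : Fin 4 → ℕ}
    (hch : IsAffineChange (S.xExp ∘ e) (S.yExp ∘ e) (fun i => p' i) (fun i => q' i))
    (hk : affineRelation (fun i => p' i) (fun i => q' i) 0 ≠ 0) :
    ∃ S₁ : DelsarteSurface K, S.IsRescaling S₁ ∧
    ∃ (S₂ : DelsarteSurface K) (N : ℤ), S₁.IsDelsarteBaseChange S₂ N ∧
    ∃ (S' : DelsarteSurface K) (B : Matrix (Fin 4) (Fin 4) ℕ),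
      IsDelsarteBirationalMap B ∧ RespectsStandardFibration B ∧ MapsSurface B S₂ S' ∧
      ∃ n : ℕ, 1 ≤ n ∧ S'.genericFibre = C (RatFunc.X ^ n) * (X 0 ^ p' 0 * X 1 ^ q' 0) +
        ∑ i : Fin 3, X 0 ^ p' i.succ * X 1 ^ q' i.succ := by
  obtain ⟨S₁, ⟨l, μ, hl, hμ, hS⟩, h⟩ :=
    (S.permRows e).exists_baseChange_and_birationalMap (S.det_permRows e hA) hch hk
  exact ⟨S₁, ⟨l, μ, hl, hμ, by rwa [equation_permRows] at hS⟩, h⟩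

/-- The exponents of an isotrivial fibration of positive genus: two of the four points coincide or
the points are equivalent to those of one of two exceptional curves. -/
theorem exists_perm_of_isIsotrivial (S : DelsarteSurface K)
    (hA : (S.A.map (Nat.cast : ℕ → ℤ)).det ≠ 0) {g : ℕ} (hg : 0 < g)
    (hfib : S.StandardFibrationHasGenus g) (hiso : S.IsIsotrivial) :
    (∃ e : Equiv.Perm (Fin 4), S.xExp (e 0) = S.xExp (e 1) ∧ S.yExp (e 0) = S.yExp (e 1)) ∨
    (∃ e : Equiv.Perm (Fin 4), IsAffineChange (S.xExp ∘ e) (S.yExp ∘ e) ![0, 3, 2, 0]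
      ![0, 0, 0, 3]) ∨
    ∃ (e : Equiv.Perm (Fin 4)) (a : ℕ), 1 ≤ a ∧
      IsAffineChange (S.xExp ∘ e) (S.yExp ∘ e) ![0, 2, 1, 0] ![0, 0, 0, (a : ℤ)] := by
  by_cases hpq : ∀ i j, i ≠ j → S.xExp i ≠ S.xExp j ∨ S.yExp i ≠ S.yExp j
  swap
  · push Not at hpq
    obtain ⟨i, j, hij, h⟩ := hpq
    left
    have : ∀ i j : Fin 4, i ≠ j → ∃ l m, i ≠ l ∧ i ≠ m ∧ j ≠ l ∧ j ≠ m ∧ l ≠ m := by decide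
    obtain ⟨l, m, hil, him, hjl, hjm, hlm⟩ := this i j hij
    obtain ⟨e, rfl, rfl, -, -⟩ := exists_perm_of_ne hij hil him hjl hjm hlm
    exact ⟨e, h⟩
  right
  have hT := S.sum_tExp_ne_zero hA
  have hk : ∃ i, affineRelation S.xExp S.yExp i ≠ 0 := by
    by_contra! hcon
    simp [hcon] at hT
  have hwidth : ¬ HasWidthOne S.xExp S.yExp := fun hw => by
    obtain ⟨h, hgen⟩ := hfib
    rw [S.planeCurveGenus_eq_zero_of_hasWidthOne h hw hpq hT] at hgen
    omega
  by_cases hD : ∀ i j l, i ≠ j → i ≠ l → j ≠ l → triangleArea S.xExp S.yExp i j l ≠ 0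
  · exfalso
    rcases hasWidthOne_or_exists_isInteriorPoint hD with h | ⟨r₁, r₂, h⟩
    · exact hwidth h
    · refine S.not_isInteriorPoint_of_isIsotrivial hiso hT (fun i => ?_) r₁ r₂ h
      have h1 := hD 1 2 3 (by decide) (by decide) (by decide)
      have h2 := hD 0 2 3 (by decide) (by decide) (by decide)
      have h3 := hD 0 1 3 (by decide) (by decide) (by decide)
      have h4 := hD 0 1 2 (by decide) (by decide) (by decide)
      fin_cases i
      exacts [h1, neg_ne_zero.2 h2, h3, neg_ne_zero.2 h4]
  push Not at hD
  obtain ⟨i, j, l, hij, hil, hjl, h0⟩ := hD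
  obtain ⟨e, j, n, b, a, hj, hjn, hba, hch⟩ := exists_collinear_normalForm hpq hk hij hil hjl h0
  have hperm : ∀ (σ : Equiv.Perm (Fin 4)) {p' q' : Fin 4 → ℤ},
      IsAffineChange (![0, (j : ℤ), n, b] ∘ σ) (![0, 0, 0, (a : ℤ)] ∘ σ) p' q' →
      IsAffineChange (S.xExp ∘ (σ.trans e)) (S.yExp ∘ (σ.trans e)) p' q' := fun σ p' q' h =>
    (hch.comp σ).trans h
  -- Height one would place the points on two neighbouring lines.
  have ha : 2 ≤ a := by
    by_contra! ha
    obtain rfl : a = 1 := by omega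
    refine hwidth (HasWidthOne.of_perm e
      (HasWidthOne.of_isAffineChange hch ⟨0, 1, 0, isCoprime_one_right, fun i => ?_⟩))
    fin_cases i <;> simp
  have hswap : ∃ σ : Equiv.Perm (Fin 4), σ 0 = 0 ∧ σ 1 = 2 ∧ σ 2 = 1 ∧ σ 3 = 3 :=
    exists_perm_of_ne (by decide) (by decide) (by decide) (by decide) (by decide) (by decide)
  have hrot : ∃ σ : Equiv.Perm (Fin 4), σ 0 = 2 ∧ σ 1 = 0 ∧ σ 2 = 1 ∧ σ 3 = 3 :=
    exists_perm_of_ne (by decide) (by decide) (by decide) (by decide) (by decide) (by decide)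
  obtain ⟨σ, s0, s1, s2, s3⟩ := hswap
  obtain ⟨τ, t0, t1, t2, t3⟩ := hrot
  rcases exists_isInteriorPoint_of_collinear (j := j) (n := n) (b := b) (a := a) (by omega)
    (by omega) (by omega) (by omega) with ⟨r₁, r₂, hr, hint⟩ | ⟨hn, hb | hb⟩ | ⟨hn, ha3, hb⟩
  · exfalso
    obtain ⟨α, β, γ, δ, ε, u, v, hε, hp, hq⟩ := hch
    exact (S.permRows e).not_isInteriorPoint_of_isIsotrivial_of_collinear
      (isIsotrivial_permRows e hiso) ((S.permRows e).sum_tExp_ne_zero (S.det_permRows e hA)) hε hj hjn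
      (by omega) hp hq hr hint
  · obtain rfl : n = 2 := by omega
    obtain rfl : b = 0 := by omega
    obtain rfl : j = 1 := by omega
    refine Or.inr ⟨σ.trans e, a, by omega, hperm σ ⟨1, 0, 0, 1, 1, 0, 0, by norm_num, fun i => ?_,
      fun i => ?_⟩⟩ <;> fin_cases i <;> simp [s0, s1, s2, s3]
  · obtain rfl : n = 2 := by omega
    obtain rfl : b = 2 := by omega
    obtain rfl : j = 1 := by omega
    -- The reflection `x ↦ 2 - x` exchanges the ends of the base and reduces `b = 2` to `b = 0`.
    refine Or.inr ⟨τ.trans e, a, by omega, hperm τ ⟨-1, 0, 0, 1, -1, 2, 0, by norm_num, fun i => ?_,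
      fun i => ?_⟩⟩ <;> fin_cases i <;> simp [t0, t1, t2, t3]
  · obtain rfl : n = 3 := by omega
    obtain rfl : b = 0 := by omega
    obtain rfl : a = 3 := by omega
    left
    rcases (by omega : j = 1 ∨ j = 2) with rfl | rfl
    -- For `j = 1` the affine map `(x, y) ↦ (3 - x - y, y)` preserves the triangle and moves the
    -- middle point to `2`.
    · refine ⟨τ.trans e, hperm τ ⟨-1, 0, -1, 1, -1, 3, 0, by norm_num, fun i => ?_,
        fun i => ?_⟩⟩ <;> fin_cases i <;> simp [t0, t1, t2, t3]
    · refine ⟨σ.trans e, hperm σ ⟨1, 0, 0, 1, 1, 0, 0, by norm_num, fun i => ?_,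
        fun i => ?_⟩⟩ <;> fin_cases i <;> simp [s0, s1, s2, s3]

end DelsarteSurface

/-! ### The three normal forms. -/

theorem mainTheorem9 {K : Type*} [Field K] [IsAlgClosed K] [CharZero K]
    (S : DelsarteSurface K) (hA : (S.A.map (Nat.cast : ℕ → ℤ)).det ≠ 0)
    (g : ℕ) (hg : 0 < g) (hfib : S.StandardFibrationHasGenus g) (hiso : S.IsIsotrivial) :
    ∃ S₁ : DelsarteSurface K, S.IsRescaling S₁ ∧
    ∃ (S₂ : DelsarteSurface K) (N : ℤ), S₁.IsDelsarteBaseChange S₂ N ∧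
    ∃ (S' : DelsarteSurface K) (B : Matrix (Fin 4) (Fin 4) ℕ),
      IsDelsarteBirationalMap B ∧ RespectsStandardFibration B ∧ MapsSurface B S₂ S' ∧
      ∃ n : ℕ, 1 ≤ n ∧
        ((∃ p q : Fin 3 → ℕ,
            S'.genericFibre =
              X 0 ^ p 0 * X 1 ^ q 0 + X 0 ^ p 1 * X 1 ^ q 1
                + C (1 + RatFunc.X ^ n) * (X 0 ^ p 2 * X 1 ^ q 2)) ∨
          S'.genericFibre = X 1 ^ 3 + X 0 ^ 3 + X 0 ^ 2 + C (RatFunc.X ^ n) ∨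
          ∃ a : ℕ, 1 ≤ a ∧
            S'.genericFibre = X 1 ^ a + X 0 ^ 2 + X 0 + C (RatFunc.X ^ n)) := by
  rcases S.exists_perm_of_isIsotrivial hA hg hfib hiso with ⟨e, hx, hy⟩ | ⟨e, hch⟩ | ⟨e, a, ha, hch⟩
  · have hT := (S.permRows e).sum_tExp_ne_zero (S.det_permRows e hA)
    -- When the points `0` and `1` coincide, the affine relation is supported on them, with opposite
    -- entries. If it vanished at `0`, the determinant would be zero.
    have hk : affineRelation (S.xExp ∘ e) (S.yExp ∘ e) 0 ≠ 0 := by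
      intro h0
      apply hT
      rw [DelsarteSurface.xExp_permRows, DelsarteSurface.yExp_permRows]
      simp only [affineRelation, Function.comp_apply, Matrix.cons_val, hx, hy] at h0
      simp only [affineRelation, Fin.sum_univ_four, Function.comp_apply, Matrix.cons_val, hx, hy]
      linear_combination ((S.permRows e).tExp 0 - (S.permRows e).tExp 1) * h0
    obtain ⟨S₁, h₁, S₂, N, h₂, S', B, hB, hB', hS', n, hn, h⟩ :=
      S.exists_baseChange_and_birationalMap_of_perm hA e (p' := fun i => S.A (e i) 0)
        (q' := fun i => S.A (e i) 1) ⟨1, 0, 0, 1, 1, 0, 0, by norm_num,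
          fun i => by simp [DelsarteSurface.xExp], fun i => by simp [DelsarteSurface.yExp]⟩ hk
    -- The coinciding monomials `e 0` and `e 1` have coefficients `t ^ n` and `1`; they merge into
    -- the term with coefficient `1 + t ^ n`.
    refine ⟨S₁, h₁, S₂, N, h₂, S', B, hB, hB', hS', n, hn, Or.inl
      ⟨![S.A (e 2) 0, S.A (e 3) 0, S.A (e 0) 0], ![S.A (e 2) 1, S.A (e 3) 1, S.A (e 0) 1], ?_⟩⟩
    have hx' : S.A (e 1) 0 = S.A (e 0) 0 := Int.ofNat_injective hx.symm
    have hy' : S.A (e 1) 1 = S.A (e 0) 1 := Int.ofNat_injective hy.symm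
    rw [h, Fin.sum_univ_three]
    simp only [Fin.succ_zero_eq_one, Fin.succ_one_eq_two, show (2 : Fin 3).succ = 3 from rfl, hx', hy',
      Matrix.cons_val, map_add, map_one]
    ring
  · obtain ⟨S₁, h₁, S₂, N, h₂, S', B, hB, hB', hS', n, hn, h⟩ :=
      S.exists_baseChange_and_birationalMap_of_perm hA e (p' := ![0, 3, 2, 0])
        (q' := ![0, 0, 0, 3]) (by
          convert hch using 1 <;> ext i <;> fin_cases i <;> rfl) (by simp [affineRelation])
    refine ⟨S₁, h₁, S₂, N, h₂, S', B, hB, hB', hS', n, hn, Or.inr (Or.inl ?_)⟩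
    rw [h, Fin.sum_univ_three]
    simp only [Fin.succ_zero_eq_one, Fin.succ_one_eq_two, show (2 : Fin 3).succ = 3 from rfl,
      Matrix.cons_val]
    ring
  · obtain ⟨S₁, h₁, S₂, N, h₂, S', B, hB, hB', hS', n, hn, h⟩ :=
      S.exists_baseChange_and_birationalMap_of_perm hA e (p' := ![0, 2, 1, 0])
        (q' := ![0, 0, 0, a]) (by
          convert hch using 1 <;> ext i <;> fin_cases i <;> rfl) (by
          simp [affineRelation]
          omega)
    refine ⟨S₁, h₁, S₂, N, h₂, S', B, hB, hB', hS', n, hn, Or.inr (Or.inr ⟨a, ha, ?_⟩)⟩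
    rw [h, Fin.sum_univ_three]
    simp only [Fin.succ_zero_eq_one, Fin.succ_one_eq_two, show (2 : Fin 3).succ = 3 from rfl,
      Matrix.cons_val]
    ring
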